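/- **Proposition 2.6 (Birkhoff).** Let $(M,\omega)$ be a compact symplectic manifold of dimension $2n$, let $\mathfrak A$ be a smooth finite-dimensional manifold (Hausdorff, second countable, without boundary), and let $(f_a)_{a\in\mathfrak A}$ be a $C^\infty$ family of symplectomorphisms of $M$, i.e. $(a,x)\mapsto f_a(x)$ is $C^\infty$ on $\mathfrak A\times M$. Write $\mathbb T^n=\mathbb R^n/\mathbb Z^n$, and call $\alpha\in\mathbb R^n$ Diophantine if there are $\gamma,\tau>0$ with $|l+\langle k,\alpha\rangle|>\gamma\|k\|^{-n-\tau}$ for all $k\in\mathbb Z^n\setminus\{0\}$ and $l\in\mathbb Z$. Let $(T_a)_{a\in\mathfrak A}$ be a $C^\infty$ family of $q$-periodic KAM tori of $f_a$ with Diophantine vector $\alpha$ independent of $a$. That is, $q\ge 1$, and there are $C^\infty$ embeddings $h_a:\mathbb T^n\to M$, jointly $C^\infty$ in $(a,\theta)$, such that $T_a=h_a(\mathbb T^n)$ is Lagrangian, $f_a^q(h_a(\theta))=h_a(\theta+\alpha)$ for all $\theta$, and $f_a^j(T_a)\cap T_a=\emptyset$ for $1\le j<q$. Then for every integer $D\ge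 0$ there exist a continuous function $\rho:\mathfrak A\to(0,\infty)$ and maps $$\Psi_a:\ \mathbb T^n\times\{r\in\mathbb R^n:\|r\|<\rho(a)\}\to M ,$$ jointly $C^\infty$ in $(a,\theta,r)$, each a diffeomorphism onto an open neighbourhood of $T_a$, with $\Psi_a^*\omega=\sum_i d\theta_i\wedge dr_i$ and $T_a=\Psi_a(\{r=0\})$ (symplectic coordinates $(\theta,r)$ near $T_a$), together with * polynomials $Q_a:\mathbb R^n\to\mathbb R$ of degree at most $D+1$, whose coefficients are $C^\infty$ functions of $a$, with $\nabla Q_a(0)=0$; * functions $s_a(\theta,r)$ on $\mathbb T^n\times\{\|r\|<\rho(a)\}$, jointly $C^\infty$ in $(a,\theta,r)$, which vanish at $r=0$ together with all their derivatives with respect to $r$ up to order $D+1$, such that for every $a\in\mathfrak A$ and all $(\theta,r),(\bar\theta,\bar r)\in\mathbb T^n\times\{\|r\|<\rho(a)\}$, one has $f_a^q(\Psi_a(\theta,r))=\Psi_a(\bar\theta,\bar r)$ if and only if $$\bar\theta=\theta+\alpha+\nabla Q_a(r)+\partial_r s_a(\bar\theta,r),\qquad \bar r=r-\partial_{\bar\theta}s_a(\bar\theta,r).$$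 -/

import Mathlib

open scoped Manifold ContDiff Gradient

noncomputable section

namespace KAMBirkhoff

/-- Euclidean space of dimension `n`. -/
abbrev Euc (n : ℕ) : Type := EuclideanSpace ℝ (Fin n)

/-- The torus `𝕋ⁿ = ℝⁿ / ℤⁿ`. -/
abbrev Torus (n : ℕ) : Type := Fin n → UnitAddCircle

/-- The covering projection `ℝⁿ → 𝕋ⁿ`.  Smooth objects on `𝕋ⁿ` are those whose composition with
this local diffeomorphism is smooth, and differentiation on `𝕋ⁿ` is differentiation of the lift. -/
def torusProj {n : ℕ} (x : Euc n) : Torus n := fun i => ((x i : ℝ) : UnitAddCircle)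

/-- Diophantine vectors.  Here `‖k‖` is the sup norm of `k`; the choice of norm is immaterial, as
it only changes `γ`. -/
def IsDiophantine {n : ℕ} (α : Euc n) : Prop :=
  ∃ γ τ : ℝ, 0 < γ ∧ 0 < τ ∧ ∀ k : Fin n → ℤ, k ≠ 0 → ∀ l : ℤ,
    γ * ‖k‖ ^ (-(n : ℝ) - τ) < |(l : ℝ) + ∑ i, (k i : ℝ) * α i|

section Forms

variable {F₁ H₁ N F₂ H₂ M : Type*}
  [NormedAddCommGroup F₁] [NormedSpace ℝ F₁] [TopologicalSpace H₁] [TopologicalSpace N]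
  [ChartedSpace H₁ N]
  [NormedAddCommGroup F₂] [NormedSpace ℝ F₂] [TopologicalSpace H₂] [TopologicalSpace M]
  [ChartedSpace H₂ M]

/-- The pullback `g^* σ` at `x` of a field `σ` of alternating bilinear forms. -/
def pullbackForm (J : ModelWithCorners ℝ F₁ H₁) (I : ModelWithCorners ℝ F₂ H₂)
    (σ : ∀ y : M, TangentSpace I y [⋀^Fin 2]→L[ℝ] ℝ) (g : N → M) (x : N) :
    TangentSpace J x [⋀^Fin 2]→L[ℝ] ℝ :=
  (σ (g x)).compContinuousLinearMap (mfderiv J I g x)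

end Forms

/-- The expression of a field of alternating bilinear forms in the preferred chart at `x₀`, to be
considered on the target of that chart. -/
def coordForm {m : ℕ} {M : Type*} [TopologicalSpace M] [ChartedSpace (Euc m) M]
    (σ : ∀ x : M, TangentSpace (𝓡 m) x [⋀^Fin 2]→L[ℝ] ℝ) (x₀ : M) :
    Euc m → Euc m [⋀^Fin 2]→L[ℝ] ℝ :=
  fun y => pullbackForm 𝓘(ℝ, Euc m) (𝓡 m) σ (chartAt (Euc m) x₀).symm y

/-- A symplectic form on an `m`-dimensional manifold: a smooth, closed, nondegenerate 2-form. -/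
structure SymplecticForm (m : ℕ) (M : Type*) [TopologicalSpace M] [ChartedSpace (Euc m) M] where
  /-- the underlying field of alternating forms -/
  form : ∀ x : M, TangentSpace (𝓡 m) x [⋀^Fin 2]→L[ℝ] ℝ
  smooth : ∀ x₀ : M, ContDiffOn ℝ ∞ (coordForm form x₀) (chartAt (Euc m) x₀).target
  closed : ∀ x₀ : M, ∀ y ∈ (chartAt (Euc m) x₀).target, extDeriv (coordForm form x₀) y = 0
  nondegenerate : ∀ (x : M) (u : TangentSpace (𝓡 m) x),
    (∀ v : TangentSpace (𝓡 m) x, form x ![u, v] = 0) → u = 0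

section Symplectic

variable {n p : ℕ} {M : Type*} [TopologicalSpace M] [ChartedSpace (Euc (2 * n)) M]
  {A : Type*} [TopologicalSpace A] [ChartedSpace (Euc p) A]

/-- `f` preserves the symplectic form. -/
def IsSymplectic (σ : SymplecticForm (2 * n) M) (f : M → M) : Prop :=
  ∀ x : M, pullbackForm (𝓡 (2 * n)) (𝓡 (2 * n)) σ.form f x = σ.form x

/-- `h : 𝕋ⁿ → M` is a smooth embedding (on the compact `𝕋ⁿ`: an injective immersion) with
Lagrangian image, conjugating the rotation by the Diophantine vector `α` to `f^q`; that is, its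
image is a KAM torus of `f`, and this torus is `q`-periodic. -/
structure IsPeriodicKAMTorus (σ : SymplecticForm (2 * n) M) (f : M → M) (q : ℕ) (α : Euc n)
    (h : Torus n → M) : Prop where
  smooth : ContMDiff (𝓡 n) (𝓡 (2 * n)) ∞ (fun x : Euc n => h (torusProj x))
  injective : Function.Injective h
  immersion : ∀ x : Euc n, Function.Injective
    (mfderiv (𝓡 n) (𝓡 (2 * n)) (fun x : Euc n => h (torusProj x)) x)
  lagrangian : ∀ x : Euc n,
    pullbackForm (𝓡 n) (𝓡 (2 * n)) σ.form (fun x : Euc n => h (torusProj x)) x = 0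
  diophantine : IsDiophantine α
  conj : ∀ θ : Torus n, f^[q] (h θ) = h (θ + torusProj α)
  one_le : 1 ≤ q
  disjoint : ∀ j : ℕ, 1 ≤ j → j < q → Disjoint (f^[j] '' Set.range h) (Set.range h)

/-- `Ψ` is a smooth family of symplectic coordinates `(θ, r)`, `‖r‖ < ρ a`, near the tori
`T a = {r = 0}`: each `Ψ a` is injective on `𝕋ⁿ × {‖r‖ < ρ a}`, its image is an open neighbourhood
of `T a`, it is jointly smooth in `(a, θ, r)`, and it pulls `σ` back to `∑ᵢ dθᵢ ∧ drᵢ`.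
(The last condition makes `Ψ a` a local diffeomorphism, hence a diffeomorphism onto its image.) -/
structure IsSymplecticCoordFamily (σ : SymplecticForm (2 * n) M) (T : A → Set M) (ρ : A → ℝ)
    (Ψ : A → Torus n → Euc n → M) : Prop where
  radius_continuous : Continuous ρ
  radius_pos : ∀ a, 0 < ρ a
  smooth : ContMDiffOn ((𝓡 p).prod 𝓘(ℝ, Euc n × Euc n)) (𝓡 (2 * n)) ∞
    (fun z : A × (Euc n × Euc n) => Ψ z.1 (torusProj z.2.1) z.2.2) {z | ‖z.2.2‖ < ρ z.1}
  injective : ∀ a, Set.InjOn (fun w : Torus n × Euc n => Ψ a w.1 w.2) {w | ‖w.2‖ < ρ a}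
  isOpen_image : ∀ a, IsOpen ((fun w : Torus n × Euc n => Ψ a w.1 w.2) '' {w | ‖w.2‖ < ρ a})
  zero_section : ∀ a, Set.range (fun θ : Torus n => Ψ a θ 0) = T a
  symplectic : ∀ (a : A) (z : Euc n × Euc n), ‖z.2‖ < ρ a → ∀ u v : Euc n × Euc n,
    pullbackForm 𝓘(ℝ, Euc n × Euc n) (𝓡 (2 * n)) σ.form
      (fun z : Euc n × Euc n => Ψ a (torusProj z.1) z.2) z ![u, v]
        = ∑ i, (u.1 i * v.2 i - v.1 i * u.2 i)

end Symplectic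

/-- The function `r ↦ Q(r)` on Euclidean space given by a polynomial `Q`. -/
def polyFun {n : ℕ} (Q : MvPolynomial (Fin n) ℝ) (r : Euc n) : ℝ :=
  MvPolynomial.eval (fun i => r i) Q

end KAMBirkhoff

end

set_option linter.unusedSectionVars false

open scoped Manifold ContDiff Gradient Topology
open Set Filter Asymptotics

noncomputable section

/-! Fix a parameter and let g be the return map `f^q`. It maps the torus T to itself as the rotation
by α. The proof puts symplectic coordinates near T, describes g there by a generating function, and
removes the angles from this function degree by degree in r.

Coordinates. T is Lagrangian, so the metric duals of the forms ω(∂ₖ, ·), for ∂ₖ tangent to T, span a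
complement of its tangent spaces. Moving off T along a suitable basis of this complement, chart by
chart with a partition of unity, gives a tube with the standard pairing between angles and actions
(`pbForm_fibreMap`). A linear shear makes the fibres isotropic along r = 0
(`IsTubeFamily.pbForm_shearMap`), and Moser's method then makes the form standard near r = 0
(`IsMoserForm.pullback_flowMap`). The result is `isSymplecticTube_tubeMap`.

Generating function. Write g(x, r) = (x', r'). As g is a rotation on r = 0, the pair (x', r)
determines (x, r') near r = 0 (`IsInvariantFamily.exists_graph`). As g is symplectic, the form (r -
r') dx' + (x' - α - x) dr is closed. Its primitive S, normalized by S = 0 on r = 0, satisfies r' = r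
- ∂S/∂x' and x' = x + α + ∂S/∂r (`IsInvariantFamily.hasFDerivAt_genFun`), and S = O(|r|²).

Normalization. Suppose S = Q(r) + v(x', r) + O(|r|^(d+3)) with v homogeneous of degree d + 2 in r. A
symplectic change of coordinates of the form (x, r) ↦ (x + ∂u/∂r, r) + O(|r|^(d+2)), with u
homogeneous of the same degree, replaces v by v - (u(x', r) - u(x' - α, r)) up to O(|r|^(d+3))
(`vanishesTo_genFun_comp`). The Diophantine condition makes u(x) - u(x - α) = v(x) - average of v
smoothly solvable (`cohom_sub`), so v can be replaced by its average over the angles. That average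
is smooth and homogeneous in r, hence a polynomial (`polyFun_homPoly`), and joins Q. After D such
steps the remainder is O(|r|^(D+2)) (`isNormalized_normalForm`).

Parameters. Once a partition of unity and one exponent are fixed, every object is given by a formula
or is characterized uniquely, and depends only on the torus and the map. The coordinates are
therefore defined over the whole parameter manifold, and smoothness can be checked in its charts
(`exists_normalFamily`). Compactness of the torus makes germs along r = 0 into tubes with locally
uniform radius; the admissible radii form an interval, so a continuous radius is obtained by
convexity. -/

namespace KAMBirkhoff

/-! ### Smoothness on a neighbourhood of a point. -/

section SmoothNear

variable {X Y F G : Type*} [NormedAddCommGroup X] [NormedSpace ℝ X] [NormedAddCommGroup Y]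
  [NormedSpace ℝ Y] [NormedAddCommGroup F] [NormedSpace ℝ F] [NormedAddCommGroup G]
  [NormedSpace ℝ G]

/-- `f` is smooth in a neighbourhood of `x`. -/
def SmoothNear (f : X → F) (x : X) : Prop := ∀ᶠ y in 𝓝 x, ContDiffAt ℝ ∞ f y

theorem SmoothNear.contDiffAt {f : X → F} {x : X} (h : SmoothNear f x) : ContDiffAt ℝ ∞ f x :=
  h.self_of_nhds

theorem SmoothNear.continuousAt {f : X → F} {x : X} (h : SmoothNear f x) : ContinuousAt f x :=
  h.contDiffAt.continuousAt

theorem SmoothNear.differentiableAt {f : X → F} {x : X} (h : SmoothNear f x) :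
    DifferentiableAt ℝ f x :=
  h.contDiffAt.differentiableAt (by simp)

theorem SmoothNear.eventually {f : X → F} {x : X} (h : SmoothNear f x) :
    ∀ᶠ y in 𝓝 x, SmoothNear f y :=
  eventually_eventually_nhds.2 h

/-- This is what `ContDiffAt ℝ ∞` at a single point does not give: there the neighbourhood on which
f is C^m may shrink as m grows. Openness lets the property be propagated by filters and by
compactness. -/
theorem isOpen_smoothNear (f : X → F) : IsOpen {x | SmoothNear f x} :=
  isOpen_iff_mem_nhds.2 fun _ hx => SmoothNear.eventually hx

theorem smoothNear_of_contDiff {f : X → F} (h : ContDiff ℝ ∞ f) (x : X) : SmoothNear f x :=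
  Eventually.of_forall fun _ => h.contDiffAt

theorem SmoothNear.congr {f g : X → F} {x : X} (h : SmoothNear f x) (hfg : f =ᶠ[𝓝 x] g) :
    SmoothNear g x := by
  filter_upwards [h, eventually_eventually_nhds.2 hfg] with y hy hy'
  exact hy.congr_of_eventuallyEq (hy'.mono fun _ h => h.symm)

theorem SmoothNear.comp {g : Y → F} {f : X → Y} {x : X} (hg : SmoothNear g (f x))
    (hf : SmoothNear f x) : SmoothNear (fun y => g (f y)) x := by
  filter_upwards [hf, hf.continuousAt.eventually hg] with y hy hy'
  exact hy'.comp y hy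

theorem SmoothNear.comp_of_eq {g : Y → F} {f : X → Y} {x : X} {y : Y} (hg : SmoothNear g y)
    (hf : SmoothNear f x) (h : f x = y) : SmoothNear (fun y => g (f y)) x :=
  SmoothNear.comp (h ▸ hg) hf

theorem SmoothNear.contDiff_comp {g : Y → F} {f : X → Y} {x : X} (hf : SmoothNear f x)
    (hg : ContDiff ℝ ∞ g) : SmoothNear (fun y => g (f y)) x :=
  SmoothNear.comp (smoothNear_of_contDiff hg _) hf

theorem SmoothNear.prodMk {f : X → F} {g : X → G} {x : X} (hf : SmoothNear f x)
    (hg : SmoothNear g x) : SmoothNear (fun y => (f y, g y)) x := by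
  filter_upwards [hf, hg] with y h1 h2 using h1.prodMk h2

theorem SmoothNear.add {f g : X → F} {x : X} (hf : SmoothNear f x)
    (hg : SmoothNear g x) : SmoothNear (fun y => f y + g y) x := by
  filter_upwards [hf, hg] with y h1 h2 using h1.add h2

theorem SmoothNear.sub {f g : X → F} {x : X} (hf : SmoothNear f x)
    (hg : SmoothNear g x) : SmoothNear (fun y => f y - g y) x := by
  filter_upwards [hf, hg] with y h1 h2 using h1.sub h2

theorem SmoothNear.neg {f : X → F} {x : X} (hf : SmoothNear f x) :
    SmoothNear (fun y => - f y) x := by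
  filter_upwards [hf] with y h1 using h1.neg

theorem SmoothNear.smul {f : X → ℝ} {g : X → F} {x : X} (hf : SmoothNear f x)
    (hg : SmoothNear g x) : SmoothNear (fun y => f y • g y) x := by
  filter_upwards [hf, hg] with y h1 h2 using h1.smul h2

theorem SmoothNear.clm_apply {f : X → F →L[ℝ] G} {g : X → F} {x : X} (hf : SmoothNear f x)
    (hg : SmoothNear g x) : SmoothNear (fun y => f y (g y)) x := by
  filter_upwards [hf, hg] with y h1 h2 using h1.clm_apply h2

theorem SmoothNear.clm_comp {f : X → F →L[ℝ] G} {g : X → Y →L[ℝ] F} {x : X} (hf : SmoothNear f x)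
    (hg : SmoothNear g x) : SmoothNear (fun y => (f y).comp (g y)) x := by
  filter_upwards [hf, hg] with y h1 h2 using h1.clm_comp h2

theorem smoothNear_const (c : F) (x : X) : SmoothNear (fun _ : X => c) x :=
  smoothNear_of_contDiff contDiff_const x

theorem SmoothNear.fderiv {f : X → F} {x : X} (hf : SmoothNear f x) :
    SmoothNear (fderiv ℝ f) x := by
  filter_upwards [hf] with y h1 using h1.fderiv_right (by simp)

theorem SmoothNear.partial_snd {f : X → Y → F} {x : X} {y : Y}
    (hf : SmoothNear (fun w : X × Y => f w.1 w.2) (x, y)) :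
    SmoothNear (fun w : X × Y => _root_.fderiv ℝ (f w.1) w.2) (x, y) := by
  filter_upwards [hf] with w hw
  refine ContDiffAt.fderiv (f := fun w : X × Y => f w.1) (n := ∞) (m := ∞) ?_ contDiffAt_snd
    (by simp)
  have : ContDiffAt ℝ ∞ (fun w : X × Y => f w.1 w.2) (w.1, w.2) := hw
  exact this.comp (w, w.2) (f := fun q : (X × Y) × Y => (q.1.1, q.2)) (by fun_prop)

theorem SmoothNear.snd_of_prod {f : X → Y → F} {x : X} {y : Y}
    (hf : SmoothNear (fun w : X × Y => f w.1 w.2) (x, y)) : SmoothNear (f x) y :=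
  SmoothNear.comp (f := fun y => (x, y)) hf (smoothNear_of_contDiff (by fun_prop) _)

theorem smoothNear_clm_apply_iff [FiniteDimensional ℝ F] {f : X → F →L[ℝ] G} {x : X} :
    SmoothNear f x ↔ ∀ v, SmoothNear (fun y => f y v) x := by
  refine ⟨fun h v => h.clm_apply (smoothNear_const v x), fun h => ?_⟩
  let b := Module.finBasis ℝ F
  have h' : ∀ᶠ y in 𝓝 x, ∀ i, ContDiffAt ℝ ∞ (fun y => f y (b i)) y :=
    eventually_all.2 fun i => h (b i)
  filter_upwards [h'] with y hy
  -- Expansion of the operator in a basis: each summand is a fixed continuous linear image of `f y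
  -- (b i)`.
  have key : f = fun y => ∑ i, ((b.equivFunL.toContinuousLinearMap).toLinearMap.toContinuousLinearMap
      |> fun L => ((ContinuousLinearMap.proj i).comp L).smulRight (f y (b i))) := by
    funext y
    ext v
    conv_lhs => rw [← b.sum_repr v, map_sum]
    simp
  rw [key]
  refine ContDiffAt.sum fun i _ => ?_
  exact (ContinuousLinearMap.smulRightL ℝ F G _).contDiff.contDiffAt.comp y (hy i)

end SmoothNear

/-! ### Superposition operators on spaces of continuous functions. -/

section Nemytskii

variable {X F : Type*} [NormedAddCommGroup X] [NormedSpace ℝ X] [NormedAddCommGroup F]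
  [NormedSpace ℝ F] {K : Type*} [TopologicalSpace K] [CompactSpace K]

/-- Superposition with `f`, as an operator between spaces of continuous functions. -/
def nemytskii (f : X → F) (c : C(K, X)) : C(K, F) := ContinuousMap.mkD (fun k => f (c k)) 0

theorem nemytskii_apply {f : X → F} {c : C(K, X)} (h : ∀ k, ContinuousAt f (c k)) (k : K) :
    nemytskii f c k = f (c k) := by
  have : Continuous (fun k => f (c k)) :=
    continuous_iff_continuousAt.2 fun k => (h k).comp c.continuous.continuousAt
  rw [nemytskii, ContinuousMap.mkD_of_continuous this]
  rfl

/-- Pointwise application, as a continuous bilinear map on spaces of continuous functions. -/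
def pointwiseApply : C(K, X →L[ℝ] F) →L[ℝ] C(K, X) →L[ℝ] C(K, F) :=
  LinearMap.mkContinuous₂
    (LinearMap.mk₂ ℝ (fun (A : C(K, X →L[ℝ] F)) (η : C(K, X)) =>
      (⟨fun k => A k (η k), by fun_prop⟩ : C(K, F)))
      (fun A B η => by ext k; simp) (fun c A η => by ext k; simp)
      (fun A η ξ => by ext k; simp) (fun c A η => by ext k; simp)) 1
    (fun A η => by
      rw [one_mul]
      refine (ContinuousMap.norm_le _ (by positivity)).2 fun k => ?_
      exact (ContinuousLinearMap.le_opNorm _ _).trans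
        (by gcongr; exacts [A.norm_coe_le_norm k, η.norm_coe_le_norm k]))

@[simp] theorem pointwiseApply_apply (A : C(K, X →L[ℝ] F)) (η : C(K, X)) (k : K) :
    pointwiseApply A η k = A k (η k) := rfl

/-- Strict differentiability at each point of the curve controls the error for all nearby base
points, and compactness of K makes the control uniform, as the sup norm requires. The derivative is
again a superposition operator followed by a bounded bilinear map, so that the argument can be
iterated. -/
theorem hasFDerivAt_nemytskii {f : X → F} {U : Set X} (hU : IsOpen U)
    (hf : ContDiffOn ℝ 1 f U) {c : C(K, X)} (hc : ∀ k, c k ∈ U) :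
    HasFDerivAt (nemytskii (K := K) f) (pointwiseApply (nemytskii (fderiv ℝ f) c)) c := by
  have hfa : ∀ x ∈ U, ContDiffAt ℝ 1 f x := fun x hx => hf.contDiffAt (hU.mem_nhds hx)
  have hd : ∀ x ∈ U, ContinuousAt (fderiv ℝ f) x := fun x hx =>
    ((hfa x hx).fderiv_right (m := 0) (by simp)).continuousAt
  rw [hasFDerivAt_iff_isLittleO_nhds_zero, isLittleO_iff]
  intro ε hε
  -- Half of ε pays for the linear approximation with the derivative frozen at `c k`, half for
  -- unfreezing it to `c z.2`.
  have key : ∀ k ∈ (univ : Set K), ∀ᶠ z : X × K in 𝓝 (0, k),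
      ‖f (c z.2 + z.1) - f (c z.2) - fderiv ℝ f (c z.2) z.1‖ ≤ ε * ‖z.1‖ ∧ c z.2 + z.1 ∈ U := by
    intro k _
    have h1 : Tendsto (fun z : X × K => (c z.2 + z.1, c z.2)) (𝓝 (0, k)) (𝓝 (c k, c k)) := by
      have : Continuous (fun z : X × K => (c z.2 + z.1, c z.2)) := by fun_prop
      simpa using this.tendsto (0, k)
    have hs := (((hfa _ (hc k)).hasStrictFDerivAt (by simp)).isLittleO.comp_tendsto h1).def
      (half_pos hε)
    have h2 : ∀ᶠ z : X × K in 𝓝 (0, k), ‖fderiv ℝ f (c z.2) - fderiv ℝ f (c k)‖ < ε / 2 := by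
      have : ContinuousAt (fun z : X × K => fderiv ℝ f (c z.2)) (0, k) :=
        ContinuousAt.comp (g := fderiv ℝ f) (hd _ (hc k)) (by fun_prop)
      simpa [dist_eq_norm] using this.eventually (Metric.ball_mem_nhds _ (half_pos hε))
    have h3 : ∀ᶠ z : X × K in 𝓝 (0, k), c z.2 + z.1 ∈ U := by
      have : Continuous (fun z : X × K => c z.2 + z.1) := by fun_prop
      exact this.continuousAt.eventually_mem (hU.mem_nhds (by simpa using hc k))
    filter_upwards [hs, h2, h3] with z hz1 hz2 hz3
    refine ⟨?_, hz3⟩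
    simp only [Function.comp_apply, add_sub_cancel_left] at hz1
    have : f (c z.2 + z.1) - f (c z.2) - fderiv ℝ f (c z.2) z.1 =
      (f (c z.2 + z.1) - f (c z.2) - fderiv ℝ f (c k) z.1) -
        (fderiv ℝ f (c z.2) - fderiv ℝ f (c k)) z.1 := by
      simp
    rw [this]
    calc _ ≤ ε / 2 * ‖z.1‖ + ε / 2 * ‖z.1‖ := (norm_sub_le _ _).trans (add_le_add hz1
          ((ContinuousLinearMap.le_opNorm _ _).trans (by gcongr)))
      _ = ε * ‖z.1‖ := by ring
  have key2 := isCompact_univ.eventually_forall_of_forall_eventually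
    (P := fun v k => ‖f (c k + v) - f (c k) - fderiv ℝ f (c k) v‖ ≤ ε * ‖v‖ ∧ c k + v ∈ U) key
  obtain ⟨δ, hδ, hball⟩ := Metric.eventually_nhds_iff.1 key2
  rw [Metric.eventually_nhds_iff]
  refine ⟨δ, hδ, fun η hη => ?_⟩
  rw [dist_zero_right] at hη
  have hk : ∀ k, dist (η k) 0 < δ := fun k => by
    rw [dist_zero_right]; exact (η.norm_coe_le_norm k).trans_lt hη
  refine (ContinuousMap.norm_le _ (by positivity)).2 fun k => ?_
  have e1 : nemytskii f (c + η) k = f (c k + η k) := nemytskii_apply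
    (fun k => (hfa _ ((hball (hk k) k (mem_univ k)).2)).continuousAt) k
  have e2 : nemytskii f c k = f (c k) := nemytskii_apply (fun k => (hfa _ (hc k)).continuousAt) k
  have e3 : nemytskii (fderiv ℝ f) c k = fderiv ℝ f (c k) :=
    nemytskii_apply (fun k => hd _ (hc k)) k
  simp only [ContinuousMap.sub_apply, e1, e2, pointwiseApply_apply, e3]
  refine (hball (hk k) k (mem_univ k)).1.trans ?_
  gcongr
  exact η.norm_coe_le_norm k

theorem isOpen_setOf_forall_mem {U : Set X} (hU : IsOpen U) :
    IsOpen {c : C(K, X) | ∀ k, c k ∈ U} := by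
  simpa [MapsTo] using ContinuousMap.isOpen_setOfPred_mapsTo (isCompact_univ (X := K)) hU

end Nemytskii

universe u

/-- Induction on the order through `hasFDerivAt_nemytskii`. The induction replaces F by `X →L[ℝ] F`,
which is why X and F share a universe. -/
theorem contDiffOn_nemytskii {X F : Type u} [NormedAddCommGroup X] [NormedSpace ℝ X]
    [NormedAddCommGroup F] [NormedSpace ℝ F] {K : Type*} [TopologicalSpace K] [CompactSpace K]
    (m : ℕ) {f : X → F} {U : Set X} (hU : IsOpen U) (hf : ContDiffOn ℝ ∞ f U) :
    ContDiffOn ℝ m (nemytskii (K := K) f) {c | ∀ k, c k ∈ U} := by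
  induction m generalizing F with
  | zero =>
    have := fun c (hc : c ∈ {c : C(K, X) | ∀ k, c k ∈ U}) =>
      (hasFDerivAt_nemytskii hU (hf.of_le (by simp)) hc).continuousAt.continuousWithinAt
        (s := {c | ∀ k, c k ∈ U})
    exact contDiffOn_zero.2 this
  | succ m ih =>
    push_cast
    rw [contDiffOn_succ_iff_fderiv_of_isOpen (isOpen_setOf_forall_mem hU)]
    have hd : ∀ c ∈ {c : C(K, X) | ∀ k, c k ∈ U}, HasFDerivAt (nemytskii (K := K) f)
        (pointwiseApply (nemytskii (fderiv ℝ f) c)) c :=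
      fun c hc => hasFDerivAt_nemytskii hU (hf.of_le (by simp)) hc
    refine ⟨fun c hc => (hd c hc).differentiableAt.differentiableWithinAt, by simp, ?_⟩
    have h2 := ih (F := X →L[ℝ] F) (hf.fderiv_of_isOpen hU (m := ∞) (by simp))
    refine ContDiffOn.congr (f := fun c => pointwiseApply (nemytskii (fderiv ℝ f) c)) ?_
      fun c hc => (hd c hc).fderiv
    exact ((pointwiseApply (K := K) (X := X) (F := F)).contDiff (n := m)).comp_contDiffOn h2

theorem SmoothNear.nemytskii {X F : Type u} [NormedAddCommGroup X] [NormedSpace ℝ X]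
    [NormedAddCommGroup F] [NormedSpace ℝ F] {K : Type*} [TopologicalSpace K] [CompactSpace K]
    {f : X → F} {c : C(K, X)} (h : ∀ k, SmoothNear f (c k)) :
    SmoothNear (KAMBirkhoff.nemytskii (K := K) f) c := by
  have hU := isOpen_smoothNear f
  have := contDiffOn_infty.2 fun m => contDiffOn_nemytskii (K := K) m hU
    (fun x hx => (SmoothNear.contDiffAt hx).contDiffWithinAt)
  filter_upwards [(isOpen_setOf_forall_mem (K := K) hU).mem_nhds h] with c' hc'
  exact this.contDiffAt ((isOpen_setOf_forall_mem hU).mem_nhds hc')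

section

/-! ### Integrals depending smoothly on a parameter. -/

section ParametricIntegral

open MeasureTheory

variable {Y T F : Type} [NormedAddCommGroup Y] [NormedSpace ℝ Y] [NormedAddCommGroup T]
  [NormedSpace ℝ T] [NormedAddCommGroup F] [NormedSpace ℝ F]
  {K : Type*} [TopologicalSpace K] [CompactSpace K]

section Weighted

variable [MeasurableSpace K] [OpensMeasurableSpace K] (μ : Measure K) [IsFiniteMeasure μ]

theorem integrable_weight_smul (κ : C(K, ℝ)) (c : C(K, F)) :
    Integrable (fun k => κ k • c k) μ :=
  Continuous.integrable_of_hasCompactSupport (by fun_prop) (HasCompactSupport.of_compactSpace _)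

/-- Integration against a continuous weight, as a continuous linear functional. -/
def weightedIntegral (κ : C(K, ℝ)) : C(K, F) →L[ℝ] F :=
  LinearMap.mkContinuous
    { toFun := fun c => ∫ k, κ k • c k ∂μ
      map_add' := fun c d => by
        simp only [ContinuousMap.add_apply, smul_add]
        exact integral_add (integrable_weight_smul μ κ c) (integrable_weight_smul μ κ d)
      map_smul' := fun a c => by
        simp only [ContinuousMap.smul_apply, RingHom.id_apply, smul_comm _ a]
        exact integral_smul _ _ }
    (‖κ‖ * μ.real univ) fun c => by
      refine (norm_integral_le_of_norm_le_const (C := ‖κ‖ * ‖c‖)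
        (Eventually.of_forall fun k => ?_)).trans (le_of_eq (by ring))
      rw [norm_smul]
      gcongr
      exacts [κ.norm_coe_le_norm k, c.norm_coe_le_norm k]

theorem weightedIntegral_apply (κ : C(K, ℝ)) (c : C(K, F)) :
    weightedIntegral μ κ c = ∫ k, κ k • c k ∂μ := rfl

end Weighted

/-- Constant curves in the first factor of a product. -/
def constInl : Y →L[ℝ] C(K, Y × T) :=
  LinearMap.mkContinuous
    { toFun := fun y => ContinuousMap.const K (y, (0 : T))
      map_add' := fun y z => by ext k <;> simp
      map_smul' := fun a y => by ext k <;> simp } 1 fun y => by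
      rw [one_mul]
      refine (ContinuousMap.norm_le _ (norm_nonneg _)).2 fun k => ?_
      simp

/-- The curve `k ↦ (y, j k)`. -/
def pairCurve (j : C(K, T)) (y : Y) : C(K, Y × T) :=
  constInl y + (ContinuousMap.const K (0 : Y)).prodMk j

@[simp] theorem pairCurve_apply (j : C(K, T)) (y : Y) (k : K) : pairCurve j y k = (y, j k) := by
  simp [pairCurve, constInl]

theorem hasFDerivAt_pairCurve (j : C(K, T)) (y : Y) :
    HasFDerivAt (pairCurve j) (constInl : Y →L[ℝ] C(K, Y × T)) y := by
  have h := (constInl : Y →L[ℝ] C(K, Y × T)).hasFDerivAt (x := y)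
  exact h.add_const ((ContinuousMap.const K (0 : Y)).prodMk j)

theorem contDiff_pairCurve (j : C(K, T)) : ContDiff ℝ ∞ (pairCurve (Y := Y) j) :=
  ContDiff.add (constInl : Y →L[ℝ] C(K, Y × T)).contDiff contDiff_const

variable [MeasurableSpace K] [OpensMeasurableSpace K] (μ : Measure K) [IsFiniteMeasure μ]

/-- The integral is a bounded linear functional of the superposition of f with the curve k ↦ (y, j
k), and this curve is affine in y. Only smoothness near the compact set of points (y, j k) enters.
-/
theorem SmoothNear.weightedIntegral (κ : C(K, ℝ)) (j : C(K, T)) {f : Y → T → F} {y : Y}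
    (h : ∀ k, SmoothNear (fun w : Y × T => f w.1 w.2) (y, j k)) :
    SmoothNear (fun y => ∫ k, κ k • f y (j k) ∂μ) y := by
  have h1 : SmoothNear (fun y => KAMBirkhoff.weightedIntegral μ κ
      (KAMBirkhoff.nemytskii (fun w : Y × T => f w.1 w.2) (pairCurve j y))) y :=
    SmoothNear.contDiff_comp (SmoothNear.comp (f := pairCurve j)
      (SmoothNear.nemytskii (by simpa using h))
      (smoothNear_of_contDiff (contDiff_pairCurve j) y))
      (ContinuousLinearMap.contDiff (E := C(K, F)) (KAMBirkhoff.weightedIntegral μ κ))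
  refine h1.congr ?_
  have h2 : ∀ᶠ y' in 𝓝 y, ∀ k, pairCurve j y' k ∈ {w | SmoothNear (fun w : Y × T => f w.1 w.2) w} :=
    (contDiff_pairCurve (Y := Y) j).continuous.continuousAt.eventually_mem
      ((isOpen_setOf_forall_mem (isOpen_smoothNear _)).mem_nhds (by simpa using h))
  filter_upwards [h2] with y' hy'
  rw [weightedIntegral_apply]
  refine integral_congr_ae (Eventually.of_forall fun k => ?_)
  simp only
  rw [nemytskii_apply (fun k => (hy' k).continuousAt) k]
  simp

theorem fderiv_weightedIntegral (κ : C(K, ℝ)) (j : C(K, T)) {f : Y → T → F} {y : Y}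
    (h : ∀ k, SmoothNear (fun w : Y × T => f w.1 w.2) (y, j k)) (v : Y) :
    fderiv ℝ (fun y => ∫ k, κ k • f y (j k) ∂μ) y v =
      ∫ k, κ k • fderiv ℝ (fun y => f y (j k)) y v ∂μ := by
  set g : Y × T → F := fun w => f w.1 w.2
  have hU := isOpen_smoothNear g
  have hg : ContDiffOn ℝ 1 g {w | SmoothNear g w} := fun w hw =>
    (hw.contDiffAt.of_le (by simp)).contDiffWithinAt
  have hmem : ∀ k, pairCurve j y k ∈ {w | SmoothNear g w} := by simpa using h
  have hp : HasFDerivAt (pairCurve j) (constInl : Y →L[ℝ] C(K, Y × T)) y :=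
    hasFDerivAt_pairCurve j y
  have h0 : HasFDerivAt (nemytskii g ∘ pairCurve j) ((pointwiseApply (nemytskii (fderiv ℝ g)
      (pairCurve j y))).comp constInl) y :=
    (hasFDerivAt_nemytskii hU hg hmem).comp y hp
  have h1 := (weightedIntegral μ κ (F := F)).hasFDerivAt.comp y h0
  have h2 : ∀ᶠ y' in 𝓝 y, ∀ k, pairCurve j y' k ∈ {w | SmoothNear g w} :=
    (contDiff_pairCurve (Y := Y) j).continuous.continuousAt.eventually_mem
      ((isOpen_setOf_forall_mem hU).mem_nhds hmem)
  have h3 : (fun y => ∫ k, κ k • f y (j k) ∂μ) =ᶠ[𝓝 y]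
      ((weightedIntegral μ κ) ∘ (nemytskii g ∘ pairCurve j)) := by
    filter_upwards [h2] with y' hy'
    simp only [Function.comp_apply, weightedIntegral_apply]
    refine integral_congr_ae (Eventually.of_forall fun k => ?_)
    simp only
    rw [nemytskii_apply (fun k => (hy' k).continuousAt) k]
    simp [g]
  rw [(h1.congr_of_eventuallyEq h3).fderiv]
  simp only [ContinuousLinearMap.comp_apply, weightedIntegral_apply]
  refine integral_congr_ae (Eventually.of_forall fun k => ?_)
  simp only [pointwiseApply_apply]
  rw [nemytskii_apply (fun k => (hmem k).fderiv.continuousAt) k]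
  have hd : HasFDerivAt (fun y => f y (j k)) ((fderiv ℝ g (y, j k)).comp
      (ContinuousLinearMap.inl ℝ Y T)) y :=
    HasFDerivAt.comp (g := g) (f := fun y => (y, j k)) y (h k).differentiableAt.hasFDerivAt (hasFDerivAt_prodMk_left y (j k))
  rw [hd.fderiv]
  simp [constInl]

theorem intervalIntegral_eq_weighted (f : ℝ → F) :
    ∫ t in (0 : ℝ)..1, f t = ∫ k : Icc (0 : ℝ) 1, (1 : C(Icc (0 : ℝ) 1, ℝ)) k •
      f ((⟨Subtype.val, continuous_subtype_val⟩ : C(Icc (0 : ℝ) 1, ℝ)) k)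
        ∂(Measure.comap Subtype.val volume) := by
  rw [intervalIntegral.integral_of_le zero_le_one, ← integral_Icc_eq_integral_Ioc,
    ← integral_subtype_comap measurableSet_Icc]
  simp

instance : IsFiniteMeasure (Measure.comap (Subtype.val : Icc (0 : ℝ) 1 → ℝ) volume) := by
  constructor
  rw [(MeasurableEmbedding.subtype_coe measurableSet_Icc).comap_apply, image_univ,
    Subtype.range_coe]
  simp

theorem SmoothNear.intervalIntegral {f : Y → ℝ → F} {y : Y}
    (h : ∀ t ∈ Icc (0 : ℝ) 1, SmoothNear (fun w : Y × ℝ => f w.1 w.2) (y, t)) :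
    SmoothNear (fun y => ∫ t in (0 : ℝ)..1, f y t) y := by
  simp only [intervalIntegral_eq_weighted]
  exact SmoothNear.weightedIntegral (K := Icc (0 : ℝ) 1) _ _ _ fun k => h k k.2

theorem fderiv_intervalIntegral {f : Y → ℝ → F} {y : Y}
    (h : ∀ t ∈ Icc (0 : ℝ) 1, SmoothNear (fun w : Y × ℝ => f w.1 w.2) (y, t)) (v : Y) :
    fderiv ℝ (fun y => ∫ t in (0 : ℝ)..1, f y t) y v =
      ∫ t in (0 : ℝ)..1, fderiv ℝ (fun y => f y t) y v := by
  simp only [intervalIntegral_eq_weighted]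
  exact fderiv_weightedIntegral (K := Icc (0 : ℝ) 1) _ _ _ (fun k => h k k.2) v

end ParametricIntegral

/-! ### Hadamard's lemma with parameters. -/

section Hadamard

variable {Y F : Type} [NormedAddCommGroup Y] [NormedSpace ℝ Y] [NormedAddCommGroup F]
  [NormedSpace ℝ F]

/-- The Hadamard quotient `(v t y - v 0 y) / t`, extended smoothly to `t = 0`. -/
def hadamardQuot (v : ℝ → Y → F) (t : ℝ) (y : Y) : F :=
  ∫ s in (0 : ℝ)..1, deriv (fun t => v t y) (s * t)

theorem smoothNear_deriv_fst {v : ℝ → Y → F} {t : ℝ} {y : Y}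
    (hv : SmoothNear (fun w : ℝ × Y => v w.1 w.2) (t, y)) :
    SmoothNear (fun w : ℝ × Y => deriv (fun t => v t w.2) w.1) (t, y) := by
  have h := hv.fderiv.clm_apply (smoothNear_const ((1 : ℝ), (0 : Y)) _)
  refine h.congr ?_
  filter_upwards [hv] with w hw
  have hd : HasFDerivAt (fun t => v t w.2) ((fderiv ℝ (fun w : ℝ × Y => v w.1 w.2) w).comp
      (ContinuousLinearMap.inl ℝ ℝ Y)) w.1 :=
    HasFDerivAt.comp (g := fun w : ℝ × Y => v w.1 w.2) (f := fun t => (t, w.2)) w.1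
      (hw.differentiableAt (by simp)).hasFDerivAt (hasFDerivAt_prodMk_left w.1 w.2)
  rw [hd.hasDerivAt.deriv]
  simp

theorem SmoothNear.hadamardQuot {v : ℝ → Y → F} {y : Y}
    (hv : SmoothNear (fun w : ℝ × Y => v w.1 w.2) (0, y)) :
    SmoothNear (fun w : ℝ × Y => hadamardQuot v w.1 w.2) (0, y) := by
  refine SmoothNear.intervalIntegral (f := fun (w : ℝ × Y) s =>
    deriv (fun t => v t w.2) (s * w.1)) fun s _ => ?_
  exact SmoothNear.comp_of_eq (f := fun q : (ℝ × Y) × ℝ => (q.2 * q.1.1, q.1.2))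
    (smoothNear_deriv_fst hv) (smoothNear_of_contDiff (by fun_prop) _) (by simp)

/-- Fundamental theorem of calculus along s ↦ v (s t) y. Working in a ball keeps the whole segment
from t = 0 in the region of smoothness. -/
theorem eventually_eq_smul_hadamardQuot [CompleteSpace F] {v : ℝ → Y → F} {y : Y}
    (hv : SmoothNear (fun w : ℝ × Y => v w.1 w.2) (0, y)) :
    ∀ᶠ w : ℝ × Y in 𝓝 (0, y), v w.1 w.2 = v 0 w.2 + w.1 • hadamardQuot v w.1 w.2 := by
  obtain ⟨δ, hδ, hb⟩ := Metric.eventually_nhds_iff_ball.1 hv.eventually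
  rw [Metric.eventually_nhds_iff_ball]
  refine ⟨δ, hδ, fun w hw => ?_⟩
  have hmem : ∀ s ∈ uIcc (0 : ℝ) 1, (s * w.1, w.2) ∈ Metric.ball ((0 : ℝ), y) δ := by
    intro s hs
    rw [uIcc_of_le zero_le_one] at hs
    rw [Metric.mem_ball, Prod.dist_eq, max_lt_iff] at hw ⊢
    refine ⟨?_, hw.2⟩
    simp only [dist_zero_right, norm_mul] at hw ⊢
    calc _ ≤ 1 * ‖w.1‖ := by
          gcongr
          rw [Real.norm_eq_abs, abs_of_nonneg hs.1]
          exact hs.2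
      _ < δ := by simpa using hw.1
  have hd : ∀ s ∈ uIcc (0 : ℝ) 1, HasDerivAt (fun s => v (s * w.1) w.2)
      (w.1 • deriv (fun t => v t w.2) (s * w.1)) s := by
    intro s hs
    have hd' : DifferentiableAt ℝ (fun t => v t w.2) (s * w.1) :=
      DifferentiableAt.comp (g := fun w : ℝ × Y => v w.1 w.2) (s * w.1)
        (hb _ (hmem s hs)).differentiableAt
        (hasFDerivAt_prodMk_left (𝕜 := ℝ) (s * w.1) w.2).differentiableAt
    exact hd'.hasDerivAt.scomp s (by simpa using (hasDerivAt_id s).mul_const w.1)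
  have hc : ContinuousOn (fun s => w.1 • deriv (fun t => v t w.2) (s * w.1)) (uIcc (0 : ℝ) 1) := by
    refine continuousOn_const.smul fun s hs => ContinuousAt.continuousWithinAt ?_
    exact ContinuousAt.comp (g := fun w : ℝ × Y => deriv (fun t => v t w.2) w.1)
      (f := fun s : ℝ => (s * w.1, w.2))
      (smoothNear_deriv_fst (hb _ (hmem s hs))).continuousAt (by fun_prop)
  have := intervalIntegral.integral_eq_sub_of_hasDerivAt hd hc.intervalIntegrable
  simp only [intervalIntegral.integral_smul, one_mul, zero_mul] at this
  rw [hadamardQuot, this]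
  abel

end Hadamard

end

/-! ### Order of vanishing along r = 0 and homogeneous leading terms. -/

section Vanishing

variable {E F G P : Type} [NormedAddCommGroup E] [NormedSpace ℝ E] [NormedAddCommGroup F]
  [NormedSpace ℝ F] [NormedAddCommGroup G] [NormedSpace ℝ G] [NormedAddCommGroup P]
  [NormedSpace ℝ P]

/-- `u (x, r) = O(‖r‖ ^ k)`, locally uniformly in `x`. -/
def VanishesTo (k : ℕ) (u : E × E → F) : Prop :=
  ∀ x : E, u =O[𝓝 (x, 0)] fun z => ‖z.2‖ ^ k

theorem isBigO_pow_of_le {k l : ℕ} (h : l ≤ k) (x : E) :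
    (fun z : E × E => ‖z.2‖ ^ k) =O[𝓝 (x, 0)] fun z => ‖z.2‖ ^ l := by
  refine IsBigO.of_bound 1 ?_
  have : ∀ᶠ z : E × E in 𝓝 (x, 0), ‖z.2‖ < 1 := by
    have h : ContinuousAt (fun z : E × E => ‖z.2‖) (x, 0) := by fun_prop
    exact h.eventually_lt_const (by simp)
  filter_upwards [this] with z hz
  simp only [norm_pow, norm_norm, one_mul]
  exact pow_le_pow_of_le_one (norm_nonneg _) hz.le h

theorem VanishesTo.mono {k l : ℕ} {u : E × E → F} (h : VanishesTo k u) (hl : l ≤ k) :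
    VanishesTo l u := fun x => (h x).trans (isBigO_pow_of_le hl x)

theorem VanishesTo.add {k : ℕ} {u v : E × E → F} (hu : VanishesTo k u) (hv : VanishesTo k v) :
    VanishesTo k fun z => u z + v z := fun x => (hu x).add (hv x)

theorem VanishesTo.sub {k : ℕ} {u v : E × E → F} (hu : VanishesTo k u) (hv : VanishesTo k v) :
    VanishesTo k fun z => u z - v z := fun x => (hu x).sub (hv x)

theorem VanishesTo.congr {k : ℕ} {u v : E × E → F} (hu : VanishesTo k u)
    (h : ∀ x, u =ᶠ[𝓝 (x, 0)] v) : VanishesTo k v := fun x =>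
  (hu x).congr' (h x) EventuallyEq.rfl

theorem VanishesTo.eq_zero {k : ℕ} {u : E × E → F} (hu : VanishesTo (k + 1) u) (x : E) :
    u (x, 0) = 0 := by
  obtain ⟨C, hC⟩ := (hu x).bound
  simpa using hC.self_of_nhds

theorem VanishesTo.hasFDerivAt {k : ℕ} {u : E × E → F} (hu : VanishesTo (k + 2) u) (x : E) :
    HasFDerivAt u (0 : E × E →L[ℝ] F) (x, 0) := by
  have h0 : u (x, 0) = 0 := VanishesTo.eq_zero (k := k + 1) hu x
  rw [hasFDerivAt_iff_isLittleO]
  simp only [h0, sub_zero, _root_.zero_apply]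
  refine ((hu.mono (by omega : 2 ≤ k + 2)) x).trans_isLittleO ?_
  have h1 : (fun z : E × E => ‖z.2‖) =O[𝓝 (x, 0)] fun z => z - (x, 0) :=
    IsBigO.of_bound 1 (Eventually.of_forall fun z => by
      have := norm_snd_le (z - (x, (0 : E)))
      rw [Prod.snd_sub, sub_zero] at this
      rwa [norm_norm, one_mul])
  have h2 : (fun z : E × E => ‖z.2‖) =o[𝓝 (x, 0)] fun _ => (1 : ℝ) := by
    rw [isLittleO_one_iff]
    have h : ContinuousAt (fun z : E × E => ‖z.2‖) (x, 0) := by fun_prop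
    simpa [ContinuousAt] using h
  simpa [pow_two] using h2.mul_isBigO h1.norm_right

/-- Strict differentiability bounds the difference between z and its projection (z.1, 0) uniformly
for z near (x, 0); at the projection the function is zero. -/
theorem VanishesTo.fst_of_smoothNear {u : E × E → F} (hs : ∀ x, SmoothNear u (x, 0))
    (h0 : ∀ x, u (x, 0) = 0) : VanishesTo 1 u := by
  intro x
  have h1 := (hs x).contDiffAt.hasStrictFDerivAt (by simp)
  have h2 : (fun z : E × E => u z - u (z.1, 0)) =O[𝓝 (x, 0)] fun z => z - (z.1, 0) := by
    have ht : Tendsto (fun z : E × E => (z, (z.1, (0 : E)))) (𝓝 (x, 0)) (𝓝 ((x, 0), (x, 0))) := by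
      have : Continuous (fun z : E × E => (z, (z.1, (0 : E)))) := by fun_prop
      exact this.tendsto (x, 0)
    exact h1.isBigO_sub.comp_tendsto ht
  simp only [h0, sub_zero] at h2
  refine h2.trans (IsBigO.of_bound 1 (Eventually.of_forall fun z => ?_))
  simp [Prod.norm_def]

/-- The quotient of `u (x, t r)` by `t ^ j`, extended smoothly to `t = 0`, provided that `u`
vanishes to order `j` along `r = 0`. -/
def scaleQuot (u : E × E → F) : ℕ → ℝ → E × E → F
  | 0 => fun t z => u (z.1, t • z.2)
  | j + 1 => hadamardQuot (scaleQuot u j)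

theorem smoothNear_scaleQuot {u : P → E × E → F} {p : P}
    (hu : ∀ x, SmoothNear (fun w : P × (E × E) => u w.1 w.2) (p, (x, 0))) (j : ℕ) (z : E × E) :
    SmoothNear (fun w : ℝ × (P × (E × E)) => scaleQuot (u w.2.1) j w.1 w.2.2) (0, (p, z)) := by
  induction j with
  | zero =>
    exact SmoothNear.comp_of_eq
      (f := fun w : ℝ × (P × (E × E)) => (w.2.1, (w.2.2.1, w.1 • w.2.2.2)))
      (hu z.1) (smoothNear_of_contDiff (by fun_prop) _) (by simp)
  | succ j ih =>
    exact SmoothNear.hadamardQuot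
      (v := fun (t : ℝ) (y : P × (E × E)) => scaleQuot (u y.1) j t y.2) ih

theorem smoothNear_scaleQuot' {u : E × E → F} (hu : ∀ x, SmoothNear u (x, 0)) (j : ℕ) (z : E × E) :
    SmoothNear (fun w : ℝ × (E × E) => scaleQuot u j w.1 w.2) (0, z) := by
  have h := smoothNear_scaleQuot (u := fun _ : ℝ => u) (p := 0)
    (fun x => SmoothNear.comp (f := fun w : ℝ × (E × E) => w.2) (hu x)
      (smoothNear_of_contDiff contDiff_snd _)) j z
  exact SmoothNear.comp_of_eq (f := fun w : ℝ × (E × E) => (w.1, ((0 : ℝ), w.2))) h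
    (smoothNear_of_contDiff (by fun_prop) _) rfl

/-- Each further division by t is exact because the quotient already obtained vanishes at t = 0: the
bound of order j + 1 makes it O(t) for t ≠ 0, and it is continuous. -/
theorem eventually_eq_pow_smul_scaleQuot [CompleteSpace F] {u : E × E → F}
    (hu : ∀ x, SmoothNear u (x, 0)) {k : ℕ} (hk : VanishesTo k u) {j : ℕ} (hj : j ≤ k) (z : E × E) :
    ∀ᶠ w : ℝ × (E × E) in 𝓝 (0, z), u (w.2.1, w.1 • w.2.2) = w.1 ^ j • scaleQuot u j w.1 w.2 := by
  induction j generalizing z with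
  | zero => exact Eventually.of_forall fun w => by simp [scaleQuot]
  | succ j ih =>
    have hz : ∀ z, scaleQuot u j 0 z = 0 := by
      intro z
      have hc : ContinuousAt (fun t : ℝ => scaleQuot u j t z) 0 :=
        ContinuousAt.comp (g := fun w : ℝ × (E × E) => scaleQuot u j w.1 w.2)
          (f := fun t : ℝ => (t, z)) (smoothNear_scaleQuot' hu j z).continuousAt (by fun_prop)
      have ht1 : Tendsto (fun t : ℝ => (t, z)) (𝓝 0) (𝓝 (0, z)) := by
        have : Continuous (fun t : ℝ => (t, z)) := by fun_prop
        exact this.tendsto 0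
      have ht2 : Tendsto (fun t : ℝ => (z.1, t • z.2)) (𝓝 0) (𝓝 (z.1, 0)) := by
        have : Continuous (fun t : ℝ => (z.1, t • z.2)) := by fun_prop
        simpa using this.tendsto 0
      obtain ⟨C, hC⟩ := ((hk.mono hj) z.1).bound
      have hb : ∀ᶠ t in 𝓝[≠] (0 : ℝ), ‖scaleQuot u j t z‖ ≤ C * ‖z.2‖ ^ (j + 1) * |t| := by
        have := (ht1.eventually (ih (by omega) z)).and (ht2.eventually hC)
        filter_upwards [this.filter_mono nhdsWithin_le_nhds, self_mem_nhdsWithin] with t ht ht0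
        have hpos : 0 < |t| ^ j := by have : t ≠ 0 := ht0; positivity
        have := ht.2
        rw [ht.1, norm_smul, norm_pow, Real.norm_eq_abs, norm_pow, norm_norm, norm_smul, mul_pow,
          Real.norm_eq_abs] at this
        refine le_of_mul_le_mul_left (this.trans (le_of_eq ?_)) hpos
        ring
      have hl : Tendsto (fun t : ℝ => C * ‖z.2‖ ^ (j + 1) * |t|) (𝓝[≠] 0) (𝓝 0) := by
        have : Continuous (fun t : ℝ => C * ‖z.2‖ ^ (j + 1) * |t|) := by fun_prop
        simpa using (this.tendsto 0).mono_left nhdsWithin_le_nhds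
      have h0 : Tendsto (fun t : ℝ => scaleQuot u j t z) (𝓝[≠] 0) (𝓝 0) :=
        squeeze_zero_norm' hb hl
      exact tendsto_nhds_unique (hc.tendsto.mono_left nhdsWithin_le_nhds) h0
    filter_upwards [ih (by omega) z,
      eventually_eq_smul_hadamardQuot (smoothNear_scaleQuot' hu j z)] with w h1 h2
    rw [h1, h2, hz, zero_add, scaleQuot, smul_smul, pow_succ]

variable [FiniteDimensional ℝ E]

/-- Use the factorization with t = ‖r‖ and the direction r / ‖r‖; compactness of the unit ball
bounds the cofactor uniformly. Together with `eventually_eq_pow_smul_scaleQuot` this translates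
orders of vanishing into smooth factorizations and back, so that they can be differentiated. -/
theorem vanishesTo_of_scaling {k : ℕ} {f : E × E → F} {g : ℝ → E × E → F}
    (hg : ∀ z, ContinuousAt (fun w : ℝ × (E × E) => g w.1 w.2) (0, z))
    (h : ∀ z, ∀ᶠ w : ℝ × (E × E) in 𝓝 (0, z), f (w.2.1, w.1 • w.2.2) = w.1 ^ k • g w.1 w.2) :
    VanishesTo k f := by
  intro x
  have hK : IsCompact (Metric.closedBall (0 : E) 1) := isCompact_closedBall 0 1
  have hgc : Continuous fun r : E => g 0 (x, r) := continuous_iff_continuousAt.2 fun r =>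
    ContinuousAt.comp (g := fun w : ℝ × (E × E) => g w.1 w.2) (f := fun r : E => ((0 : ℝ), (x, r)))
      (hg (x, r)) (by fun_prop)
  obtain ⟨C, hC⟩ := hK.exists_bound_of_continuousOn hgc.continuousOn
  have key : ∀ r ∈ Metric.closedBall (0 : E) 1, ∀ᶠ q : (ℝ × E) × E in 𝓝 (((0 : ℝ), x), r),
      ‖f (q.1.2, q.1.1 • q.2)‖ ≤ (C + 1) * ‖q.1.1‖ ^ k := by
    intro r hr
    have ht : Tendsto (fun q : (ℝ × E) × E => (q.1.1, (q.1.2, q.2))) (𝓝 (((0 : ℝ), x), r))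
        (𝓝 (0, (x, r))) := by
      have : Continuous (fun q : (ℝ × E) × E => (q.1.1, (q.1.2, q.2))) := by fun_prop
      exact this.tendsto _
    have hb : ∀ᶠ w : ℝ × (E × E) in 𝓝 (0, (x, r)), ‖g w.1 w.2‖ < C + 1 :=
      (hg (x, r)).norm.eventually_lt_const (by have := hC r hr; dsimp only; linarith)
    filter_upwards [ht.eventually (h (x, r)), ht.eventually hb] with q h1 h2
    rw [h1, norm_smul, norm_pow, mul_comm]
    gcongr
  have key2 := hK.eventually_forall_of_forall_eventually
    (P := fun (q : ℝ × E) r => ‖f (q.2, q.1 • r)‖ ≤ (C + 1) * ‖q.1‖ ^ k) key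
  have ht : Tendsto (fun z : E × E => (‖z.2‖, z.1)) (𝓝 (x, 0)) (𝓝 ((0 : ℝ), x)) := by
    have : Continuous (fun z : E × E => (‖z.2‖, z.1)) := by fun_prop
    simpa using this.tendsto (x, 0)
  refine IsBigO.of_bound (C + 1) ?_
  filter_upwards [ht.eventually key2] with z hz
  -- The ball is used instead of the sphere because for `z.2 = 0` the normalized vector is 0.
  have h1 := hz (‖z.2‖⁻¹ • z.2) (by
    rw [mem_closedBall_zero_iff, norm_smul, norm_inv, norm_norm]
    exact inv_mul_le_one)
  have h2 : ‖z.2‖ • ‖z.2‖⁻¹ • z.2 = z.2 := by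
    by_cases hz2 : z.2 = 0
    · simp [hz2]
    · rw [smul_smul, mul_inv_cancel₀ (norm_ne_zero_iff.2 hz2), one_smul]
  simp only [h2] at h1
  simpa using h1

/-- Both sides are continuous in t and agree on a punctured neighbourhood, so the case t = 0
follows. This permits a division by t before the order of vanishing is read off. -/
theorem vanishesTo_of_scaling_ne {k : ℕ} {f : E × E → F} {g : ℝ → E × E → F}
    (hf : ∀ x, ∀ᶠ z in 𝓝 (x, 0), ContinuousAt f z)
    (hg : ∀ z, ∀ᶠ w : ℝ × (E × E) in 𝓝 (0, z), ContinuousAt (fun w : ℝ × (E × E) => g w.1 w.2) w)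
    (h : ∀ z, ∀ᶠ w : ℝ × (E × E) in 𝓝 (0, z), w.1 ≠ 0 →
      f (w.2.1, w.1 • w.2.2) = w.1 ^ k • g w.1 w.2) :
    VanishesTo k f := by
  refine vanishesTo_of_scaling (fun z => (hg z).self_of_nhds) fun z => ?_
  have ht : Tendsto (fun w : ℝ × (E × E) => (w.2.1, w.1 • w.2.2)) (𝓝 (0, z)) (𝓝 (z.1, 0)) := by
    have : Continuous (fun w : ℝ × (E × E) => (w.2.1, w.1 • w.2.2)) := by fun_prop
    simpa using this.tendsto (0, z)
  filter_upwards [eventually_eventually_nhds.2 (h z), hg z, ht.eventually (hf z.1)] with w h1 h2 h3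
  by_cases hw : w.1 = 0
  swap
  · exact h1.self_of_nhds hw
  obtain ⟨t, y⟩ := w
  obtain rfl : t = 0 := hw
  have hty : Tendsto (fun t : ℝ => (t, y)) (𝓝 0) (𝓝 (0, y)) := by
    have : Continuous (fun t : ℝ => (t, y)) := by fun_prop
    exact this.tendsto 0
  have e : ∀ᶠ t in 𝓝[≠] (0 : ℝ), f (y.1, t • y.2) = t ^ k • g t y := by
    filter_upwards [(hty.eventually h1).filter_mono nhdsWithin_le_nhds, self_mem_nhdsWithin]
      with t ht ht0 using ht ht0
  have c1 : ContinuousAt (fun t : ℝ => f (y.1, t • y.2)) 0 :=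
    ContinuousAt.comp (g := f) h3 (by fun_prop)
  have c2 : ContinuousAt (fun t : ℝ => t ^ k • g t y) 0 :=
    (continuous_pow k).continuousAt.smul
      (ContinuousAt.comp (g := fun w : ℝ × (E × E) => g w.1 w.2) (f := fun t : ℝ => (t, y)) h2
        (by fun_prop))
  exact tendsto_nhds_unique_of_eventuallyEq (c1.tendsto.mono_left nhdsWithin_le_nhds)
    (c2.tendsto.mono_left nhdsWithin_le_nhds) e

theorem tendsto_scale (z : E × E) :
    Tendsto (fun w : ℝ × (E × E) => (w.2.1, w.1 • w.2.2)) (𝓝 (0, z)) (𝓝 (z.1, 0)) := by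
  have : Continuous (fun w : ℝ × (E × E) => (w.2.1, w.1 • w.2.2)) := by fun_prop
  simpa using this.tendsto (0, z)

theorem hasFDerivAt_scale (t : ℝ) (z : E × E) :
    HasFDerivAt (fun z : E × E => (z.1, t • z.2))
      ((ContinuousLinearMap.fst ℝ E E).prod (t • ContinuousLinearMap.snd ℝ E E)) z :=
  ((ContinuousLinearMap.fst ℝ E E).prod (t • ContinuousLinearMap.snd ℝ E E)).hasFDerivAt

variable [CompleteSpace F]

/-- Differentiate the factorization of u (x, t r) in (x, r) while t is held fixed. The chain rule
scales the second component of v by t. -/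
theorem VanishesTo.eventually_fderiv_scale {u : E × E → F} (hu : ∀ x, SmoothNear u (x, 0)) {k : ℕ}
    (hk : VanishesTo k u) (z v : E × E) :
    ∀ᶠ w : ℝ × (E × E) in 𝓝 (0, z), fderiv ℝ u (w.2.1, w.1 • w.2.2) (v.1, w.1 • v.2) =
      w.1 ^ k • fderiv ℝ (scaleQuot u k w.1) w.2 v := by
  filter_upwards [eventually_eventually_nhds.2 (eventually_eq_pow_smul_scaleQuot hu hk le_rfl z),
    (tendsto_scale z).eventually (hu z.1), smoothNear_scaleQuot' hu k z] with w h1 h2 h3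
  have hw : Tendsto (fun y : E × E => (w.1, y)) (𝓝 w.2) (𝓝 w) := by
    have : Continuous (fun y : E × E => (w.1, y)) := by fun_prop
    exact this.tendsto w.2
  have e1 : (fun y : E × E => u (y.1, w.1 • y.2)) =ᶠ[𝓝 w.2]
      fun y => w.1 ^ k • scaleQuot u k w.1 y := hw.eventually h1
  have d1 : HasFDerivAt (fun y : E × E => u (y.1, w.1 • y.2)) _ w.2 :=
    (h2.differentiableAt (by simp)).hasFDerivAt.comp w.2 (hasFDerivAt_scale w.1 w.2)
  have d2 : DifferentiableAt ℝ (scaleQuot u k w.1) w.2 :=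
    DifferentiableAt.comp (g := fun w : ℝ × (E × E) => scaleQuot u k w.1 w.2) w.2
      (h3.differentiableAt (by simp)) (hasFDerivAt_prodMk_right (𝕜 := ℝ) w.1 w.2).differentiableAt
  have := DFunLike.congr_fun ((d1.congr_of_eventuallyEq e1.symm).unique
    (d2.hasFDerivAt.const_smul (w.1 ^ k))) v
  simpa using this

theorem VanishesTo.fderiv_fst {u : E × E → F} (hu : ∀ x, SmoothNear u (x, 0)) {k : ℕ}
    (hk : VanishesTo k u) (v : E) : VanishesTo k fun z => fderiv ℝ u z (v, 0) := by
  refine vanishesTo_of_scaling (g := fun t z => fderiv ℝ (scaleQuot u k t) z (v, 0))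
    (fun z => ?_) fun z => ?_
  · exact ((SmoothNear.partial_snd (smoothNear_scaleQuot' hu k z)).clm_apply
      (smoothNear_const _ _)).continuousAt
  · filter_upwards [hk.eventually_fderiv_scale hu z (v, 0)] with w hw
    simpa using hw

/-- An angular derivative keeps the order, a radial one loses one: in the scaled identity the vector
(0, v.2) carries a factor t, which can be cancelled against `t ^ (k + 1)` only for t ≠ 0. -/
theorem VanishesTo.fderiv_apply {u : E × E → F} (hu : ∀ x, SmoothNear u (x, 0)) {k : ℕ}
    (hk : VanishesTo (k + 1) u) (v : E × E) : VanishesTo k fun z => fderiv ℝ u z v := by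
  have h1 := (hk.fderiv_fst hu v.1).mono k.le_succ
  have h2 : VanishesTo k fun z => fderiv ℝ u z (0, v.2) := by
    refine vanishesTo_of_scaling_ne (g := fun t z => fderiv ℝ (scaleQuot u (k + 1) t) z (0, v.2))
      (fun x => ?_) (fun z => ?_) fun z => ?_
    · filter_upwards [(hu x).fderiv.eventually] with z hz
      exact (hz.clm_apply (smoothNear_const _ _)).continuousAt
    · filter_upwards [((SmoothNear.partial_snd (smoothNear_scaleQuot' hu (k + 1) z)).clm_apply
        (smoothNear_const (0, v.2) _)).eventually] with w hw using hw.continuousAt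
    · filter_upwards [hk.eventually_fderiv_scale hu z (0, v.2)] with w hw hw0
      have e : ((0 : E), w.1 • v.2) = w.1 • ((0 : E), v.2) := by simp
      rw [e, map_smul, pow_succ', mul_smul] at hw
      exact smul_right_injective _ hw0 hw
  refine (h1.add h2).congr fun x => Eventually.of_forall fun z => ?_
  simp only
  rw [← map_add]
  simp

/-- The leading term, homogeneous of degree `k` in `r`, of a function vanishing to order `k`. -/
def leadingTerm (k : ℕ) (u : E × E → F) (z : E × E) : F := scaleQuot u k 0 z

theorem smoothNear_leadingTerm {u : P → E × E → F} {p : P}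
    (hu : ∀ x, SmoothNear (fun w : P × (E × E) => u w.1 w.2) (p, (x, 0))) (k : ℕ) (z : E × E) :
    SmoothNear (fun w : P × (E × E) => leadingTerm k (u w.1) w.2) (p, z) :=
  SmoothNear.comp (f := fun w : P × (E × E) => ((0 : ℝ), w)) (smoothNear_scaleQuot hu k z)
    (smoothNear_of_contDiff (by fun_prop) _)

theorem tendsto_leadingTerm {u : E × E → F} (hu : ∀ x, SmoothNear u (x, 0)) {k : ℕ}
    (hk : VanishesTo k u) (z : E × E) :
    Tendsto (fun t : ℝ => (t ^ k)⁻¹ • u (z.1, t • z.2)) (𝓝[≠] 0) (𝓝 (leadingTerm k u z)) := by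
  have hc : ContinuousAt (fun t : ℝ => scaleQuot u k t z) 0 :=
    ContinuousAt.comp (g := fun w : ℝ × (E × E) => scaleQuot u k w.1 w.2)
      (f := fun t : ℝ => (t, z)) (smoothNear_scaleQuot' hu k z).continuousAt (by fun_prop)
  refine (hc.tendsto.mono_left nhdsWithin_le_nhds).congr' ?_
  have ht1 : Tendsto (fun t : ℝ => (t, z)) (𝓝 0) (𝓝 (0, z)) := by
    have : Continuous (fun t : ℝ => (t, z)) := by fun_prop
    exact this.tendsto 0
  filter_upwards [(ht1.eventually (eventually_eq_pow_smul_scaleQuot hu hk le_rfl z)).filter_mono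
    nhdsWithin_le_nhds, self_mem_nhdsWithin] with t ht ht0
  have ht0 : t ≠ 0 := ht0
  rw [ht, smul_smul, inv_mul_cancel₀ (pow_ne_zero _ ht0), one_smul]

/-- The leading term is the limit of t⁻ᵏ u (x, t r); substitute t c for t. At c = 0 this
substitution degenerates, so that case is computed directly. -/
theorem leadingTerm_smul {u : E × E → F} (hu : ∀ x, SmoothNear u (x, 0)) {k : ℕ}
    (hk : VanishesTo k u) (c : ℝ) (x r : E) :
    leadingTerm k u (x, c • r) = c ^ k • leadingTerm k u (x, r) := by
  by_cases hc : c = 0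
  · subst hc
    cases k with
    | zero =>
      have h0 : ∀ r : E, leadingTerm 0 u (x, r) = u (x, 0) := fun r => by
        simp [leadingTerm, scaleQuot]
      simp [h0]
    | succ k =>
      have h := tendsto_leadingTerm hu hk (x, (0 : E))
      have h0 : u (x, 0) = 0 := hk.eq_zero x
      simp only [smul_zero, h0] at h
      rw [zero_smul, tendsto_nhds_unique h tendsto_const_nhds]
      simp
  · have h1 := tendsto_leadingTerm hu hk (x, c • r)
    have h2 : Tendsto (fun t : ℝ => t * c) (𝓝[≠] 0) (𝓝[≠] 0) := by
      refine tendsto_nhdsWithin_of_tendsto_nhds_of_eventually_within _ ?_ ?_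
      · have : Continuous (fun t : ℝ => t * c) := by fun_prop
        simpa using (this.tendsto 0).mono_left nhdsWithin_le_nhds
      · filter_upwards [self_mem_nhdsWithin] with t ht
        exact mul_ne_zero ht hc
    have h3 := ((tendsto_leadingTerm hu hk (x, r)).comp h2).const_smul (c ^ k)
    refine tendsto_nhds_unique h1 (h3.congr fun t => ?_)
    simp only [Function.comp_apply, smul_smul, mul_pow, mul_inv]
    rw [mul_comm (c ^ k), mul_assoc, inv_mul_cancel₀ (pow_ne_zero _ hc), mul_one]

theorem vanishesTo_of_homogeneous {u : E × E → F} (hu : Continuous u) {k : ℕ}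
    (hk : ∀ (c : ℝ) (x r : E), u (x, c • r) = c ^ k • u (x, r)) : VanishesTo k u :=
  vanishesTo_of_scaling (g := fun _ z => u z) (fun z => by fun_prop) fun z =>
    Eventually.of_forall fun w => hk _ _ _

/-- The next Hadamard quotient is the cofactor of the difference, once the homogeneity of the
leading term is used. -/
theorem vanishesTo_sub_leadingTerm {u : E × E → F} (hu : ∀ x, SmoothNear u (x, 0)) {k : ℕ}
    (hk : VanishesTo k u) : VanishesTo (k + 1) fun z => u z - leadingTerm k u z := by
  refine vanishesTo_of_scaling (g := scaleQuot u (k + 1))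
    (fun z => (smoothNear_scaleQuot' hu (k + 1) z).continuousAt) fun z => ?_
  filter_upwards [eventually_eq_pow_smul_scaleQuot hu hk le_rfl z,
      eventually_eq_smul_hadamardQuot (smoothNear_scaleQuot' hu k z)] with w h1 h2
  rw [leadingTerm_smul hu hk, h1, h2, smul_add, leadingTerm, add_sub_cancel_left, smul_smul,
    ← pow_succ, scaleQuot]

end Vanishing

/-! ### The integer lattice, the unit cube and uniform tubes. -/

section Lattice

variable {n : ℕ}

/-- Integer vectors as elements of Euclidean space. -/
def lat (k : Fin n → ℤ) : Euc n := WithLp.toLp 2 fun i => (k i : ℝ)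

@[simp] theorem lat_apply (k : Fin n → ℤ) (i : Fin n) : lat k i = k i := rfl

theorem lat_neg (k : Fin n → ℤ) : lat (-k) = -lat k := by ext i; simp

theorem lat_zero : lat (0 : Fin n → ℤ) = 0 := by ext i; simp

theorem lat_sub (k l : Fin n → ℤ) : lat (k - l) = lat k - lat l := by ext i; simp

theorem lat_eq_zero_of_norm_lt {k : Fin n → ℤ} (h : ‖lat k‖ < 1) : k = 0 := by
  funext i
  have h1 : ‖lat k i‖ < 1 := (PiLp.norm_apply_le (lat k) i).trans_lt h
  rw [lat_apply, Real.norm_eq_abs] at h1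
  exact Int.abs_lt_one_iff.1 (by exact_mod_cast h1)

/-- The closed unit cube. -/
def unitCube (n : ℕ) : Set (Euc n) := {x | ∀ i, x i ∈ Icc (0 : ℝ) 1}

theorem isCompact_unitCube : IsCompact (unitCube n) := by
  have h : IsCompact (Set.univ.pi fun _ : Fin n => Icc (0 : ℝ) 1) :=
    isCompact_univ_pi fun _ => isCompact_Icc
  have h2 := h.image (EuclideanSpace.equiv (Fin n) ℝ).symm.continuous
  convert h2 using 1
  ext x
  constructor
  · intro hx
    exact ⟨EuclideanSpace.equiv (Fin n) ℝ x, fun i _ => hx i, by simp⟩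
  · rintro ⟨y, hy, rfl⟩ i
    exact hy i (mem_univ i)

theorem exists_add_lat_mem_unitCube (x : Euc n) : ∃ k : Fin n → ℤ, x + lat k ∈ unitCube n := by
  refine ⟨fun i => -⌊x i⌋, fun i => ?_⟩
  simp only [PiLp.add_apply, lat_apply, Int.cast_neg, ← sub_eq_add_neg]
  exact ⟨Int.fract_nonneg _, (Int.fract_lt_one _).le⟩

/-- By periodicity only x in the compact unit cube matters, and the tube lemma gives one radius for
all of them, valid for all nearby parameters. This is how statements near points of r = 0 become
statements on tubes ‖r‖ < ε. -/
theorem exists_uniform_tube {T : Type*} [TopologicalSpace T] {p : T} {G : T → Euc n → Euc n → Prop}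
    (hper : ∀ p x r k, G p (x + lat k) r → G p x r)
    (h : ∀ x, ∀ᶠ w : T × (Euc n × Euc n) in 𝓝 (p, (x, 0)), G w.1 w.2.1 w.2.2) :
    ∃ ε > 0, ∀ᶠ q in 𝓝 p, ∀ x r, ‖r‖ < ε → G q x r := by
  have key : ∀ x ∈ unitCube n, ∀ᶠ q : (T × Euc n) × Euc n in 𝓝 ((p, 0), x), G q.1.1 q.2 q.1.2 := by
    intro x _
    have ht : Tendsto (fun q : (T × Euc n) × Euc n => (q.1.1, (q.2, q.1.2))) (𝓝 ((p, 0), x))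
        (𝓝 (p, (x, 0))) := by
      have : Continuous (fun q : (T × Euc n) × Euc n => (q.1.1, (q.2, q.1.2))) := by fun_prop
      exact this.tendsto _
    exact ht.eventually (h x)
  have key2 := isCompact_unitCube.eventually_forall_of_forall_eventually
    (P := fun (q : T × Euc n) x => G q.1 x q.2) key
  rw [nhds_prod_eq] at key2
  obtain ⟨pa, ha, pb, hb, hab⟩ := eventually_prod_iff.1 key2
  obtain ⟨ε, hε, hball⟩ := Metric.eventually_nhds_iff.1 hb
  refine ⟨ε, hε, ha.mono fun q hq x r hr => ?_⟩
  obtain ⟨k, hk⟩ := exists_add_lat_mem_unitCube x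
  exact hper q x r k (hab hq (hball (by simpa using hr)) _ hk)

end Lattice

/-! ### The Poincaré lemma relative to r = 0. -/

section Poincare

variable {E F : Type} [NormedAddCommGroup E] [NormedSpace ℝ E] [NormedAddCommGroup F]
  [NormedSpace ℝ F]

/-- Scaling of the second factor. -/
def scaleSnd (t : ℝ) : E × E →L[ℝ] E × E :=
  (ContinuousLinearMap.fst ℝ E E).prod (t • ContinuousLinearMap.snd ℝ E E)

@[simp] theorem scaleSnd_apply (t : ℝ) (z : E × E) : scaleSnd t z = (z.1, t • z.2) := rfl

/-- The radial segment from (x, r) down to (x, 0) stays near the zero section. The integrals of the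
Poincaré lemma run along these segments. -/
theorem eventually_forall_scaleSnd {T : Type*} [TopologicalSpace T] {p : T → E × E → Prop} {q : T}
    {x : E} (h : ∀ᶠ w : T × (E × E) in 𝓝 (q, (x, 0)), p w.1 w.2) :
    ∀ᶠ w : T × (E × E) in 𝓝 (q, (x, 0)), ∀ t ∈ Icc (0 : ℝ) 1, p w.1 (scaleSnd t w.2) := by
  refine isCompact_Icc.eventually_forall_of_forall_eventually
    (P := fun (w : T × (E × E)) t => p w.1 (scaleSnd t w.2)) fun t _ => ?_
  have : Continuous fun v : (T × (E × E)) × ℝ => (v.1.1, (scaleSnd v.2 v.1.2 : E × E)) := by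
    simp only [scaleSnd_apply]
    fun_prop
  exact (this.tendsto' ((q, (x, 0)), t) (q, (x, 0)) (by simp)).eventually h

theorem eventually_forall_scaleSnd' {p : E × E → Prop} {x : E} (h : ∀ᶠ z in 𝓝 (x, 0), p z) :
    ∀ᶠ z : E × E in 𝓝 (x, 0), ∀ t ∈ Icc (0 : ℝ) 1, p (scaleSnd t z) := by
  have h1 := eventually_forall_scaleSnd (p := fun _ => p) (q := ())
    ((continuous_snd.tendsto ((), (x, (0 : E)))).eventually h)
  exact (Continuous.tendsto (f := fun z : E × E => ((), z)) (by fun_prop) _).eventually h1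

theorem eventually_slice {T X : Type*} [TopologicalSpace T] [TopologicalSpace X] {q : T} {x : X}
    {p : T × X → Prop} (h : ∀ᶠ w in 𝓝 (q, x), p w) : ∀ᶠ y in 𝓝 x, p (q, y) :=
  (Continuous.tendsto (f := fun y : X => (q, y)) (by fun_prop) x).eventually h

theorem contDiff_scaleSnd_uncurried :
    ContDiff ℝ ∞ (fun q : (E × E) × ℝ => scaleSnd q.2 q.1) := by
  simp only [scaleSnd_apply]
  fun_prop

theorem contDiff_scaleSnd : ContDiff ℝ ∞ (scaleSnd : ℝ → E × E →L[ℝ] E × E) := by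
  have : (scaleSnd : ℝ → E × E →L[ℝ] E × E) = fun t =>
      (ContinuousLinearMap.inl ℝ E E).comp (ContinuousLinearMap.fst ℝ E E) +
        t • (ContinuousLinearMap.inr ℝ E E).comp (ContinuousLinearMap.snd ℝ E E) := by
    funext t
    ext z <;> simp
  rw [this]
  fun_prop

theorem hasDerivAt_scaleSnd (t : ℝ) (z : E × E) :
    HasDerivAt (fun t : ℝ => scaleSnd t z) ((0 : E), z.2) t := by
  have h : HasDerivAt (fun t : ℝ => (z.1, t • z.2)) ((0 : E), (1 : ℝ) • z.2) t :=
    (hasDerivAt_const t z.1).prodMk ((hasDerivAt_id t).smul_const z.2)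
  simpa using h

/-- Mean value inequality along the radial segment; the factor ‖r‖ from its velocity supplies the
extra order. -/
theorem VanishesTo.of_fderiv_snd {u : E × E → F} (hu : ∀ x, SmoothNear u (x, 0))
    (h0 : ∀ x, u (x, 0) = 0) {k : ℕ}
    (h : VanishesTo k fun z => (fderiv ℝ u z).comp (ContinuousLinearMap.inr ℝ E E)) :
    VanishesTo (k + 1) u := by
  intro x
  obtain ⟨C, hC0, hC⟩ := (h x).exists_nonneg
  refine IsBigO.of_bound C ?_
  filter_upwards [eventually_forall_scaleSnd' hC.bound, eventually_forall_scaleSnd' (hu x)]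
    with z hz hz'
  have hd : ∀ t ∈ Icc (0 : ℝ) 1, HasDerivWithinAt (fun t : ℝ => u (scaleSnd t z))
      (fderiv ℝ u (scaleSnd t z) (0, z.2)) (Icc 0 1) t := fun t ht =>
    (((hz' t ht).differentiableAt (by simp)).hasFDerivAt.comp_hasDerivAt t
      (hasDerivAt_scaleSnd t z)).hasDerivWithinAt
  have hb : ∀ t ∈ Ico (0 : ℝ) 1, ‖fderiv ℝ u (scaleSnd t z) (0, z.2)‖ ≤ C * ‖z.2‖ ^ (k + 1) := by
    intro t ht
    have ht' : t ∈ Icc (0 : ℝ) 1 := ⟨ht.1, ht.2.le⟩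
    have ht0 : 0 ≤ t := ht.1
    have h1 := ((fderiv ℝ u (scaleSnd t z)).comp (ContinuousLinearMap.inr ℝ E E)).le_opNorm z.2
    have h2 := hz t ht'
    rw [norm_pow, norm_norm, scaleSnd_apply, norm_smul, Real.norm_eq_abs, abs_of_nonneg ht.1] at h2
    refine h1.trans ?_
    rw [pow_succ, ← mul_assoc]
    gcongr
    refine h2.trans ?_
    gcongr
    exact mul_le_of_le_one_left (norm_nonneg z.2) ht.2.le
  have := norm_image_sub_le_of_norm_deriv_le_segment_01' hd hb
  simp only [scaleSnd_apply, one_smul, zero_smul, h0, sub_zero] at this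
  simpa using this

theorem hasFDerivAt_scaleSnd_apply {L : E × E → E × E →L[ℝ] F} {L' : E × E →L[ℝ] E × E →L[ℝ] F}
    {t : ℝ} {z : E × E} (h : HasFDerivAt L L' (scaleSnd t z)) :
    HasFDerivAt (fun z : E × E => L (scaleSnd t z) (0, z.2))
      ((L (scaleSnd t z)).comp ((ContinuousLinearMap.inr ℝ E E).comp
        (ContinuousLinearMap.snd ℝ E E)) + (L'.comp (scaleSnd t)).flip (0, z.2)) z := by
  have h1 : HasFDerivAt (fun z : E × E => L (scaleSnd t z)) (L'.comp (scaleSnd t)) z :=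
    h.comp z (scaleSnd (E := E) t).hasFDerivAt
  have h2 : HasFDerivAt (fun z : E × E => ((0 : E), z.2)) ((ContinuousLinearMap.inr ℝ E E).comp
      (ContinuousLinearMap.snd ℝ E E)) z :=
    ((ContinuousLinearMap.inr ℝ E E).comp (ContinuousLinearMap.snd ℝ E E)).hasFDerivAt
  exact h1.clm_apply h2

theorem hasDerivAt_scaleSnd_apply {L : E × E → E × E →L[ℝ] F} {L' : E × E →L[ℝ] E × E →L[ℝ] F}
    {t : ℝ} {z : E × E} (h : HasFDerivAt L L' (scaleSnd t z)) (v : E × E) :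
    HasDerivAt (fun t => L (scaleSnd t z) (scaleSnd t v))
      (L' (0, z.2) (scaleSnd t v) + L (scaleSnd t z) (0, v.2)) t := by
  have h1 : HasDerivAt (fun t => L (scaleSnd t z)) (L' (0, z.2)) t :=
    h.comp_hasDerivAt t (hasDerivAt_scaleSnd t z)
  exact h1.clm_apply (hasDerivAt_scaleSnd t v)

variable [FiniteDimensional ℝ E]

/-- The primitive, vanishing along `r = 0`, of a closed 1-form that vanishes along `r = 0`. -/
def primitiveOne (lam : E × E → E × E →L[ℝ] ℝ) (z : E × E) : ℝ :=
  ∫ t in (0 : ℝ)..1, lam (scaleSnd t z) (0, z.2)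

theorem SmoothNear.primitiveOne {P : Type} [NormedAddCommGroup P] [NormedSpace ℝ P]
    {lam : P → E × E → E × E →L[ℝ] ℝ} {p : P} {x : E}
    (h : SmoothNear (fun w : P × (E × E) => lam w.1 w.2) (p, (x, 0))) :
    SmoothNear (fun w : P × (E × E) => primitiveOne (lam w.1) w.2) (p, (x, 0)) := by
  refine SmoothNear.intervalIntegral (f := fun (w : P × (E × E)) t =>
    lam w.1 (scaleSnd t w.2) (0, w.2.2)) fun t _ => ?_
  refine SmoothNear.clm_apply ?_ (smoothNear_of_contDiff (by fun_prop) _)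
  exact SmoothNear.comp_of_eq (f := fun q : (P × (E × E)) × ℝ => (q.1.1, scaleSnd q.2 q.1.2))
    h (smoothNear_of_contDiff (by simp only [scaleSnd_apply]; fun_prop) _) (by simp)

/-- Closedness turns the derivative of the integrand in the direction v into the total t-derivative
of the pullback of `lam` under the scaling by t. The integral is then a difference of end values,
and the value at t = 0 is zero. -/
theorem hasFDerivAt_primitiveOne {lam : E × E → E × E →L[ℝ] ℝ} {z : E × E}
    (hz : ∀ t ∈ Icc (0 : ℝ) 1, SmoothNear lam (scaleSnd t z))
    (hzc : ∀ t ∈ Icc (0 : ℝ) 1, ∀ u v,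
      fderiv ℝ lam (scaleSnd t z) u v = fderiv ℝ lam (scaleSnd t z) v u)
    (h0 : lam (z.1, 0) = 0) : HasFDerivAt (primitiveOne lam) (lam z) z := by
  have hsm : ∀ t ∈ Icc (0 : ℝ) 1, SmoothNear (fun w : (E × E) × ℝ =>
      lam (scaleSnd w.2 w.1) (0, w.1.2)) (z, t) := fun t ht => by
    refine SmoothNear.clm_apply ?_ (smoothNear_of_contDiff (by fun_prop) _)
    exact SmoothNear.comp (f := fun q : (E × E) × ℝ => scaleSnd q.2 q.1)
      (hz t ht) (smoothNear_of_contDiff contDiff_scaleSnd_uncurried _)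
  have hdiff : DifferentiableAt ℝ (primitiveOne lam) z :=
    (SmoothNear.intervalIntegral (f := fun z t => lam (scaleSnd t z) (0, z.2)) hsm).differentiableAt
  have : fderiv ℝ (primitiveOne lam) z = lam z := by
    refine ContinuousLinearMap.ext fun v => ?_
    refine (fderiv_intervalIntegral (f := fun z t => lam (scaleSnd t z) (0, z.2)) hsm v).trans ?_
    have hd : ∀ t ∈ uIcc (0 : ℝ) 1, HasDerivAt (fun t => lam (scaleSnd t z) (scaleSnd t v))
        (fderiv ℝ (fun z => lam (scaleSnd t z) (0, z.2)) z v) t := by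
      intro t ht
      rw [uIcc_of_le zero_le_one] at ht
      have hl := (hz t ht).differentiableAt.hasFDerivAt
      rw [(hasFDerivAt_scaleSnd_apply hl).fderiv]
      refine (hasDerivAt_scaleSnd_apply hl v).congr_deriv ?_
      have := hzc t ht (scaleSnd t v) (0, z.2)
      simp only [scaleSnd_apply] at this
      simp [this, add_comm]
    have hcont : ContinuousOn (fun t => fderiv ℝ (fun z => lam (scaleSnd t z) (0, z.2)) z v)
        (uIcc (0 : ℝ) 1) := by
      intro t ht
      rw [uIcc_of_le zero_le_one] at ht
      refine ContinuousAt.continuousWithinAt ?_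
      have h1 : SmoothNear (fun w : ℝ × (E × E) => lam (scaleSnd w.1 w.2) (0, w.2.2)) (t, z) :=
        SmoothNear.comp (g := fun w : (E × E) × ℝ => lam (scaleSnd w.2 w.1) (0, w.1.2))
          (f := fun w : ℝ × (E × E) => (w.2, w.1)) (hsm t ht)
          (smoothNear_of_contDiff (by fun_prop) _)
      have h2 := ((SmoothNear.partial_snd (f := fun t z => lam (scaleSnd t z) (0, z.2))
        h1).clm_apply (smoothNear_const v _)).continuousAt
      exact ContinuousAt.comp (f := fun t : ℝ => (t, z)) h2 (by fun_prop)
    rw [intervalIntegral.integral_eq_sub_of_hasDerivAt hd hcont.intervalIntegrable]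
    simp [h0]
  exact this ▸ hdiff.hasFDerivAt

/-- The primitive, vanishing along `r = 0`, of a closed 2-form that vanishes along `r = 0`. -/
def primitiveTwo (C : E × E → E × E →L[ℝ] E × E →L[ℝ] ℝ) (z : E × E) : E × E →L[ℝ] ℝ :=
  ∫ t in (0 : ℝ)..1, (C (scaleSnd t z) (0, z.2)).comp (scaleSnd t)

theorem SmoothNear.primitiveTwo {P : Type} [NormedAddCommGroup P] [NormedSpace ℝ P]
    {C : P → E × E → E × E →L[ℝ] E × E →L[ℝ] ℝ} {p : P} {x : E}
    (h : SmoothNear (fun w : P × (E × E) => C w.1 w.2) (p, (x, 0))) :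
    SmoothNear (fun w : P × (E × E) => primitiveTwo (C w.1) w.2) (p, (x, 0)) := by
  refine SmoothNear.intervalIntegral (f := fun (w : P × (E × E)) t =>
    (C w.1 (scaleSnd t w.2) (0, w.2.2)).comp (scaleSnd t)) fun t _ => ?_
  refine SmoothNear.clm_comp (SmoothNear.clm_apply ?_ (smoothNear_of_contDiff (by fun_prop) _))
    (smoothNear_of_contDiff ((contDiff_scaleSnd (E := E)).comp contDiff_snd) _)
  exact SmoothNear.comp_of_eq (f := fun q : (P × (E × E)) × ℝ => (q.1.1, scaleSnd q.2 q.1.2))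
    h (smoothNear_of_contDiff (by simp only [scaleSnd_apply]; fun_prop) _) (by simp)

theorem smoothNear_primitiveTwo_integrand {C : E × E → E × E →L[ℝ] E × E →L[ℝ] ℝ} {z : E × E}
    {t : ℝ} (h : SmoothNear C (scaleSnd t z)) :
    SmoothNear (fun w : (E × E) × ℝ => (C (scaleSnd w.2 w.1) (0, w.1.2)).comp (scaleSnd w.2))
      (z, t) := by
  refine SmoothNear.clm_comp (SmoothNear.clm_apply ?_ (smoothNear_of_contDiff (by fun_prop) _))
    (smoothNear_of_contDiff ((contDiff_scaleSnd (E := E)).comp contDiff_snd) _)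
  exact SmoothNear.comp (f := fun q : (E × E) × ℝ => scaleSnd q.2 q.1)
    h (smoothNear_of_contDiff contDiff_scaleSnd_uncurried _)

/-- The integrand contracts C with the radial vector (0, r), which contributes one more power of
‖r‖. -/
theorem VanishesTo.primitiveTwo {C : E × E → E × E →L[ℝ] E × E →L[ℝ] ℝ} {k : ℕ}
    (h : VanishesTo k C) : VanishesTo (k + 1) (primitiveTwo C) := by
  intro x
  obtain ⟨c, hc0, hc⟩ := (h x).exists_nonneg
  refine IsBigO.of_bound c ?_
  filter_upwards [eventually_forall_scaleSnd' hc.bound] with z hz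
  have : ∀ t ∈ uIoc (0 : ℝ) 1,
      ‖(C (scaleSnd t z) (0, z.2)).comp (scaleSnd t)‖ ≤ c * ‖‖z.2‖ ^ (k + 1)‖ := by
    intro t ht
    rw [uIoc_of_le zero_le_one] at ht
    have ht0 : 0 ≤ t := ht.1.le
    have h2 := hz t ⟨ht.1.le, ht.2⟩
    rw [norm_pow, norm_norm, scaleSnd_apply, norm_smul, Real.norm_eq_abs,
      abs_of_nonneg ht.1.le] at h2
    have h3 : ‖(scaleSnd t : E × E →L[ℝ] E × E)‖ ≤ 1 := by
      refine ContinuousLinearMap.opNorm_le_bound _ zero_le_one fun v => ?_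
      rw [scaleSnd_apply, Prod.norm_def, one_mul]
      refine max_le (norm_fst_le v) ?_
      simp only [norm_smul, Real.norm_eq_abs, abs_of_nonneg ht.1.le]
      exact (mul_le_of_le_one_left (norm_nonneg _) ht.2).trans (norm_snd_le v)
    calc _ ≤ ‖C (scaleSnd t z) (0, z.2)‖ * 1 :=
          (ContinuousLinearMap.opNorm_comp_le _ _).trans (by gcongr)
      _ ≤ ‖C (scaleSnd t z)‖ * ‖((0 : E), z.2)‖ := by
          rw [mul_one]; exact ContinuousLinearMap.le_opNorm _ _
      _ ≤ c * ‖z.2‖ ^ k * ‖z.2‖ := by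
          have e : ‖((0 : E), z.2)‖ = ‖z.2‖ := by simp [Prod.norm_def]
          rw [e]
          gcongr
          refine h2.trans ?_
          gcongr
          exact mul_le_of_le_one_left (norm_nonneg z.2) ht.2
      _ = c * ‖‖z.2‖ ^ (k + 1)‖ := by rw [norm_pow, norm_norm]; ring
  have := intervalIntegral.norm_integral_le_of_norm_le_const this
  rw [sub_zero, abs_one, mul_one] at this
  exact this

/-- As in degree one: antisymmetrizing the derivative of the integrand gives the t-derivative of the
pullback of C under the scaling by t, where closedness and antisymmetry account for the terms
containing the derivative of C. -/
theorem fderiv_primitiveTwo {C : E × E → E × E →L[ℝ] E × E →L[ℝ] ℝ} {z : E × E}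
    (hz : ∀ t ∈ Icc (0 : ℝ) 1, SmoothNear C (scaleSnd t z))
    (ha : ∀ z u v, C z u v = - C z v u)
    (hzc : ∀ t ∈ Icc (0 : ℝ) 1, ∀ u v w, fderiv ℝ C (scaleSnd t z) u v w +
      fderiv ℝ C (scaleSnd t z) v w u + fderiv ℝ C (scaleSnd t z) w u v = 0)
    (h0 : C (z.1, 0) = 0) (u v : E × E) :
    fderiv ℝ (primitiveTwo C) z u v - fderiv ℝ (primitiveTwo C) z v u = C z u v := by
  have hsm : ∀ t ∈ Icc (0 : ℝ) 1, SmoothNear (fun w : (E × E) × ℝ =>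
      (C (scaleSnd w.2 w.1) (0, w.1.2)).comp (scaleSnd w.2)) (z, t) := fun t ht =>
    smoothNear_primitiveTwo_integrand (hz t ht)
  have hcont : ∀ u, ContinuousOn (fun t => fderiv ℝ (fun z =>
      (C (scaleSnd t z) (0, z.2)).comp (scaleSnd t)) z u) (uIcc (0 : ℝ) 1) := by
    intro u t ht
    rw [uIcc_of_le zero_le_one] at ht
    refine ContinuousAt.continuousWithinAt ?_
    have h1 : SmoothNear (fun w : ℝ × (E × E) => (C (scaleSnd w.1 w.2) (0, w.2.2)).comp
        (scaleSnd w.1)) (t, z) :=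
      SmoothNear.comp (g := fun w : (E × E) × ℝ =>
          (C (scaleSnd w.2 w.1) (0, w.1.2)).comp (scaleSnd w.2))
        (f := fun w : ℝ × (E × E) => (w.2, w.1)) (hsm t ht)
        (smoothNear_of_contDiff (by fun_prop) _)
    have h2 := ((SmoothNear.partial_snd (f := fun t z => (C (scaleSnd t z) (0, z.2)).comp
      (scaleSnd t)) h1).clm_apply (smoothNear_const u _)).continuousAt
    exact ContinuousAt.comp (f := fun t : ℝ => (t, z)) h2 (by fun_prop)
  have hI : ∀ u v, fderiv ℝ (primitiveTwo C) z u v = ∫ t in (0 : ℝ)..1, fderiv ℝ (fun z =>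
      (C (scaleSnd t z) (0, z.2)).comp (scaleSnd t)) z u v := by
    intro u v
    have := fderiv_intervalIntegral (f := fun z t => (C (scaleSnd t z) (0, z.2)).comp
      (scaleSnd t)) hsm u
    have h2 : fderiv ℝ (primitiveTwo C) z u = _ := this
    rw [h2, ContinuousLinearMap.intervalIntegral_apply (hcont u).intervalIntegrable]
  rw [hI, hI, ← intervalIntegral.integral_sub]
  rotate_left
  · exact ((hcont u).clm_apply continuousOn_const).intervalIntegrable
  · exact ((hcont v).clm_apply continuousOn_const).intervalIntegrable
  have hd : ∀ t ∈ uIcc (0 : ℝ) 1, HasDerivAt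
      (fun t => C (scaleSnd t z) (scaleSnd t u) (scaleSnd t v))
      (fderiv ℝ (fun z => (C (scaleSnd t z) (0, z.2)).comp (scaleSnd t)) z u v -
        fderiv ℝ (fun z => (C (scaleSnd t z) (0, z.2)).comp (scaleSnd t)) z v u) t := by
    intro t ht
    rw [uIcc_of_le zero_le_one] at ht
    have hl := (hz t ht).differentiableAt.hasFDerivAt
    have e1 := (hasFDerivAt_scaleSnd_apply hl).clm_comp
      (hasFDerivAt_const (scaleSnd t : E × E →L[ℝ] E × E) z)
    have e0 := hasDerivAt_scaleSnd_apply hl u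
    have e2 := e0.clm_apply (hasDerivAt_scaleSnd t v)
    have hda : ∀ a b w, fderiv ℝ C (scaleSnd t z) w a b = - fderiv ℝ C (scaleSnd t z) w b a := by
      intro a b w
      have g1 : HasFDerivAt (fun z => C z a b) _ (scaleSnd t z) :=
        (hl.clm_apply (hasFDerivAt_const a _)).clm_apply (hasFDerivAt_const b _)
      have g2 : HasFDerivAt (fun z => - C z b a) _ (scaleSnd t z) :=
        ((hl.clm_apply (hasFDerivAt_const b _)).clm_apply (hasFDerivAt_const a _)).neg
      have g3 : (fun z => - C z b a) = fun z => C z a b := funext fun y => (ha y a b).symm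
      rw [g3] at g2
      have := DFunLike.congr_fun (g1.unique g2) w
      simpa using this
    rw [e1.fderiv]
    refine e2.congr_deriv ?_
    have k1 := hzc t ht (0, z.2) (scaleSnd t u) (scaleSnd t v)
    have k2 := hda (scaleSnd t v) (0, z.2) (scaleSnd t u)
    have k3 := ha (scaleSnd t z) (scaleSnd t u) (0, v.2)
    simp only [scaleSnd_apply] at k1 k2 k3
    simp
    linarith
  rw [intervalIntegral.integral_eq_sub_of_hasDerivAt hd]
  · simp [h0]
  · exact (((hcont u).clm_apply continuousOn_const).sub
      ((hcont v).clm_apply continuousOn_const)).intervalIntegrable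

end Poincare

section

/-! ### The implicit function theorem, smooth near a point. -/

section Implicit

variable {W Y Z : Type*} [NormedAddCommGroup W] [NormedSpace ℝ W] [CompleteSpace W]
  [NormedAddCommGroup Y] [NormedSpace ℝ Y] [CompleteSpace Y]
  [NormedAddCommGroup Z] [NormedSpace ℝ Z] [CompleteSpace Z]

/-- At a nearby w the theorem applies afresh at (w, ψ w), since invertibility of the partial
derivative is an open condition. Local uniqueness identifies the new implicit function with ψ, which
is therefore smooth at w and not only at the centre. -/
theorem exists_smoothNear_implicit {f : W × Y → Z} {u : W × Y} (hf : SmoothNear f u)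
    (hi : (fderiv ℝ f u ∘L .inr ℝ W Y).IsInvertible) :
    ∃ ψ : W → Y, SmoothNear ψ u.1 ∧ ψ u.1 = u.2 ∧ (∀ᶠ w in 𝓝 u.1, f (w, ψ w) = f u) ∧
      ∀ᶠ v in 𝓝 u, f v = f u → v.2 = ψ v.1 := by
  have pn : (∞ : WithTop ℕ∞) ≠ 0 := by simp
  set cdf := hf.contDiffAt
  set ψ := cdf.implicitFunction pn hi with hψ
  have h0 : ψ u.1 = u.2 := cdf.implicitFunction_apply_self pn hi
  have hc : ContDiffAt ℝ ∞ ψ u.1 := cdf.contDiffAt_implicitFunction pn hi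
  have h1 : ∀ᶠ w in 𝓝 u.1, f (w, ψ w) = f u := cdf.eventually_apply_implicitFunction pn hi
  have h2 : ∀ᶠ v in 𝓝 u, f v = f u ↔ ψ v.1 = v.2 :=
    cdf.eventually_apply_eq_iff_implicitFunction pn hi
  refine ⟨ψ, ?_, h0, h1, h2.mono fun v hv h => (hv.1 h).symm⟩
  have hcont : ∀ᶠ w in 𝓝 u.1, ContinuousAt ψ w :=
    ((hc.of_le (m := 1) (by simp)).eventually (by simp)).mono fun w hw => hw.continuousAt
  have hinv : ∀ᶠ v in 𝓝 u, (fderiv ℝ f v ∘L .inr ℝ W Y).IsInvertible := by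
    obtain ⟨e, he⟩ := hi
    have hcd : ContinuousAt (fun v => fderiv ℝ f v ∘L .inr ℝ W Y) u :=
      (hf.fderiv.clm_comp (smoothNear_const _ _)).continuousAt
    have := hcd.eventually_mem (s := range ((↑) : (Y ≃L[ℝ] Z) → Y →L[ℝ] Z))
      (by rw [← he]; exact ContinuousLinearEquiv.nhds e)
    exact this
  have hpair : Tendsto (fun w => (w, ψ w)) (𝓝 u.1) (𝓝 u) := by
    have : ContinuousAt (fun w => (w, ψ w)) u.1 := continuousAt_id.prodMk hc.continuousAt
    simpa [ContinuousAt, h0] using this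
  filter_upwards [hcont, eventually_eventually_nhds.2 h1, hpair.eventually hf,
    hpair.eventually hinv] with w hw1 hw2 hw3 hw4
  have hc' := hw3.contDiffAt_implicitFunction pn hw4
  refine hc'.congr_of_eventuallyEq ?_
  have ht : Tendsto (fun w => (w, ψ w)) (𝓝 w) (𝓝 (w, ψ w)) := continuousAt_id.prodMk hw1
  filter_upwards [hw2, ht.eventually (hw3.eventually_apply_eq_iff_implicitFunction pn hw4)]
    with w' a1 a2
  exact (a2.1 (by rw [a1, hw2.self_of_nhds])).symm

theorem isInvertible_of_injective {X Y : Type*} [NormedAddCommGroup X] [NormedSpace ℝ X]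
    [FiniteDimensional ℝ X] [NormedAddCommGroup Y] [NormedSpace ℝ Y] [FiniteDimensional ℝ Y]
    {f : X →L[ℝ] Y} (hf : Function.Injective f)
    (hd : Module.finrank ℝ X = Module.finrank ℝ Y) : f.IsInvertible :=
  ⟨(LinearMap.linearEquivOfInjective (f : X →ₗ[ℝ] Y) hf hd).toContinuousLinearEquiv, by
    ext v; simp⟩

end Implicit

/-! ### Operators on curves over the unit interval. -/

section Flow

open unitInterval

variable {V : Type} [NormedAddCommGroup V] [NormedSpace ℝ V]

/-- The primitive of a continuous function on `[0, 1]`. -/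
def primitiveOp [CompleteSpace V] : C(I, V) →L[ℝ] C(I, V) :=
  LinearMap.mkContinuous
    { toFun := fun c => ⟨fun t => ∫ s in (0 : ℝ)..t, c (projIcc 0 1 zero_le_one s), by
        refine (intervalIntegral.continuous_primitive (fun a b => ?_) 0).comp
          continuous_subtype_val
        exact (Continuous.intervalIntegrable (by fun_prop) _ _)⟩
      map_add' := fun c d => by
        ext t
        exact intervalIntegral.integral_add (Continuous.intervalIntegrable (by fun_prop) _ _)
          (Continuous.intervalIntegrable (by fun_prop) _ _)
      map_smul' := fun a c => by
        ext t
        exact intervalIntegral.integral_smul _ _ } 1 fun c => by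
      rw [one_mul]
      refine (ContinuousMap.norm_le _ (norm_nonneg _)).2 fun t => ?_
      refine (intervalIntegral.norm_integral_le_of_norm_le_const (C := ‖c‖) fun s _ =>
        c.norm_coe_le_norm _).trans ?_
      rw [sub_zero, abs_of_nonneg t.2.1]
      exact mul_le_of_le_one_right (norm_nonneg _) t.2.2

theorem primitiveOp_apply [CompleteSpace V] (c : C(I, V)) (t : I) :
    primitiveOp c t = ∫ s in (0 : ℝ)..t, c (projIcc 0 1 zero_le_one s) := rfl

theorem norm_primitiveOp_le [CompleteSpace V] (c : C(I, V)) {M : ℝ} (hM : ∀ t, ‖c t‖ ≤ M) (t : I) :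
    ‖primitiveOp c t‖ ≤ M := by
  rw [primitiveOp_apply]
  refine (intervalIntegral.norm_integral_le_of_norm_le_const (C := M) fun s _ => hM _).trans ?_
  rw [sub_zero, abs_of_nonneg t.2.1]
  exact mul_le_of_le_one_right ((norm_nonneg _).trans (hM 0)) t.2.2

theorem hasDerivAt_primitiveOp [CompleteSpace V] (c : C(I, V)) (t : I) :
    HasDerivAt (fun t : ℝ => ∫ s in (0 : ℝ)..t, c (projIcc 0 1 zero_le_one s)) (c t) t := by
  have hc : Continuous fun s : ℝ => c (projIcc 0 1 zero_le_one s) := by fun_prop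
  have := intervalIntegral.integral_hasDerivAt_right (hc.intervalIntegrable 0 t)
    (hc.stronglyMeasurableAtFilter _ _) hc.continuousAt
  simpa using this

/-- The graph curve `t ↦ (p, t, γ t)`, up to a constant: its linear part in `(p, γ)`. -/
def graphCurveLin {P : Type} [NormedAddCommGroup P] [NormedSpace ℝ P] :
    P × C(I, V) →L[ℝ] C(I, P × (ℝ × V)) :=
  LinearMap.mkContinuous
    { toFun := fun q => ⟨fun t => (q.1, ((0 : ℝ), q.2 t)), by fun_prop⟩
      map_add' := fun q q' => by ext t <;> simp
      map_smul' := fun a q => by ext t <;> simp } 1 fun q => by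
      rw [one_mul]
      refine (ContinuousMap.norm_le _ (norm_nonneg _)).2 fun t => ?_
      simp only [LinearMap.coe_mk, AddHom.coe_mk, ContinuousMap.coe_mk]
      refine max_le (norm_fst_le q) (max_le (by simp) ?_)
      exact (q.2.norm_coe_le_norm t).trans (norm_snd_le q)

/-- The curve `t ↦ (p, t, γ t)`. -/
def graphCurve {P : Type} [NormedAddCommGroup P] [NormedSpace ℝ P] (q : P × C(I, V)) :
    C(I, P × (ℝ × V)) :=
  graphCurveLin q + ⟨fun t => (0, ((t : ℝ), 0)), by fun_prop⟩

@[simp] theorem graphCurve_apply {P : Type} [NormedAddCommGroup P] [NormedSpace ℝ P]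
    (q : P × C(I, V)) (t : I) : graphCurve q t = (q.1, ((t : ℝ), q.2 t)) := by
  simp [graphCurve, graphCurveLin]

theorem hasFDerivAt_graphCurve {P : Type} [NormedAddCommGroup P] [NormedSpace ℝ P]
    (q : P × C(I, V)) : HasFDerivAt (graphCurve (V := V) (P := P)) graphCurveLin q := by
  have h := (graphCurveLin (V := V) (P := P)).hasFDerivAt (x := q)
  exact h.add_const _

theorem contDiff_graphCurve {P : Type} [NormedAddCommGroup P] [NormedSpace ℝ P] :
    ContDiff ℝ ∞ (graphCurve (V := V) (P := P)) :=
  ContDiff.add (graphCurveLin (V := V) (P := P)).contDiff contDiff_const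

end Flow

/-! ### Flows of fields that vanish to second order along r = 0. -/

section TubeFlow

open unitInterval

variable {n : ℕ} {P : Type} [NormedAddCommGroup P] [NormedSpace ℝ P]

/-- On the tube `‖r‖ < ε` the time-dependent vector field `X` is continuous, and `1/2`-Lipschitz in
the space variable. -/
def IsContractingOn (X : ℝ → Euc n × Euc n → Euc n × Euc n) (ε : ℝ) : Prop :=
  ∀ x r : Euc n, ‖r‖ < ε → ∀ s ∈ Icc (0 : ℝ) 1,
    ContinuousAt (fun w : ℝ × (Euc n × Euc n) => X w.1 w.2) (s, (x, r)) ∧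
      DifferentiableAt ℝ (X s) (x, r) ∧ ‖fderiv ℝ (X s) (x, r)‖ ≤ 1 / 2

/-- `γ` is an integral curve of `X` starting at `z` that stays in a tube in which `X` is
contracting. -/
def IsFlowCurve (X : ℝ → Euc n × Euc n → Euc n × Euc n) (z : Euc n × Euc n)
    (γ : C(I, Euc n × Euc n)) : Prop :=
  ∃ ε, IsContractingOn X ε ∧ (∀ t, ‖(γ t).2‖ < ε) ∧
    ∀ t, γ t = z + primitiveOp (nemytskii (fun w : ℝ × (Euc n × Euc n) => X w.1 w.2)
      ((⟨Subtype.val, continuous_subtype_val⟩ : C(I, ℝ)).prodMk γ)) t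

theorem IsContractingOn.norm_sub_le {X : ℝ → Euc n × Euc n → Euc n × Euc n} {ε : ℝ}
    (h : IsContractingOn X ε) {z z' : Euc n × Euc n} (hz : ‖z.2‖ < ε) (hz' : ‖z'.2‖ < ε)
    {s : ℝ} (hs : s ∈ Icc (0 : ℝ) 1) : ‖X s z - X s z'‖ ≤ 1 / 2 * ‖z - z'‖ := by
  have hconv : Convex ℝ (univ ×ˢ Metric.ball (0 : Euc n) ε : Set (Euc n × Euc n)) :=
    convex_univ.prod (convex_ball 0 ε)
  refine hconv.norm_image_sub_le_of_norm_fderiv_le (𝕜 := ℝ) (fun y hy => (h y.1 y.2 ?_ s hs).2.1)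
    (fun y hy => (h y.1 y.2 ?_ s hs).2.2) ⟨mem_univ _, by simpa using hz'⟩
    ⟨mem_univ _, by simpa using hz⟩
  all_goals simpa using hy.2

theorem IsContractingOn.nemytskii_apply {X : ℝ → Euc n × Euc n → Euc n × Euc n} {ε : ℝ}
    (h : IsContractingOn X ε) {γ : C(I, Euc n × Euc n)} (hγ : ∀ t, ‖(γ t).2‖ < ε) (t : I) :
    nemytskii (fun w : ℝ × (Euc n × Euc n) => X w.1 w.2)
      ((⟨Subtype.val, continuous_subtype_val⟩ : C(I, ℝ)).prodMk γ) t = X t (γ t) :=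
  KAMBirkhoff.nemytskii_apply (fun k => (h _ _ (hγ k) k k.2).1) t

/-- Time has length 1 and the Lipschitz constant is 1/2, so the Picard operator halves distances.
Uniqueness makes `flowMap` independent of the curve chosen in its definition. -/
theorem IsFlowCurve.unique {X : ℝ → Euc n × Euc n → Euc n × Euc n} {z : Euc n × Euc n}
    {γ γ' : C(I, Euc n × Euc n)} (h : IsFlowCurve X z γ) (h' : IsFlowCurve X z γ') : γ = γ' := by
  obtain ⟨ε, hε, ht, he⟩ := h
  obtain ⟨ε', hε', ht', he'⟩ := h'
  -- The two curves come with different tubes; the larger one contains both.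
  wlog hle : ε' ≤ ε generalizing γ γ' ε ε'
  · exact (this ε' hε' ht' he' ε hε ht he (le_of_not_ge hle)).symm
  have ht'' : ∀ t, ‖(γ' t).2‖ < ε := fun t => (ht' t).trans_le hle
  have key : ‖γ - γ'‖ ≤ 1 / 2 * ‖γ - γ'‖ := by
    refine (ContinuousMap.norm_le _ (by positivity)).2 fun t => ?_
    rw [ContinuousMap.sub_apply, he, he', add_sub_add_left_eq_sub, ← ContinuousMap.sub_apply,
      ← map_sub]
    refine norm_primitiveOp_le _ (fun s => ?_) t
    rw [ContinuousMap.sub_apply, hε.nemytskii_apply ht, hε.nemytskii_apply ht'']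
    refine (hε.norm_sub_le (ht s) (ht'' s) s.2).trans ?_
    gcongr
    exact (γ - γ').norm_coe_le_norm s
  have : ‖γ - γ'‖ = 0 := by have := norm_nonneg (γ - γ'); linarith
  exact sub_eq_zero.1 (norm_eq_zero.1 this)

open Classical in
/-- The time-one map of the flow of `X` near `r = 0`. -/
def flowMap (X : ℝ → Euc n × Euc n → Euc n × Euc n) (z : Euc n × Euc n) : Euc n × Euc n :=
  if h : ∃ γ, IsFlowCurve X z γ then h.choose 1 else z

theorem IsFlowCurve.flowMap_eq {X : ℝ → Euc n × Euc n → Euc n × Euc n} {z : Euc n × Euc n}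
    {γ : C(I, Euc n × Euc n)} (h : IsFlowCurve X z γ) : flowMap X z = γ 1 := by
  have h' : ∃ γ, IsFlowCurve X z γ := ⟨γ, h⟩
  rw [flowMap, dif_pos h', h'.choose_spec.unique h]

theorem IsFlowCurve.add_lat {X : ℝ → Euc n × Euc n → Euc n × Euc n}
    (hX : ∀ s z k, X s (z + (lat k, 0)) = X s z) {z : Euc n × Euc n} {γ : C(I, Euc n × Euc n)}
    (h : IsFlowCurve X z γ) (k : Fin n → ℤ) :
    IsFlowCurve X (z + (lat k, 0)) (γ + ContinuousMap.const I ((lat k, 0) : Euc n × Euc n)) := by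
  obtain ⟨ε, hε, ht, he⟩ := h
  have ht' : ∀ t, ‖((γ + ContinuousMap.const I ((lat k, 0) : Euc n × Euc n)) t).2‖ < ε := fun t => by
    simpa using ht t
  refine ⟨ε, hε, ht', fun t => ?_⟩
  have : nemytskii (fun w : ℝ × (Euc n × Euc n) => X w.1 w.2)
      ((⟨Subtype.val, continuous_subtype_val⟩ : C(I, ℝ)).prodMk
        (γ + ContinuousMap.const I ((lat k, 0) : Euc n × Euc n))) = nemytskii (fun w : ℝ × (Euc n × Euc n) =>
          X w.1 w.2) ((⟨Subtype.val, continuous_subtype_val⟩ : C(I, ℝ)).prodMk γ) := by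
    ext1 s
    rw [hε.nemytskii_apply ht', hε.nemytskii_apply ht]
    simp [hX]
  rw [this, ContinuousMap.add_apply, he t]
  simp only [ContinuousMap.const_apply]
  abel

/-- Flow curves translate to flow curves. Where there is none, the default value z is equivariant
too, so the identity holds at every point. -/
theorem flowMap_add_lat {X : ℝ → Euc n × Euc n → Euc n × Euc n}
    (hX : ∀ s z k, X s (z + (lat k, 0)) = X s z) (z : Euc n × Euc n) (k : Fin n → ℤ) :
    flowMap X (z + (lat k, 0)) = flowMap X z + (lat k, 0) := by
  by_cases h : ∃ γ, IsFlowCurve X z γ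
  · obtain ⟨γ, hγ⟩ := h
    rw [(hγ.add_lat hX k).flowMap_eq, hγ.flowMap_eq]
    rfl
  · have h' : ¬ ∃ γ, IsFlowCurve X (z + (lat k, 0)) γ := by
      rintro ⟨γ, hγ⟩
      have := hγ.add_lat hX (-k)
      have e : z + (lat k, 0) + (lat (-k), 0) = z := by
        rw [lat_neg, add_assoc]; simp
      rw [e] at this
      exact h ⟨_, this⟩
    rw [flowMap, dif_neg h', flowMap, dif_neg h]

variable [CompleteSpace P]

/-- A smooth family of vector fields, defined near `r = 0` and for times in `[0, 1]`, all vanishing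
to second order along `r = 0` for the value `p` of the parameter. -/
structure IsFlatField (X : P → ℝ → Euc n × Euc n → Euc n × Euc n) (p : P) : Prop where
  smooth : ∀ x, ∀ s ∈ Icc (0 : ℝ) 1,
    SmoothNear (fun w : P × (ℝ × (Euc n × Euc n)) => X w.1 w.2.1 w.2.2) (p, (s, (x, 0)))
  zero : ∀ x, ∀ s ∈ Icc (0 : ℝ) 1, X p s (x, 0) = 0
  fderiv_zero : ∀ x, ∀ s ∈ Icc (0 : ℝ) 1, fderiv ℝ (X p s) (x, 0) = 0
  periodic : ∀ p s z k, X p s (z + (lat k, 0)) = X p s z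

/-- On r = 0 the derivative of the field vanishes at the central parameter, so it is at most 1/2
nearby; compactness of the time interval and of the unit cube makes the tube uniform. -/
theorem IsFlatField.exists_isContractingOn {X : P → ℝ → Euc n × Euc n → Euc n × Euc n} {p : P}
    (h : IsFlatField X p) : ∃ ε > 0, ∀ᶠ q in 𝓝 p, IsContractingOn (X q) ε := by
  refine exists_uniform_tube (G := fun q x r => ∀ s ∈ Icc (0 : ℝ) 1,
    ContinuousAt (fun w : ℝ × (Euc n × Euc n) => X q w.1 w.2) (s, (x, r)) ∧
      DifferentiableAt ℝ (X q s) (x, r) ∧ ‖fderiv ℝ (X q s) (x, r)‖ ≤ 1 / 2) ?_ ?_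
  · intro q x r k hG s hs
    obtain ⟨h1, h2, h3⟩ := hG s hs
    have e : X q s = fun z => X q s (z + (lat k, 0)) := funext fun z => (h.periodic q s z k).symm
    have e' : (fun w : ℝ × (Euc n × Euc n) => X q w.1 w.2) =
      fun w => X q w.1 (w.2 + (lat k, 0)) := funext fun w => (h.periodic q w.1 w.2 k).symm
    have ez : (x, r) + (lat k, 0) = (x + lat k, r) := by simp
    refine ⟨?_, ?_, ?_⟩
    · rw [e']
      exact ContinuousAt.comp (g := fun w : ℝ × (Euc n × Euc n) => X q w.1 w.2)
        (f := fun w : ℝ × (Euc n × Euc n) => (w.1, w.2 + (lat k, 0)))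
        (by simpa only [ez] using h1) (by fun_prop)
    · rw [e]
      exact (differentiableAt_comp_add_right _).2 (by rwa [ez])
    · rw [e, fderiv_comp_add_right, ez]
      exact h3
  · intro x
    have key : ∀ s ∈ Icc (0 : ℝ) 1, ∀ᶠ w : (P × (Euc n × Euc n)) × ℝ in 𝓝 ((p, (x, 0)), s),
        ContinuousAt (fun v : ℝ × (Euc n × Euc n) => X w.1.1 v.1 v.2) (w.2, w.1.2) ∧
        DifferentiableAt ℝ (X w.1.1 w.2) w.1.2 ∧ ‖fderiv ℝ (X w.1.1 w.2) w.1.2‖ ≤ 1 / 2 := by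
      intro s hs
      have ht : Tendsto (fun w : (P × (Euc n × Euc n)) × ℝ => (w.1.1, (w.2, w.1.2)))
          (𝓝 ((p, (x, 0)), s)) (𝓝 (p, (s, (x, 0)))) := by
        have : Continuous (fun w : (P × (Euc n × Euc n)) × ℝ => (w.1.1, (w.2, w.1.2))) := by
          fun_prop
        exact this.tendsto _
      have hp : SmoothNear (fun w : (P × ℝ) × (Euc n × Euc n) => X w.1.1 w.1.2 w.2)
          ((p, s), (x, 0)) :=
        SmoothNear.comp_of_eq (f := fun w : (P × ℝ) × (Euc n × Euc n) => (w.1.1, (w.1.2, w.2)))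
          (h.smooth x s hs) (smoothNear_of_contDiff (by fun_prop) _) rfl
      have hpd := (SmoothNear.partial_snd (f := fun q : P × ℝ => X q.1 q.2) hp).continuousAt.norm
      have hlt : ∀ᶠ w : (P × ℝ) × (Euc n × Euc n) in 𝓝 ((p, s), (x, 0)),
          ‖fderiv ℝ (X w.1.1 w.1.2) w.2‖ < 1 / 2 :=
        hpd.eventually_lt_const (by simp [h.fderiv_zero x s hs])
      have ht' : Tendsto (fun w : (P × (Euc n × Euc n)) × ℝ => ((w.1.1, w.2), w.1.2))
          (𝓝 ((p, (x, 0)), s)) (𝓝 ((p, s), (x, 0))) := by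
        have : Continuous (fun w : (P × (Euc n × Euc n)) × ℝ => ((w.1.1, w.2), w.1.2)) := by
          fun_prop
        exact this.tendsto _
      filter_upwards [ht.eventually (h.smooth x s hs).eventually, ht'.eventually hlt]
        with w h1 h2
      refine ⟨?_, ?_, h2.le⟩
      · exact (SmoothNear.snd_of_prod (f := fun q (v : ℝ × (Euc n × Euc n)) => X q v.1 v.2)
          h1).continuousAt
      · have h3 := SmoothNear.snd_of_prod
          (f := fun q (v : ℝ × (Euc n × Euc n)) => X q v.1 v.2) h1
        exact (SmoothNear.snd_of_prod (f := fun s v => X w.1.1 s v) h3).differentiableAt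
    exact isCompact_Icc.eventually_forall_of_forall_eventually (P := fun
      (w : P × (Euc n × Euc n)) s =>
        ContinuousAt (fun v : ℝ × (Euc n × Euc n) => X w.1 v.1 v.2) (s, w.2) ∧
        DifferentiableAt ℝ (X w.1 s) w.2 ∧ ‖fderiv ℝ (X w.1 s) w.2‖ ≤ 1 / 2) key

/-- The implicit function theorem in the Banach space of curves, applied to γ - z - ∫ X(γ). At r = 0
the constant curve is a solution, because the field vanishes, and the linearization in γ is the
identity, because its derivative vanishes. Smooth dependence on the parameter and on the initial
point is part of the conclusion. -/
theorem IsFlatField.exists_flow {X : P → ℝ → Euc n × Euc n → Euc n × Euc n} {p : P}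
    (h : IsFlatField X p) (x : Euc n) :
    ∃ Γ : P × (Euc n × Euc n) → C(I, Euc n × Euc n), SmoothNear Γ (p, (x, 0)) ∧
      (∀ t, Γ (p, (x, 0)) t = (x, 0)) ∧
      ∀ᶠ w in 𝓝 (p, (x, 0)), IsFlowCurve (X w.1) w.2 (Γ w) := by
  set Xu : P × (ℝ × (Euc n × Euc n)) → Euc n × Euc n := fun w => X w.1 w.2.1 w.2.2 with hXu
  let cst : Euc n × Euc n →L[ℝ] C(I, Euc n × Euc n) := ContinuousLinearMap.const ℝ I
  let N : (P × (Euc n × Euc n)) × C(I, Euc n × Euc n) → C(I, Euc n × Euc n) := fun w =>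
    w.2 - cst w.1.2 - primitiveOp (nemytskii Xu (graphCurve (w.1.1, w.2)))
  set γ₀ : C(I, Euc n × Euc n) := ContinuousMap.const I (x, 0) with hγ₀
  have hcurve : ∀ t, SmoothNear Xu (graphCurve (p, γ₀) t) := fun t => by
    rw [graphCurve_apply]
    exact h.smooth x t t.2
  have hN : SmoothNear N ((p, (x, 0)), γ₀) := by
    have h1 : SmoothNear (fun w : (P × (Euc n × Euc n)) × C(I, Euc n × Euc n) =>
        graphCurve (w.1.1, w.2)) ((p, (x, 0)), γ₀) :=
      SmoothNear.contDiff_comp (g := graphCurve)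
        (f := fun w : (P × (Euc n × Euc n)) × C(I, Euc n × Euc n) => (w.1.1, w.2))
        (smoothNear_of_contDiff (by fun_prop) _) contDiff_graphCurve
    have h2 := SmoothNear.comp (g := fun c => nemytskii Xu c)
      (f := fun w : (P × (Euc n × Euc n)) × C(I, Euc n × Euc n) => graphCurve (w.1.1, w.2))
      (SmoothNear.nemytskii hcurve) h1
    have h3 := h2.contDiff_comp (primitiveOp (V := Euc n × Euc n)).contDiff
    exact ((smoothNear_of_contDiff contDiff_snd _).sub
      (smoothNear_of_contDiff (cst.contDiff.comp (by fun_prop)) _)).sub h3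
  have hN0 : N ((p, (x, 0)), γ₀) = 0 := by
    ext1 t
    have e : nemytskii Xu (graphCurve (p, γ₀)) = 0 := by
      ext1 s
      rw [nemytskii_apply (fun k => (hcurve k).continuousAt), graphCurve_apply]
      exact h.zero x s s.2
    change γ₀ t - (x, 0) - primitiveOp (nemytskii Xu (graphCurve (p, γ₀))) t = 0
    rw [e, map_zero]
    simp [hγ₀]
  have hDN : fderiv ℝ N ((p, (x, 0)), γ₀) ∘L .inr ℝ _ _ = ContinuousLinearMap.id ℝ _ := by
    have hc1 : HasFDerivAt (fun γ : C(I, Euc n × Euc n) => N ((p, (x, 0)), γ))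
        (fderiv ℝ N ((p, (x, 0)), γ₀) ∘L .inr ℝ _ _) γ₀ :=
      hN.differentiableAt.hasFDerivAt.comp γ₀ (hasFDerivAt_prodMk_right (p, (x, 0)) γ₀)
    have hU := isOpen_smoothNear Xu
    have hg : ContDiffOn ℝ 1 Xu {w | SmoothNear Xu w} := fun w hw =>
      (hw.contDiffAt.of_le (by simp)).contDiffWithinAt
    have e1 : HasFDerivAt (fun γ : C(I, Euc n × Euc n) => graphCurve (p, γ))
        (graphCurveLin ∘L .inr ℝ P _) γ₀ :=
      (hasFDerivAt_graphCurve (p, γ₀)).comp γ₀ (hasFDerivAt_prodMk_right p γ₀)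
    have e2 : HasFDerivAt (fun γ : C(I, Euc n × Euc n) => nemytskii Xu (graphCurve (p, γ)))
        ((pointwiseApply (nemytskii (fderiv ℝ Xu) (graphCurve (p, γ₀)))) ∘L
          (graphCurveLin ∘L .inr ℝ P _)) γ₀ :=
      HasFDerivAt.comp (g := nemytskii Xu) (f := fun γ : C(I, Euc n × Euc n) => graphCurve (p, γ))
        γ₀ (hasFDerivAt_nemytskii hU hg hcurve) e1
    have e3 : HasFDerivAt (fun γ : C(I, Euc n × Euc n) =>
        primitiveOp (nemytskii Xu (graphCurve (p, γ)))) (primitiveOp ∘L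
          ((pointwiseApply (nemytskii (fderiv ℝ Xu) (graphCurve (p, γ₀)))) ∘L
            (graphCurveLin ∘L .inr ℝ P _))) γ₀ :=
      HasFDerivAt.comp (g := primitiveOp (V := Euc n × Euc n)) γ₀
        (primitiveOp (V := Euc n × Euc n)).hasFDerivAt e2
    have e4 : HasFDerivAt (fun γ : C(I, Euc n × Euc n) => N ((p, (x, 0)), γ))
        (ContinuousLinearMap.id ℝ _ - primitiveOp ∘L
          ((pointwiseApply (nemytskii (fderiv ℝ Xu) (graphCurve (p, γ₀)))) ∘L
            (graphCurveLin ∘L .inr ℝ P _))) γ₀ :=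
      ((hasFDerivAt_id γ₀).sub_const (cst (x, 0))).sub e3
    rw [hc1.unique e4]
    -- The linearized integral term only involves the derivative of the field in space along r = 0,
    -- which is zero.
    have e5 : (pointwiseApply (nemytskii (fderiv ℝ Xu) (graphCurve (p, γ₀)))) ∘L
            (graphCurveLin ∘L .inr ℝ P C(I, Euc n × Euc n)) = 0 := by
      refine ContinuousLinearMap.ext fun η => ?_
      ext1 t
      simp only [ContinuousLinearMap.comp_apply, pointwiseApply_apply]
      rw [nemytskii_apply (fun k => (hcurve k).fderiv.continuousAt)]
      have d1 : HasFDerivAt (X p t) (fderiv ℝ Xu (p, ((t : ℝ), (x, 0))) ∘L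
          ((ContinuousLinearMap.inr ℝ P (ℝ × (Euc n × Euc n))) ∘L
            (ContinuousLinearMap.inr ℝ ℝ (Euc n × Euc n)))) (x, 0) :=
        HasFDerivAt.comp (g := Xu) (f := fun z => (p, ((t : ℝ), z))) (x, 0)
          (h.smooth x t t.2).differentiableAt.hasFDerivAt
          ((hasFDerivAt_prodMk_right p _).comp (x, 0) (hasFDerivAt_prodMk_right (t : ℝ) _))
      have d2 := DFunLike.congr_fun (d1.fderiv.symm.trans (h.fderiv_zero x t t.2)) (η t)
      simpa [graphCurveLin, hγ₀] using d2
    rw [e5]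
    simp
  obtain ⟨ψ, hψ1, hψ2, hψ3, -⟩ := exists_smoothNear_implicit hN (by
    rw [hDN]
    exact ⟨ContinuousLinearEquiv.refl ℝ _, rfl⟩)
  refine ⟨ψ, hψ1, fun t => by simp only at hψ2; rw [hψ2]; rfl, ?_⟩
  obtain ⟨ε, hε, hcon⟩ := h.exists_isContractingOn
  have hclose : ∀ᶠ w in 𝓝 (p, (x, (0 : Euc n))), ‖ψ w - γ₀‖ < ε := by
    have : ContinuousAt (fun w => ‖ψ w - γ₀‖) (p, (x, (0 : Euc n))) :=
      (hψ1.continuousAt.sub continuousAt_const).norm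
    exact this.eventually_lt_const (by simp only at hψ2; simpa [hψ2] using hε)
  filter_upwards [hψ3, hclose, continuousAt_fst.eventually hcon] with w h1 h2 h3
  have htube : ∀ t, ‖(ψ w t).2‖ < ε := fun t => by
    have a1 := ((ψ w - γ₀).norm_coe_le_norm t).trans_lt h2
    have a2 := norm_snd_le ((ψ w - γ₀) t)
    simp only [hγ₀, ContinuousMap.sub_apply, ContinuousMap.const_apply, Prod.snd_sub,
      sub_zero] at a2
    exact a2.trans_lt a1
  refine ⟨ε, h3, htube, fun t => ?_⟩
  rw [hN0] at h1
  have h4 := DFunLike.congr_fun h1 t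
  have e : nemytskii Xu (graphCurve (w.1, ψ w)) =
      nemytskii (fun v : ℝ × (Euc n × Euc n) => X w.1 v.1 v.2)
        ((⟨Subtype.val, continuous_subtype_val⟩ : C(I, ℝ)).prodMk (ψ w)) := by
    simp only [nemytskii, graphCurve_apply]
    rfl
  simp only [N, e, cst] at h4
  rw [ContinuousMap.sub_apply, ContinuousMap.sub_apply, ContinuousMap.zero_apply] at h4
  have h5 : ψ w t - w.2 - primitiveOp (nemytskii (fun v : ℝ × (Euc n × Euc n) => X w.1 v.1 v.2)
        ((⟨Subtype.val, continuous_subtype_val⟩ : C(I, ℝ)).prodMk (ψ w))) t = 0 := h4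
  rw [sub_sub] at h5
  exact sub_eq_zero.1 h5

theorem IsFlatField.smoothNear_flowMap {X : P → ℝ → Euc n × Euc n → Euc n × Euc n} {p : P}
    (h : IsFlatField X p) (x : Euc n) :
    SmoothNear (fun w : P × (Euc n × Euc n) => flowMap (X w.1) w.2) (p, (x, 0)) := by
  obtain ⟨Γ, h1, -, h2⟩ := h.exists_flow x
  have h3 : SmoothNear (fun w => Γ w 1) (p, (x, 0)) :=
    h1.contDiff_comp (ContinuousLinearMap.contDiff (ContinuousMap.evalCLM ℝ (1 : I)))
  exact h3.congr (h2.mono fun w hw => hw.flowMap_eq.symm)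

end TubeFlow

end

section

/-! ### Moser's method near r = 0. -/

section Moser

open unitInterval

variable {n : ℕ} {P : Type} [NormedAddCommGroup P] [NormedSpace ℝ P]

scoped instance instNormedAddCommGroupEucProd : NormedAddCommGroup (Euc n × Euc n) := inferInstance

scoped instance instNormedSpaceEucProd : NormedSpace ℝ (Euc n × Euc n) := inferInstance

scoped instance instNormedAddCommGroupCovec : NormedAddCommGroup (Euc n × Euc n →L[ℝ] ℝ) := inferInstance

scoped instance instNormedSpaceCovec : NormedSpace ℝ (Euc n × Euc n →L[ℝ] ℝ) := inferInstance

scoped instance instNormedAddCommGroupBilin :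
    NormedAddCommGroup (Euc n × Euc n →L[ℝ] Euc n × Euc n →L[ℝ] ℝ) := inferInstance

scoped instance instNormedSpaceBilin :
    NormedSpace ℝ (Euc n × Euc n →L[ℝ] Euc n × Euc n →L[ℝ] ℝ) := inferInstance

scoped instance instAddCommGroupBilin :
    AddCommGroup (Euc n × Euc n →L[ℝ] Euc n × Euc n →L[ℝ] ℝ) := inferInstance

scoped instance instAddCommMonoidBilin :
    AddCommMonoid (Euc n × Euc n →L[ℝ] Euc n × Euc n →L[ℝ] ℝ) := inferInstance

scoped instance instModuleBilin :
    Module ℝ (Euc n × Euc n →L[ℝ] Euc n × Euc n →L[ℝ] ℝ) := inferInstance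

/-- The inner product of `Euc n` as a continuous bilinear map. -/
def innerL : Euc n →L[ℝ] Euc n →L[ℝ] ℝ :=
  (isBoundedBilinearMap_inner (𝕜 := ℝ) (E := Euc n)).toContinuousLinearMap

@[simp] theorem innerL_apply (x y : Euc n) : innerL x y = inner ℝ x y := rfl

/-- The standard symplectic form on `Euc n × Euc n`. -/
def w0 : Euc n × Euc n →L[ℝ] Euc n × Euc n →L[ℝ] ℝ :=
  innerL.bilinearComp (.fst ℝ _ _) (.snd ℝ _ _) - innerL.bilinearComp (.snd ℝ _ _) (.fst ℝ _ _)

theorem w0_apply (u v : Euc n × Euc n) :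
    w0 u v = inner ℝ u.1 v.2 - inner ℝ u.2 v.1 := rfl

theorem w0_antisymm (u v : Euc n × Euc n) : w0 u v = - w0 v u := by
  rw [w0_apply, w0_apply, real_inner_comm v.2, real_inner_comm v.1]
  ring

theorem w0_eq_sum (u v : Euc n × Euc n) : w0 u v = ∑ i, (u.1 i * v.2 i - v.1 i * u.2 i) := by
  rw [w0_apply, PiLp.inner_apply, PiLp.inner_apply, ← Finset.sum_sub_distrib]
  refine Finset.sum_congr rfl fun i _ => ?_
  simp [mul_comm]

theorem isInvertible_w0 : (w0 (n := n)).IsInvertible := by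
  refine isInvertible_of_injective ?_ ?_
  · refine (injective_iff_map_eq_zero _).2 fun u hu => ?_
    have h1 := DFunLike.congr_fun hu (0, u.1)
    have h2 := DFunLike.congr_fun hu (u.2, 0)
    simp only [w0_apply, inner_zero_right, sub_zero, zero_sub, _root_.zero_apply] at h1 h2
    exact Prod.ext (inner_self_eq_zero.1 h1) (inner_self_eq_zero.1 (neg_eq_zero.1 h2))
  · rw [← LinearEquiv.finrank_eq (LinearMap.toContinuousLinearMap (𝕜 := ℝ) (E := Euc n × Euc n)
      (F' := ℝ))]
    exact (Subspace.dual_finrank_eq (K := ℝ) (V := Euc n × Euc n)).symm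

theorem eventually_isInvertible_w0 :
    ∀ᶠ Ω in 𝓝 (w0 (n := n)), Ω.IsInvertible := by
  obtain ⟨e, he⟩ := isInvertible_w0 (n := n)
  rw [← he]
  exact ContinuousLinearEquiv.nhds e

theorem smoothNear_inverse {Ω : Euc n × Euc n →L[ℝ] Euc n × Euc n →L[ℝ] ℝ}
    (h : Ω.IsInvertible) : SmoothNear ContinuousLinearMap.inverse Ω := by
  have : ∀ᶠ Ω' in 𝓝 Ω, Ω'.IsInvertible := by
    obtain ⟨e, rfl⟩ := h
    exact ContinuousLinearEquiv.nhds e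
  exact this.mono fun Ω' h' => h'.contDiffAt_map_inverse

/-- The interpolation between the standard symplectic form and `B`. -/
def interpForm (B : Euc n × Euc n → Euc n × Euc n →L[ℝ] Euc n × Euc n →L[ℝ] ℝ) (s : ℝ)
    (z : Euc n × Euc n) : Euc n × Euc n →L[ℝ] Euc n × Euc n →L[ℝ] ℝ :=
  w0 + s • (B z - w0)

/-- Moser's vector field. -/
def moserField (B : Euc n × Euc n → Euc n × Euc n →L[ℝ] Euc n × Euc n →L[ℝ] ℝ) (s : ℝ)
    (z : Euc n × Euc n) : Euc n × Euc n :=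
  -(interpForm B s z).inverse (primitiveTwo (fun y => B y - w0) z)

/-- A smooth family of symplectic forms near `r = 0`, standard along `r = 0`. -/
structure IsMoserForm (B : P → Euc n × Euc n → Euc n × Euc n →L[ℝ] Euc n × Euc n →L[ℝ] ℝ)
    (p : P) : Prop where
  smooth : ∀ x, SmoothNear (fun w : P × (Euc n × Euc n) => B w.1 w.2) (p, (x, 0))
  base_eventually : ∀ᶠ q in 𝓝 p, ∀ x, B q (x, 0) = w0
  periodic : ∀ p z k, B p (z + (lat k, 0)) = B p z
  antisymm : ∀ q z u v, B q z u v = - B q z v u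
  closed : ∀ x, ∀ᶠ w in 𝓝 (p, (x, 0)), ∀ u v v', fderiv ℝ (B w.1) w.2 u v v' +
    fderiv ℝ (B w.1) w.2 v v' u + fderiv ℝ (B w.1) w.2 v' u v = 0

variable {B : P → Euc n × Euc n → Euc n × Euc n →L[ℝ] Euc n × Euc n →L[ℝ] ℝ} {p : P}

theorem primitiveTwo_zero (C : Euc n × Euc n → Euc n × Euc n →L[ℝ] Euc n × Euc n →L[ℝ] ℝ)
    (x : Euc n) : primitiveTwo C (x, 0) = 0 := by
  have : ((0 : Euc n), (0 : Euc n)) = 0 := rfl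
  simp [primitiveTwo, this]

theorem primitiveTwo_add_lat {C : Euc n × Euc n → Euc n × Euc n →L[ℝ] Euc n × Euc n →L[ℝ] ℝ}
    (hC : ∀ z k, C (z + (lat k, 0)) = C z) (z : Euc n × Euc n) (k : Fin n → ℤ) :
    primitiveTwo C (z + (lat k, 0)) = primitiveTwo C z := by
  have : ∀ t : ℝ, scaleSnd t (z + (lat k, 0)) = scaleSnd t z + (lat k, 0) := fun t => by
    simp
  simp only [primitiveTwo, this, hC]
  simp

namespace IsMoserForm

theorem base (h : IsMoserForm B p) (x : Euc n) : B p (x, 0) = w0 := h.base_eventually.self_of_nhds x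

theorem smooth_sub (h : IsMoserForm B p) (x : Euc n) :
    SmoothNear (fun w : P × (Euc n × Euc n) => B w.1 w.2 - w0) (p, (x, 0)) :=
  (h.smooth x).sub (smoothNear_const _ _)

theorem smooth_right (h : IsMoserForm B p) (x : Euc n) : SmoothNear (B p) (x, 0) :=
  SmoothNear.snd_of_prod (h.smooth x)

theorem smooth_interpForm (h : IsMoserForm B p) (x : Euc n) (s : ℝ) :
    SmoothNear (fun w : P × (ℝ × (Euc n × Euc n)) => interpForm (B w.1) w.2.1 w.2.2)
      (p, (s, (x, 0))) := by
  have h1 : SmoothNear (fun w : P × (ℝ × (Euc n × Euc n)) => B w.1 w.2.2 - w0)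
      (p, (s, (x, 0))) :=
    SmoothNear.comp (g := fun w : P × (Euc n × Euc n) => B w.1 w.2 - w0)
      (f := fun w : P × (ℝ × (Euc n × Euc n)) => (w.1, w.2.2)) (h.smooth_sub x)
      (smoothNear_of_contDiff (by fun_prop) _)
  have h2 : SmoothNear (fun w : P × (ℝ × (Euc n × Euc n)) => w.2.1) (p, (s, (x, 0))) :=
    smoothNear_of_contDiff (by fun_prop) _
  have h3 := h2.smul h1
  have h4 : SmoothNear (fun _ : P × (ℝ × (Euc n × Euc n)) => w0 (n := n)) (p, (s, (x, 0))) :=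
    smoothNear_const _ _
  exact h4.add h3

theorem interpForm_base (h : IsMoserForm B p) (x : Euc n) (s : ℝ) :
    interpForm (B p) s (x, 0) = w0 := by
  simp [interpForm, h.base]

theorem eventually_interpForm (h : IsMoserForm B p) (x : Euc n)
    {q : (Euc n × Euc n →L[ℝ] Euc n × Euc n →L[ℝ] ℝ) → Prop} (hq : ∀ᶠ Ω in 𝓝 w0, q Ω) :
    ∀ᶠ w in 𝓝 (p, (x, 0)), ∀ s ∈ Icc (0 : ℝ) 1, q (interpForm (B w.1) s w.2) := by
  obtain ⟨δ, hδ, hb⟩ := Metric.eventually_nhds_iff_ball.1 hq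
  have hc : ContinuousAt (fun w : P × (Euc n × Euc n) => ‖B w.1 w.2 - w0‖) (p, (x, 0)) :=
    ((h.smooth x).continuousAt.sub continuousAt_const).norm
  filter_upwards [hc.eventually_lt_const (u := δ) (by simpa [h.base] using hδ)] with w hw s hs
  refine hb _ ?_
  rw [Metric.mem_ball, dist_eq_norm, interpForm, add_sub_cancel_left, norm_smul, Real.norm_eq_abs,
    abs_of_nonneg hs.1]
  exact (mul_le_of_le_one_left (norm_nonneg _) hs.2).trans_lt hw

theorem smooth_moserField (h : IsMoserForm B p) (x : Euc n) (s : ℝ) :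
    SmoothNear (fun w : P × (ℝ × (Euc n × Euc n)) => moserField (B w.1) w.2.1 w.2.2)
      (p, (s, (x, 0))) := by
  refine SmoothNear.neg (SmoothNear.clm_apply ?_ ?_)
  · refine SmoothNear.comp (g := ContinuousLinearMap.inverse) ?_ (h.smooth_interpForm x s)
    simp only [h.interpForm_base]
    exact smoothNear_inverse isInvertible_w0
  · exact SmoothNear.comp (g := fun w : P × (Euc n × Euc n) =>
      primitiveTwo (fun y => B w.1 y - w0) w.2) (f := fun w : P × (ℝ × (Euc n × Euc n)) =>
        (w.1, w.2.2)) (SmoothNear.primitiveTwo (C := fun p y => B p y - w0) (h.smooth_sub x))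
      (smoothNear_of_contDiff (by fun_prop) _)

/-- The primitive of B - w0 has one order more than B - w0, and the inverse of the interpolating
form is bounded near `w0`, uniformly in time. -/
theorem exists_norm_moserField_le (h : IsMoserForm B p) {k : ℕ}
    (hk : VanishesTo k fun z => B p z - w0) (x : Euc n) :
    ∃ c, ∀ᶠ z in 𝓝 (x, (0 : Euc n)), ∀ s ∈ Icc (0 : ℝ) 1,
      ‖moserField (B p) s z‖ ≤ c * ‖z.2‖ ^ (k + 1) := by
  obtain ⟨c, hc0, hc⟩ := (hk.primitiveTwo x).exists_nonneg
  set K := ‖(w0 (n := n)).inverse‖ + 1 with hK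
  have h1 : ∀ᶠ Ω in 𝓝 (w0 (n := n)), ‖Ω.inverse‖ < K :=
    (smoothNear_inverse isInvertible_w0).continuousAt.norm.eventually_lt_const (by simp [hK])
  refine ⟨K * c, ?_⟩
  filter_upwards [hc.bound, (Continuous.tendsto (f := fun z : Euc n × Euc n => (p, z)) (by fun_prop)
    (x, 0)).eventually (h.eventually_interpForm x h1)] with z hz1 hz2 s hs
  rw [moserField, norm_neg]
  refine (ContinuousLinearMap.le_opNorm _ _).trans ?_
  rw [mul_assoc]
  rw [norm_pow, norm_norm] at hz1
  exact mul_le_mul (hz2 s hs).le hz1 (norm_nonneg _) (by positivity)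

theorem isFlatField [CompleteSpace P] (h : IsMoserForm B p) :
    IsFlatField (fun q => moserField (B q)) p where
  smooth x s _ := h.smooth_moserField x s
  zero x s _ := by simp [moserField, primitiveTwo_zero]
  fderiv_zero x s hs := by
    -- Agreement along r = 0 gives order 1 and the primitive raises it to 2, which is what makes the
    -- derivative of the field vanish there.
    have h1 : VanishesTo 1 fun z => B p z - w0 :=
      VanishesTo.fst_of_smoothNear (fun x => (h.smooth_right x).sub (smoothNear_const _ _))
        fun x => by simp [h.base]
    have h2 : VanishesTo 2 (moserField (B p) s) := fun x => by
      obtain ⟨c, hc⟩ := h.exists_norm_moserField_le h1 x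
      refine IsBigO.of_bound c ?_
      filter_upwards [hc] with z hz
      rw [norm_pow, norm_norm]
      exact hz s hs
    exact (h2.hasFDerivAt x).fderiv
  periodic q s z k := by
    have hC : ∀ z k, B q (z + (lat k, 0)) - w0 = B q z - w0 := fun z k => by rw [h.periodic]
    rw [moserField, moserField, interpForm, interpForm, h.periodic,
      primitiveTwo_add_lat (C := fun y => B q y - w0) hC]

variable [CompleteSpace P]

theorem smooth_flowMap (h : IsMoserForm B p) (x : Euc n) :
    SmoothNear (fun w : P × (Euc n × Euc n) => flowMap (moserField (B w.1)) w.2) (p, (x, 0)) :=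
  h.isFlatField.smoothNear_flowMap x

theorem flowMap_add_lat (h : IsMoserForm B p) (q : P) (z : Euc n × Euc n) (k : Fin n → ℤ) :
    flowMap (moserField (B q)) (z + (lat k, 0)) = flowMap (moserField (B q)) z + (lat k, 0) :=
  KAMBirkhoff.flowMap_add_lat (fun s z k => h.isFlatField.periodic q s z k) z k

theorem flowMap_base (h : IsMoserForm B p) (x : Euc n) :
    flowMap (moserField (B p)) (x, 0) = (x, 0) := by
  obtain ⟨Γ, -, h2, h3⟩ := h.isFlatField.exists_flow x
  rw [h3.self_of_nhds.flowMap_eq, h2]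

/-- The contraction estimate keeps the curve within 2‖r‖ of the torus, so the field along it is
O(‖r‖^(k+1)), and so is the displacement in unit time. -/
theorem vanishesTo_flowMap_sub (h : IsMoserForm B p) {k : ℕ}
    (hk : VanishesTo k fun z => B p z - w0) :
    VanishesTo (k + 1) fun z => flowMap (moserField (B p)) z - z := by
  intro x
  obtain ⟨Γ, h1, h2, h3⟩ := h.isFlatField.exists_flow x
  obtain ⟨c, hc⟩ := h.exists_norm_moserField_le hk x
  have hΓ : ContinuousAt (fun z => Γ (p, z)) (x, 0) :=
    (SmoothNear.snd_of_prod (f := fun p z => Γ (p, z)) h1).continuousAt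
  obtain ⟨U, hU, hUo, hxU⟩ := eventually_nhds_iff.1 hc
  have h4 : ∀ᶠ z in 𝓝 (x, (0 : Euc n)), ∀ t, Γ (p, z) t ∈ U :=
    hΓ.eventually_mem ((isOpen_setOf_forall_mem hUo).mem_nhds fun t => by rw [h2]; exact hxU)
  have h5 : ∀ᶠ z in 𝓝 (x, (0 : Euc n)), IsFlowCurve (moserField (B p)) z (Γ (p, z)) :=
    (continuousAt_const.prodMk continuousAt_id).eventually h3
  refine IsBigO.of_bound (|c| * 2 ^ (k + 1)) ?_
  filter_upwards [h4, h5] with z h4 h5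
  rw [h5.flowMap_eq]
  obtain ⟨ε, hε, ht, he⟩ := h5
  set γ := Γ (p, z) with hγ
  have hz : ‖z.2‖ < ε := by
    have e := he 0
    rw [primitiveOp_apply] at e
    have e' : γ 0 = z := by simpa using e
    rw [← e']; exact ht 0
  -- The field vanishes at (z.1, 0), so half the distance bounds it; absorbing that half on the left
  -- gives the factor 2.
  have hbound : ‖γ - ContinuousMap.const I (z.1, 0)‖ ≤
      ‖z.2‖ + 1 / 2 * ‖γ - ContinuousMap.const I (z.1, 0)‖ := by
    refine (ContinuousMap.norm_le _ (by positivity)).2 fun t => ?_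
    rw [ContinuousMap.sub_apply, he t, ContinuousMap.const_apply, add_sub_right_comm]
    refine (norm_add_le _ _).trans (add_le_add ?_ (norm_primitiveOp_le _ (fun s => ?_) t))
    · rw [Prod.norm_def]; simp
    · rw [hε.nemytskii_apply ht]
      have e1 := hε.norm_sub_le (z := γ s) (z' := (z.1, 0)) (ht s)
        (by simpa using (norm_nonneg _).trans_lt hz) s.2
      rw [show moserField (B p) s (z.1, 0) = 0 by simp [moserField, primitiveTwo_zero],
        sub_zero] at e1
      refine e1.trans ?_
      gcongr
      exact (γ - ContinuousMap.const I (z.1, 0)).norm_coe_le_norm s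
  have hsnd : ∀ t, ‖(γ t).2‖ ≤ 2 * ‖z.2‖ := fun t => by
    have e1 := (γ - ContinuousMap.const I ((z.1, 0) : Euc n × Euc n)).norm_coe_le_norm t
    have e2 := norm_snd_le ((γ - ContinuousMap.const I ((z.1, 0) : Euc n × Euc n)) t)
    simp only [ContinuousMap.sub_apply, ContinuousMap.const_apply, Prod.snd_sub, sub_zero] at e1 e2
    linarith
  rw [he 1, add_sub_cancel_left, norm_pow, norm_norm]
  refine norm_primitiveOp_le _ (fun s => ?_) 1
  rw [hε.nemytskii_apply ht]
  refine (hU _ (h4 s) s s.2).trans ?_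
  rw [mul_assoc, ← mul_pow]
  have := hsnd s
  gcongr
  exact le_abs_self c

/-- The infinitesimal form of the invariance of the interpolating forms. -/
theorem infinitesimal (h : IsMoserForm B p) (x : Euc n) :
    ∀ᶠ w in 𝓝 (p, (x, 0)), ∀ s ∈ Icc (0 : ℝ) 1, ∀ a b,
      B w.1 w.2 a b - w0 a b + s * fderiv ℝ (B w.1) w.2 (moserField (B w.1) s w.2) a b +
        interpForm (B w.1) s w.2 (fderiv ℝ (moserField (B w.1) s) w.2 a) b +
        interpForm (B w.1) s w.2 a (fderiv ℝ (moserField (B w.1) s) w.2 b) = 0 := by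
  have h1 : ∀ q z, fderiv ℝ (fun y => B q y - w0) z = fderiv ℝ (B q) z :=
    fun q z => fderiv_sub_const _
  have h4 : ∀ᶠ w in 𝓝 (p, (x, (0 : Euc n))), ∀ s ∈ Icc (0 : ℝ) 1,
      (interpForm (B w.1) s w.2).IsInvertible := h.eventually_interpForm x eventually_isInvertible_w0
  have h5 : ∀ᶠ w in 𝓝 (p, (x, (0 : Euc n))), ∀ s ∈ Icc (0 : ℝ) 1,
      DifferentiableAt ℝ (moserField (B w.1) s) w.2 := by
    obtain ⟨ε, hε, hq⟩ := h.isFlatField.exists_isContractingOn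
    have : ∀ᶠ w in 𝓝 (p, (x, (0 : Euc n))), ‖w.2.2‖ < ε :=
      (continuous_snd.snd.norm.continuousAt (x := (p, (x, (0 : Euc n))))).eventually_lt_const
        (by simpa)
    filter_upwards [this, (continuous_fst.tendsto (p, (x, (0 : Euc n)))).eventually hq]
      with w hw hq s hs using (hq w.2.1 w.2.2 hw s hs).2.1
  filter_upwards [eventually_forall_scaleSnd (p := fun q z => SmoothNear (fun w : P × (Euc n × Euc n)
      => B w.1 w.2) (q, z)) (h.smooth x).eventually,
    eventually_forall_scaleSnd (p := fun q z => ∀ u v v', fderiv ℝ (B q) z u v v' +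
      fderiv ℝ (B q) z v v' u + fderiv ℝ (B q) z v' u v = 0) (h.closed x),
    (SmoothNear.primitiveTwo (C := fun q y => B q y - w0) (h.smooth_sub x)).eventually,
    h4.eventually_nhds, h5, h.closed x, (h.smooth x).eventually,
    (continuous_fst.tendsto (p, (x, (0 : Euc n)))).eventually h.base_eventually]
    with ⟨q, z⟩ g1 g2 h3 h4 h5 h6 h8 g3 s hs a b
  replace h3 := SmoothNear.snd_of_prod (f := fun q => primitiveTwo fun y => B q y - w0) h3
  replace h8 := SmoothNear.snd_of_prod (f := B) h8
  replace h4 : ∀ᶠ y in 𝓝 z, ∀ s ∈ Icc (0 : ℝ) 1, (interpForm (B q) s y).IsInvertible :=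
    (Continuous.tendsto (f := fun y : Euc n × Euc n => (q, y)) (by fun_prop) z).eventually h4
  simp only at h5 h6 g3 ⊢
  set β := primitiveTwo fun y => B q y - w0 with hβ
  -- This is dβ = B - w0, from the relative Poincaré lemma.
  have h2 : ∀ u v, fderiv ℝ β z u v - fderiv ℝ β z v u = B q z u v - w0 u v := by
    refine fderiv_primitiveTwo (C := fun y => B q y - w0) (fun t ht => ?_) (fun z u v => ?_)
      (fun t ht => ?_) (by simp [g3])
    · exact (SmoothNear.snd_of_prod (f := B) (g1 t ht)).sub (smoothNear_const _ _)
    · rw [_root_.sub_apply, _root_.sub_apply, _root_.sub_apply, _root_.sub_apply, h.antisymm,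
        w0_antisymm]
      ring
    · rw [h1]
      exact g2 t ht
  have hB := h8.differentiableAt.hasFDerivAt
  have hX := (h5 s hs).hasFDerivAt
  have hΩ : HasFDerivAt (interpForm (B q) s) (s • fderiv ℝ (B q) z) z :=
    ((hB.sub_const w0).const_smul s).const_add w0
  -- Derivative of the defining identity Ω_s(X_s, ·) = -β, which holds near z because Ω_s is
  -- invertible there.
  have key : ∀ a b, s * fderiv ℝ (B q) z a (moserField (B q) s z) b +
      interpForm (B q) s z (fderiv ℝ (moserField (B q) s) z a) b = - fderiv ℝ β z a b := by
    intro a b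
    have e1 := hΩ.clm_apply hX
    have e2 := (h3.differentiableAt.hasFDerivAt).neg
    have e3 : (fun y => interpForm (B q) s y (moserField (B q) s y)) =ᶠ[𝓝 z] fun y => - β y := by
      filter_upwards [h4] with y hy
      rw [moserField, map_neg, (hy s hs).self_apply_inverse]
    have := DFunLike.congr_fun (DFunLike.congr_fun (e1.unique (e2.congr_of_eventuallyEq e3)) a) b
    simp only [_root_.add_apply, ContinuousLinearMap.comp_apply, ContinuousLinearMap.flip_apply,
      _root_.smul_apply, smul_eq_mul, _root_.neg_apply] at this
    linarith
  have hanti : ∀ u v, interpForm (B q) s z u v = - interpForm (B q) s z v u := by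
    intro u v
    simp only [interpForm, _root_.add_apply, _root_.sub_apply, _root_.smul_apply, smul_eq_mul]
    rw [h.antisymm q z u v, w0_antisymm u v]
    ring
  have hda : ∀ a b w, fderiv ℝ (B q) z w a b = - fderiv ℝ (B q) z w b a := by
    intro a b w
    have g1 : HasFDerivAt (fun z => B q z a b) _ z :=
      (hB.clm_apply (hasFDerivAt_const a _)).clm_apply (hasFDerivAt_const b _)
    have g2 : HasFDerivAt (fun z => - B q z b a) _ z :=
      ((hB.clm_apply (hasFDerivAt_const b _)).clm_apply (hasFDerivAt_const a _)).neg
    have g3 : (fun z => - B q z b a) = fun z => B q z a b :=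
      funext fun y => (h.antisymm q y a b).symm
    rw [g3] at g2
    have := DFunLike.congr_fun (g1.unique g2) w
    simpa using this
  have k1 := key a b
  have k2 := key b a
  have k3 := h2 a b
  have k4 := h6 (moserField (B q) s z) a b
  have k5 := hanti a (fderiv ℝ (moserField (B q) s) z b)
  have k6 := hda b (moserField (B q) s z) a
  have k7 := hda a (moserField (B q) s z) b
  -- Antisymmetrize `key` in (a, b), insert dβ = B - w0, and use closedness of B to trade the
  -- derivatives along a and b for the derivative along the field.
  linear_combination k1 - k2 + k5 - k3 + s * k4 - s * k6

end IsMoserForm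

end Moser

end

section

/-! ### The variational equation and invariance under the flow. -/

section FlowPullback

open unitInterval

/-- The integral from `0` to `t` of a continuous function on `[0, 1]`, extended to `ℝ`. -/
def primitiveEval {V : Type} [NormedAddCommGroup V] [NormedSpace ℝ V] (t : ℝ) : C(I, V) →L[ℝ] V :=
  LinearMap.mkContinuous
    { toFun := fun c => ∫ s in (0 : ℝ)..t, c (projIcc 0 1 zero_le_one s)
      map_add' := fun c d => intervalIntegral.integral_add
        (Continuous.intervalIntegrable (by fun_prop) _ _)
        (Continuous.intervalIntegrable (by fun_prop) _ _)
      map_smul' := fun a c => intervalIntegral.integral_smul _ _ } |t| fun c => by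
    refine (intervalIntegral.norm_integral_le_of_norm_le_const (C := ‖c‖) fun s _ =>
      c.norm_coe_le_norm _).trans_eq ?_
    rw [sub_zero, mul_comm]

variable {n : ℕ} {P : Type} [NormedAddCommGroup P] [NormedSpace ℝ P] [CompleteSpace P]
  {B : P → Euc n × Euc n → Euc n × Euc n →L[ℝ] Euc n × Euc n →L[ℝ] ℝ} {p : P}

set_option maxHeartbeats 1600000 in
/-- The variational equation along the flow of a flat field. -/
theorem IsFlatField.exists_variation {X : P → ℝ → Euc n × Euc n → Euc n × Euc n}
    (h : IsFlatField X p) (x : Euc n) {Q : P → Euc n × Euc n → Prop}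
    (hQ : ∀ᶠ w in 𝓝 (p, (x, 0)), Q w.1 w.2) :
    ∀ᶠ w in 𝓝 (p, (x, 0)), ∃ (γ : ℝ → Euc n × Euc n) (W : ℝ → Euc n × Euc n →L[ℝ] Euc n × Euc n),
      γ 0 = w.2 ∧ γ 1 = flowMap (X w.1) w.2 ∧ W 0 = .id ℝ _ ∧
      W 1 = fderiv ℝ (flowMap (X w.1)) w.2 ∧
      ∀ t ∈ Icc (0 : ℝ) 1, Q w.1 (γ t) ∧ HasDerivAt γ (X w.1 t (γ t)) t ∧
        ∀ u, HasDerivAt (fun t => W t u) (fderiv ℝ (X w.1 t) (γ t) (W t u)) t := by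
  obtain ⟨Γ, h1, h2, h3⟩ := h.exists_flow x
  set Xu : P × (ℝ × (Euc n × Euc n)) → Euc n × Euc n := fun w => X w.1 w.2.1 w.2.2 with hXu
  have hsm : ∀ᶠ w in 𝓝 (p, (x, (0 : Euc n))), ∀ s ∈ Icc (0 : ℝ) 1,
      SmoothNear Xu (w.1, (s, w.2)) := by
    refine isCompact_Icc.eventually_forall_of_forall_eventually (P := fun
      (w : P × (Euc n × Euc n)) s => SmoothNear Xu (w.1, (s, w.2))) fun s hs => ?_
    have ht : Tendsto (fun v : (P × (Euc n × Euc n)) × ℝ => (v.1.1, (v.2, v.1.2)))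
        (𝓝 ((p, (x, 0)), s)) (𝓝 (p, (s, (x, 0)))) :=
      (by fun_prop : Continuous fun v : (P × (Euc n × Euc n)) × ℝ =>
        (v.1.1, (v.2, v.1.2))).tendsto _
    exact ht.eventually (h.smooth x s hs).eventually
  obtain ⟨U, hU, hUo, hxU⟩ := eventually_nhds_iff.1 (hsm.and hQ)
  have h4 : ∀ᶠ w in 𝓝 (p, (x, (0 : Euc n))), ∀ t, (w.1, Γ w t) ∈ U := by
    have c1 : ContinuousAt (fun w => graphCurve (w.1, Γ w)) (p, (x, (0 : Euc n))) :=
      ContinuousAt.comp (g := fun w : P × C(I, Euc n × Euc n) => graphCurve w)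
        (f := fun w : P × (Euc n × Euc n) => (w.1, Γ w))
        (contDiff_graphCurve (V := Euc n × Euc n) (P := P)).continuous.continuousAt
        (continuousAt_fst.prodMk h1.continuousAt)
    have hV : IsOpen {v : P × (ℝ × (Euc n × Euc n)) | (v.1, v.2.2) ∈ U} :=
      hUo.preimage (by fun_prop)
    have := c1.eventually_mem ((isOpen_setOf_forall_mem (K := I) hV).mem_nhds fun t => by
      rw [graphCurve_apply]
      change (p, Γ (p, (x, 0)) t) ∈ U
      rw [h2]
      exact hxU)
    filter_upwards [this] with w hw t
    have := hw t
    rwa [graphCurve_apply] at this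
  filter_upwards [h4.eventually_nhds, h3.eventually_nhds, h1.eventually] with ⟨q, z⟩ h4 h5 h6
  have hslice : Tendsto (fun y : Euc n × Euc n => (q, y)) (𝓝 z) (𝓝 (q, z)) :=
    Continuous.tendsto (by fun_prop) z
  replace h4 := hslice.eventually h4
  replace h5 := hslice.eventually h5
  replace h6 : SmoothNear (fun z => Γ (q, z)) z :=
    SmoothNear.snd_of_prod (f := fun q z => Γ (q, z)) h6
  simp only at h4 h5 ⊢
  set Γ' : Euc n × Euc n → C(I, Euc n × Euc n) := fun z => Γ (q, z) with hΓ'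
  have hflow : flowMap (X q) =ᶠ[𝓝 z] fun z => Γ' z 1 := h5.mono fun y hy => hy.flowMap_eq
  have hD : HasFDerivAt Γ' (fderiv ℝ Γ' z) z := h6.differentiableAt.hasFDerivAt
  set D := fderiv ℝ Γ' z with hDdef
  have hc : ∀ t, graphCurve (q, Γ' z) t ∈ {w | SmoothNear Xu w} := fun t => by
    rw [graphCurve_apply]
    exact (hU _ (h4.self_of_nhds t)).1 t t.2
  -- The integral equation holds for all initial points near z, so it may be differentiated in the
  -- initial point. This gives the linearized equation in integrated form.
  have heq : Γ' =ᶠ[𝓝 z] fun y => ContinuousLinearMap.const ℝ I y +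
      primitiveOp (nemytskii Xu (graphCurve (q, Γ' y))) := by
    filter_upwards [h5] with y hy
    obtain ⟨ε, hε, ht, he⟩ := hy
    ext1 t
    rw [he t, ContinuousMap.add_apply]
    have e : nemytskii Xu (graphCurve (q, Γ' y)) =
        nemytskii (fun v : ℝ × (Euc n × Euc n) => X q v.1 v.2)
          ((⟨Subtype.val, continuous_subtype_val⟩ : C(I, ℝ)).prodMk (Γ' y)) := by
      simp only [nemytskii, graphCurve_apply]
      rfl
    rw [e]
    rfl
  have e1 : HasFDerivAt (fun γ : C(I, Euc n × Euc n) => graphCurve (q, γ))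
      (graphCurveLin ∘L .inr ℝ P _) (Γ' z) :=
    (hasFDerivAt_graphCurve (q, Γ' z)).comp (Γ' z) (hasFDerivAt_prodMk_right q (Γ' z))
  have e2 : HasFDerivAt (fun γ : C(I, Euc n × Euc n) => nemytskii Xu (graphCurve (q, γ)))
      ((pointwiseApply (nemytskii (fderiv ℝ Xu) (graphCurve (q, Γ' z)))) ∘L
        (graphCurveLin ∘L .inr ℝ P _)) (Γ' z) :=
    HasFDerivAt.comp (g := nemytskii Xu) (f := fun γ : C(I, Euc n × Euc n) => graphCurve (q, γ))
      (Γ' z) (hasFDerivAt_nemytskii (isOpen_smoothNear Xu)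
        (fun w hw => ((SmoothNear.contDiffAt hw).of_le (by simp)).contDiffWithinAt) hc) e1
  have e3 := HasFDerivAt.comp (g := primitiveOp (V := Euc n × Euc n)) (Γ' z)
    (primitiveOp (V := Euc n × Euc n)).hasFDerivAt e2
  have e4 := HasFDerivAt.comp (g := fun γ => primitiveOp (nemytskii Xu (graphCurve (q, γ))))
    (f := Γ') z e3 hD
  have e5 := (((ContinuousLinearMap.const ℝ I :
    Euc n × Euc n →L[ℝ] C(I, Euc n × Euc n)).hasFDerivAt (x := z)).add e4).congr_of_eventuallyEq heq
  have hDeq := hD.unique e5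
  set A : C(I, P × (ℝ × (Euc n × Euc n)) →L[ℝ] Euc n × Euc n) :=
    nemytskii (fderiv ℝ Xu) (graphCurve (q, Γ' z)) with hA
  have hAapp : ∀ (t : I) v, A t (0, ((0 : ℝ), v)) = fderiv ℝ (X q t) (Γ' z t) v := by
    intro t v
    rw [hA, nemytskii_apply (fun k => (SmoothNear.fderiv (hc k)).continuousAt), graphCurve_apply]
    have hk := hc t
    rw [graphCurve_apply] at hk
    have d1 : HasFDerivAt (X q t) (fderiv ℝ Xu (q, ((t : ℝ), Γ' z t)) ∘L
        ((ContinuousLinearMap.inr ℝ P (ℝ × (Euc n × Euc n))) ∘L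
          (ContinuousLinearMap.inr ℝ ℝ (Euc n × Euc n)))) (Γ' z t) :=
      HasFDerivAt.comp (g := Xu) (f := fun z => (q, ((t : ℝ), z))) (Γ' z t)
        (SmoothNear.differentiableAt hk).hasFDerivAt
        ((hasFDerivAt_prodMk_right q _).comp (Γ' z t) (hasFDerivAt_prodMk_right (t : ℝ) _))
    rw [d1.fderiv]
    rfl
  set ev : ℝ → C(I, Euc n × Euc n) →L[ℝ] Euc n × Euc n := primitiveEval with hevdef
  have hev : ∀ t c, ev t c = ∫ s in (0 : ℝ)..t, c (projIcc 0 1 zero_le_one s) := fun _ _ => rfl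
  set S : Euc n × Euc n →L[ℝ] C(I, Euc n × Euc n) :=
    pointwiseApply A ∘L (graphCurveLin ∘L .inr ℝ P _) ∘L D with hS
  have hSapp : ∀ u (t : I), S u t = fderiv ℝ (X q t) (Γ' z t) (D u t) := fun u t => by
    rw [← hAapp]
    rfl
  have hDS : ∀ u, D u = ContinuousLinearMap.const ℝ I u + primitiveOp (S u) := fun u =>
    DFunLike.congr_fun hDeq u
  have hγS : Γ' z = ContinuousLinearMap.const ℝ I z +
      primitiveOp (nemytskii Xu (graphCurve (q, Γ' z))) := heq.self_of_nhds
  have hγ : ∀ t (ht : t ∈ Icc (0 : ℝ) 1), z + ev t (nemytskii Xu (graphCurve (q, Γ' z))) =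
      Γ' z ⟨t, ht⟩ := fun t ht => by
    conv_rhs => rw [hγS]
    rfl
  have hW : ∀ t (ht : t ∈ Icc (0 : ℝ) 1) u,
      (ContinuousLinearMap.id ℝ (Euc n × Euc n) + ev t ∘L S : Euc n × Euc n →L[ℝ] Euc n × Euc n) u =
        D u ⟨t, ht⟩ := fun t ht u => by
    rw [hDS]
    rfl
  -- The curves are written with integrals extended to real t, so that two-sided derivatives exist
  -- at t = 0 and t = 1 as well.
  refine ⟨fun t => z + ev t (nemytskii Xu (graphCurve (q, Γ' z))),
    fun t => .id ℝ _ + ev t ∘L S, ?_, ?_, ?_, ?_, fun t ht => ⟨?_, ?_, fun u => ?_⟩⟩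
  · simp [hev]
  · rw [hflow.self_of_nhds]
    exact hγ 1 ⟨zero_le_one, le_rfl⟩
  · refine ContinuousLinearMap.ext fun u => ?_
    simp [hev]
  · refine ContinuousLinearMap.ext fun u => ?_
    refine (hW 1 ⟨zero_le_one, le_rfl⟩ u).trans ?_
    set e1 : C(I, Euc n × Euc n) →L[ℝ] Euc n × Euc n := ContinuousMap.evalCLM ℝ (1 : I)
    have : HasFDerivAt (fun z => Γ' z 1) (e1 ∘L D) z :=
      HasFDerivAt.comp (g := e1) (f := Γ') z e1.hasFDerivAt hD
    rw [(this.congr_of_eventuallyEq hflow).fderiv]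
    rfl
  · beta_reduce
    rw [hγ t ht]
    exact (hU _ (h4.self_of_nhds _)).2
  · have d := (hasDerivAt_primitiveOp (nemytskii Xu (graphCurve (q, Γ' z))) ⟨t, ht⟩).const_add z
    rw [nemytskii_apply (fun k => (SmoothNear.continuousAt (hc k))), graphCurve_apply] at d
    beta_reduce
    rw [hγ t ht]
    exact d
  · have d := (hasDerivAt_primitiveOp (S u) ⟨t, ht⟩).const_add u
    rw [hSapp] at d
    beta_reduce
    rw [hγ t ht, hW t ht]
    exact d

/-- Moser's theorem: the time-one map of Moser's field pulls the given form back to the standard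
one. -/
theorem IsMoserForm.pullback_flowMap (h : IsMoserForm B p) (x : Euc n) :
    ∀ᶠ w in 𝓝 (p, (x, 0)), ∀ u v, B w.1 (flowMap (moserField (B w.1)) w.2)
      (fderiv ℝ (flowMap (moserField (B w.1))) w.2 u)
      (fderiv ℝ (flowMap (moserField (B w.1))) w.2 v) =
        w0 u v := by
  filter_upwards [h.isFlatField.exists_variation x (Q := fun q z => (∀ s ∈ Icc (0 : ℝ) 1, ∀ a b,
      B q z a b - w0 a b + s * fderiv ℝ (B q) z (moserField (B q) s z) a b +
        interpForm (B q) s z (fderiv ℝ (moserField (B q) s) z a) b +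
        interpForm (B q) s z a (fderiv ℝ (moserField (B q) s) z b) = 0) ∧
      SmoothNear (fun w : P × (Euc n × Euc n) => B w.1 w.2) (q, z)) ((h.infinitesimal x).and (h.smooth x).eventually)]
    with ⟨q, z⟩ ⟨γ, W, hγ0, hγ1, hW0, hW1, hd⟩ u v
  simp only at hγ0 hγ1 hW0 hW1 hd ⊢
  -- This quantity is constant along the flow: its t-derivative is the left side of `infinitesimal`.
  -- At t = 0 it is the standard form, at t = 1 the pullback of B.
  set y : ℝ → ℝ := fun t => interpForm (B q) t (γ t) (W t u) (W t v) with hy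
  have hder : ∀ t ∈ Icc (0 : ℝ) 1, HasDerivAt y 0 t := by
    intro t ht
    obtain ⟨⟨hinf, hs⟩, hγ, hW⟩ := hd t ht
    have hB : HasDerivAt (fun t => B q (γ t)) (fderiv ℝ (B q) (γ t) (moserField (B q) t (γ t))) t :=
      (SmoothNear.snd_of_prod (f := B) hs).differentiableAt.hasFDerivAt.comp_hasDerivAt t hγ
    have hΩ : HasDerivAt (fun t => interpForm (B q) t (γ t))
        (t • fderiv ℝ (B q) (γ t) (moserField (B q) t (γ t)) + (1 : ℝ) • (B q (γ t) - w0)) t :=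
      ((hasDerivAt_id t).smul (hB.sub_const w0)).const_add w0
    have e := (hΩ.clm_apply (hW u)).clm_apply (hW v)
    refine e.congr_deriv ?_
    have := hinf t ht (W t u) (W t v)
    simp only [_root_.add_apply, _root_.smul_apply, smul_eq_mul, _root_.sub_apply, one_mul]
    linarith
  have hconst := constant_of_has_deriv_right_zero (f := y) (a := 0) (b := 1)
    (fun t ht => (hder t ht).continuousAt.continuousWithinAt)
    (fun t ht => (hder t ⟨ht.1, ht.2.le⟩).hasDerivWithinAt) 1 ⟨zero_le_one, le_rfl⟩
  simpa [hy, interpForm, hγ0, hγ1, hW0, hW1] using hconst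

end FlowPullback

end

section

open MeasureTheory UnitAddTorus

/-! ### Summability over the integer lattice. -/

section Lattice

variable {n : ℕ}

theorem summable_norm_rpow_int (r : ℝ) (hr : r < -(n : ℝ)) :
    Summable fun k : Fin n → ℤ => ‖k‖ ^ r := by
  set L : Submodule ℤ (Fin n → ℝ) := Submodule.span ℤ (range (Pi.basisFun ℝ (Fin n))) with hL
  have hrank : Module.finrank ℤ L = n := by
    rw [ZLattice.rank ℝ L]
    simp
  have hmem : ∀ k : Fin n → ℤ, (fun i => (k i : ℝ)) ∈ L := fun k => by
    rw [hL, Module.Basis.mem_span_iff_repr_mem ℤ]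
    intro i
    exact ⟨k i, by simp⟩
  have hs := ZLattice.summable_norm_rpow L r (by rw [hrank]; exact hr)
  have hinj : Function.Injective fun k : Fin n → ℤ => (⟨_, hmem k⟩ : L) := fun k l hkl => by
    ext i
    have : (k i : ℝ) = l i := congrFun (congrArg Subtype.val hkl) i
    exact_mod_cast this
  refine (hs.comp_injective hinj).congr fun k => ?_
  have : ‖(fun i => (k i : ℝ) : Fin n → ℝ)‖ = ‖k‖ := by
    simp only [Pi.norm_def, nnnorm, Int.norm_eq_abs, Real.norm_eq_abs]
  simp [this]

end Lattice

/-! ### Averages of periodic functions over the unit cube. -/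

section CubeAverage

variable {n : ℕ} {F : Type} [NormedAddCommGroup F] [NormedSpace ℝ F]

/-- Periodicity under the integer lattice. -/
def IsPeriodic {Y : Type*} (g : Euc n → Y) : Prop := ∀ x k, g (x + lat k) = g x

/-- The unit cube in `Fin n → ℝ`. -/
abbrev PiCube (n : ℕ) : Type := Icc (0 : Fin n → ℝ) 1

/-- The unit cube as a family of points of `Euc n`. -/
def cubePoint : C(PiCube n, Euc n) :=
  ⟨fun y => WithLp.toLp 2 y.1, (PiLp.continuous_toLp 2 _).comp continuous_subtype_val⟩

/-- The Lebesgue measure of the unit cube. -/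
def cubeMeasure (n : ℕ) : Measure (PiCube n) := Measure.comap Subtype.val volume

instance : IsFiniteMeasure (cubeMeasure n) := by
  constructor
  rw [cubeMeasure, Measure.comap_apply _ Subtype.val_injective
    (fun s hs => measurableSet_Icc.subtype_image hs) _ MeasurableSet.univ]
  rw [image_univ, Subtype.range_coe]
  exact isCompact_Icc.measure_lt_top

/-- The average of a function over the unit cube. -/
def cubeAvg (f : Euc n → F) : F := ∫ y, f (cubePoint y) ∂cubeMeasure n

theorem cubeAvg_eq_setIntegral (f : Euc n → F) :
    cubeAvg f = ∫ y in Icc (0 : Fin n → ℝ) 1, f (WithLp.toLp 2 y) :=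
  integral_subtype_comap measurableSet_Icc fun y : Fin n → ℝ => f (WithLp.toLp 2 y)

theorem integrable_cubeAvg {f : Euc n → F} (hf : Continuous f) :
    Integrable (fun y => f (cubePoint y)) (cubeMeasure n) :=
  Continuous.integrable_of_hasCompactSupport (by fun_prop) (HasCompactSupport.of_compactSpace _)

theorem cubeAvg_sub {f g : Euc n → F} (hf : Continuous f) (hg : Continuous g) :
    cubeAvg (fun x => f x - g x) = cubeAvg f - cubeAvg g :=
  integral_sub (integrable_cubeAvg hf) (integrable_cubeAvg hg)

theorem cubeAvg_sum {ι : Type*} (s : Finset ι) {f : ι → Euc n → F}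
    (hf : ∀ i ∈ s, Continuous (f i)) :
    cubeAvg (fun x => ∑ i ∈ s, f i x) = ∑ i ∈ s, cubeAvg (f i) :=
  integral_finsetSum _ fun i hi => integrable_cubeAvg (hf i hi)

theorem cubeAvg_const_mul (c : ℂ) (f : Euc n → ℂ) :
    cubeAvg (fun x => c * f x) = c * cubeAvg f :=
  integral_const_mul _ _

theorem cubeAvg_smul (c : ℝ) (f : Euc n → F) :
    cubeAvg (fun x => c • f x) = c • cubeAvg f :=
  integral_smul _ _

theorem SmoothNear.cubeAvg {Y : Type} [NormedAddCommGroup Y] [NormedSpace ℝ Y]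
    {f : Y → Euc n → F} {y : Y}
    (h : ∀ x, SmoothNear (fun w : Y × Euc n => f w.1 w.2) (y, x)) :
    SmoothNear (fun y => KAMBirkhoff.cubeAvg (f y)) y := by
  have := SmoothNear.weightedIntegral (cubeMeasure n) 1 cubePoint fun k => h (cubePoint k)
  simpa [KAMBirkhoff.cubeAvg] using this

theorem fderiv_cubeAvg {Y : Type} [NormedAddCommGroup Y] [NormedSpace ℝ Y] {f : Y → Euc n → F}
    {y : Y} (h : ∀ x, SmoothNear (fun w : Y × Euc n => f w.1 w.2) (y, x)) (v : Y) :
    fderiv ℝ (fun y => cubeAvg (f y)) y v = cubeAvg fun x => fderiv ℝ (fun y => f y x) y v := by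
  have := fderiv_weightedIntegral (cubeMeasure n) 1 cubePoint (fun k => h (cubePoint k)) v
  simpa [cubeAvg] using this

/-- The normalized Haar measure on the circle. -/
local instance haarUnitAddCircle : MeasureSpace UnitAddCircle := ⟨AddCircle.haarAddCircle⟩

local instance isAddHaarMeasure_haarUnitAddCircle :
    Measure.IsAddHaarMeasure (volume : Measure UnitAddCircle) :=
  inferInstanceAs (Measure.IsAddHaarMeasure AddCircle.haarAddCircle)

/-- The closed cube differs from a fundamental domain by a null set, so the average is the
normalized Haar integral on the torus, with its translation and reflection invariance. -/
theorem cubeAvg_comp_torusProj (f : Torus n → F) :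
    cubeAvg (fun x => f (torusProj x)) = ∫ θ, f θ := by
  have h := UnitAddTorus.integral_preimage f (0 : Fin n → ℝ)
  rw [cubeAvg_eq_setIntegral]
  refine Eq.trans ?_ h.symm
  refine (setIntegral_congr_set ?_).symm
  have := Measure.univ_pi_Ioc_ae_eq_Icc (μ := fun _ : Fin n => (volume : Measure ℝ)) (f := 0) (g := 1)
  refine EventuallyEq.trans (Eq.eventuallyEq (funext fun x => ?_)) this
  change (∀ i, x i ∈ Ioc ((0 : Fin n → ℝ) i) ((0 : Fin n → ℝ) i + 1)) = (x ∈ univ.pi _)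
  simp only [mem_univ_pi]
  simp

theorem isOpenQuotientMap_torusProj : IsOpenQuotientMap (torusProj : Euc n → Torus n) := by
  have h1 : IsOpenQuotientMap (Pi.map fun (_ : Fin n) (x : ℝ) => (x : UnitAddCircle)) :=
    IsOpenQuotientMap.piMap fun _ => QuotientAddGroup.isOpenQuotientMap_mk
  exact h1.comp (EuclideanSpace.equiv (Fin n) ℝ).toHomeomorph.isOpenQuotientMap

theorem torusProj_eq_iff {x y : Euc n} : torusProj x = torusProj y ↔ ∃ k, y = x + lat k := by
  constructor
  · intro h
    have h' : ∀ i, ∃ k : ℤ, y i = x i + k := fun i => by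
      obtain ⟨k, hk⟩ := QuotientAddGroup.eq.1 (congrFun h i)
      refine ⟨k, ?_⟩
      simp only [zsmul_eq_mul, mul_one] at hk
      linarith
    choose k hk using h'
    exact ⟨k, by ext i; simpa using hk i⟩
  · rintro ⟨k, rfl⟩
    ext i
    simp [torusProj]

theorem torusProj_add (x y : Euc n) : torusProj (x + y) = torusProj x + torusProj y := by
  ext i
  simp [torusProj]

theorem torusProj_sub (x y : Euc n) : torusProj (x - y) = torusProj x - torusProj y := by
  ext i
  simp [torusProj]

theorem exists_torusProj_comp {Y : Type*} [TopologicalSpace Y] {g : Euc n → Y} (hg : Continuous g)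
    (hp : IsPeriodic g) : ∃ G : C(Torus n, Y), ∀ x, G (torusProj x) = g x := by
  have hq := (isOpenQuotientMap_torusProj (n := n)).isQuotientMap
  let π : C(Euc n, Torus n) := ⟨torusProj, hq.continuous⟩
  have hq' : Topology.IsQuotientMap π := hq
  have hfac : Function.FactorsThrough (⟨g, hg⟩ : C(Euc n, Y)) π := fun x y hxy => by
    obtain ⟨k, rfl⟩ := torusProj_eq_iff.1 hxy
    exact (hp x k).symm
  exact ⟨hq'.lift ⟨g, hg⟩ hfac, fun x => DFunLike.congr_fun (hq'.lift_comp ⟨g, hg⟩ hfac) x⟩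

theorem cubeAvg_add_right {f : Euc n → F} (hf : Continuous f) (hp : IsPeriodic f) (a : Euc n) :
    cubeAvg (fun x => f (x + a)) = cubeAvg f := by
  obtain ⟨G, hG⟩ := exists_torusProj_comp hf hp
  have e1 : (fun x => f (x + a)) = fun x => (fun θ => G (θ + torusProj a)) (torusProj x) := by
    ext x
    rw [← hG, torusProj_add]
  have e2 : f = fun x => G (torusProj x) := by
    ext x
    rw [hG]
  rw [e1, cubeAvg_comp_torusProj fun θ => G (θ + torusProj a), e2, cubeAvg_comp_torusProj]
  exact integral_add_right_eq_self _ _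

theorem cubeAvg_sub_left {f : Euc n → F} (hf : Continuous f) (hp : IsPeriodic f) (a : Euc n) :
    cubeAvg (fun x => f (a - x)) = cubeAvg f := by
  obtain ⟨G, hG⟩ := exists_torusProj_comp hf hp
  have e1 : (fun x => f (a - x)) = fun x => (fun θ => G (torusProj a - θ)) (torusProj x) := by
    ext x
    rw [← hG, torusProj_sub]
  have e2 : f = fun x => G (torusProj x) := by
    ext x
    rw [hG]
  rw [e1, cubeAvg_comp_torusProj fun θ => G (torusProj a - θ), e2, cubeAvg_comp_torusProj]
  have : (volume : Measure (Torus n)).IsNegInvariant :=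
    Measure.IsAddHaarMeasure.isNegInvariant_of_regular _
  exact integral_sub_left_eq_self _ _ _

/-- The average of x ↦ f (x + y) does not depend on y; differentiate under the integral at y = 0.
This takes the place of integration by parts. -/
theorem cubeAvg_fderiv_eq_zero [CompleteSpace F] {f : Euc n → F} (hf : ContDiff ℝ ∞ f)
    (hp : IsPeriodic f) (v : Euc n) : cubeAvg (fun x => fderiv ℝ f x v) = 0 := by
  have h1 := fderiv_cubeAvg (f := fun (y : Euc n) x => f (x + y)) (y := 0)
    (fun x => smoothNear_of_contDiff (by fun_prop) _) v
  have h2 : (fun y : Euc n => cubeAvg fun x => f (x + y)) = fun _ => cubeAvg f :=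
    funext fun y => cubeAvg_add_right hf.continuous hp y
  rw [h2, fderiv_fun_const] at h1
  rw [← show (0 : Euc n →L[ℝ] F) v = 0 from rfl]
  refine Eq.trans ?_ h1.symm
  congr 1
  ext x
  have := fderiv_comp_add_left (𝕜 := ℝ) (f := f) (x := 0) x
  rw [add_zero] at this
  rw [← this]

end CubeAverage

end

section

open MeasureTheory UnitAddTorus

/-! ### Fourier modes and powers of 1 - Δ / 4π². -/

section Fourier

variable {n : ℕ}

/-- The exponential monomials on `Euc n`. -/
def expMode (k : Fin n → ℤ) (x : Euc n) : ℂ :=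
  Complex.exp (2 * Real.pi * Complex.I * ∑ i, (k i : ℂ) * (x i : ℂ))

theorem mFourier_torusProj (k : Fin n → ℤ) (x : Euc n) :
    mFourier k (torusProj x) = expMode k x := by
  simp only [mFourier, ContinuousMap.coe_mk, torusProj, fourier_coe_apply, expMode,
    ← Complex.exp_sum]
  congr 1
  rw [Finset.mul_sum]
  refine Finset.sum_congr rfl fun i _ => ?_
  push_cast
  ring

theorem isPeriodic_expMode (k : Fin n → ℤ) : IsPeriodic (expMode k) := fun x l => by
  rw [← mFourier_torusProj, ← mFourier_torusProj, ← torusProj_eq_iff.2 ⟨l, rfl⟩]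

theorem expMode_add (k : Fin n → ℤ) (x y : Euc n) :
    expMode k (x + y) = expMode k x * expMode k y := by
  rw [expMode, expMode, expMode, ← Complex.exp_add, ← mul_add, ← Finset.sum_add_distrib]
  simp [mul_add]

theorem expMode_neg (k : Fin n → ℤ) (x : Euc n) : expMode k (-x) = expMode (-k) x := by
  simp [expMode]

theorem norm_expMode (k : Fin n → ℤ) (x : Euc n) : ‖expMode k x‖ = 1 := by
  have : (2 * Real.pi * Complex.I * ∑ i, (k i : ℂ) * (x i : ℂ)) =
      ((2 * Real.pi * ∑ i, (k i : ℝ) * x i : ℝ) : ℂ) * Complex.I := by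
    push_cast
    ring
  rw [expMode, this, Complex.norm_exp_ofReal_mul_I]

theorem contDiff_expMode (k : Fin n → ℤ) : ContDiff ℝ ∞ (expMode k) := by
  have : ContDiff ℝ ∞ fun x : Euc n => ∑ i, (k i : ℂ) * (x i : ℂ) := by
    refine ContDiff.sum fun i _ => contDiff_const.mul ?_
    exact Complex.ofRealCLM.contDiff.comp (by fun_prop)
  exact Complex.contDiff_exp.comp (contDiff_const.mul this)

theorem fderiv_expMode (k : Fin n → ℤ) (x : Euc n) (i : Fin n) :
    fderiv ℝ (expMode k) x (EuclideanSpace.single i 1) =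
      2 * Real.pi * Complex.I * k i * expMode k x := by
  have h1 : HasDerivAt (fun t : ℝ => expMode k (x + t • EuclideanSpace.single i 1))
      (fderiv ℝ (expMode k) x (EuclideanSpace.single i 1)) 0 :=
    (((contDiff_expMode k).differentiable (by simp)) x).hasFDerivAt.hasLineDerivAt _
  have h2 : (fun t : ℝ => expMode k (x + t • EuclideanSpace.single i 1)) = fun t : ℝ =>
      expMode k x * Complex.exp ((t : ℂ) * (2 * Real.pi * Complex.I * k i)) := by
    ext t
    rw [expMode_add]
    congr 1
    rw [expMode]
    congr 1
    rw [Finset.sum_eq_single i]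
    · simp
      ring
    · intro j _ hj
      simp [hj]
    · simp
  rw [h2] at h1
  have h3 : HasDerivAt (fun t : ℝ => expMode k x *
      Complex.exp ((t : ℂ) * (2 * Real.pi * Complex.I * k i)))
      (expMode k x * (Complex.exp (((0 : ℝ) : ℂ) * (2 * Real.pi * Complex.I * k i)) *
        (1 * (2 * Real.pi * Complex.I * k i)))) 0 :=
    (((Complex.ofRealCLM.hasDerivAt (x := (0 : ℝ))).mul_const _).cexp).const_mul _
  rw [h1.unique h3]
  simp
  ring

/-- The operator `1 - Δ / 4π²`. -/
def besselOp (g : Euc n → ℝ) (x : Euc n) : ℝ :=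
  g x - (4 * Real.pi ^ 2)⁻¹ * ∑ i, fderiv ℝ (fun y => fderiv ℝ g y (EuclideanSpace.single i 1)) x
    (EuclideanSpace.single i 1)

/-- The symbol of `1 - Δ / 4π²`. -/
def besselSymbol (k : Fin n → ℤ) : ℝ := 1 + ∑ i, (k i : ℝ) ^ 2

theorem IsPeriodic.fderiv_apply {F : Type*} [NormedAddCommGroup F] [NormedSpace ℝ F]
    {g : Euc n → F} (hp : IsPeriodic g) (v : Euc n) :
    IsPeriodic fun x => fderiv ℝ g x v := fun x k => by
  have : (fun y => g (y + lat k)) = g := funext fun y => hp y k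
  have h := fderiv_comp_add_right (𝕜 := ℝ) (f := g) (x := x) (lat k)
  rw [this] at h
  simp only [h]

theorem contDiff_fderiv_const {F : Type*} [NormedAddCommGroup F] [NormedSpace ℝ F]
    {g : Euc n → F} (hg : ContDiff ℝ ∞ g) (v : Euc n) : ContDiff ℝ ∞ fun x => fderiv ℝ g x v :=
  (hg.fderiv_right (by simp)).clm_apply contDiff_const

theorem contDiff_besselOp {g : Euc n → ℝ} (hg : ContDiff ℝ ∞ g) : ContDiff ℝ ∞ (besselOp g) :=
  hg.sub (contDiff_const.mul (ContDiff.sum fun _ _ =>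
    contDiff_fderiv_const (contDiff_fderiv_const hg _) _))

theorem IsPeriodic.besselOp {g : Euc n → ℝ} (hp : IsPeriodic g) :
    IsPeriodic (besselOp g) := fun x k => by
  simp only [KAMBirkhoff.besselOp, hp x k]
  congr 2
  exact Finset.sum_congr rfl fun i _ => ((hp.fderiv_apply _).fderiv_apply _) x k

theorem besselOp_smul (c : ℝ) {g : Euc n → ℝ} (hg : ContDiff ℝ ∞ g) :
    besselOp (fun x => c * g x) = fun x => c * besselOp g x := by
  have e : ∀ {g : Euc n → ℝ}, ContDiff ℝ ∞ g → ∀ v, (fun x => fderiv ℝ (fun x => c * g x) x v) =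
      fun x => c * fderiv ℝ g x v := fun {g} hg v => by
    ext x
    rw [fderiv_const_mul ((hg.differentiable (by simp)) x)]
    rfl
  ext x
  simp only [besselOp]
  rw [mul_sub]
  congr 1
  rw [mul_left_comm, Finset.mul_sum _ _ c]
  congr 1
  refine Finset.sum_congr rfl fun i _ => ?_
  rw [e hg (EuclideanSpace.single i 1)]
  exact congrFun (e (contDiff_fderiv_const hg _) _) x

/-- The derivative of the periodic product of h and the mode has average zero; this is integration
by parts. -/
theorem cubeAvg_expMode_mul_fderiv {h : Euc n → ℝ} (hh : ContDiff ℝ ∞ h) (hp : IsPeriodic h)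
    (k : Fin n → ℤ) (i : Fin n) :
    cubeAvg (fun x => expMode (-k) x * (fderiv ℝ h x (EuclideanSpace.single i 1) : ℝ)) =
      2 * Real.pi * Complex.I * k i * cubeAvg (fun x => expMode (-k) x * (h x : ℂ)) := by
  have hc : ContDiff ℝ ∞ fun x => ((h x : ℝ) : ℂ) := Complex.ofRealCLM.contDiff.comp hh
  have h0 := cubeAvg_fderiv_eq_zero ((contDiff_expMode (-k)).mul hc)
    (fun x l => by simp only [isPeriodic_expMode _ x l, hp x l]) (EuclideanSpace.single i 1)
  have h1 : ∀ x, fderiv ℝ (fun x => expMode (-k) x * (h x : ℂ)) x (EuclideanSpace.single i 1) =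
      expMode (-k) x * (fderiv ℝ h x (EuclideanSpace.single i 1) : ℝ) -
        (2 * Real.pi * Complex.I * k i) * (expMode (-k) x * (h x : ℂ)) := by
    intro x
    have d1 := (((contDiff_expMode (-k)).differentiable (by simp)) x).hasFDerivAt
    have d2 : HasFDerivAt (fun x => ((h x : ℝ) : ℂ)) (Complex.ofRealCLM ∘L fderiv ℝ h x) x :=
      HasFDerivAt.comp (g := Complex.ofRealCLM) (f := h) x Complex.ofRealCLM.hasFDerivAt
        ((hh.differentiable (by simp)) x).hasFDerivAt
    rw [(d1.fun_mul d2).fderiv]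
    simp only [_root_.add_apply, _root_.smul_apply, ContinuousLinearMap.comp_apply,
      fderiv_expMode, Complex.ofRealCLM_apply, smul_eq_mul]
    push_cast [Pi.neg_apply]
    ring
  simp only [h1] at h0
  rw [cubeAvg_sub, cubeAvg_const_mul, sub_eq_zero] at h0
  · exact h0
  · exact (contDiff_expMode _).continuous.mul
      (Complex.continuous_ofReal.comp (contDiff_fderiv_const hh _).continuous)
  · exact continuous_const.mul ((contDiff_expMode _).continuous.mul hc.continuous)

theorem cubeAvg_expMode_mul_besselOp {h : Euc n → ℝ} (hh : ContDiff ℝ ∞ h) (hp : IsPeriodic h)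
    (k : Fin n → ℤ) :
    cubeAvg (fun x => expMode (-k) x * (besselOp h x : ℂ)) =
      besselSymbol k * cubeAvg (fun x => expMode (-k) x * (h x : ℂ)) := by
  have key : ∀ i, cubeAvg (fun x => expMode (-k) x * ((fderiv ℝ (fun y => fderiv ℝ h y
      (EuclideanSpace.single i 1)) x (EuclideanSpace.single i 1) : ℝ) : ℂ)) =
      -(4 * Real.pi ^ 2) * (k i) ^ 2 * cubeAvg (fun x => expMode (-k) x * (h x : ℂ)) := by
    intro i
    rw [cubeAvg_expMode_mul_fderiv (contDiff_fderiv_const hh _) (hp.fderiv_apply _),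
      cubeAvg_expMode_mul_fderiv hh hp]
    linear_combination (4 * Real.pi ^ 2 * (k i) ^ 2 * cubeAvg (fun x => expMode (-k) x * (h x : ℂ)))
      * Complex.I_sq
  have e : (fun x => expMode (-k) x * (besselOp h x : ℂ)) = fun x =>
      expMode (-k) x * (h x : ℂ) - (4 * Real.pi ^ 2 : ℂ)⁻¹ * ∑ i, expMode (-k) x *
        ((fderiv ℝ (fun y => fderiv ℝ h y (EuclideanSpace.single i 1)) x
          (EuclideanSpace.single i 1) : ℝ) : ℂ) := by
    ext x
    rw [← Finset.mul_sum, besselOp]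
    push_cast
    ring
  have hcont : ∀ i, Continuous fun x => expMode (-k) x * ((fderiv ℝ (fun y => fderiv ℝ h y
      (EuclideanSpace.single i 1)) x (EuclideanSpace.single i 1) : ℝ) : ℂ) := fun i =>
    (contDiff_expMode _).continuous.mul (Complex.continuous_ofReal.comp
      (contDiff_fderiv_const (contDiff_fderiv_const hh _) _).continuous)
  rw [e, cubeAvg_sub, cubeAvg_const_mul, cubeAvg_sum _ fun i _ => hcont i]
  · simp only [key]
    have hpi : (Real.pi : ℂ) ≠ 0 := by exact_mod_cast Real.pi_ne_zero
    rw [← Finset.sum_mul, ← Finset.mul_sum, besselSymbol]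
    push_cast
    field_simp
    ring
  · exact (contDiff_expMode _).continuous.mul (Complex.continuous_ofReal.comp hh.continuous)
  · exact continuous_const.mul (continuous_finsetSum _ fun i _ => hcont i)

theorem contDiff_besselOp_iterate {g : Euc n → ℝ} (hg : ContDiff ℝ ∞ g) (N : ℕ) :
    ContDiff ℝ ∞ (besselOp^[N] g) := by
  induction N with
  | zero => exact hg
  | succ N ih =>
    rw [Function.iterate_succ_apply']
    exact contDiff_besselOp ih

theorem IsPeriodic.besselOp_iterate {g : Euc n → ℝ} (hg : IsPeriodic g) (N : ℕ) :
    IsPeriodic (KAMBirkhoff.besselOp^[N] g) := by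
  induction N with
  | zero => exact hg
  | succ N ih =>
    rw [Function.iterate_succ_apply']
    exact ih.besselOp

theorem besselOp_iterate_smul (c : ℝ) {g : Euc n → ℝ} (hg : ContDiff ℝ ∞ g) (N : ℕ) :
    besselOp^[N] (fun x => c * g x) = fun x => c * besselOp^[N] g x := by
  induction N with
  | zero => rfl
  | succ N ih =>
    rw [Function.iterate_succ_apply', ih, Function.iterate_succ_apply',
      besselOp_smul c (contDiff_besselOp_iterate hg N)]

theorem cubeAvg_expMode_mul_besselOp_iterate {h : Euc n → ℝ} (hh : ContDiff ℝ ∞ h)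
    (hp : IsPeriodic h) (k : Fin n → ℤ) (N : ℕ) :
    cubeAvg (fun x => expMode (-k) x * (besselOp^[N] h x : ℂ)) =
      (besselSymbol k : ℂ) ^ N * cubeAvg (fun x => expMode (-k) x * (h x : ℂ)) := by
  induction N with
  | zero => simp
  | succ N ih =>
    simp only [Function.iterate_succ_apply']
    rw [cubeAvg_expMode_mul_besselOp (contDiff_besselOp_iterate hh N) (hp.besselOp_iterate N), ih,
      pow_succ]
    ring

theorem smoothNear_besselOp {P : Type} [NormedAddCommGroup P] [NormedSpace ℝ P]
    {g : P → Euc n → ℝ} {p : P} (h : ∀ x, SmoothNear (fun w : P × Euc n => g w.1 w.2) (p, x))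
    (x : Euc n) : SmoothNear (fun w : P × Euc n => besselOp (g w.1) w.2) (p, x) := by
  refine (h x).sub ((smoothNear_const _ _).smul ?_)
  have : ∀ s : Finset (Fin n), SmoothNear (fun w : P × Euc n => ∑ i ∈ s,
      fderiv ℝ (fun y => fderiv ℝ (g w.1) y (EuclideanSpace.single i 1)) w.2
        (EuclideanSpace.single i 1)) (p, x) := by
    intro s
    induction s using Finset.induction_on with
    | empty => simpa using smoothNear_const _ _
    | insert i s hi ih =>
      simp only [Finset.sum_insert hi]
      refine SmoothNear.add ?_ ih
      have h1 := (SmoothNear.partial_snd (h x)).clm_apply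
        (smoothNear_const (EuclideanSpace.single i (1 : ℝ)) _)
      exact (SmoothNear.partial_snd (f := fun q y => fderiv ℝ (g q) y (EuclideanSpace.single i 1))
        h1).clm_apply (smoothNear_const _ _)
  exact this _

theorem smoothNear_besselOp_iterate {P : Type} [NormedAddCommGroup P] [NormedSpace ℝ P]
    {g : P → Euc n → ℝ} {p : P} (h : ∀ x, SmoothNear (fun w : P × Euc n => g w.1 w.2) (p, x))
    (N : ℕ) (x : Euc n) :
    SmoothNear (fun w : P × Euc n => besselOp^[N] (g w.1) w.2) (p, x) := by
  induction N generalizing x with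
  | zero => exact h x
  | succ N ih =>
    simp only [Function.iterate_succ_apply']
    exact smoothNear_besselOp (g := fun q => besselOp^[N] (g q)) ih x

end Fourier

end

section

open MeasureTheory UnitAddTorus

/-! ### The cohomological equation over a Diophantine rotation. -/

section Cohomological

variable {n : ℕ}

attribute [local instance] haarUnitAddCircle isAddHaarMeasure_haarUnitAddCircle

theorem one_le_norm_int {k : Fin n → ℤ} (hk : k ≠ 0) : 1 ≤ ‖k‖ := by
  obtain ⟨i, hi⟩ := Function.ne_iff.1 hk
  refine le_trans ?_ (norm_le_pi_norm k i)
  rw [Int.norm_eq_abs]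
  exact_mod_cast Int.one_le_abs hi

theorem norm_sq_le_besselSymbol (k : Fin n → ℤ) : ‖k‖ ^ 2 ≤ besselSymbol k := by
  have h1 : ∀ i, ‖k i‖ ≤ √(besselSymbol k) := fun i => by
    rw [Int.norm_eq_abs]
    refine Real.abs_le_sqrt ?_
    have := Finset.single_le_sum (f := fun i => (k i : ℝ) ^ 2) (fun i _ => sq_nonneg _)
      (Finset.mem_univ i)
    rw [besselSymbol]
    linarith
  have h2 := (pi_norm_le_iff_of_nonneg (Real.sqrt_nonneg _)).2 h1
  have h3 : 0 ≤ besselSymbol k := by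
    rw [besselSymbol]
    positivity
  calc ‖k‖ ^ 2 ≤ √(besselSymbol k) ^ 2 := by gcongr
    _ = besselSymbol k := Real.sq_sqrt h3

theorem one_le_besselSymbol (k : Fin n → ℤ) : 1 ≤ besselSymbol k := by
  have : 0 ≤ ∑ i, (k i : ℝ) ^ 2 := by positivity
  rw [besselSymbol]
  linarith

theorem norm_one_sub_expMode_le (k : Fin n → ℤ) (x : Euc n) : ‖1 - expMode k x‖ ≤ 2 := by
  refine (norm_sub_le _ _).trans ?_
  rw [norm_one, norm_expMode]
  norm_num

/-- With l the integer nearest to t = ⟨k, α⟩, the left norm is 2 |sin π(t - l)|. As |t - l| ≤ 1/2,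
Jordan's inequality bounds this below by 4 |t - l|. -/
theorem le_norm_one_sub_expMode {α : Euc n} {c : ℝ} {k : Fin n → ℤ}
    (h : ∀ l : ℤ, c < |(l : ℝ) + ∑ i, (k i : ℝ) * α i|) : 4 * c ≤ ‖1 - expMode k α‖ := by
  set t := ∑ i, (k i : ℝ) * α i with ht
  set l := round t with hl
  have e1 : expMode k α = Complex.exp (Complex.I * ((2 * Real.pi * (t - l) : ℝ) : ℂ)) := by
    have : (2 * Real.pi * Complex.I * ∑ i, (k i : ℂ) * (α i : ℂ)) =
        Complex.I * ((2 * Real.pi * (t - l) : ℝ) : ℂ) + l * (2 * Real.pi * Complex.I) := by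
      rw [ht]
      push_cast
      ring
    rw [expMode, this, Complex.exp_add, Complex.exp_int_mul_two_pi_mul_I, mul_one]
  have h1 := h (-l)
  have h2 : |t - l| ≤ 1 / 2 := abs_sub_round t
  rw [e1, norm_sub_rev, Complex.norm_exp_I_mul_ofReal_sub_one, norm_mul, Real.norm_eq_abs,
    Real.norm_eq_abs, abs_two]
  have h3 : |2 * Real.pi * (t - l) / 2| ≤ Real.pi / 2 := by
    rw [show 2 * Real.pi * (t - l) / 2 = Real.pi * (t - l) by ring, abs_mul,
      abs_of_pos Real.pi_pos]
    nlinarith [Real.pi_pos]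
  have h4 := Real.mul_abs_le_abs_sin h3
  rw [show 2 * Real.pi * (t - l) / 2 = Real.pi * (t - l) by ring] at h4 ⊢
  rw [abs_mul Real.pi, abs_of_pos Real.pi_pos, ← mul_assoc, div_mul_cancel₀ _ Real.pi_ne_zero] at h4
  push_cast at h1
  rw [neg_add_eq_sub] at h1
  linarith

/-- The Fourier coefficients of the kernel solving the cohomological equation for functions of the
form `(1 - Δ / 4π²) ^ N g`. -/
def kernelCoeff (α : Euc n) (N : ℕ) (k : Fin n → ℤ) : ℂ :=
  ((1 - expMode (-k) α) * (besselSymbol k : ℂ) ^ N)⁻¹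

/-- The divisors are at least 4γ‖k‖^(-n-τ), and N powers of the symbol contribute ‖k‖^(2N). For N
large the quotient is O(‖k‖^(-n-1)), which is summable over the lattice. -/
theorem IsDiophantine.exists_summable_kernelCoeff {α : Euc n} (h : IsDiophantine α) :
    ∃ N, (Summable fun k => ‖kernelCoeff α N k‖) ∧ ∀ k, k ≠ 0 → 1 - expMode (-k) α ≠ 0 := by
  obtain ⟨γ, τ, hγ, hτ, hd⟩ := h
  have hsd : ∀ k : Fin n → ℤ, k ≠ 0 → 4 * (γ * ‖k‖ ^ (-(n : ℝ) - τ)) ≤ ‖1 - expMode (-k) α‖ := by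
    intro k hk
    refine le_norm_one_sub_expMode fun l => ?_
    have := hd (-k) (neg_ne_zero.2 hk) l
    rwa [norm_neg] at this
  -- Only 2 N ≥ 2 n + τ + 1 is needed.
  obtain ⟨N, hN⟩ := exists_nat_ge (2 * n + τ + 1)
  refine ⟨N, ?_, fun k hk h0 => ?_⟩
  · have hs := (summable_norm_rpow_int (n := n) (-(n + 1 : ℝ)) (by linarith)).mul_left (4 * γ)⁻¹
    refine Summable.of_norm_bounded hs fun k => ?_
    rw [norm_norm]
    by_cases hk : k = 0
    · subst hk
      -- For k = 0 the divisor vanishes and its inverse is 0 by convention, so the kernel has no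
      -- constant mode.
      have : kernelCoeff α N 0 = 0 := by simp [kernelCoeff, expMode]
      rw [this, norm_zero]
      positivity
    · have hk1 := one_le_norm_int hk
      have hk0 : 0 < ‖k‖ := by linarith
      have h1 := hsd k hk
      have h2 : ‖k‖ ^ ((2 * N : ℕ) : ℝ) ≤ besselSymbol k ^ N := by
        rw [Real.rpow_natCast, pow_mul]
        exact pow_le_pow_left₀ (by positivity) (norm_sq_le_besselSymbol k) N
      have h3 : 0 < besselSymbol k := by linarith [one_le_besselSymbol k]
      rw [kernelCoeff, norm_inv, norm_mul, norm_pow, Complex.norm_real, Real.norm_eq_abs,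
        abs_of_pos h3]
      have h4 : 4 * γ * ‖k‖ ^ (n + 1 : ℝ) ≤ ‖1 - expMode (-k) α‖ * besselSymbol k ^ N := by
        calc 4 * γ * ‖k‖ ^ (n + 1 : ℝ)
            ≤ 4 * γ * ‖k‖ ^ (-(n : ℝ) - τ + ((2 * N : ℕ) : ℝ)) := by
              refine mul_le_mul_of_nonneg_left (Real.rpow_le_rpow_of_exponent_le hk1 ?_)
                (by positivity)
              push_cast
              linarith
          _ = 4 * (γ * ‖k‖ ^ (-(n : ℝ) - τ)) * ‖k‖ ^ ((2 * N : ℕ) : ℝ) := by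
              rw [Real.rpow_add hk0]
              ring
          _ ≤ _ := by gcongr
      rw [Real.rpow_neg hk0.le, ← mul_inv]
      exact inv_anti₀ (by positivity) h4
  · have h1 := hsd k hk
    have hk1 := one_le_norm_int hk
    have hk0 : 0 < ‖k‖ := by linarith
    rw [h0, norm_zero] at h1
    have : 0 < ‖k‖ ^ (-(n : ℝ) - τ) := by positivity
    nlinarith

/-- The kernel solving the cohomological equation. -/
def kernelFun (α : Euc n) (N : ℕ) (x : Euc n) : ℂ := ∑' k, kernelCoeff α N k * expMode k x

theorem continuous_kernelFun {α : Euc n} {N : ℕ} (h : Summable fun k => ‖kernelCoeff α N k‖) :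
    Continuous (kernelFun α N) :=
  continuous_tsum (fun k => continuous_const.mul (contDiff_expMode k).continuous) h fun k x => by
    rw [norm_mul, norm_expMode, mul_one]

/-- The solution of the cohomological equation. -/
def cohom (α : Euc n) (N : ℕ) (g : Euc n → ℝ) (x : Euc n) : ℝ :=
  ∫ y, (ContinuousMap.mkD (fun y : PiCube n => (kernelFun α N (cubePoint y)).re) 0) y •
    besselOp^[N] g (x - cubePoint y) ∂cubeMeasure n

/-- The solution is the convolution of a fixed continuous kernel with `besselOp^[N] g`. The loss of
derivatives from the small divisors sits entirely in that differential operator, so smoothness in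
the point and in the parameter is differentiation under the integral. -/
theorem smoothNear_cohom {P : Type} [NormedAddCommGroup P] [NormedSpace ℝ P] (α : Euc n) (N : ℕ)
    {g : P → Euc n → ℝ} {p : P} (h : ∀ x, SmoothNear (fun w : P × Euc n => g w.1 w.2) (p, x))
    (x : Euc n) : SmoothNear (fun w : P × Euc n => cohom α N (g w.1) w.2) (p, x) := by
  refine SmoothNear.weightedIntegral (cubeMeasure n) _ cubePoint
    (f := fun (w : P × Euc n) y => besselOp^[N] (g w.1) (w.2 - y)) fun k => ?_
  exact SmoothNear.comp (g := fun w : P × Euc n => besselOp^[N] (g w.1) w.2)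
    (f := fun w : (P × Euc n) × Euc n => (w.1.1, w.1.2 - w.2))
    (smoothNear_besselOp_iterate h N _) (smoothNear_of_contDiff (by fun_prop) _)

theorem isPeriodic_cohom (α : Euc n) (N : ℕ) {g : Euc n → ℝ} (hg : IsPeriodic g) :
    IsPeriodic (cohom α N g) := fun x k => by
  simp only [cohom, add_sub_right_comm x (lat k), (hg.besselOp_iterate N) _ k]

theorem cohom_smul (α : Euc n) (N : ℕ) (c : ℝ) {g : Euc n → ℝ} (hg : ContDiff ℝ ∞ g) (x : Euc n) :
    cohom α N (fun x => c * g x) x = c * cohom α N g x := by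
  simp only [cohom, besselOp_iterate_smul c hg, smul_eq_mul]
  rw [← integral_const_mul]
  congr 1
  ext y
  ring

theorem cohom_eq_re {α : Euc n} {N : ℕ} (h : Summable fun k => ‖kernelCoeff α N k‖)
    {g : Euc n → ℝ} (hg : ContDiff ℝ ∞ g) (x : Euc n) :
    cohom α N g x = (cubeAvg fun y => kernelFun α N y * (besselOp^[N] g (x - y) : ℂ)).re := by
  have hc : Continuous fun y : PiCube n => (kernelFun α N (cubePoint y)).re :=
    Complex.continuous_re.comp ((continuous_kernelFun h).comp cubePoint.continuous)
  rw [cohom, ContinuousMap.mkD_of_continuous hc, cubeAvg]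
  have hint : Integrable (fun y => kernelFun α N (cubePoint y) *
      (besselOp^[N] g (x - cubePoint y) : ℂ)) (cubeMeasure n) :=
    integrable_cubeAvg (f := fun y => kernelFun α N y * (besselOp^[N] g (x - y) : ℂ))
      ((continuous_kernelFun h).mul (Complex.continuous_ofReal.comp
        ((contDiff_besselOp_iterate hg N).continuous.comp (by fun_prop))))
  have := Complex.reCLM.integral_comp_comm hint
  rw [← Complex.reCLM_apply, ← this]
  congr 1
  ext y
  simp

/-- Absolute summability of the kernel coefficients justifies integrating the kernel series
termwise. Reflecting the variable then turns each term into a Fourier coefficient of g. -/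
theorem hasSum_cubeAvg_kernelFun {α : Euc n} {N : ℕ} (h : Summable fun k => ‖kernelCoeff α N k‖)
    {g : Euc n → ℝ} (hg : ContDiff ℝ ∞ g) (hp : IsPeriodic g) (x : Euc n) :
    HasSum (fun k => kernelCoeff α N k * ((besselSymbol k : ℂ) ^ N *
      cubeAvg (fun y => expMode (-k) y * (g y : ℂ))) * expMode k x)
      (cubeAvg fun y => kernelFun α N y * (besselOp^[N] g (x - y) : ℂ)) := by
  set G := besselOp^[N] g with hG
  have hGc : Continuous G := (contDiff_besselOp_iterate hg N).continuous
  have hcont : ∀ k, Continuous fun y => kernelCoeff α N k * expMode k y * (G (x - y) : ℂ) :=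
    fun k => (continuous_const.mul (contDiff_expMode k).continuous).mul
      (Complex.continuous_ofReal.comp (hGc.comp (by fun_prop)))
  have hGx : Continuous fun y => ‖G (x - y)‖ := (hGc.comp (by fun_prop)).norm
  have hsum := hasSum_integral_of_summable_integral_norm
    (F := fun k (y : PiCube n) => kernelCoeff α N k * expMode k (cubePoint y) *
      (G (x - cubePoint y) : ℂ)) (μ := cubeMeasure n) (fun k => integrable_cubeAvg (hcont k)) (by
      have : ∀ k, ∫ y, ‖kernelCoeff α N k * expMode k (cubePoint y) *
          (G (x - cubePoint y) : ℂ)‖ ∂cubeMeasure n =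
          ‖kernelCoeff α N k‖ * ∫ y, ‖G (x - cubePoint y)‖ ∂cubeMeasure n := fun k => by
        rw [← integral_const_mul]
        congr 1
        ext y
        rw [norm_mul, norm_mul, norm_expMode, mul_one, Complex.norm_real]
      simp only [this]
      exact h.mul_right _)
  have e1 : (∫ y, ∑' k, kernelCoeff α N k * expMode k (cubePoint y) *
      (G (x - cubePoint y) : ℂ) ∂cubeMeasure n) =
      cubeAvg fun y => kernelFun α N y * (G (x - y) : ℂ) := by
    rw [cubeAvg]
    congr 1
    ext y
    rw [tsum_mul_right, kernelFun]
  rw [e1] at hsum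
  refine hsum.congr_fun fun k => ?_
  rw [← cubeAvg_expMode_mul_besselOp_iterate hg hp k N, ← hG]
  have e2 : (fun y => kernelCoeff α N k * expMode k y * (G (x - y) : ℂ)) = fun y =>
      (fun z => kernelCoeff α N k * expMode k x * (expMode (-k) z * (G z : ℂ))) (x - y) := by
    ext y
    have : expMode k y = expMode k x * expMode (-k) (x - y) := by
      rw [← expMode_neg, ← expMode_add]
      congr 1
      abel
    simp only [this]
    ring
  have e3 : (∫ y, kernelCoeff α N k * expMode k (cubePoint y) *
      (G (x - cubePoint y) : ℂ) ∂cubeMeasure n) =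
      cubeAvg fun y => kernelCoeff α N k * expMode k y * (G (x - y) : ℂ) := rfl
  rw [e3, e2, cubeAvg_sub_left (f := fun z => kernelCoeff α N k * expMode k x *
    (expMode (-k) z * (G z : ℂ))), cubeAvg_const_mul]
  · ring
  · exact continuous_const.mul ((contDiff_expMode _).continuous.mul
      (Complex.continuous_ofReal.comp hGc))
  · intro y l
    simp only [isPeriodic_expMode _ y l, hG, (hp.besselOp_iterate N) y l]

theorem hasSum_expMode {g : Euc n → ℝ} (hg : ContDiff ℝ ∞ g) (hp : IsPeriodic g)
    (hs : Summable fun k => cubeAvg fun y => expMode (-k) y * (g y : ℂ)) (x : Euc n) :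
    HasSum (fun k => cubeAvg (fun y => expMode (-k) y * (g y : ℂ)) * expMode k x) (g x : ℂ) := by
  obtain ⟨G, hG⟩ := exists_torusProj_comp (g := fun x => (g x : ℂ))
    (Complex.continuous_ofReal.comp hg.continuous) fun x k => by simp only [hp x k]
  have hcoef : ∀ k, mFourierCoeff G k = cubeAvg fun y => expMode (-k) y * (g y : ℂ) := by
    intro k
    have := cubeAvg_comp_torusProj (n := n) fun θ => mFourier (-k) θ • G θ
    simp only [mFourier_torusProj, hG, smul_eq_mul] at this
    exact this.symm
  have h1 : Summable (mFourierCoeff G) := by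
    refine hs.congr fun k => (hcoef k).symm
  have h2 := hasSum_mFourier_series_apply_of_summable h1 (torusProj x)
  simpa only [hcoef, mFourier_torusProj, hG, smul_eq_mul] using h2

/-- Compare Fourier series. For k ≠ 0 the symbol and the divisor cancel and leave the coefficient of
g; for k = 0 the left side contributes nothing, which accounts for the average. The same
cancellation bounds the coefficients of g by the kernel coefficients, so the Fourier series of g
converges to g pointwise. -/
theorem cohom_sub {α : Euc n} {N : ℕ} (h : Summable fun k => ‖kernelCoeff α N k‖)
    (hα : ∀ k, k ≠ 0 → 1 - expMode (-k) α ≠ 0)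
    {g : Euc n → ℝ} (hg : ContDiff ℝ ∞ g) (hp : IsPeriodic g) (x : Euc n) :
    cohom α N g x - cohom α N g (x - α) = g x - cubeAvg g := by
  have hbound : ∃ C, ∀ k, ‖(besselSymbol k : ℂ) ^ N *
      cubeAvg (fun y => expMode (-k) y * (g y : ℂ))‖ ≤ C := by
    -- These products are the Fourier coefficients of `besselOp^[N] g`, so its L¹ norm bounds them
    -- all.
    refine ⟨∫ y, ‖besselOp^[N] g (cubePoint y)‖ ∂cubeMeasure n, fun k => ?_⟩
    rw [← cubeAvg_expMode_mul_besselOp_iterate hg hp k N]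
    refine (norm_integral_le_integral_norm _).trans_eq ?_
    congr 1
    ext y
    rw [norm_mul, norm_expMode, one_mul, Complex.norm_real]
  obtain ⟨C, hC⟩ := hbound
  have hne : ∀ k : Fin n → ℤ, (besselSymbol k : ℂ) ^ N ≠ 0 := fun k => by
    refine pow_ne_zero _ ?_
    have := one_le_besselSymbol k
    exact_mod_cast (by linarith : besselSymbol k ≠ 0)
  have hcoef : ∀ k, k ≠ 0 → kernelCoeff α N k * ((besselSymbol k : ℂ) ^ N *
      cubeAvg (fun y => expMode (-k) y * (g y : ℂ))) * (1 - expMode (-k) α) =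
      cubeAvg (fun y => expMode (-k) y * (g y : ℂ)) := fun k hk => by
    have h1 := hα k hk
    have h2 := hne k
    rw [kernelCoeff]
    field_simp
  have hs : Summable fun k => cubeAvg fun y => expMode (-k) y * (g y : ℂ) := by
    refine Summable.of_norm_bounded_eventually (h.mul_right (C * 2)) ?_
    have hfin : ({0} : Set (Fin n → ℤ)).Finite := finite_singleton 0
    filter_upwards [hfin.compl_mem_cofinite] with k hk
    rw [← hcoef k hk, norm_mul, norm_mul, mul_assoc]
    gcongr
    · exact (norm_nonneg _).trans (hC k)
    · exact hC k
    · exact norm_one_sub_expMode_le _ _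
  have h1 := (hasSum_cubeAvg_kernelFun h hg hp x).sub (hasSum_cubeAvg_kernelFun h hg hp (x - α))
  have h2 := (hasSum_expMode hg hp hs x).sub (hasSum_ite_eq (0 : Fin n → ℤ)
    (cubeAvg fun y => expMode (-0) y * (g y : ℂ)))
  have h3 := h1.unique (h2.congr_fun fun k => ?_)
  · rw [cohom_eq_re h hg, cohom_eq_re h hg, ← Complex.sub_re, h3]
    have e : (cubeAvg fun y => expMode (-0) y * (g y : ℂ)) = ((cubeAvg g : ℝ) : ℂ) := by
      have := Complex.ofRealCLM.integral_comp_comm (integrable_cubeAvg hg.continuous)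
      rw [cubeAvg, cubeAvg, ← Complex.ofRealCLM_apply, ← this]
      congr 1
      ext y
      simp [expMode]
    rw [e, Complex.sub_re, Complex.ofReal_re, Complex.ofReal_re]
  · have hx : expMode k (x - α) = expMode k x * expMode (-k) α := by
      rw [sub_eq_add_neg, expMode_add, expMode_neg]
    by_cases hk : k = 0
    · subst hk
      simp [expMode]
    · rw [if_neg hk, hx]
      linear_combination expMode k x * hcoef k hk

end Cohomological

end

/-! ### Uniform tubes over compact sets of representatives. -/

section Tube

/-- Tube lemma over a compact set of representatives. -/
theorem exists_uniform_tube_of_isCompact {T Y W : Type*} [TopologicalSpace T] [TopologicalSpace Y]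
    [NormedAddCommGroup W] {p : T} {K : Set Y} (hK : IsCompact K) {G : T → Y → W → Prop}
    (hrep : ∀ y, ∃ y' ∈ K, ∀ q w, G q y' w → G q y w)
    (h : ∀ y ∈ K, ∀ᶠ w : T × (Y × W) in 𝓝 (p, (y, 0)), G w.1 w.2.1 w.2.2) :
    ∃ ε > 0, ∀ᶠ q in 𝓝 p, ∀ y w, ‖w‖ < ε → G q y w := by
  have key : ∀ y ∈ K, ∀ᶠ q : (T × W) × Y in 𝓝 ((p, 0), y), G q.1.1 q.2 q.1.2 := by
    intro y hy
    have ht : Tendsto (fun q : (T × W) × Y => (q.1.1, (q.2, q.1.2))) (𝓝 ((p, 0), y))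
        (𝓝 (p, (y, 0))) := by
      have : Continuous (fun q : (T × W) × Y => (q.1.1, (q.2, q.1.2))) := by fun_prop
      exact this.tendsto _
    exact ht.eventually (h y hy)
  have key2 := hK.eventually_forall_of_forall_eventually (P := fun (q : T × W) y => G q.1 y q.2) key
  rw [nhds_prod_eq] at key2
  obtain ⟨pa, ha, pb, hb, hab⟩ := eventually_prod_iff.1 key2
  obtain ⟨ε, hε, hball⟩ := Metric.eventually_nhds_iff.1 hb
  refine ⟨ε, hε, ha.mono fun q hq y w hw => ?_⟩
  obtain ⟨y', hy', hG⟩ := hrep y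
  exact hG q w (hab hq (hball (by simpa using hw)) y' hy')

end Tube

/-! ### Alternating 2-forms as bilinear maps. -/

section AltBilin

variable {X Y : Type*} [NormedAddCommGroup X] [NormedSpace ℝ X] [NormedAddCommGroup Y]
  [NormedSpace ℝ Y]

theorem update_zero_pair (u v x : Y) : Function.update ![u, v] 0 x = ![x, v] := by
  ext i; fin_cases i <;> rfl

theorem update_one_pair (u v x : Y) : Function.update ![u, v] 1 x = ![u, x] := by
  ext i; fin_cases i <;> rfl

/-- An alternating 2-form as a continuous bilinear map. -/
def altBilin (η : Y [⋀^Fin 2]→L[ℝ] ℝ) : Y →L[ℝ] Y →L[ℝ] ℝ :=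
  LinearMap.mkContinuous₂ (LinearMap.mk₂ ℝ (fun u v => η ![u, v])
    (fun u u' v => by
      have h := η.map_update_add ![u, v] 0 u u'
      rwa [update_zero_pair, update_zero_pair, update_zero_pair] at h)
    (fun c u v => by
      have h := η.map_update_smul ![u, v] 0 c u
      rwa [update_zero_pair, update_zero_pair] at h)
    (fun u v v' => by
      have h := η.map_update_add ![u, v] 1 v v'
      rwa [update_one_pair, update_one_pair, update_one_pair] at h)
    (fun c u v => by
      have h := η.map_update_smul ![u, v] 1 c v
      rwa [update_one_pair, update_one_pair] at h)) ‖η‖ fun u v => by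
      simpa [Fin.prod_univ_two, mul_assoc] using η.le_opNorm ![u, v]

@[simp] theorem altBilin_apply (η : Y [⋀^Fin 2]→L[ℝ] ℝ) (u v : Y) :
    altBilin η u v = η ![u, v] := rfl

theorem altBilin_antisymm (η : Y [⋀^Fin 2]→L[ℝ] ℝ) (u v : Y) :
    altBilin η u v = - altBilin η v u := by
  have h : η (![v, u] ∘ Equiv.swap 0 1) = - η ![v, u] :=
    η.toAlternatingMap.map_swap ![v, u] (show (0 : Fin 2) ≠ 1 by decide)
  have e : ![v, u] ∘ Equiv.swap (0 : Fin 2) 1 = ![u, v] := by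
    ext i; fin_cases i <;> simp
  rw [altBilin_apply, altBilin_apply, ← h, e]

theorem SmoothNear.altBilin [FiniteDimensional ℝ Y] {η : X → Y [⋀^Fin 2]→L[ℝ] ℝ} {x : X}
    (h : SmoothNear η x) : SmoothNear (fun x => KAMBirkhoff.altBilin (η x)) x := by
  refine smoothNear_clm_apply_iff.2 fun u => smoothNear_clm_apply_iff.2 fun v => ?_
  have h1 : SmoothNear (fun x => (η x).toContinuousMultilinearMap) x :=
    h.contDiff_comp (g := ContinuousAlternatingMap.toContinuousMultilinearMapCLM ℝ)
      (ContinuousLinearMap.contDiff _)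
  exact h1.contDiff_comp (g := ContinuousMultilinearMap.apply ℝ (fun _ : Fin 2 => Y) ℝ ![u, v])
    (ContinuousLinearMap.contDiff _)

/-- Expand the exterior derivative on three vectors. The cyclic form of closedness is the one that
the Poincaré lemma and Moser's argument use. -/
theorem cyclic_fderiv_altBilin {η : Y → Y [⋀^Fin 2]→L[ℝ] ℝ} {y : Y}
    (hs : DifferentiableAt ℝ η y) (hb : DifferentiableAt ℝ (fun y => altBilin (η y)) y)
    (h : extDeriv η y = 0) (a b c : Y) :
    fderiv ℝ (fun y => altBilin (η y)) y a b c + fderiv ℝ (fun y => altBilin (η y)) y b c a +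
      fderiv ℝ (fun y => altBilin (η y)) y c a b = 0 := by
  have h1 := extDeriv_apply hs ![a, b, c]
  rw [h, Fin.sum_univ_three] at h1
  have key : ∀ u v w, fderiv ℝ (fun y => altBilin (η y)) y w u v =
      fderiv ℝ (fun y => η y ![u, v]) y w := fun u v w => by
    have d := (hb.hasFDerivAt.clm_apply (hasFDerivAt_const u y)).clm_apply (hasFDerivAt_const v y)
    simp only [altBilin_apply] at d
    rw [d.fderiv]
    simp
  have hanti : ∀ u v w, fderiv ℝ (fun y => altBilin (η y)) y w u v =
      - fderiv ℝ (fun y => altBilin (η y)) y w v u := fun u v w => by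
    rw [key, key]
    have : (fun y => η y ![u, v]) = fun y => - η y ![v, u] :=
      funext fun y => altBilin_antisymm (η y) u v
    rw [this, fderiv_fun_neg]
    rfl
  have e0 : (0 : Fin 3).removeNth ![a, b, c] = ![b, c] := by
    ext i; fin_cases i <;> rfl
  have e1 : (1 : Fin 3).removeNth ![a, b, c] = ![a, c] := by
    ext i; fin_cases i <;> rfl
  have e2 : (2 : Fin 3).removeNth ![a, b, c] = ![a, b] := by
    ext i; fin_cases i <;> rfl
  rw [e0, e1, e2, ← key, ← key, ← key] at h1
  have h2 := hanti c a b
  simp at h1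
  linarith

end AltBilin

/-! ### Manifold-valued maps smooth near a point. -/

section MNear

variable {X X' : Type} [NormedAddCommGroup X] [NormedSpace ℝ X] [NormedAddCommGroup X']
  [NormedSpace ℝ X'] {m : ℕ} {M : Type*} [TopologicalSpace M] [ChartedSpace (Euc m) M]

/-- `f` is smooth on a neighbourhood of `x`. -/
def MNear (m : ℕ) {M : Type*} [TopologicalSpace M] [ChartedSpace (Euc m) M] (f : X → M) (x : X) : Prop := ∀ᶠ y in 𝓝 x, ContMDiffAt 𝓘(ℝ, X) (𝓡 m) ∞ f y

theorem MNear.contMDiffAt {f : X → M} {x : X} (h : MNear m f x) :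
    ContMDiffAt 𝓘(ℝ, X) (𝓡 m) ∞ f x := h.self_of_nhds

theorem MNear.continuousAt {f : X → M} {x : X} (h : MNear m f x) : ContinuousAt f x :=
  h.contMDiffAt.continuousAt

theorem MNear.eventually {f : X → M} {x : X} (h : MNear m f x) : ∀ᶠ y in 𝓝 x, MNear m f y :=
  eventually_eventually_nhds.2 h

theorem MNear.comp {f : X' → M} {g : X → X'} {x : X} (hf : MNear m f (g x)) (hg : SmoothNear g x) :
    MNear m (fun x => f (g x)) x := by
  filter_upwards [hg, hg.continuousAt.eventually hf] with y h1 h2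
  exact ContMDiffAt.comp y h2 h1.contMDiffAt

theorem MNear.comp_of_eq {f : X' → M} {g : X → X'} {x : X} {y : X'} (hf : MNear m f y)
    (hg : SmoothNear g x) (h : g x = y) : MNear m (fun x => f (g x)) x :=
  MNear.comp (h ▸ hf) hg

theorem MNear.congr {f g : X → M} {x : X} (h : MNear m f x) (hfg : f =ᶠ[𝓝 x] g) : MNear m g x := by
  filter_upwards [h, eventually_eventually_nhds.2 hfg] with y hy hy'
  exact hy.congr_of_eventuallyEq (hy'.mono fun _ h => h.symm)

theorem MNear.snd_of_prod {f : X → X' → M} {x : X} {y : X'}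
    (hf : MNear m (fun w : X × X' => f w.1 w.2) (x, y)) : MNear m (f x) y :=
  MNear.comp (g := fun y => (x, y)) hf (smoothNear_of_contDiff (by fun_prop) _)

theorem MNear.eventually_mem_source {f : X → M} {x : X} (h : MNear m f x) {c : M}
    (hc : f x ∈ (chartAt (Euc m) c).source) : ∀ᶠ y in 𝓝 x, f y ∈ (chartAt (Euc m) c).source :=
  h.continuousAt.eventually_mem ((chartAt (Euc m) c).open_source.mem_nhds hc)

variable [IsManifold (𝓡 m) ∞ M]

theorem MNear.chart {f : X → M} {x : X} (h : MNear m f x) {c : M}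
    (hc : f x ∈ (chartAt (Euc m) c).source) :
    SmoothNear (fun y => chartAt (Euc m) c (f y)) x := by
  filter_upwards [h, h.eventually_mem_source hc] with y h1 h2
  exact contMDiffAt_iff_contDiffAt.1 (ContMDiffAt.comp y (contMDiffOn_chart.contMDiffAt
    ((chartAt (Euc m) c).open_source.mem_nhds h2)) h1)

theorem mNear_chart_symm {u : X → Euc m} {x : X} (h : SmoothNear u x) {c : M}
    (hc : u x ∈ (chartAt (Euc m) c).target) :
    MNear m (fun y => (chartAt (Euc m) c).symm (u y)) x := by
  filter_upwards [h, h.continuousAt.eventually_mem ((chartAt (Euc m) c).open_target.mem_nhds hc)]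
    with y h1 h2
  exact ContMDiffAt.comp y (contMDiffOn_chart_symm.contMDiffAt
    ((chartAt (Euc m) c).open_target.mem_nhds h2)) h1.contMDiffAt

end MNear

/-! ### Pullbacks of 2-forms and their expressions in charts. -/

section PbForm

variable {Y : Type} [NormedAddCommGroup Y] [NormedSpace ℝ Y]
  {m : ℕ} {M : Type*} [TopologicalSpace M] [ChartedSpace (Euc m) M]

/-- The pullback of a 2-form by a parametrization, as a bilinear map. -/
def pbForm (σ : ∀ x : M, TangentSpace (𝓡 m) x [⋀^Fin 2]→L[ℝ] ℝ) (Ψ : Y → M) (z : Y) :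
    Y →L[ℝ] Y →L[ℝ] ℝ :=
  altBilin (Y := Y) (pullbackForm 𝓘(ℝ, Y) (𝓡 m) σ Ψ z)

/-- The expression of a 2-form in a chart, as a bilinear map. -/
def chartBilin (σ : ∀ x : M, TangentSpace (𝓡 m) x [⋀^Fin 2]→L[ℝ] ℝ) (c : M) (y : Euc m) :
    Euc m →L[ℝ] Euc m →L[ℝ] ℝ :=
  altBilin (coordForm σ c y)

variable {σ : ∀ x : M, TangentSpace (𝓡 m) x [⋀^Fin 2]→L[ℝ] ℝ}

theorem pbForm_apply (Ψ : Y → M) (z u v : Y) :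
    pbForm σ Ψ z u v = pullbackForm 𝓘(ℝ, Y) (𝓡 m) σ Ψ z ![u, v] := rfl

theorem pbForm_antisymm (Ψ : Y → M) (z u v : Y) : pbForm σ Ψ z u v = - pbForm σ Ψ z v u :=
  altBilin_antisymm _ _ _

theorem pbForm_congr {Ψ Ψ' : Y → M} {z : Y} (h : Ψ =ᶠ[𝓝 z] Ψ') : pbForm σ Ψ z = pbForm σ Ψ' z := by
  rw [pbForm, pbForm, pullbackForm, pullbackForm, h.mfderiv_eq, h.self_of_nhds]

theorem pbForm_comp {Y' : Type} [NormedAddCommGroup Y'] [NormedSpace ℝ Y'] {Ψ : Y → M}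
    {G : Y' → Y} {z : Y'} (hΨ : MDifferentiableAt 𝓘(ℝ, Y) (𝓡 m) Ψ (G z))
    (hG : DifferentiableAt ℝ G z) (u v : Y') :
    pbForm σ (fun z => Ψ (G z)) z u v = pbForm σ Ψ (G z) (fderiv ℝ G z u) (fderiv ℝ G z v) := by
  rw [pbForm_apply, pbForm_apply, pullbackForm, pullbackForm]
  have := mfderiv_comp (I := 𝓘(ℝ, Y')) (I' := 𝓘(ℝ, Y)) (I'' := 𝓡 m) z hΨ hG.mdifferentiableAt
  rw [mfderiv_eq_fderiv] at this
  simp only [ContinuousAlternatingMap.compContinuousLinearMap_apply]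
  change _ = (σ (Ψ (G z))) _
  congr 1
  ext i
  have e : (fun z => Ψ (G z)) = Ψ ∘ G := rfl
  rw [e, this]
  fin_cases i <;> rfl

variable [IsManifold (𝓡 m) ∞ M]

/-- Factor Ψ through the chart and its inverse near z. This turns the pullback into one between
vector spaces, where smoothness and closedness of the coordinate expression are available. -/
theorem pullbackForm_eq_chart {Ψ : Y → M} {z : Y} (hΨ : MDifferentiableAt 𝓘(ℝ, Y) (𝓡 m) Ψ z)
    {c : M} (hc : Ψ z ∈ (chartAt (Euc m) c).source) :
    (pullbackForm 𝓘(ℝ, Y) (𝓡 m) σ Ψ z : Y [⋀^Fin 2]→L[ℝ] ℝ) =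
      (coordForm σ c (chartAt (Euc m) c (Ψ z))).compContinuousLinearMap
        (fderiv ℝ (fun z => chartAt (Euc m) c (Ψ z)) z) := by
  set e := chartAt (Euc m) c with he
  have ht : e (Ψ z) ∈ e.target := e.map_source hc
  have h1 : MDifferentiableAt (𝓡 m) (𝓡 m) e (Ψ z) :=
    mdifferentiableAt_atlas (chart_mem_atlas _ _) hc
  have h2 : MDifferentiableAt (𝓡 m) (𝓡 m) e.symm (e (Ψ z)) :=
    mdifferentiableAt_atlas_symm (chart_mem_atlas _ _) ht
  have h3 : MDifferentiableAt 𝓘(ℝ, Y) (𝓡 m) (fun z => e (Ψ z)) z := h1.comp z hΨ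
  have h4 : Ψ =ᶠ[𝓝 z] e.symm ∘ fun z => e (Ψ z) := by
    filter_upwards [hΨ.continuousAt.eventually_mem (e.open_source.mem_nhds hc)] with y hy
    exact (e.left_inv hy).symm
  have h5 := mfderiv_comp (I := 𝓘(ℝ, Y)) (I' := 𝓡 m) (I'' := 𝓡 m) z h2 h3
  rw [← h4.mfderiv_eq] at h5
  have h6 : mfderiv 𝓘(ℝ, Y) (𝓡 m) (fun z => e (Ψ z)) z = fderiv ℝ (fun z => e (Ψ z)) z :=
    mfderiv_eq_fderiv
  rw [h6] at h5
  have h7 : e.symm (e (Ψ z)) = Ψ z := e.left_inv hc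
  refine ContinuousAlternatingMap.ext fun v => ?_
  change (σ (Ψ z)) (fun i => mfderiv 𝓘(ℝ, Y) (𝓡 m) Ψ z (v i)) =
    (σ (e.symm (e (Ψ z)))) (fun i => mfderiv (𝓡 m) (𝓡 m) e.symm (e (Ψ z))
      (fderiv ℝ (fun z => e (Ψ z)) z (v i)))
  rw [h5, h7]
  rfl

theorem pbForm_eq_chart {Ψ : Y → M} {z : Y} (hΨ : MDifferentiableAt 𝓘(ℝ, Y) (𝓡 m) Ψ z)
    {c : M} (hc : Ψ z ∈ (chartAt (Euc m) c).source) (u v : Y) :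
    pbForm σ Ψ z u v = chartBilin σ c (chartAt (Euc m) c (Ψ z))
      (fderiv ℝ (fun z => chartAt (Euc m) c (Ψ z)) z u)
      (fderiv ℝ (fun z => chartAt (Euc m) c (Ψ z)) z v) := by
  have := pullbackForm_eq_chart (σ := σ) hΨ hc
  rw [pbForm, this]
  simp only [altBilin_apply, chartBilin, ContinuousAlternatingMap.compContinuousLinearMap_apply]
  congr 1
  ext i
  fin_cases i <;> rfl

end PbForm

/-! ### Smoothness and closedness of pulled-back symplectic forms. -/

section Symplectic

variable {Y : Type} [NormedAddCommGroup Y] [NormedSpace ℝ Y]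
  {m : ℕ} {M : Type*} [TopologicalSpace M] [ChartedSpace (Euc m) M] [IsManifold (𝓡 m) ∞ M]
  (σ : SymplecticForm m M)

theorem SymplecticForm.smoothNear_coordForm (c : M) {y : Euc m}
    (hy : y ∈ (chartAt (Euc m) c).target) : SmoothNear (coordForm σ.form c) y := by
  filter_upwards [(chartAt (Euc m) c).open_target.mem_nhds hy] with y' hy'
  exact (σ.smooth c).contDiffAt ((chartAt (Euc m) c).open_target.mem_nhds hy')

theorem SymplecticForm.smoothNear_chartBilin (c : M) {y : Euc m}
    (hy : y ∈ (chartAt (Euc m) c).target) : SmoothNear (chartBilin σ.form c) y :=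
  (σ.smoothNear_coordForm c hy).altBilin

theorem SymplecticForm.chartBilin_nondegenerate (c : M) {y : Euc m}
    (hy : y ∈ (chartAt (Euc m) c).target) {u : Euc m}
    (h : ∀ v, chartBilin σ.form c y u v = 0) : u = 0 := by
  have hd := (mdifferentiable_chart (I := 𝓡 m) c).symm.mfderiv_bijective hy
  have h1 : mfderiv (𝓡 m) (𝓡 m) (chartAt (Euc m) c).symm y u = 0 := by
    refine σ.nondegenerate _ _ fun v => ?_
    obtain ⟨w, rfl⟩ := hd.2 v
    have h2 := h w
    refine Eq.trans ?_ h2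
    change (σ.form _) _ = (σ.form _) _
    congr 1
    ext i
    fin_cases i <;> rfl
  exact hd.1 (h1.trans (map_zero _).symm)

theorem smoothNear_pbForm [FiniteDimensional ℝ Y] {P : Type} [NormedAddCommGroup P]
    [NormedSpace ℝ P] {Ψ : P → Y → M} {p : P} {z : Y}
    (h : MNear m (fun w : P × Y => Ψ w.1 w.2) (p, z)) :
    SmoothNear (fun w : P × Y => pbForm σ.form (Ψ w.1) w.2) (p, z) := by
  set c := Ψ p z with hc
  have hcs : Ψ p z ∈ (chartAt (Euc m) c).source := mem_chart_source _ _
  have h1 := h.chart (c := c) hcs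
  have h2 := SmoothNear.partial_snd (f := fun q z => chartAt (Euc m) c (Ψ q z)) h1
  have h3 : SmoothNear (fun w : P × Y => chartBilin σ.form c (chartAt (Euc m) c (Ψ w.1 w.2)))
      (p, z) :=
    SmoothNear.comp (g := chartBilin σ.form c) (f := fun w : P × Y => chartAt (Euc m) c (Ψ w.1 w.2))
      (σ.smoothNear_chartBilin c ((chartAt (Euc m) c).map_source hcs)) h1
  refine smoothNear_clm_apply_iff.2 fun u => smoothNear_clm_apply_iff.2 fun v => ?_
  refine SmoothNear.congr ((h3.clm_apply (h2.clm_apply (smoothNear_const u _))).clm_apply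
    (h2.clm_apply (smoothNear_const v _))) ?_
  filter_upwards [h.eventually, h.eventually_mem_source (c := c) hcs] with w hw1 hw2
  exact (pbForm_eq_chart ((MNear.snd_of_prod hw1).contMDiffAt.mdifferentiableAt (by simp))
    hw2 u v).symm

theorem smoothNear_pbForm' [FiniteDimensional ℝ Y] {Ψ : Y → M} {z : Y} (h : MNear m Ψ z) :
    SmoothNear (pbForm σ.form Ψ) z :=
  SmoothNear.snd_of_prod (f := fun _ : ℝ => pbForm σ.form Ψ) (x := 0)
    (smoothNear_pbForm (Ψ := fun _ : ℝ => Ψ) σ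
      (MNear.comp (g := fun w : ℝ × Y => w.2) h (smoothNear_of_contDiff contDiff_snd _)))

/-- In the chart at Ψ z the exterior derivative commutes with pullback, and the coordinate form is
closed. -/
theorem cyclic_fderiv_pbForm [FiniteDimensional ℝ Y] {Ψ : Y → M} {z : Y} (h : MNear m Ψ z)
    (u v w : Y) :
    fderiv ℝ (pbForm σ.form Ψ) z u v w + fderiv ℝ (pbForm σ.form Ψ) z v w u +
      fderiv ℝ (pbForm σ.form Ψ) z w u v = 0 := by
  set c := Ψ z with hc
  have hcs : Ψ z ∈ (chartAt (Euc m) c).source := mem_chart_source _ _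
  have h1 := h.chart (c := c) hcs
  set f : Y → Euc m := fun z => chartAt (Euc m) c (Ψ z) with hf
  set η : Y → Y [⋀^Fin 2]→L[ℝ] ℝ := fun y =>
    (coordForm σ.form c (f y)).compContinuousLinearMap (fderiv ℝ f y) with hη
  have hev : pbForm σ.form Ψ =ᶠ[𝓝 z] fun y => altBilin (η y) := by
    filter_upwards [h.eventually, h.eventually_mem_source (c := c) hcs] with y hy1 hy2
    rw [pbForm, pullbackForm_eq_chart (hy1.contMDiffAt.mdifferentiableAt (by simp)) hy2]
  have ht : f z ∈ (chartAt (Euc m) c).target := (chartAt (Euc m) c).map_source hcs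
  have hω := σ.smoothNear_coordForm c ht
  have hclosed : extDeriv η z = 0 := by
    rw [hη, extDeriv_pullback (r := ∞) hω.differentiableAt h1.contDiffAt
        (by rw [minSmoothness_of_isRCLikeNormedField]; exact WithTop.coe_le_coe.2 (le_top : (2 : ℕ∞) ≤ ⊤)),
      σ.closed c _ ht]
    rfl
  have hd : DifferentiableAt ℝ η z := by
    have e1 : DifferentiableAt ℝ (fun y => coordForm σ.form c (f y)) z :=
      (SmoothNear.comp (g := coordForm σ.form c) (f := f) hω h1).differentiableAt
    have e2 : DifferentiableAt ℝ (fderiv ℝ f) z := h1.fderiv.differentiableAt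
    exact (e1.hasFDerivAt.continuousAlternatingMapCompContinuousLinearMap
      e2.hasFDerivAt).differentiableAt
  rw [hev.fderiv_eq]
  refine cyclic_fderiv_altBilin hd ?_ hclosed u v w
  exact (smoothNear_pbForm' σ h).differentiableAt.congr_of_eventuallyEq hev.symm

end Symplectic

section SymplecticMap

variable {Y : Type} [NormedAddCommGroup Y] [NormedSpace ℝ Y]
  {n : ℕ} {M : Type*} [TopologicalSpace M] [ChartedSpace (Euc (2 * n)) M]
  [IsManifold (𝓡 (2 * n)) ∞ M] {σ : SymplecticForm (2 * n) M}

theorem IsSymplectic.pbForm_comp {g : M → M} (hg : IsSymplectic σ g) {Ψ : Y → M} {z : Y}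
    (hgd : MDifferentiableAt (𝓡 (2 * n)) (𝓡 (2 * n)) g (Ψ z))
    (hΨ : MDifferentiableAt 𝓘(ℝ, Y) (𝓡 (2 * n)) Ψ z) :
    pbForm σ.form (fun z => g (Ψ z)) z = pbForm σ.form Ψ z := by
  have h1 := mfderiv_comp (I := 𝓘(ℝ, Y)) (I' := 𝓡 (2 * n)) (I'' := 𝓡 (2 * n)) z hgd hΨ
  have h2 := hg (Ψ z)
  refine ContinuousLinearMap.ext fun u => ContinuousLinearMap.ext fun v => ?_
  have h3 := DFunLike.congr_fun h2 fun i => mfderiv 𝓘(ℝ, Y) (𝓡 (2 * n)) Ψ z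
    ((![u, v] : Fin 2 → Y) i)
  refine Eq.trans ?_ h3
  have e : (fun z => g (Ψ z)) = g ∘ Ψ := rfl
  rw [pbForm_apply, pullbackForm, e, h1]
  rfl

end SymplecticMap

section Partial

variable {X Y F : Type*} [NormedAddCommGroup X] [NormedSpace ℝ X] [NormedAddCommGroup Y]
  [NormedSpace ℝ Y] [NormedAddCommGroup F] [NormedSpace ℝ F]

theorem hasFDerivAt_left {f : X × Y → F} {x : X} {y : Y} (h : DifferentiableAt ℝ f (x, y)) :
    HasFDerivAt (fun x => f (x, y)) (fderiv ℝ f (x, y) ∘L .inl ℝ X Y) x :=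
  HasFDerivAt.comp (g := f) (f := fun x => (x, y)) x h.hasFDerivAt (hasFDerivAt_prodMk_left x y)

theorem hasFDerivAt_right {f : X × Y → F} {x : X} {y : Y} (h : DifferentiableAt ℝ f (x, y)) :
    HasFDerivAt (fun y => f (x, y)) (fderiv ℝ f (x, y) ∘L .inr ℝ X Y) y :=
  HasFDerivAt.comp (g := f) (f := fun y => (x, y)) y h.hasFDerivAt (hasFDerivAt_prodMk_right x y)

end Partial

/-! ### A canonical complement to an isotropic range. -/

section Transversal

variable {n m : ℕ} {X : Type*} [NormedAddCommGroup X] [NormedSpace ℝ X]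

theorem isInvertible_innerL : (innerL (n := n)).IsInvertible := by
  refine isInvertible_of_injective ?_ ?_
  · refine (injective_iff_map_eq_zero _).2 fun u hu => ?_
    have h1 := DFunLike.congr_fun hu u
    exact inner_self_eq_zero.1 h1
  · rw [← LinearEquiv.finrank_eq (LinearMap.toContinuousLinearMap (𝕜 := ℝ) (E := Euc n)
      (F' := ℝ))]
    exact (Subspace.dual_finrank_eq (K := ℝ) (V := Euc n)).symm

theorem inner_inverse_innerL (f : Euc n →L[ℝ] ℝ) (v : Euc n) :
    inner ℝ ((innerL (n := n)).inverse f) v = f v := by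
  rw [← innerL_apply, isInvertible_innerL.self_apply_inverse]

/-- The vectors dual to a bilinear form along a linear map. -/
def dualAlong (B : Euc m →L[ℝ] Euc m →L[ℝ] ℝ) (A : Euc n →L[ℝ] Euc m) : Euc n →L[ℝ] Euc m :=
  (innerL (n := m)).inverse ∘L (B ∘L A)

theorem inner_dualAlong (B : Euc m →L[ℝ] Euc m →L[ℝ] ℝ) (A : Euc n →L[ℝ] Euc m) (k : Euc n)
    (v : Euc m) : inner ℝ (dualAlong B A k) v = B (A k) v :=
  inner_inverse_innerL _ _

/-- The Gram form of a linear map. -/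
def gramForm (S : Euc n →L[ℝ] Euc m) : Euc n →L[ℝ] Euc n →L[ℝ] ℝ := innerL.bilinearComp S S

theorem gramForm_apply (S : Euc n →L[ℝ] Euc m) (k l : Euc n) :
    gramForm S k l = inner ℝ (S k) (S l) := rfl

theorem isInvertible_gramForm {S : Euc n →L[ℝ] Euc m} (hS : ∀ k, S k = 0 → k = 0) :
    (gramForm S).IsInvertible := by
  refine isInvertible_of_injective ?_ ?_
  · refine (injective_iff_map_eq_zero _).2 fun u hu => hS u ?_
    exact inner_self_eq_zero.1 (DFunLike.congr_fun hu u)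
  · rw [← LinearEquiv.finrank_eq (LinearMap.toContinuousLinearMap (𝕜 := ℝ) (E := Euc n)
      (F' := ℝ))]
    exact (Subspace.dual_finrank_eq (K := ℝ) (V := Euc n)).symm

/-- A complement to the range of `A` dual to it with respect to `B`. -/
def transversal (B : Euc m →L[ℝ] Euc m →L[ℝ] ℝ) (A : Euc n →L[ℝ] Euc m) : Euc n →L[ℝ] Euc m :=
  dualAlong B A ∘L ((gramForm (dualAlong B A)).inverse ∘L innerL)

variable {B : Euc m →L[ℝ] Euc m →L[ℝ] ℝ} {A : Euc n →L[ℝ] Euc m}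

theorem dualAlong_eq_zero (hB : ∀ u, (∀ v, B u v = 0) → u = 0) (hA : Function.Injective A)
    {k : Euc n} (h : dualAlong B A k = 0) : k = 0 := by
  refine (injective_iff_map_eq_zero _).1 hA k (hB _ fun v => ?_)
  rw [← inner_dualAlong, h, inner_zero_left]

/-- Let D k be the metric dual of B (A k, ·). Then B (A k, D l) is the Gram form of D, which is
invertible because D is injective; composing D with the inverse Gram form normalizes the pairing.
The formula involves no choice and is smooth in (B, A). -/
theorem apply_transversal (hB : ∀ u, (∀ v, B u v = 0) → u = 0) (hA : Function.Injective A)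
    (k l : Euc n) : B (A k) (transversal B A l) = inner ℝ k l := by
  have hi := isInvertible_gramForm (S := dualAlong B A) fun k h => dualAlong_eq_zero hB hA h
  rw [← inner_dualAlong, transversal]
  change inner ℝ (dualAlong B A k) (dualAlong B A ((gramForm (dualAlong B A)).inverse
    (innerL l))) = _
  rw [real_inner_comm, ← gramForm_apply, hi.self_apply_inverse, innerL_apply, real_inner_comm]

theorem SmoothNear.transversal {B : X → Euc m →L[ℝ] Euc m →L[ℝ] ℝ} {A : X → Euc n →L[ℝ] Euc m}
    {x : X} (hBs : SmoothNear B x) (hAs : SmoothNear A x)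
    (hB : ∀ u, (∀ v, B x u v = 0) → u = 0) (hA : Function.Injective (A x)) :
    SmoothNear (fun x => KAMBirkhoff.transversal (B x) (A x)) x := by
  have h1 : SmoothNear (fun x => dualAlong (B x) (A x)) x :=
    (smoothNear_const _ _).clm_comp (hBs.clm_comp hAs)
  have h2 : SmoothNear (fun x => gramForm (dualAlong (B x) (A x))) x := by
    refine smoothNear_clm_apply_iff.2 fun k => smoothNear_clm_apply_iff.2 fun l => ?_
    exact ((smoothNear_const innerL x).clm_apply (h1.clm_apply (smoothNear_const k x))).clm_apply
      (h1.clm_apply (smoothNear_const l x))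
  have hi := isInvertible_gramForm (S := dualAlong (B x) (A x))
    fun k h => dualAlong_eq_zero hB hA h
  have h3 : SmoothNear ContinuousLinearMap.inverse (gramForm (dualAlong (B x) (A x))) := by
    have : ∀ᶠ Ω' in 𝓝 (gramForm (dualAlong (B x) (A x))), Ω'.IsInvertible := by
      obtain ⟨e, he⟩ := hi
      rw [← he]
      exact ContinuousLinearEquiv.nhds e
    exact this.mono fun Ω' h' => h'.contDiffAt_map_inverse
  exact h1.clm_comp ((SmoothNear.comp (g := ContinuousLinearMap.inverse)
    (f := fun x => gramForm (dualAlong (B x) (A x))) h3 h2).clm_comp (smoothNear_const _ _))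

end Transversal

/-! ### Moving off the torus within one chart. -/

section FibreStep

variable {n m : ℕ} {M : Type*} [TopologicalSpace M] [ChartedSpace (Euc m) M]
  [IsManifold (𝓡 m) ∞ M] (σ : SymplecticForm m M)

/-- Moving `Φ (x, r)` linearly in `r` in the chart at `j`, with cutoff `χ`. -/
def fibreStep (j : M) (χ : M → ℝ) (h : Euc n → M) (Φ : Euc n × Euc n → M) (z : Euc n × Euc n) : M :=
  open scoped Classical in
  if h z.1 ∈ tsupport χ then
    (chartAt (Euc m) j).symm (chartAt (Euc m) j (Φ z) +
      χ (h z.1) • transversal (chartBilin σ.form j (chartAt (Euc m) j (h z.1)))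
        (fderiv ℝ (fun x => chartAt (Euc m) j (h x)) z.1) z.2)
  else Φ z

variable {σ} {j : M} {χ : M → ℝ}

theorem fibreStep_zero (hχ : tsupport χ ⊆ (chartAt (Euc m) j).source) {h : Euc n → M}
    {Φ : Euc n × Euc n → M} (x : Euc n) (hΦ : Φ (x, 0) = h x) :
    fibreStep σ j χ h Φ (x, 0) = h x := by
  rw [fibreStep]
  split_ifs with hx
  · rw [map_zero, smul_zero, add_zero, hΦ]
    exact (chartAt (Euc m) j).left_inv (hχ hx)
  · exact hΦ

theorem fderiv_add_lat {F : Type*} [NormedAddCommGroup F] [NormedSpace ℝ F] {f : Euc n → F}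
    (hf : ∀ x k, f (x + lat k) = f x) (x : Euc n) (k : Fin n → ℤ) :
    fderiv ℝ f (x + lat k) = fderiv ℝ f x := by
  rw [← fderiv_comp_add_right (f := f) (lat k)]
  congr 1
  funext y
  exact hf y k

theorem fibreStep_add_lat {h : Euc n → M} {Φ : Euc n × Euc n → M}
    (hh : ∀ x k, h (x + lat k) = h x) (hΦ : ∀ z k, Φ (z + (lat k, 0)) = Φ z)
    (z : Euc n × Euc n) (k : Fin n → ℤ) :
    fibreStep σ j χ h Φ (z + (lat k, 0)) = fibreStep σ j χ h Φ z := by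
  have e : fderiv ℝ (fun x => chartAt (Euc m) j (h x)) (z.1 + lat k) =
      fderiv ℝ (fun x => chartAt (Euc m) j (h x)) z.1 :=
    fderiv_add_lat (fun x k => by rw [hh]) _ _
  simp only [fibreStep, Prod.fst_add, Prod.snd_add, hh, hΦ, add_zero, e]
  classical exact if_congr (by rw [hh]) rfl rfl

theorem MNear.contMDiff_comp {X : Type} [NormedAddCommGroup X] [NormedSpace ℝ X] {f : X → M}
    {x : X} (hf : MNear m f x) (hχ : ContMDiff (𝓡 m) 𝓘(ℝ, ℝ) ∞ χ) :
    SmoothNear (fun y => χ (f y)) x := by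
  filter_upwards [hf] with y hy
  exact contMDiffAt_iff_contDiffAt.1 (ContMDiffAt.comp y (hχ.contMDiffAt) hy)

variable {P : Type} [NormedAddCommGroup P] [NormedSpace ℝ P] {h : P → Euc n → M}
  {Φ : P → Euc n × Euc n → M} {p : P}

/-- A smooth family of immersed periodic parametrizations, near the parameter `p`. -/
structure IsTorusFamily (σ : SymplecticForm m M) (h : P → Euc n → M) (p : P) : Prop where
  smooth : ∀ x, MNear m (fun w : P × Euc n => h w.1 w.2) (p, x)
  periodic : ∀ q x k, h q (x + lat k) = h q x
  immersion : ∀ q x, Function.Injective (mfderiv 𝓘(ℝ, Euc n) (𝓡 m) (h q) x)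
  lagrangian : ∀ q x u v, pbForm σ.form (h q) x u v = 0

theorem IsTorusFamily.injective_fderiv (H : IsTorusFamily σ h p) (x : Euc n)
    (hx : h p x ∈ (chartAt (Euc m) j).source) :
    Function.Injective (fderiv ℝ (fun x => chartAt (Euc m) j (h p x)) x) := by
  have h2 := (MNear.snd_of_prod (H.smooth x)).contMDiffAt.mdifferentiableAt (by simp)
  have h3 := mfderiv_comp (I := 𝓘(ℝ, Euc n)) (I' := 𝓡 m) (I'' := 𝓡 m) x
    (mdifferentiableAt_atlas (chart_mem_atlas _ j) hx) h2
  have h4 : mfderiv 𝓘(ℝ, Euc n) (𝓡 m) (chartAt (Euc m) j ∘ h p) x =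
      fderiv ℝ (fun x => chartAt (Euc m) j (h p x)) x := mfderiv_eq_fderiv
  rw [← h4, h3]
  exact ((mdifferentiable_chart (I := 𝓡 m) j).mfderiv_bijective hx).1.comp (H.immersion p x)

theorem smoothNear_chart_fibreStep (H : IsTorusFamily σ h p)
    (hχs : ContMDiff (𝓡 m) 𝓘(ℝ, ℝ) ∞ χ) (x : Euc n)
    (hΦ : MNear m (fun w : P × (Euc n × Euc n) => Φ w.1 w.2) (p, (x, 0)))
    (h0 : Φ p (x, 0) = h p x) (hx : h p x ∈ (chartAt (Euc m) j).source) :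
    SmoothNear (fun w : P × (Euc n × Euc n) => chartAt (Euc m) j (Φ w.1 w.2) +
      χ (h w.1 w.2.1) • transversal (chartBilin σ.form j (chartAt (Euc m) j (h w.1 w.2.1)))
        (fderiv ℝ (fun x => chartAt (Euc m) j (h w.1 x)) w.2.1) w.2.2) (p, (x, 0)) := by
  have hpr : SmoothNear (fun w : P × (Euc n × Euc n) => (w.1, w.2.1)) (p, (x, 0)) :=
    smoothNear_of_contDiff (by fun_prop) _
  have h1 := hΦ.chart (c := j) (by simpa only [h0] using hx)
  have h2 : MNear m (fun w : P × (Euc n × Euc n) => h w.1 w.2.1) (p, (x, 0)) :=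
    MNear.comp (f := fun w : P × Euc n => h w.1 w.2)
      (g := fun w : P × (Euc n × Euc n) => (w.1, w.2.1)) (H.smooth x) hpr
  have h3 := (H.smooth x).chart (c := j) hx
  have h4 : SmoothNear (fun w : P × Euc n => transversal
      (chartBilin σ.form j (chartAt (Euc m) j (h w.1 w.2)))
      (fderiv ℝ (fun x => chartAt (Euc m) j (h w.1 x)) w.2)) (p, x) := by
    refine SmoothNear.transversal ?_ (SmoothNear.partial_snd
      (f := fun q x => chartAt (Euc m) j (h q x)) h3) ?_ (H.injective_fderiv x hx)
    · exact SmoothNear.comp (g := chartBilin σ.form j)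
        (f := fun w : P × Euc n => chartAt (Euc m) j (h w.1 w.2))
        (σ.smoothNear_chartBilin j ((chartAt (Euc m) j).map_source hx)) h3
    · intro u hu
      exact σ.chartBilin_nondegenerate j ((chartAt (Euc m) j).map_source hx) hu
  have h5 : SmoothNear (fun w : P × (Euc n × Euc n) => transversal
      (chartBilin σ.form j (chartAt (Euc m) j (h w.1 w.2.1)))
      (fderiv ℝ (fun x => chartAt (Euc m) j (h w.1 x)) w.2.1)) (p, (x, 0)) :=
    SmoothNear.comp (f := fun w : P × (Euc n × Euc n) => (w.1, w.2.1)) h4 hpr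
  exact h1.add ((h2.contMDiff_comp hχs).smul (h5.clm_apply
    (smoothNear_of_contDiff (by fun_prop) _)))

/-- The two branches of the definition agree where both make sense, because the cutoff vanishes off
its support. So near a point over the chart domain the chart formula can be used alone. -/
theorem fibreStep_eventuallyEq (x : Euc n)
    (hΦ : MNear m (fun w : P × (Euc n × Euc n) => Φ w.1 w.2) (p, (x, 0)))
    (h0 : Φ p (x, 0) = h p x) (hx : h p x ∈ (chartAt (Euc m) j).source) :
    (fun w : P × (Euc n × Euc n) => fibreStep σ j χ (h w.1) (Φ w.1) w.2) =ᶠ[𝓝 (p, (x, 0))]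
      fun w => (chartAt (Euc m) j).symm (chartAt (Euc m) j (Φ w.1 w.2) +
      χ (h w.1 w.2.1) • transversal (chartBilin σ.form j (chartAt (Euc m) j (h w.1 w.2.1)))
        (fderiv ℝ (fun x => chartAt (Euc m) j (h w.1 x)) w.2.1) w.2.2) := by
  filter_upwards [hΦ.eventually_mem_source (c := j) (by simpa only [h0] using hx)] with w hw
  rw [fibreStep]
  split_ifs with hw'
  · rfl
  · rw [image_eq_zero_of_notMem_tsupport hw', zero_smul, add_zero]
    exact ((chartAt (Euc m) j).left_inv hw).symm

theorem fibreStep_eventuallyEq_of_notMem (H : IsTorusFamily σ h p) (x : Euc n)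
    (hx : h p x ∉ tsupport χ) :
    (fun w : P × (Euc n × Euc n) => fibreStep σ j χ (h w.1) (Φ w.1) w.2) =ᶠ[𝓝 (p, (x, 0))]
      fun w => Φ w.1 w.2 := by
  have h2 : ContinuousAt (fun w : P × (Euc n × Euc n) => h w.1 w.2.1) (p, (x, 0)) :=
    (MNear.comp (f := fun w : P × Euc n => h w.1 w.2)
      (g := fun w : P × (Euc n × Euc n) => (w.1, w.2.1)) (H.smooth x)
      (smoothNear_of_contDiff (by fun_prop) _)).continuousAt
  filter_upwards [h2.eventually_mem ((isClosed_tsupport χ).isOpen_compl.mem_nhds hx)] with w hw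
  rw [fibreStep, if_neg hw]

/-- On the support of the cutoff the chart formula is smooth; off the support, which is closed, the
map is locally unchanged. The two cases cover everything. -/
theorem mNear_fibreStep (H : IsTorusFamily σ h p)
    (hχ : tsupport χ ⊆ (chartAt (Euc m) j).source) (hχs : ContMDiff (𝓡 m) 𝓘(ℝ, ℝ) ∞ χ) (x : Euc n)
    (hΦ : MNear m (fun w : P × (Euc n × Euc n) => Φ w.1 w.2) (p, (x, 0)))
    (h0 : Φ p (x, 0) = h p x) :
    MNear m (fun w : P × (Euc n × Euc n) => fibreStep σ j χ (h w.1) (Φ w.1) w.2) (p, (x, 0)) := by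
  by_cases hx : h p x ∈ tsupport χ
  · refine MNear.congr (mNear_chart_symm (c := j)
      (smoothNear_chart_fibreStep H hχs x hΦ h0 (hχ hx)) ?_)
      (fibreStep_eventuallyEq x hΦ h0 (hχ hx)).symm
    simp only [map_zero, smul_zero, add_zero, h0]
    exact (chartAt (Euc m) j).map_source (hχ hx)
  · exact hΦ.congr (fibreStep_eventuallyEq_of_notMem H x hx).symm

/-- Along r = 0 the step keeps the x-derivatives and adds χ times the transversal to the
r-derivatives; `apply_transversal` evaluates the extra pairing. Summed over a partition of unity,
these increments give the standard pairing. -/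
theorem pbForm_fibreStep (H : IsTorusFamily σ h p)
    (hχ : tsupport χ ⊆ (chartAt (Euc m) j).source) (hχs : ContMDiff (𝓡 m) 𝓘(ℝ, ℝ) ∞ χ) (x : Euc n)
    (hΦ : MNear m (fun w : P × (Euc n × Euc n) => Φ w.1 w.2) (p, (x, 0)))
    (h0 : ∀ x, Φ p (x, 0) = h p x) (k l : Euc n) :
    pbForm σ.form (fibreStep σ j χ (h p) (Φ p)) (x, 0) (k, 0) (0, l) =
      pbForm σ.form (Φ p) (x, 0) (k, 0) (0, l) + χ (h p x) * inner ℝ k l := by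
  by_cases hx : h p x ∈ tsupport χ
  · have hxs := hχ hx
    set c := chartAt (Euc m) j with hc
    set u : Euc n × Euc n → Euc m := fun z => c (Φ p z) +
      χ (h p z.1) • transversal (chartBilin σ.form j (c (h p z.1)))
        (fderiv ℝ (fun x => c (h p x)) z.1) z.2 with hu
    have hus : SmoothNear u (x, 0) :=
      SmoothNear.snd_of_prod (f := fun q z => c (Φ q z) +
        χ (h q z.1) • transversal (chartBilin σ.form j (c (h q z.1)))
          (fderiv ℝ (fun x => c (h q x)) z.1) z.2)
        (smoothNear_chart_fibreStep H hχs x hΦ (h0 x) hxs)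
    have hu0 : u (x, 0) = c (h p x) := by simp [hu, h0]
    have hut : u (x, 0) ∈ c.target := hu0 ▸ c.map_source hxs
    have hstep : fibreStep σ j χ (h p) (Φ p) =ᶠ[𝓝 (x, 0)] fun z => c.symm (u z) :=
      (Continuous.tendsto (f := fun z : Euc n × Euc n => (p, z)) (by fun_prop) (x, 0)).eventually
        (fibreStep_eventuallyEq x hΦ (h0 x) hxs)
    have hcu : (fun z => c (fibreStep σ j χ (h p) (Φ p) z)) =ᶠ[𝓝 (x, 0)] u := by
      filter_upwards [hstep, hus.continuousAt.eventually_mem (c.open_target.mem_nhds hut)]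
        with z hz hz'
      rw [hz, c.right_inv hz']
    have hF := mNear_fibreStep (j := j) H hχ hχs x hΦ (h0 x)
    have hFx : fibreStep σ j χ (h p) (Φ p) (x, 0) = h p x := fibreStep_zero hχ x (h0 x)
    have hΦp : MNear m (Φ p) (x, 0) := MNear.snd_of_prod hΦ
    have hdΦ := (hΦp.chart (c := j) (by simpa only [h0 x] using hxs)).differentiableAt
    have hFp : MNear m (fibreStep σ j χ (h p) (Φ p)) (x, 0) :=
      MNear.snd_of_prod (f := fun q => fibreStep σ j χ (h q) (Φ q)) hF
    rw [pbForm_eq_chart (hFp.contMDiffAt.mdifferentiableAt (by simp))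
        (c := j) (by rw [hFx]; exact hxs), pbForm_eq_chart (hΦp.contMDiffAt.mdifferentiableAt
        (by simp)) (c := j) (by rw [h0]; exact hxs), hcu.fderiv_eq, hFx, h0 x]
    have dA : HasFDerivAt (fun x => c (h p x)) (fderiv ℝ (fun x => c (h p x)) x) x :=
      ((MNear.snd_of_prod (H.smooth x)).chart (c := j) hxs).differentiableAt.hasFDerivAt
    have e1 : ∀ k, fderiv ℝ (fun z => c (Φ p z)) (x, 0) (k, 0) = fderiv ℝ (fun x => c (h p x)) x k := by
      intro k
      have d1 := hasFDerivAt_left hdΦ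
      have : (fun x => c (Φ p (x, 0))) = fun x => c (h p x) := by
        funext y; rw [h0]
      rw [this] at d1
      rw [dA.unique d1]
      rfl
    have e2 : ∀ k, fderiv ℝ u (x, 0) (k, 0) = fderiv ℝ (fun x => c (h p x)) x k := by
      intro k
      have d1 := hasFDerivAt_left hus.differentiableAt
      have : (fun x => u (x, 0)) = fun x => c (h p x) := by
        funext y; simp [hu, h0]
      rw [this] at d1
      rw [dA.unique d1]
      rfl
    have e3 : fderiv ℝ u (x, 0) (0, l) = fderiv ℝ (fun z => c (Φ p z)) (x, 0) (0, l) +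
        χ (h p x) • transversal (chartBilin σ.form j (c (h p x)))
          (fderiv ℝ (fun x => c (h p x)) x) l := by
      have d1 := hasFDerivAt_right hus.differentiableAt
      have d2 := hasFDerivAt_right hdΦ
      have d3 := d2.add (χ (h p x) • transversal (chartBilin σ.form j (c (h p x)))
          (fderiv ℝ (fun x => c (h p x)) x)).hasFDerivAt
      exact DFunLike.congr_fun (d1.unique d3) l
    rw [e2, e3, e1, map_add, map_smul, apply_transversal
      (fun u hu => σ.chartBilin_nondegenerate j (c.map_source hxs) hu)
      (H.injective_fderiv x hxs), smul_eq_mul]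
  · have : fibreStep σ j χ (h p) (Φ p) =ᶠ[𝓝 (x, 0)] Φ p :=
      (Continuous.tendsto (f := fun z : Euc n × Euc n => (p, z)) (by fun_prop) (x, 0)).eventually
        (fibreStep_eventuallyEq_of_notMem H x hx)
    rw [pbForm_congr this, image_eq_zero_of_notMem_tsupport hx, zero_mul, add_zero]

end FibreStep

/-! ### Making a tube parametrization symplectic. -/

section MoserCorrect

variable {n m : ℕ} {M : Type*} [TopologicalSpace M] [ChartedSpace (Euc m) M]

/-- Nondifferentiable points are included, where the derivative takes its default value 0 on both
sides, because `IsMoserForm.periodic` is required at every point. -/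
theorem pbForm_add_of_periodic {Y : Type} [NormedAddCommGroup Y] [NormedSpace ℝ Y]
    {σ : ∀ x : M, TangentSpace (𝓡 m) x [⋀^Fin 2]→L[ℝ] ℝ} {Ψ : Y → M} {c : Y}
    (h : ∀ z, Ψ (z + c) = Ψ z) (z : Y) : pbForm σ Ψ (z + c) = pbForm σ Ψ z := by
  have e : (fun z => Ψ (z + c)) = Ψ := funext h
  have hd : ∀ z c, HasFDerivAt (fun z : Y => z + c) (ContinuousLinearMap.id ℝ Y) z := fun z c =>
    (hasFDerivAt_id z).add_const c
  by_cases h1 : MDifferentiableAt 𝓘(ℝ, Y) (𝓡 m) Ψ (z + c)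
  · refine ContinuousLinearMap.ext fun u => ContinuousLinearMap.ext fun v => ?_
    have := pbForm_comp (σ := σ) (G := fun z => z + c) (z := z) h1 (hd z c).differentiableAt u v
    rw [e, (hd z c).fderiv] at this
    exact this.symm
  · have h2 : ¬ MDifferentiableAt 𝓘(ℝ, Y) (𝓡 m) Ψ z := by
      intro h2
      apply h1
      have e2 : Ψ = Ψ ∘ fun y => y + -c := by
        funext y
        rw [Function.comp_apply, ← h (y + -c), neg_add_cancel_right]
      rw [e2]
      refine MDifferentiableAt.comp (I' := 𝓘(ℝ, Y)) (z + c) ?_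
        (hd (z + c) (-c)).differentiableAt.mdifferentiableAt
      rwa [add_neg_cancel_right]
    refine ContinuousLinearMap.ext fun u => ContinuousLinearMap.ext fun v => ?_
    rw [pbForm_apply, pbForm_apply, pullbackForm, pullbackForm,
      mfderiv_zero_of_not_mdifferentiableAt h1, mfderiv_zero_of_not_mdifferentiableAt h2, h]
    rfl

variable [IsManifold (𝓡 m) ∞ M]
  {P : Type} [NormedAddCommGroup P] [NormedSpace ℝ P] {h : P → Euc n → M}
  {Ψ : P → Euc n × Euc n → M} {p : P}

/-- A smooth family of periodic parametrizations of neighbourhoods of the tori `h q`. -/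
structure IsTubeFamily (m : ℕ) {M : Type*} [TopologicalSpace M] [ChartedSpace (Euc m) M]
    (h : P → Euc n → M) (Ψ : P → Euc n × Euc n → M) (p : P) : Prop where
  smooth : ∀ x, MNear m (fun w : P × (Euc n × Euc n) => Ψ w.1 w.2) (p, (x, 0))
  base : ∀ x, Ψ p (x, 0) = h p x
  periodic : ∀ q z k, Ψ q (z + (lat k, 0)) = Ψ q z

theorem IsTubeFamily.smooth_right (H : IsTubeFamily m h Ψ p) (x : Euc n) :
    MNear m (Ψ p) (x, 0) :=
  MNear.snd_of_prod (H.smooth x)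

/-- Composition of `Ψ` with the map that makes it symplectic. -/
def moserCorrect (σ : SymplecticForm m M) (Ψ : Euc n × Euc n → M) (z : Euc n × Euc n) : M :=
  Ψ (flowMap (moserField (pbForm σ.form Ψ)) z)

variable {σ : SymplecticForm m M}

theorem IsTubeFamily.isMoserForm (H : IsTubeFamily m h Ψ p)
    (hb : ∀ᶠ q in 𝓝 p, ∀ x, pbForm σ.form (Ψ q) (x, 0) = w0) :
    IsMoserForm (fun q => pbForm σ.form (Ψ q)) p where
  smooth x := smoothNear_pbForm σ (H.smooth x)
  base_eventually := hb
  periodic q z k := pbForm_add_of_periodic (fun z => H.periodic q z k) z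
  antisymm q z u v := pbForm_antisymm _ _ _ _
  closed x := by
    filter_upwards [(H.smooth x).eventually] with w hw u v v'
    exact cyclic_fderiv_pbForm σ (MNear.snd_of_prod (f := Ψ) hw) u v v'

/-- A smooth family of symplectic tube parametrizations. -/
structure IsSymplecticTube (σ : SymplecticForm m M) (h : P → Euc n → M)
    (Ψ : P → Euc n × Euc n → M) (p : P) : Prop extends IsTubeFamily m h Ψ p where
  symplectic : ∀ x, ∀ᶠ w in 𝓝 (p, (x, 0)), pbForm σ.form (Ψ w.1) w.2 = w0

theorem IsSymplecticTube.symplectic_right {σ : SymplecticForm m M} (H : IsSymplecticTube σ h Ψ p)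
    (x : Euc n) : ∀ᶠ z in 𝓝 (x, 0), pbForm σ.form (Ψ p) z = w0 :=
  eventually_slice (H.symplectic x)

/-- The form has to be standard on r = 0 only; the Moser flow fixes r = 0, so the torus keeps its
parametrization while the form becomes standard nearby. -/
theorem IsTubeFamily.moserCorrect [CompleteSpace P] (H : IsTubeFamily m h Ψ p)
    (hb : ∀ᶠ q in 𝓝 p, ∀ x, pbForm σ.form (Ψ q) (x, 0) = w0) :
    IsSymplecticTube σ h (fun q => KAMBirkhoff.moserCorrect σ (Ψ q)) p where
  smooth x := by
    have hB := H.isMoserForm hb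
    refine MNear.comp_of_eq (f := fun w : P × (Euc n × Euc n) => Ψ w.1 w.2) (g := fun
      w : P × (Euc n × Euc n) => (w.1, flowMap (moserField (pbForm σ.form (Ψ w.1))) w.2))
      (H.smooth x) ((smoothNear_of_contDiff contDiff_fst _).prodMk (hB.smooth_flowMap x)) ?_
    exact congrArg (Prod.mk p) (hB.flowMap_base x)
  base x := by
    rw [KAMBirkhoff.moserCorrect, (H.isMoserForm hb).flowMap_base x, H.base]
  periodic q z k := by
    rw [KAMBirkhoff.moserCorrect, (H.isMoserForm hb).flowMap_add_lat q z k, H.periodic]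
    rfl
  symplectic x := by
    have hB := H.isMoserForm hb
    have hc : ContinuousAt (fun w : P × (Euc n × Euc n) =>
        (w.1, flowMap (moserField (pbForm σ.form (Ψ w.1))) w.2)) (p, (x, 0)) :=
      continuousAt_fst.prodMk (hB.smooth_flowMap x).continuousAt
    rw [ContinuousAt, hB.flowMap_base x] at hc
    filter_upwards [hB.pullback_flowMap x, (hB.smooth_flowMap x).eventually,
      hc.eventually (H.smooth x).eventually] with w hw h1 h2
    refine ContinuousLinearMap.ext fun u => ContinuousLinearMap.ext fun v => ?_
    rw [← hw u v]
    exact pbForm_comp ((MNear.snd_of_prod (f := Ψ) h2).contMDiffAt.mdifferentiableAt (by simp))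
      (SmoothNear.snd_of_prod (f := fun q z => flowMap (moserField (pbForm σ.form (Ψ q))) z)
        h1).differentiableAt u v

end MoserCorrect

/-! ### Symplectic coordinates near a Lagrangian torus. -/

section Tube

variable {n m : ℕ} {M : Type*} [TopologicalSpace M] [ChartedSpace (Euc m) M]
  [IsManifold (𝓡 m) ∞ M]

/-- A parametrization of a neighbourhood of a torus with prescribed normal derivative, obtained by
moving successively in charts. -/
def fibreMap (σ : SymplecticForm m M) (χ : M → M → ℝ) (h : Euc n → M) : List M →
    Euc n × Euc n → M
  | [] => fun z => h z.1
  | j :: l => fibreStep σ j (χ j) h (fibreMap σ χ h l)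

/-- The linear shear that makes the fibres of `Φ` isotropic along the zero section. -/
def shear (σ : SymplecticForm m M) (Φ : Euc n × Euc n → M) (x : Euc n) : Euc n →L[ℝ] Euc n :=
  -((1 / 2 : ℝ) • ((innerL (n := n)).inverse ∘L
    ((pbForm σ.form Φ (x, 0)).bilinearComp (.inr ℝ _ _) (.inr ℝ _ _))))

variable {σ : SymplecticForm m M} {χ : M → M → ℝ}
  {P : Type} [NormedAddCommGroup P] [NormedSpace ℝ P] {h : P → Euc n → M}
  {Φ : P → Euc n × Euc n → M} {p : P}

theorem isTubeFamily_fibreMap (H : IsTorusFamily σ h p)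
    (hχ : ∀ j, tsupport (χ j) ⊆ (chartAt (Euc m) j).source)
    (hχs : ∀ j, ContMDiff (𝓡 m) 𝓘(ℝ, ℝ) ∞ (χ j)) (l : List M) :
    IsTubeFamily m h (fun q => fibreMap σ χ (h q) l) p := by
  induction l with
  | nil =>
    refine ⟨fun x => ?_, fun x => rfl, fun q z k => H.periodic q _ _⟩
    exact MNear.comp (f := fun w : P × Euc n => h w.1 w.2)
      (g := fun w : P × (Euc n × Euc n) => (w.1, w.2.1)) (H.smooth x)
      (smoothNear_of_contDiff (by fun_prop) _)
  | cons j l ih =>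
    refine ⟨fun x => ?_, fun x => fibreStep_zero (hχ j) x (ih.base x),
      fun q z k => fibreStep_add_lat (H.periodic q) (ih.periodic q) z k⟩
    exact mNear_fibreStep (Φ := fun q => fibreMap σ χ (h q) l) H (hχ j) (hχs j) x (ih.smooth x)
      (ih.base x)

/-- With no charts used the map ignores r, so the pairing is zero. Each fibre step then adds its own
cutoff times the inner product. -/
theorem pbForm_fibreMap (H : IsTorusFamily σ h p)
    (hχ : ∀ j, tsupport (χ j) ⊆ (chartAt (Euc m) j).source)
    (hχs : ∀ j, ContMDiff (𝓡 m) 𝓘(ℝ, ℝ) ∞ (χ j)) (l : List M) (x k v : Euc n) :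
    pbForm σ.form (fibreMap σ χ (h p) l) (x, 0) (k, 0) (0, v) =
      (l.map fun j => χ j (h p x)).sum * inner ℝ k v := by
  induction l with
  | nil =>
    have h1 : MNear m (h p) x := MNear.snd_of_prod (H.smooth x)
    have := pbForm_comp (σ := σ.form) (Ψ := h p) (G := fun z : Euc n × Euc n => z.1) (z := (x, 0))
      (h1.contMDiffAt.mdifferentiableAt (by simp)) differentiableAt_fst (k, 0) (0, v)
    rw [H.lagrangian] at this
    simpa [fibreMap] using this
  | cons j l ih =>
    have h1 := isTubeFamily_fibreMap H hχ hχs l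
    rw [fibreMap, pbForm_fibreStep (Φ := fun q => fibreMap σ χ (h q) l) H (hχ j) (hχs j) x
      (h1.smooth x) h1.base, ih, List.map_cons, List.sum_cons]
    ring

theorem IsTubeFamily.pbForm_horizontal (H : IsTorusFamily σ h p) (hΦ : IsTubeFamily m h Φ p)
    (x k l : Euc n) : pbForm σ.form (Φ p) (x, 0) (k, 0) (l, 0) = 0 := by
  have e : (fun x => Φ p (x, 0)) = h p := funext hΦ.base
  have d := hasFDerivAt_prodMk_left (𝕜 := ℝ) x (0 : Euc n)
  have := pbForm_comp (σ := σ.form) (Ψ := Φ p) (G := fun x : Euc n => (x, (0 : Euc n))) (z := x)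
    ((hΦ.smooth_right x).contMDiffAt.mdifferentiableAt (by simp)) d.differentiableAt k l
  rw [e, H.lagrangian, d.fderiv] at this
  exact this.symm

theorem inner_shear (Φ : Euc n × Euc n → M) (x l l' : Euc n) :
    inner ℝ (shear σ Φ x l) l' = -(1 / 2) * pbForm σ.form Φ (x, 0) (0, l) (0, l') := by
  rw [shear]
  simp only [_root_.neg_apply, _root_.smul_apply, ContinuousLinearMap.comp_apply, inner_neg_left,
    inner_smul_left, inner_inverse_innerL]
  simp

/-- The tube parametrization corrected by the shear. -/
def shearMap (σ : SymplecticForm m M) (Φ : Euc n × Euc n → M) (z : Euc n × Euc n) : M :=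
  Φ (z.1 + shear σ Φ z.1 z.2, z.2)

theorem IsTubeFamily.smoothNear_shear (hΦ : IsTubeFamily m h Φ p) (x : Euc n) :
    SmoothNear (fun w : P × Euc n => shear σ (Φ w.1) w.2) (p, x) := by
  have h1 := SmoothNear.comp (g := fun w : P × (Euc n × Euc n) => pbForm σ.form (Φ w.1) w.2)
    (f := fun w : P × Euc n => (w.1, (w.2, 0))) (x := (p, x))
    (smoothNear_pbForm σ (hΦ.smooth x)) (smoothNear_of_contDiff (by fun_prop) _)
  have h2 : SmoothNear (fun w : P × Euc n => (pbForm σ.form (Φ w.1) (w.2, 0)).bilinearComp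
      (.inr ℝ (Euc n) (Euc n)) (.inr ℝ (Euc n) (Euc n))) (p, x) := by
    refine smoothNear_clm_apply_iff.2 fun k => smoothNear_clm_apply_iff.2 fun l => ?_
    exact (h1.clm_apply (smoothNear_const _ _)).clm_apply (smoothNear_const _ _)
  exact ((smoothNear_const (1 / 2 : ℝ) _).smul ((smoothNear_const _ _).clm_comp h2)).neg

theorem IsTubeFamily.smoothNear_shearArg (hΦ : IsTubeFamily m h Φ p) (x : Euc n) :
    SmoothNear (fun w : P × (Euc n × Euc n) => (w.2.1 + shear σ (Φ w.1) w.2.1 w.2.2, w.2.2))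
      (p, (x, 0)) := by
  have h1 : SmoothNear (fun w : P × (Euc n × Euc n) => shear σ (Φ w.1) w.2.1) (p, (x, 0)) :=
    SmoothNear.comp (g := fun w : P × Euc n => shear σ (Φ w.1) w.2)
      (f := fun w : P × (Euc n × Euc n) => (w.1, w.2.1)) (hΦ.smoothNear_shear x)
      (smoothNear_of_contDiff (by fun_prop) _)
  exact ((smoothNear_of_contDiff (by fun_prop) _).add
    (h1.clm_apply (smoothNear_of_contDiff (by fun_prop) _))).prodMk
      (smoothNear_of_contDiff (by fun_prop) _)

theorem IsTubeFamily.shearMap (hΦ : IsTubeFamily m h Φ p) :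
    IsTubeFamily m h (fun q => KAMBirkhoff.shearMap σ (Φ q)) p where
  smooth x := by
    refine MNear.comp_of_eq (f := fun w : P × (Euc n × Euc n) => Φ w.1 w.2) (g := fun
      w : P × (Euc n × Euc n) => (w.1, (w.2.1 + shear σ (Φ w.1) w.2.1 w.2.2, w.2.2)))
      (hΦ.smooth x) ((smoothNear_of_contDiff contDiff_fst _).prodMk (hΦ.smoothNear_shearArg x)) ?_
    simp
  base x := by simp [KAMBirkhoff.shearMap, hΦ.base]
  periodic q z k := by
    have e : shear σ (Φ q) (z.1 + lat k) = shear σ (Φ q) z.1 := by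
      have := pbForm_add_of_periodic (σ := σ.form) (fun z => hΦ.periodic q z k) (z.1, 0)
      simp only [Prod.mk_add_mk, add_zero] at this
      rw [shear, this, shear]
    simp only [KAMBirkhoff.shearMap, Prod.fst_add, Prod.snd_add, add_zero, e]
    refine Eq.trans ?_ (hΦ.periodic q (z.1 + shear σ (Φ q) z.1 z.2, z.2) k)
    congr 1
    ext1 <;> simp [add_right_comm]

/-- On r = 0 the angle directions are isotropic and pair with the actions in the standard way. The
shear subtracts half of the fibre form in each argument; by antisymmetry the two halves cancel it.
-/
theorem IsTubeFamily.pbForm_shearMap (H : IsTorusFamily σ h p) (hΦ : IsTubeFamily m h Φ p)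
    (hpair : ∀ x k l, pbForm σ.form (Φ p) (x, 0) (k, 0) (0, l) = inner ℝ k l) (x : Euc n) :
    pbForm σ.form (KAMBirkhoff.shearMap σ (Φ p)) (x, 0) = w0 := by
  refine ContinuousLinearMap.ext fun u => ContinuousLinearMap.ext fun v => ?_
  have hs : SmoothNear (fun x => shear σ (Φ p) x) x :=
    SmoothNear.snd_of_prod (f := fun q x => shear σ (Φ q) x) (hΦ.smoothNear_shear x)
  have d1 : HasFDerivAt (fun z : Euc n × Euc n => shear σ (Φ p) z.1)
      (fderiv ℝ (fun x => shear σ (Φ p) x) x ∘L .fst ℝ _ _) (x, 0) :=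
    HasFDerivAt.comp (g := fun x => shear σ (Φ p) x) (f := Prod.fst) (x, (0 : Euc n))
      hs.differentiableAt.hasFDerivAt hasFDerivAt_fst
  have d := ((hasFDerivAt_fst (𝕜 := ℝ) (p := (x, (0 : Euc n)))).add
    (d1.clm_apply hasFDerivAt_snd)).prodMk (hasFDerivAt_snd (𝕜 := ℝ) (p := (x, (0 : Euc n))))
  have e0 : (x + shear σ (Φ p) x 0, (0 : Euc n)) = (x, 0) := by simp
  have hpb := pbForm_comp (σ := σ.form) (Ψ := Φ p)
    (G := fun z : Euc n × Euc n => (z.1 + shear σ (Φ p) z.1 z.2, z.2)) (z := (x, 0))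
    (by beta_reduce; rw [e0]; exact (hΦ.smooth_right x).contMDiffAt.mdifferentiableAt (by simp))
    d.differentiableAt u v
  refine hpb.trans ?_
  have ed : ∀ u : Euc n × Euc n, fderiv ℝ (fun z : Euc n × Euc n =>
      (z.1 + shear σ (Φ p) z.1 z.2, z.2)) (x, 0) u =
        (u.1 + shear σ (Φ p) x u.2, 0) + (0, u.2) := by
    intro u
    refine (DFunLike.congr_fun (HasFDerivAt.fderiv d) u).trans ?_
    simp
  rw [ed, ed]
  beta_reduce
  rw [e0]
  simp only [map_add, _root_.add_apply]
  rw [hΦ.pbForm_horizontal H, hpair, pbForm_antisymm _ _ (0, u.2), hpair]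
  have e1 := inner_shear (σ := σ) (Φ p) x u.2 v.2
  have e2 := inner_shear (σ := σ) (Φ p) x v.2 u.2
  rw [pbForm_antisymm] at e2
  rw [inner_add_left, inner_add_left, w0_apply, real_inner_comm v.1 u.2]
  linarith

/-- Symplectic coordinates near a torus. -/
def tubeMap (σ : SymplecticForm m M) (χ : M → M → ℝ) (l : List M) (h : Euc n → M) :
    Euc n × Euc n → M :=
  moserCorrect σ (shearMap σ (fibreMap σ χ h l))

/-- The three constructions are combined here. For fixed χ and l, `tubeMap` depends on the parameter
only through h, so statements made near different parameters concern the same coordinates. -/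
theorem isSymplecticTube_tubeMap [CompleteSpace P] (H : ∀ᶠ q in 𝓝 p, IsTorusFamily σ h q)
    (hχ : ∀ j, tsupport (χ j) ⊆ (chartAt (Euc m) j).source)
    (hχs : ∀ j, ContMDiff (𝓡 m) 𝓘(ℝ, ℝ) ∞ (χ j)) {l : List M}
    (hl : ∀ y, (l.map fun j => χ j y).sum = 1) :
    IsSymplecticTube σ h (fun q => tubeMap σ χ l (h q)) p := by
  have h1 : ∀ q, IsTorusFamily σ h q → IsTubeFamily m h (fun q => fibreMap σ χ (h q) l) q :=
    fun q H => isTubeFamily_fibreMap H hχ hχs l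
  have h2 : ∀ᶠ q in 𝓝 p, ∀ x, pbForm σ.form (KAMBirkhoff.shearMap σ (fibreMap σ χ (h q) l)) (x, 0) =
      w0 := by
    filter_upwards [H] with q Hq x
    refine IsTubeFamily.pbForm_shearMap (σ := σ) (Φ := fun q => fibreMap σ χ (h q) l) (p := q) Hq
      (h1 q Hq) (fun x k v => ?_) x
    rw [pbForm_fibreMap Hq hχ hχs, hl, one_mul]
  have h3 : IsTubeFamily m h (fun q => KAMBirkhoff.shearMap σ (fibreMap σ χ (h q) l)) p :=
    IsTubeFamily.shearMap (σ := σ) (Φ := fun q => fibreMap σ χ (h q) l) (h1 p H.self_of_nhds)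
  exact IsTubeFamily.moserCorrect (Ψ := fun q => KAMBirkhoff.shearMap σ (fibreMap σ χ (h q) l))
    h3 h2

theorem exists_finite_partitionOfUnity (m : ℕ) (M : Type*) [TopologicalSpace M]
    [ChartedSpace (Euc m) M] [IsManifold (𝓡 m) ∞ M] [T2Space M] [CompactSpace M] :
    ∃ (χ : M → M → ℝ) (l : List M), (∀ j, tsupport (χ j) ⊆ (chartAt (Euc m) j).source) ∧
      (∀ j, ContMDiff (𝓡 m) 𝓘(ℝ, ℝ) ∞ (χ j)) ∧ ∀ y, (l.map fun j => χ j y).sum = 1 := by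
  obtain ⟨f, hf⟩ := SmoothPartitionOfUnity.exists_isSubordinate_chartAt_source (𝓡 m) M
  have hfin := f.locallyFinite.finite_nonempty_of_compact
  refine ⟨fun j => f j, hfin.toFinset.toList, hf, fun j => (f j).contMDiff, fun y => ?_⟩
  rw [Finset.sum_map_toList, ← finsum_eq_sum_of_support_subset]
  · exact f.sum_eq_one (mem_univ y)
  · intro j hj
    exact Finset.mem_coe.2 (hfin.mem_toFinset.2 ⟨y, hj⟩)

end Tube

/-! ### Invariant tori and the graph of the return map near them. -/

section Invariant

variable {n : ℕ} {M : Type*} [TopologicalSpace M] [ChartedSpace (Euc (2 * n)) M]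
  [IsManifold (𝓡 (2 * n)) ∞ M] {σ : SymplecticForm (2 * n) M}
  {P : Type} [NormedAddCommGroup P] [NormedSpace ℝ P] {h : P → Euc n → M}
  {g : P → M → M} {α : Euc n} {Ψ : P → Euc n × Euc n → M} {p : P}

/-- A smooth family of embedded Lagrangian tori, invariant under the maps `g q`, which act on them
as the rotation by `α`. -/
structure IsInvariantFamily (σ : SymplecticForm (2 * n) M) (h : P → Euc n → M) (g : P → M → M)
    (α : Euc n) (p : P) : Prop extends IsTorusFamily σ h p where
  smooth_map : ∀ᶠ q in 𝓝 p, ∀ y, ContMDiffAt (𝓘(ℝ, P).prod (𝓡 (2 * n))) (𝓡 (2 * n)) ∞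
    (fun w : P × M => g w.1 w.2) (q, y)
  injective : ∀ q x y, h q x = h q y → ∃ k, y = x + lat k
  conj : ∀ q x, g q (h q x) = h q (x + α)

theorem IsInvariantFamily.mNear_comp {X : Type} [NormedAddCommGroup X] [NormedSpace ℝ X]
    (H : IsInvariantFamily σ h g α p) {u : X → P} {f : X → M} {x : X} (hu : SmoothNear u x)
    (hx : u x = p) (hf : MNear (2 * n) f x) : MNear (2 * n) (fun x => g (u x) (f x)) x := by
  have h1 : ∀ᶠ y in 𝓝 x, ∀ z, ContMDiffAt (𝓘(ℝ, P).prod (𝓡 (2 * n))) (𝓡 (2 * n)) ∞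
      (fun w : P × M => g w.1 w.2) (u y, z) :=
    hu.continuousAt.eventually (by rw [hx]; exact H.smooth_map)
  filter_upwards [hu, hf, h1] with y h2 h3 h4
  exact ContMDiffAt.comp y (h4 (f y)) (h2.contMDiffAt.prodMk h3)

/-- With g the identity and α = 0, uniqueness on the graph of g becomes injectivity of the
coordinates. -/
theorem IsInvariantFamily.id (H : IsInvariantFamily σ h g α p) :
    IsInvariantFamily σ h (fun _ y => y) 0 p where
  toIsTorusFamily := H.toIsTorusFamily
  smooth_map := Eventually.of_forall fun _ _ => contMDiffAt_snd
  injective := H.injective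
  conj q x := by rw [add_zero]

/-- The map `g` in the coordinates on its domain. -/
def liftMap (g : M → M) (Ψ : Euc n × Euc n → M) (z : Euc n × Euc n) : M := g (Ψ z)

theorem IsInvariantFamily.smooth_liftMap (H : IsInvariantFamily σ h g α p)
    (hΨ : IsTubeFamily (2 * n) h Ψ p) (x : Euc n) :
    MNear (2 * n) (fun w : P × (Euc n × Euc n) => liftMap (g w.1) (Ψ w.1) w.2) (p, (x, 0)) :=
  H.mNear_comp (smoothNear_of_contDiff contDiff_fst _) rfl (hΨ.smooth x)

theorem IsInvariantFamily.liftMap_base (H : IsInvariantFamily σ h g α p)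
    (hΨ : IsTubeFamily (2 * n) h Ψ p) (x : Euc n) : liftMap (g p) (Ψ p) (x, 0) = h p (x + α) := by
  rw [liftMap, hΨ.base, H.conj]

theorem IsSymplecticTube.injective_fderiv_chart (hΨ : IsSymplecticTube σ h Ψ p) (x : Euc n) {c : M}
    (hc : h p x ∈ (chartAt (Euc (2 * n)) c).source) :
    Function.Injective (fderiv ℝ (fun z => chartAt (Euc (2 * n)) c (Ψ p z)) (x, 0)) := by
  refine (injective_iff_map_eq_zero _).2 fun u hu => ?_
  have hs := hΨ.smooth_right x
  have h0 : pbForm σ.form (Ψ p) (x, 0) = w0 := (hΨ.symplectic x).self_of_nhds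
  obtain ⟨e, he⟩ := isInvertible_w0 (n := n)
  have h1 : w0 u = 0 := by
    refine ContinuousLinearMap.ext fun v => ?_
    rw [← h0, pbForm_eq_chart (c := c) (hs.contMDiffAt.mdifferentiableAt (by simp))
      (by rw [hΨ.base]; exact hc), hu, map_zero]
    rfl
  rw [← he] at h1
  exact e.map_eq_zero_iff.1 h1

variable [CompleteSpace P]

/-- Given (x', r), solve for (x, r') by the implicit function theorem. At r = 0 only the restriction
of g to the torus enters the linearization; there g is a rotation, so the linearization is (ξ, η) ↦
DΨ (ξ, -η). It is injective because Ψ is symplectic, and the dimensions agree. No condition on the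
derivative of g transverse to the torus is needed. -/
theorem IsInvariantFamily.exists_graph (H : IsInvariantFamily σ h g α p)
    (hΨ : IsSymplecticTube σ h Ψ p) (x : Euc n) :
    ∃ ψ : P × (Euc n × Euc n) → Euc n × Euc n, SmoothNear ψ (p, (x, 0)) ∧
      ψ (p, (x, 0)) = (x - α, 0) ∧
      (∀ᶠ w in 𝓝 (p, (x, 0)), liftMap (g w.1) (Ψ w.1) ((ψ w).1, w.2.2) =
        Ψ w.1 (w.2.1, (ψ w).2)) ∧
      ∀ᶠ v in 𝓝 ((p, (x, (0 : Euc n))), (x - α, (0 : Euc n))),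
        liftMap (g v.1.1) (Ψ v.1.1) (v.2.1, v.1.2.2) = Ψ v.1.1 (v.1.2.1, v.2.2) →
          v.2 = ψ v.1 := by
  set c := chartAt (Euc (2 * n)) (h p x) with hc
  have hxs : h p x ∈ c.source := mem_chart_source _ _
  set u : (P × (Euc n × Euc n)) × (Euc n × Euc n) := ((p, (x, 0)), (x - α, 0)) with hu
  have hA : MNear (2 * n) (fun v : (P × (Euc n × Euc n)) × (Euc n × Euc n) =>
      liftMap (g v.1.1) (Ψ v.1.1) (v.2.1, v.1.2.2)) u :=
    MNear.comp (f := fun w : P × (Euc n × Euc n) => liftMap (g w.1) (Ψ w.1) w.2)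
      (g := fun v : (P × (Euc n × Euc n)) × (Euc n × Euc n) => (v.1.1, (v.2.1, v.1.2.2)))
      (H.smooth_liftMap hΨ.toIsTubeFamily (x - α)) (smoothNear_of_contDiff (by fun_prop) _)
  have hB : MNear (2 * n) (fun v : (P × (Euc n × Euc n)) × (Euc n × Euc n) =>
      Ψ v.1.1 (v.1.2.1, v.2.2)) u :=
    MNear.comp (f := fun w : P × (Euc n × Euc n) => Ψ w.1 w.2)
      (g := fun v : (P × (Euc n × Euc n)) × (Euc n × Euc n) => (v.1.1, (v.1.2.1, v.2.2)))
      (hΨ.smooth x) (smoothNear_of_contDiff (by fun_prop) _)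
  have hA0 : liftMap (g p) (Ψ p) (x - α, 0) = h p x := by
    rw [H.liftMap_base hΨ.toIsTubeFamily, sub_add_cancel]
  have hB0 : Ψ p (x, 0) = h p x := hΨ.base x
  have hcA := hA.chart (c := h p x) (by rw [hu]; beta_reduce; rw [hA0]; exact hxs)
  have hcB := hB.chart (c := h p x) (by rw [hu]; beta_reduce; rw [hB0]; exact hxs)
  have hf := hcA.sub hcB
  have hΨc : SmoothNear (fun z => c (Ψ p z)) (x, 0) :=
    (hΨ.smooth_right x).chart (c := h p x) (by rw [hB0]; exact hxs)
  have hi : (fderiv ℝ (fun v : (P × (Euc n × Euc n)) × (Euc n × Euc n) =>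
      c (liftMap (g v.1.1) (Ψ v.1.1) (v.2.1, v.1.2.2)) - c (Ψ v.1.1 (v.1.2.1, v.2.2))) u ∘L
        .inr ℝ (P × (Euc n × Euc n)) (Euc n × Euc n)).IsInvertible := by
    refine isInvertible_of_injective ?_ (by simp; ring)
    have d1 := hasFDerivAt_right (x := u.1) (y := u.2) hf.differentiableAt
    have e : (fun y : Euc n × Euc n => c (liftMap (g p) (Ψ p) (y.1, 0)) - c (Ψ p (x, y.2))) =
        fun y => c (Ψ p (y.1 + α, 0)) - c (Ψ p (x, y.2)) := by
      funext y
      rw [H.liftMap_base hΨ.toIsTubeFamily, hΨ.base]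
    have d2 : HasFDerivAt (fun y : Euc n × Euc n => c (Ψ p (y.1 + α, 0)))
        (fderiv ℝ (fun z => c (Ψ p z)) (x, 0) ∘L (.inl ℝ _ _ ∘L .fst ℝ _ _)) (x - α, 0) := by
      refine HasFDerivAt.comp (g := fun z => c (Ψ p z))
        (f := fun y : Euc n × Euc n => (y.1 + α, (0 : Euc n))) (x - α, 0) ?_ ?_
      · beta_reduce
        rw [sub_add_cancel]
        exact hΨc.differentiableAt.hasFDerivAt
      · exact ((ContinuousLinearMap.inl ℝ (Euc n) (Euc n) ∘L
          ContinuousLinearMap.fst ℝ (Euc n) (Euc n)).hasFDerivAt.add_const (α, 0)).congr_of_eventuallyEq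
          (Eventually.of_forall fun y => by simp)
    have d3 : HasFDerivAt (fun y : Euc n × Euc n => c (Ψ p (x, y.2)))
        (fderiv ℝ (fun z => c (Ψ p z)) (x, 0) ∘L (.inr ℝ _ _ ∘L .snd ℝ _ _)) (x - α, 0) := by
      refine HasFDerivAt.comp (g := fun z => c (Ψ p z))
        (f := fun y : Euc n × Euc n => (x, y.2)) (x - α, 0) ?_ ?_
      · exact hΨc.differentiableAt.hasFDerivAt
      · exact ((ContinuousLinearMap.inr ℝ (Euc n) (Euc n) ∘L
          ContinuousLinearMap.snd ℝ (Euc n) (Euc n)).hasFDerivAt.add_const (x, 0)).congr_of_eventuallyEq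
          (Eventually.of_forall fun y => by simp)
    have d4 := d2.sub d3
    have d1' : HasFDerivAt (fun y : Euc n × Euc n => c (liftMap (g p) (Ψ p) (y.1, 0)) -
      c (Ψ p (x, y.2))) _ (x - α, 0) := d1
    rw [e] at d1'
    have key := d1'.unique d4
    refine (injective_iff_map_eq_zero _).2 fun y hy => ?_
    have h1 := DFunLike.congr_fun key y
    rw [show _ = (0 : Euc (2 * n)) from hy] at h1
    have h2 : fderiv ℝ (fun z => c (Ψ p z)) (x, 0) (y.1, -y.2) = 0 := by
      rw [h1]
      simp only [_root_.sub_apply, ContinuousLinearMap.comp_apply, ← map_sub]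
      simp
    have h3 := (injective_iff_map_eq_zero _).1 (hΨ.injective_fderiv_chart x hxs) _ h2
    rw [Prod.mk_eq_zero, neg_eq_zero] at h3
    exact Prod.ext h3.1 h3.2
  obtain ⟨ψ, hψ1, hψ2, hψ3, hψ4⟩ := exists_smoothNear_implicit (W := P × (Euc n × Euc n)) hf hi
  have hfu : c (liftMap (g p) (Ψ p) (x - α, 0)) - c (Ψ p (x, 0)) = 0 := by
    rw [hA0, hB0, sub_self]
  refine ⟨ψ, hψ1, hψ2, ?_, ?_⟩
  · have ht : Tendsto (fun w => (w, ψ w)) (𝓝 (p, (x, (0 : Euc n)))) (𝓝 u) := by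
      have := continuousAt_id.prodMk hψ1.continuousAt
      rw [ContinuousAt] at this
      simp only [id_eq] at this
      rwa [hψ2] at this
    filter_upwards [hψ3, ht.eventually (hA.eventually_mem_source (c := h p x)
      (by rw [hu]; beta_reduce; rw [hA0]; exact hxs)), ht.eventually
      (hB.eventually_mem_source (c := h p x) (by rw [hu]; beta_reduce; rw [hB0]; exact hxs))]
      with w h1 h2 h3
    refine c.injOn h2 h3 (sub_eq_zero.1 (h1.trans hfu))
  · filter_upwards [hψ4] with v hv h1
    refine hv ?_
    rw [h1, sub_self]
    exact hfu.symm

end Invariant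

/-! ### The graph map as a globally defined function. -/

section GraphMap

variable {n : ℕ} {M : Type*}

/-- Points of the tube of radius `ε` with the same initial action and the same final angle under
`g` agree modulo the lattice. -/
def IsGraphUnique (g : M → M) (Ψ : Euc n × Euc n → M) (ε : ℝ) : Prop :=
  ∀ x₁ x₂ x' r r₁ r₂ : Euc n, ‖r‖ < ε → ‖r₁‖ < ε → ‖r₂‖ < ε →
    liftMap g Ψ (x₁, r) = Ψ (x', r₁) → liftMap g Ψ (x₂, r) = Ψ (x', r₂) →
      (∃ k, x₂ = x₁ + lat k) ∧ r₂ = r₁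

/-- `w = (x, r')` solves `g (Ψ (x, r)) = Ψ (x', r')`, where `z = (x', r)`, within the tube of radius
`ε`. -/
structure IsGraphPoint (g : M → M) (Ψ : Euc n × Euc n → M) (α : Euc n) (ε : ℝ)
    (z w : Euc n × Euc n) : Prop where
  eq : liftMap g Ψ (w.1, z.2) = Ψ (z.1, w.2)
  near : ‖w.1 - (z.1 - α)‖ < 1 / 2
  norm_init : ‖z.2‖ < ε
  norm_final : ‖w.2‖ < ε

/-- The map `(x', r) ↦ (x, r')` with `g (Ψ (x, r)) = Ψ (x', r')`. -/
def graphMap (g : M → M) (Ψ : Euc n × Euc n → M) (α : Euc n) (z : Euc n × Euc n) : Euc n × Euc n :=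
  open scoped Classical in
  if h : ∃ w, ∃ ε, IsGraphUnique g Ψ ε ∧ IsGraphPoint g Ψ α ε z w then h.choose else (z.1 - α, 0)

/-- Uniqueness holds modulo the lattice, and the bounds by 1/2 on both angles leave a lattice vector
of norm less than 1, which is zero. -/
theorem IsGraphUnique.eq_of_isGraphPoint {g : M → M} {Ψ : Euc n × Euc n → M} {α : Euc n}
    {ε ε' : ℝ} {z w w' : Euc n × Euc n} (hε : IsGraphUnique g Ψ ε) (h : IsGraphPoint g Ψ α ε z w)
    (hle : ε' ≤ ε) (h' : IsGraphPoint g Ψ α ε' z w') : w' = w := by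
  obtain ⟨⟨k, hk⟩, hr⟩ := hε w.1 w'.1 z.1 z.2 w.2 w'.2 h.norm_init h.norm_final
    (h'.norm_final.trans_le hle) h.eq h'.eq
  have hk0 : k = 0 := by
    refine lat_eq_zero_of_norm_lt ?_
    have e : lat k = (w'.1 - (z.1 - α)) - (w.1 - (z.1 - α)) := by rw [hk]; abel
    rw [e]
    calc _ ≤ ‖w'.1 - (z.1 - α)‖ + ‖w.1 - (z.1 - α)‖ := norm_sub_le _ _
      _ < 1 / 2 + 1 / 2 := add_lt_add h'.near h.near
      _ = 1 := by norm_num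
  rw [hk0, lat_zero, add_zero] at hk
  exact Prod.ext hk hr

theorem graphMap_eq {g : M → M} {Ψ : Euc n × Euc n → M} {α : Euc n} {ε : ℝ}
    {z w : Euc n × Euc n} (hε : IsGraphUnique g Ψ ε) (h : IsGraphPoint g Ψ α ε z w) :
    graphMap g Ψ α z = w := by
  have hex : ∃ w, ∃ ε, IsGraphUnique g Ψ ε ∧ IsGraphPoint g Ψ α ε z w := ⟨w, ε, hε, h⟩
  rw [graphMap, dif_pos hex]
  obtain ⟨ε', hε', h'⟩ := hex.choose_spec
  rcases le_total ε' ε with hle | hle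
  · exact hε.eq_of_isGraphPoint h hle h'
  · exact (hε'.eq_of_isGraphPoint h' hle h).symm

variable {g : M → M} {Ψ : Euc n × Euc n → M} {α : Euc n}

theorem liftMap_add_lat (hΨ : ∀ z k, Ψ (z + (lat k, 0)) = Ψ z) (x r : Euc n) (k : Fin n → ℤ) :
    liftMap g Ψ (x + lat k, r) = liftMap g Ψ (x, r) := by
  have := hΨ (x, r) k
  rw [Prod.mk_add_mk, add_zero] at this
  rw [liftMap, this, liftMap]

theorem IsGraphPoint.add_lat (hΨ : ∀ z k, Ψ (z + (lat k, 0)) = Ψ z) {ε : ℝ} {z w : Euc n × Euc n}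
    (h : IsGraphPoint g Ψ α ε z w) (k : Fin n → ℤ) :
    IsGraphPoint g Ψ α ε (z + (lat k, 0)) (w + (lat k, 0)) where
  eq := by
    have e := hΨ (z.1, w.2) k
    rw [Prod.mk_add_mk, add_zero] at e
    simp only [Prod.fst_add, Prod.snd_add, add_zero]
    rw [liftMap_add_lat hΨ, h.eq, e]
  near := by
    have e : w.1 + lat k - (z.1 + lat k - α) = w.1 - (z.1 - α) := by abel
    simpa only [Prod.fst_add, e] using h.near
  norm_init := by simpa using h.norm_init
  norm_final := by simpa using h.norm_final

theorem graphMap_add_lat (hΨ : ∀ z k, Ψ (z + (lat k, 0)) = Ψ z) (z : Euc n × Euc n)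
    (k : Fin n → ℤ) : graphMap g Ψ α (z + (lat k, 0)) = graphMap g Ψ α z + (lat k, 0) := by
  by_cases h : ∃ w, ∃ ε, IsGraphUnique g Ψ ε ∧ IsGraphPoint g Ψ α ε z w
  · obtain ⟨w, ε, h1, h2⟩ := h
    rw [graphMap_eq h1 h2, graphMap_eq h1 (h2.add_lat hΨ k)]
  · have h' : ¬ ∃ w, ∃ ε, IsGraphUnique g Ψ ε ∧ IsGraphPoint g Ψ α ε (z + (lat k, 0)) w := by
      rintro ⟨w, ε, h1, h2⟩
      refine h ⟨w + (lat (-k), 0), ε, h1, ?_⟩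
      have := h2.add_lat hΨ (-k)
      rwa [show z + (lat k, (0 : Euc n)) + (lat (-k), 0) = z by ext1 <;> simp [lat_neg]] at this
    rw [graphMap, graphMap, dif_neg h, dif_neg h']
    -- The default value (z.1 - α, 0) is itself equivariant, so no assumption on z is needed.
    ext1 <;> simp [add_sub_right_comm]

end GraphMap

/-! ### Smoothness of the graph map and uniform tubes. -/

section GraphFamily

variable {n : ℕ} {M : Type*} [TopologicalSpace M] [ChartedSpace (Euc (2 * n)) M]
  [IsManifold (𝓡 (2 * n)) ∞ M] {σ : SymplecticForm (2 * n) M}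
  {P : Type} [NormedAddCommGroup P] [NormedSpace ℝ P] {h : P → Euc n → M}
  {g : P → M → M} {α : Euc n} {Ψ : P → Euc n × Euc n → M} {p : P} [CompleteSpace P] [T2Space M]

/-- If one of the two points of the torus is not sent to that with angle x', then the Hausdorff
property excludes the corresponding equation nearby. Otherwise both initial angles are lattice
translates of x' - α, and local uniqueness of the implicit function compares them. -/
theorem IsInvariantFamily.eventually_graph_unique (H : IsInvariantFamily σ h g α p)
    (hΨ : IsSymplecticTube σ h Ψ p) (x₁ x₂ x' : Euc n) :
    ∀ᶠ w : P × ((Euc n × Euc n × Euc n) × (Euc n × Euc n × Euc n)) in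
      𝓝 (p, ((x₁, x₂, x'), 0)),
      liftMap (g w.1) (Ψ w.1) (w.2.1.1, w.2.2.1) = Ψ w.1 (w.2.1.2.2, w.2.2.2.1) →
      liftMap (g w.1) (Ψ w.1) (w.2.1.2.1, w.2.2.1) = Ψ w.1 (w.2.1.2.2, w.2.2.2.2) →
      (∃ k, w.2.1.2.1 = w.2.1.1 + lat k) ∧ w.2.2.2.2 = w.2.2.2.1 := by
  have cA : ∀ x, ContinuousAt (fun w : P × (Euc n × Euc n) => liftMap (g w.1) (Ψ w.1) w.2)
      (p, (x, 0)) := fun x => (H.smooth_liftMap hΨ.toIsTubeFamily x).continuousAt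
  have cB : ∀ x, ContinuousAt (fun w : P × (Euc n × Euc n) => Ψ w.1 w.2) (p, (x, 0)) :=
    fun x => (hΨ.smooth x).continuousAt
  have hcase : ∀ {y : Euc n} {f : P × ((Euc n × Euc n × Euc n) × (Euc n × Euc n × Euc n)) →
      (P × (Euc n × Euc n)) × (P × (Euc n × Euc n))},
      Continuous f → f (p, ((x₁, x₂, x'), 0)) = ((p, (y, 0)), (p, (x', 0))) →
      h p (y + α) ≠ h p x' → ∀ᶠ w in 𝓝 (p, ((x₁, x₂, x'), 0)),
        liftMap (g (f w).1.1) (Ψ (f w).1.1) (f w).1.2 ≠ Ψ (f w).2.1 (f w).2.2 := by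
    intro y f hf hfe hne
    have h1 := (ContinuousAt.comp_of_eq (f := fun w => (f w).1) (cA y)
      (x := (p, ((x₁, x₂, x'), 0))) (by fun_prop) (by rw [hfe]))
    have h2 := (ContinuousAt.comp_of_eq (f := fun w => (f w).2) (cB x')
      (x := (p, ((x₁, x₂, x'), 0))) (by fun_prop) (by rw [hfe]))
    refine ((h1.prodMk h2).eventually_mem (isClosed_diagonal.isOpen_compl.mem_nhds ?_)).mono
      fun w hw => hw
    simp only [Function.comp_apply, hfe, mem_compl_iff, mem_diagonal_iff]
    rwa [H.liftMap_base hΨ.toIsTubeFamily, hΨ.base]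
  by_cases h1 : h p (x₁ + α) = h p x'
  swap
  · filter_upwards [hcase (f := fun w => ((w.1, (w.2.1.1, w.2.2.1)),
      (w.1, (w.2.1.2.2, w.2.2.2.1)))) (by fun_prop) rfl h1] with w hw hw1
    exact absurd hw1 hw
  by_cases h2 : h p (x₂ + α) = h p x'
  swap
  · filter_upwards [hcase (f := fun w => ((w.1, (w.2.1.2.1, w.2.2.1)),
      (w.1, (w.2.1.2.2, w.2.2.2.2)))) (by fun_prop) rfl h2] with w hw _ hw2
    exact absurd hw2 hw
  obtain ⟨k₁, hk₁⟩ := H.injective p _ _ h1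
  obtain ⟨k₂, hk₂⟩ := H.injective p _ _ h2
  obtain ⟨ψ, -, -, -, hψ⟩ := H.exists_graph hΨ x'
  have hlim : ∀ {y : Euc n} {f : P × ((Euc n × Euc n × Euc n) × (Euc n × Euc n × Euc n)) →
      (P × (Euc n × Euc n)) × (Euc n × Euc n)}, Continuous f →
      f (p, ((x₁, x₂, x'), 0)) = ((p, (x', 0)), (x' - α, 0)) →
      ∀ᶠ w in 𝓝 (p, ((x₁, x₂, x'), 0)), liftMap (g (f w).1.1) (Ψ (f w).1.1)
        ((f w).2.1, (f w).1.2.2) = Ψ (f w).1.1 ((f w).1.2.1, (f w).2.2) → (f w).2 = ψ (f w).1 := by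
    intro y f hf hfe
    exact (hf.tendsto' _ _ hfe).eventually hψ
  filter_upwards [hlim (y := 0) (f := fun w => ((w.1, (w.2.1.2.2, w.2.2.1)),
      (w.2.1.1 + lat k₁, w.2.2.2.1))) (by fun_prop) (by rw [hk₁]; simp; abel),
    hlim (y := 0) (f := fun w => ((w.1, (w.2.1.2.2, w.2.2.1)),
      (w.2.1.2.1 + lat k₂, w.2.2.2.2))) (by fun_prop) (by
        change ((p, (x', (0 : Euc n))), (x₂ + lat k₂, (0 : Euc n))) = _
        rw [hk₂]; simp; abel)]
    with w hw1 hw2 e1 e2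
  have a1 := hw1 (by rw [liftMap_add_lat (hΨ.periodic w.1)]; exact e1)
  have a2 := hw2 (by rw [liftMap_add_lat (hΨ.periodic w.1)]; exact e2)
  have a3 := a1.trans a2.symm
  rw [Prod.mk.injEq] at a3
  refine ⟨⟨k₁ - k₂, ?_⟩, a3.2.symm⟩
  rw [lat_sub, add_sub, a3.1, add_sub_cancel_right]

theorem IsInvariantFamily.exists_isGraphUnique (H : IsInvariantFamily σ h g α p)
    (hΨ : IsSymplecticTube σ h Ψ p) :
    ∃ ε > 0, ∀ᶠ q in 𝓝 p, IsGraphUnique (g q) (Ψ q) ε := by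
  obtain ⟨ε, hε, h1⟩ := exists_uniform_tube_of_isCompact (p := p)
    (isCompact_unitCube.prod (isCompact_unitCube.prod isCompact_unitCube))
    (K := unitCube n ×ˢ unitCube n ×ˢ unitCube n)
    (G := fun q (y : Euc n × Euc n × Euc n) (w : Euc n × Euc n × Euc n) =>
      liftMap (g q) (Ψ q) (y.1, w.1) = Ψ q (y.2.2, w.2.1) →
      liftMap (g q) (Ψ q) (y.2.1, w.1) = Ψ q (y.2.2, w.2.2) →
      (∃ k, y.2.1 = y.1 + lat k) ∧ w.2.2 = w.2.1)
    (fun y => by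
      obtain ⟨k₁, h1⟩ := exists_add_lat_mem_unitCube y.1
      obtain ⟨k₂, h2⟩ := exists_add_lat_mem_unitCube y.2.1
      obtain ⟨k₃, h3⟩ := exists_add_lat_mem_unitCube y.2.2
      refine ⟨(y.1 + lat k₁, y.2.1 + lat k₂, y.2.2 + lat k₃), ⟨h1, h2, h3⟩, ?_⟩
      intro q w hG e1 e2
      have e : ∀ r, Ψ q (y.2.2 + lat k₃, r) = Ψ q (y.2.2, r) := fun r => by
        have := hΨ.periodic q (y.2.2, r) k₃
        rwa [Prod.mk_add_mk, add_zero] at this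
      obtain ⟨⟨k, hk⟩, hr⟩ := hG
        (by simp only [liftMap_add_lat (hΨ.periodic q), e]; exact e1)
        (by simp only [liftMap_add_lat (hΨ.periodic q), e]; exact e2)
      refine ⟨⟨k - (k₂ - k₁), ?_⟩, hr⟩
      simp only [lat_sub]
      simp only at hk
      rw [eq_sub_of_add_eq hk]
      abel)
    (fun y _ => H.eventually_graph_unique hΨ y.1 y.2.1 y.2.2)
  refine ⟨ε, hε, h1.mono fun q hq x₁ x₂ x' r r₁ r₂ hr hr₁ hr₂ e1 e2 => ?_⟩
  refine hq (x₁, x₂, x') (r, r₁, r₂) ?_ e1 e2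
  simp only [Prod.norm_def]
  exact max_lt hr (max_lt hr₁ hr₂)

/-- Uniqueness in a tube identifies the local implicit function with the globally defined
`graphMap`, which inherits its smoothness. The radius below δ records that the final action is
strictly inside the tube. -/
theorem IsInvariantFamily.graph_local (H : IsInvariantFamily σ h g α p)
    (hΨ : IsSymplecticTube σ h Ψ p) (x : Euc n) {δ : ℝ} (hδ : 0 < δ) :
    SmoothNear (fun w : P × (Euc n × Euc n) => graphMap (g w.1) (Ψ w.1) α w.2) (p, (x, 0)) ∧
      graphMap (g p) (Ψ p) α (x, 0) = (x - α, 0) ∧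
      ∀ᶠ w in 𝓝 (p, (x, (0 : Euc n))), ∃ ε < δ, IsGraphUnique (g w.1) (Ψ w.1) ε ∧
        IsGraphPoint (g w.1) (Ψ w.1) α ε w.2 (graphMap (g w.1) (Ψ w.1) α w.2) := by
  obtain ⟨ε, hε, hU⟩ := H.exists_isGraphUnique hΨ
  obtain ⟨ψ, hψ1, hψ2, hψ3, -⟩ := H.exists_graph hΨ x
  set η := min ε (δ / 2) with hη
  have hη0 : 0 < η := lt_min hε (half_pos hδ)
  have hηδ : η < δ := (min_le_right _ _).trans_lt (half_lt_self hδ)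
  have hUη : ∀ᶠ q in 𝓝 p, IsGraphUnique (g q) (Ψ q) η := hU.mono
    fun q hq x₁ x₂ x' r r₁ r₂ hr hr₁ hr₂ => hq x₁ x₂ x' r r₁ r₂ (hr.trans_le (min_le_left _ _))
      (hr₁.trans_le (min_le_left _ _)) (hr₂.trans_le (min_le_left _ _))
  have h1 : ∀ᶠ w in 𝓝 (p, (x, (0 : Euc n))), IsGraphUnique (g w.1) (Ψ w.1) η :=
    (continuous_fst.tendsto (p, (x, (0 : Euc n)))).eventually hUη
  have c1 : ContinuousAt (fun w : P × (Euc n × Euc n) => ‖(ψ w).1 - (w.2.1 - α)‖) (p, (x, 0)) := by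
    have := hψ1.continuousAt
    fun_prop
  have c2 : ContinuousAt (fun w : P × (Euc n × Euc n) => ‖w.2.2‖) (p, (x, 0)) := by fun_prop
  have c3 : ContinuousAt (fun w : P × (Euc n × Euc n) => ‖(ψ w).2‖) (p, (x, 0)) := by
    have := hψ1.continuousAt
    fun_prop
  have key : ∀ᶠ w in 𝓝 (p, (x, (0 : Euc n))), IsGraphUnique (g w.1) (Ψ w.1) η ∧
      IsGraphPoint (g w.1) (Ψ w.1) α η w.2 (ψ w) := by
    filter_upwards [h1, hψ3, c1.tendsto.eventually_lt_const (u := 1 / 2) (by simp [hψ2]),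
      c2.tendsto.eventually_lt_const (u := η) (by simpa using hη0),
      c3.tendsto.eventually_lt_const (u := η) (by simpa [hψ2] using hη0)] with w a1 a2 a3 a4 a5
    exact ⟨a1, a2, a3, a4, a5⟩
  have heq : ∀ᶠ w in 𝓝 (p, (x, (0 : Euc n))), ψ w = graphMap (g w.1) (Ψ w.1) α w.2 :=
    key.mono fun w hw => (graphMap_eq hw.1 hw.2).symm
  refine ⟨hψ1.congr heq, heq.self_of_nhds.symm.trans hψ2, ?_⟩
  filter_upwards [key, heq] with w hw hw2
  rw [← hw2]
  exact ⟨η, hηδ, hw⟩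

theorem IsInvariantFamily.smoothNear_graphMap (H : IsInvariantFamily σ h g α p)
    (hΨ : IsSymplecticTube σ h Ψ p) (x : Euc n) :
    SmoothNear (fun w : P × (Euc n × Euc n) => graphMap (g w.1) (Ψ w.1) α w.2) (p, (x, 0)) :=
  (H.graph_local hΨ x one_pos).1

theorem IsInvariantFamily.graphMap_base (H : IsInvariantFamily σ h g α p)
    (hΨ : IsSymplecticTube σ h Ψ p) (x : Euc n) : graphMap (g p) (Ψ p) α (x, 0) = (x - α, 0) :=
  (H.graph_local hΨ x one_pos).2.1

theorem IsInvariantFamily.liftMap_graphMap (H : IsInvariantFamily σ h g α p)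
    (hΨ : IsSymplecticTube σ h Ψ p) (x : Euc n) :
    ∀ᶠ w in 𝓝 (p, (x, (0 : Euc n))),
      liftMap (g w.1) (Ψ w.1) ((graphMap (g w.1) (Ψ w.1) α w.2).1, w.2.2) =
        Ψ w.1 (w.2.1, (graphMap (g w.1) (Ψ w.1) α w.2).2) :=
  (H.graph_local hΨ x one_pos).2.2.mono fun _ ⟨_, _, _, hw⟩ => hw.eq

/-- In a tube that is uniform in the parameter, the graph of `g` is described by `graphMap`. -/
theorem IsInvariantFamily.exists_graph_tube (H : IsInvariantFamily σ h g α p)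
    (hΨ : IsSymplecticTube σ h Ψ p) :
    ∃ ε > 0, ∀ᶠ q in 𝓝 p, ∀ x' r, ‖r‖ < ε →
      ∀ x r', ‖r'‖ < ε → (liftMap (g q) (Ψ q) (x, r) = Ψ q (x', r') ↔
        (∃ k, (graphMap (g q) (Ψ q) α (x', r)).1 = x + lat k) ∧
          (graphMap (g q) (Ψ q) α (x', r)).2 = r') := by
  obtain ⟨ε, hε, hU⟩ := H.exists_isGraphUnique hΨ
  have h1 : ∀ x, ∀ᶠ w in 𝓝 (p, (x, (0 : Euc n))), IsGraphUnique (g w.1) (Ψ w.1) ε ∧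
      ∃ η < ε, IsGraphUnique (g w.1) (Ψ w.1) η ∧
        ∃ y, IsGraphPoint (g w.1) (Ψ w.1) α η w.2 y := fun x => by
    filter_upwards [(H.graph_local hΨ x hε).2.2,
      (continuous_fst.tendsto (p, (x, (0 : Euc n)))).eventually hU]
      with w ⟨η, h1, h2, h3⟩ h4
    exact ⟨h4, η, h1, h2, _, h3⟩
  obtain ⟨ε', hε', h2⟩ := exists_uniform_tube (p := p) (G := fun q x' r =>
    IsGraphUnique (g q) (Ψ q) ε ∧ ∃ η < ε, IsGraphUnique (g q) (Ψ q) η ∧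
        ∃ y, IsGraphPoint (g q) (Ψ q) α η (x', r) y)
    (fun q x' r k ⟨a, η, b, c, y, d⟩ => ⟨a, η, b, c, y + (lat (-k), 0), by
      have := d.add_lat (hΨ.periodic q) (-k)
      simpa [lat_neg] using this⟩) h1
  refine ⟨min ε ε', lt_min hε hε', h2.mono fun q hq x' r hr => ?_⟩
  obtain ⟨hUε, η, hηε, hη, y, hy⟩ := hq x' r (hr.trans_le (min_le_right _ _))
  have e := graphMap_eq hη hy
  intro x r' hr'
  rw [e]
  constructor
  · intro hg
    exact hUε x y.1 x' r r' y.2 (hr.trans_le (min_le_left _ _))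
      (hr'.trans_le (min_le_left _ _)) (hy.norm_final.trans hηε) hg hy.eq
  · rintro ⟨⟨k, hk⟩, rfl⟩
    have := hy.eq
    simp only at this
    rwa [hk, liftMap_add_lat (hΨ.periodic q)] at this

/-- Apply uniqueness for the identity map to the given coincidence and to the trivial one Ψ (x', r)
= Ψ (x', r), which have the same initial action and final angle. -/
theorem IsInvariantFamily.exists_injective_tube (H : IsInvariantFamily σ h g α p)
    (hΨ : IsSymplecticTube σ h Ψ p) :
    ∃ ε > 0, ∀ᶠ q in 𝓝 p, ∀ x r x' r', ‖r‖ < ε → ‖r'‖ < ε → Ψ q (x, r) = Ψ q (x', r') →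
      (∃ k, x' = x + lat k) ∧ r' = r := by
  obtain ⟨ε, hε, hU⟩ := H.id.exists_isGraphUnique hΨ
  refine ⟨ε, hε, hU.mono fun q hq x r x' r' hr hr' e => ?_⟩
  obtain ⟨hk, h2⟩ := hq x x' x' r r' r hr hr' hr e rfl
  exact ⟨hk, h2.symm⟩

end GraphFamily

/-! ### Partial gradients and estimates along nearby curves. -/

section GradParts

variable {n : ℕ}

/-- The vector representing a linear form. -/
def sharp : (Euc n →L[ℝ] ℝ) →L[ℝ] Euc n := (innerL (n := n)).inverse

theorem inner_sharp (f : Euc n →L[ℝ] ℝ) (v : Euc n) : inner ℝ (sharp f) v = f v :=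
  inner_inverse_innerL f v

theorem sharp_eq_iff {f : Euc n →L[ℝ] ℝ} {y : Euc n} :
    sharp f = y ↔ ∀ v, f v = inner ℝ y v := by
  refine ⟨fun h v => by rw [← h, inner_sharp], fun h => ?_⟩
  refine ext_inner_right ℝ fun v => ?_
  rw [inner_sharp, h]

/-- The gradient with respect to the first variable. -/
def gradFst (u : Euc n × Euc n → ℝ) (z : Euc n × Euc n) : Euc n :=
  sharp (fderiv ℝ u z ∘L .inl ℝ _ _)

/-- The gradient with respect to the second variable. -/
def gradSnd (u : Euc n × Euc n → ℝ) (z : Euc n × Euc n) : Euc n :=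
  sharp (fderiv ℝ u z ∘L .inr ℝ _ _)

theorem inner_gradFst (u : Euc n × Euc n → ℝ) (z : Euc n × Euc n) (v : Euc n) :
    inner ℝ (gradFst u z) v = fderiv ℝ u z (v, 0) := inner_sharp _ _

theorem inner_gradSnd (u : Euc n × Euc n → ℝ) (z : Euc n × Euc n) (v : Euc n) :
    inner ℝ (gradSnd u z) v = fderiv ℝ u z (0, v) := inner_sharp _ _

variable {P : Type} [NormedAddCommGroup P] [NormedSpace ℝ P]

theorem SmoothNear.gradFst {u : P → Euc n × Euc n → ℝ} {p : P} {z : Euc n × Euc n}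
    (h : SmoothNear (fun w : P × (Euc n × Euc n) => u w.1 w.2) (p, z)) :
    SmoothNear (fun w : P × (Euc n × Euc n) => KAMBirkhoff.gradFst (u w.1) w.2) (p, z) :=
  (smoothNear_const sharp _).clm_apply
    ((SmoothNear.partial_snd h).clm_comp (smoothNear_const _ _))

theorem SmoothNear.gradSnd {u : P → Euc n × Euc n → ℝ} {p : P} {z : Euc n × Euc n}
    (h : SmoothNear (fun w : P × (Euc n × Euc n) => u w.1 w.2) (p, z)) :
    SmoothNear (fun w : P × (Euc n × Euc n) => KAMBirkhoff.gradSnd (u w.1) w.2) (p, z) :=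
  (smoothNear_const sharp _).clm_apply
    ((SmoothNear.partial_snd h).clm_comp (smoothNear_const _ _))

theorem SmoothNear.gradFst' {u : Euc n × Euc n → ℝ} {z : Euc n × Euc n} (h : SmoothNear u z) :
    SmoothNear (KAMBirkhoff.gradFst u) z :=
  (smoothNear_const sharp _).clm_apply (h.fderiv.clm_comp (smoothNear_const _ _))

theorem SmoothNear.gradSnd' {u : Euc n × Euc n → ℝ} {z : Euc n × Euc n} (h : SmoothNear u z) :
    SmoothNear (KAMBirkhoff.gradSnd u) z :=
  (smoothNear_const sharp _).clm_apply (h.fderiv.clm_comp (smoothNear_const _ _))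

theorem VanishesTo.clm_comp {F G : Type} [NormedAddCommGroup F] [NormedSpace ℝ F]
    [NormedAddCommGroup G] [NormedSpace ℝ G] {k : ℕ} {u : Euc n × Euc n → F}
    (h : VanishesTo k u) (T : F →L[ℝ] G) : VanishesTo k fun z => T (u z) :=
  fun x => (T.isBigO_comp _ _).trans (h x)

theorem VanishesTo.of_apply {X F : Type} [NormedAddCommGroup X] [NormedSpace ℝ X]
    [FiniteDimensional ℝ X] [NormedAddCommGroup F] [NormedSpace ℝ F] {k : ℕ}
    {L : Euc n × Euc n → X →L[ℝ] F} (h : ∀ v, VanishesTo k fun z => L z v) : VanishesTo k L := by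
  intro x
  let b := Module.finBasis ℝ X
  have key : L = fun z => ∑ i, (((ContinuousLinearMap.proj i).comp
      (b.equivFunL.toContinuousLinearMap).toLinearMap.toContinuousLinearMap).smulRight
        (L z (b i))) := by
    funext z
    ext v
    conv_lhs => rw [← b.sum_repr v, map_sum]
    simp
  have h1 := fun i => (h (b i)).clm_comp (ContinuousLinearMap.smulRightL ℝ X F
    ((ContinuousLinearMap.proj i).comp
      (b.equivFunL.toContinuousLinearMap).toLinearMap.toContinuousLinearMap)) x
  rw [key]
  exact IsBigO.fun_sum (s := Finset.univ) fun i _ => h1 i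

theorem VanishesTo.gradFst {u : Euc n × Euc n → ℝ} (hu : ∀ x, SmoothNear u (x, 0)) {k : ℕ}
    (h : VanishesTo k u) : VanishesTo k (KAMBirkhoff.gradFst u) :=
  VanishesTo.clm_comp (u := fun z => fderiv ℝ u z ∘L .inl ℝ _ _)
    (VanishesTo.of_apply fun v => h.fderiv_fst hu v) sharp

theorem VanishesTo.gradSnd {u : Euc n × Euc n → ℝ} (hu : ∀ x, SmoothNear u (x, 0)) {k : ℕ}
    (h : VanishesTo (k + 1) u) : VanishesTo k (KAMBirkhoff.gradSnd u) :=
  VanishesTo.clm_comp (u := fun z => fderiv ℝ u z ∘L .inr ℝ _ _)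
    (VanishesTo.of_apply fun v => h.fderiv_apply hu (0, v)) sharp

theorem VanishesTo.of_gradSnd {u : Euc n × Euc n → ℝ} (hu : ∀ x, SmoothNear u (x, 0))
    (h0 : ∀ x, u (x, 0) = 0) {k : ℕ} (h : VanishesTo k (KAMBirkhoff.gradSnd u)) :
    VanishesTo (k + 1) u := by
  refine VanishesTo.of_fderiv_snd hu h0 ?_
  refine (h.clm_comp innerL).congr fun x => Eventually.of_forall fun z => ?_
  ext v
  exact inner_gradSnd u z v

theorem VanishesTo.comp_isBigO {F : Type} [NormedAddCommGroup F] [NormedSpace ℝ F] {k : ℕ}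
    {u : Euc n × Euc n → F} (h : VanishesTo k u) {x y : Euc n}
    {c : Euc n × Euc n → Euc n × Euc n} (hc : Tendsto c (𝓝 (x, 0)) (𝓝 (y, 0)))
    (hc2 : (fun z => (c z).2) =O[𝓝 (x, 0)] fun z => ‖z.2‖) :
    (fun z => u (c z)) =O[𝓝 (x, 0)] fun z => ‖z.2‖ ^ k :=
  ((h y).comp_tendsto hc).trans (hc2.norm_left.pow k)

/-- The difference of the values of `a`, which vanishes to order `d + 1`, along two curves. -/
theorem VanishesTo.sub_comp_isBigO {F : Type} [NormedAddCommGroup F] [NormedSpace ℝ F]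
    [CompleteSpace F] {d : ℕ} {a : Euc n × Euc n → F} (ha : ∀ x, SmoothNear a (x, 0))
    (h : VanishesTo (d + 1) a) {x y : Euc n} {c c' : Euc n × Euc n → Euc n × Euc n}
    (hc : Tendsto c (𝓝 (x, 0)) (𝓝 (y, 0))) (hc' : Tendsto c' (𝓝 (x, 0)) (𝓝 (y, 0)))
    (hc2 : (fun z => (c z).2) =O[𝓝 (x, 0)] fun z => ‖z.2‖)
    (hc2' : (fun z => (c' z).2) =O[𝓝 (x, 0)] fun z => ‖z.2‖)
    (h1 : (fun z => (c z).1 - (c' z).1) =O[𝓝 (x, 0)] fun z => ‖z.2‖)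
    (h2 : (fun z => (c z).2 - (c' z).2) =O[𝓝 (x, 0)] fun z => ‖z.2‖ ^ 2) :
    (fun z => a (c z) - a (c' z)) =O[𝓝 (x, 0)] fun z => ‖z.2‖ ^ (d + 2) := by
  obtain ⟨A, hA0, hA⟩ := ((VanishesTo.of_apply (L := fun z => fderiv ℝ a z ∘L .inl ℝ _ _)
    fun v => h.fderiv_fst ha v) y).exists_nonneg
  obtain ⟨B, hB0, hB⟩ := ((VanishesTo.of_apply (L := fun z => fderiv ℝ a z ∘L .inr ℝ _ _)
    fun v => h.fderiv_apply ha (0, v)) y).exists_nonneg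
  obtain ⟨ε, hε, hball⟩ := Metric.eventually_nhds_iff.1
    ((hA.bound.and hB.bound).and (ha y).eventually)
  obtain ⟨K, hK0, hK⟩ := hc2.exists_nonneg
  obtain ⟨K', hK0', hK'⟩ := hc2'.exists_nonneg
  obtain ⟨C, hC0, hC⟩ := h1.exists_nonneg
  obtain ⟨C', hC0', hC'⟩ := h2.exists_nonneg
  refine IsBigO.of_bound (A * K ^ (d + 1) * C + B * (max K K') ^ d * C') ?_
  filter_upwards [hK.bound, hK'.bound, hC.bound, hC'.bound,
    hc.eventually (Metric.ball_mem_nhds _ hε), hc'.eventually (Metric.ball_mem_nhds _ hε)]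
    with z z1 z2 z3 z4 z5 z6
  simp only [norm_norm, norm_pow] at z1 z2 z3 z4 ⊢
  rw [Prod.dist_eq, max_lt_iff] at z5 z6
  -- The angle is moved first, at cost ‖r‖^(d+1) · ‖r‖, and then the action: its derivative has one
  -- order less, but the actions differ by O(‖r‖²).
  have e1 : ‖a (c z) - a ((c' z).1, (c z).2)‖ ≤ A * ‖(c z).2‖ ^ (d + 1) * ‖(c z).1 - (c' z).1‖ := by
    refine (convex_ball y ε).norm_image_sub_le_of_norm_hasFDerivWithin_le
      (f := fun x => a (x, (c z).2)) (f' := fun x => fderiv ℝ a (x, (c z).2) ∘L .inl ℝ _ _)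
      (fun x hx => ?_) (fun x hx => ?_) z6.1 z5.1
    · exact (hasFDerivAt_left (hball (y := (x, (c z).2)) (by
        rw [Prod.dist_eq]; exact max_lt hx z5.2)).2.differentiableAt).hasFDerivWithinAt
    · have := (hball (y := (x, (c z).2)) (by rw [Prod.dist_eq]; exact max_lt hx z5.2)).1.1
      simpa using this
  have e2 : ‖a ((c' z).1, (c z).2) - a (c' z)‖ ≤
      B * (max ‖(c z).2‖ ‖(c' z).2‖) ^ d * ‖(c z).2 - (c' z).2‖ := by
    refine ((convex_ball (0 : Euc n) ε).inter (convex_closedBall (0 : Euc n)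
      (max ‖(c z).2‖ ‖(c' z).2‖))).norm_image_sub_le_of_norm_hasFDerivWithin_le
      (f := fun r => a ((c' z).1, r)) (f' := fun r => fderiv ℝ a ((c' z).1, r) ∘L .inr ℝ _ _)
      (fun x hx => ?_) (fun x hx => ?_) ⟨z6.2, ?_⟩ ⟨z5.2, ?_⟩
    · exact (hasFDerivAt_right (hball (y := ((c' z).1, x)) (by
        rw [Prod.dist_eq]; exact max_lt z6.1 hx.1)).2.differentiableAt).hasFDerivWithinAt
    · have := (hball (y := ((c' z).1, x)) (by rw [Prod.dist_eq]; exact max_lt z6.1 hx.1)).1.2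
      simp only [norm_pow, norm_norm] at this
      refine this.trans ?_
      have hx2 : ‖x‖ ≤ max ‖(c z).2‖ ‖(c' z).2‖ := by simpa using hx.2
      gcongr
    · simp
    · simp
  have e3 : max ‖(c z).2‖ ‖(c' z).2‖ ≤ max K K' * ‖z.2‖ := by
    refine max_le (z1.trans ?_) (z2.trans ?_) <;> gcongr
    exacts [le_max_left _ _, le_max_right _ _]
  calc ‖a (c z) - a (c' z)‖ ≤ ‖a (c z) - a ((c' z).1, (c z).2)‖ +
        ‖a ((c' z).1, (c z).2) - a (c' z)‖ := norm_sub_le_norm_sub_add_norm_sub _ _ _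
    _ ≤ A * (K * ‖z.2‖) ^ (d + 1) * (C * ‖z.2‖) +
        B * (max K K' * ‖z.2‖) ^ d * (C' * ‖z.2‖ ^ 2) := by
        refine add_le_add (e1.trans ?_) (e2.trans ?_) <;> gcongr
    _ = _ := by ring

end GradParts

/-! ### The generating function. -/

section GenFun

variable {n : ℕ} {M : Type*}

/-- The differential of the generating function of `g` in the coordinates `Ψ`. -/
def genForm (g : M → M) (Ψ : Euc n × Euc n → M) (α : Euc n) (z : Euc n × Euc n) :
    Euc n × Euc n →L[ℝ] ℝ :=
  innerL (z.2 - (graphMap g Ψ α z).2) ∘L .fst ℝ _ _ +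
    innerL (z.1 - α - (graphMap g Ψ α z).1) ∘L .snd ℝ _ _

theorem genForm_apply (g : M → M) (Ψ : Euc n × Euc n → M) (α : Euc n) (z v : Euc n × Euc n) :
    genForm g Ψ α z v = inner ℝ (z.2 - (graphMap g Ψ α z).2) v.1 +
      inner ℝ (z.1 - α - (graphMap g Ψ α z).1) v.2 := rfl

/-- The generating function of `g` in the coordinates `Ψ`. -/
def genFun (g : M → M) (Ψ : Euc n × Euc n → M) (α : Euc n) (z : Euc n × Euc n) : ℝ :=
  primitiveOne (genForm g Ψ α) z

theorem genFun_base (g : M → M) (Ψ : Euc n × Euc n → M) (α : Euc n) (x : Euc n) :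
    genFun g Ψ α (x, 0) = 0 := by
  have : ((0 : Euc n), (0 : Euc n)) = 0 := rfl
  simp [genFun, primitiveOne, this]

theorem genFun_add_lat {g : M → M} {Ψ : Euc n × Euc n → M} (hΨ : ∀ z k, Ψ (z + (lat k, 0)) = Ψ z)
    (α : Euc n) (z : Euc n × Euc n) (k : Fin n → ℤ) :
    genFun g Ψ α (z + (lat k, 0)) = genFun g Ψ α z := by
  have h1 : ∀ z, genForm g Ψ α (z + (lat k, 0)) = genForm g Ψ α z := fun z => by
    rw [genForm, graphMap_add_lat hΨ]
    simp only [Prod.fst_add, Prod.snd_add, add_zero]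
    rw [show z.1 + lat k - α - ((graphMap g Ψ α z).1 + lat k) = z.1 - α - (graphMap g Ψ α z).1 by
      abel]
    rfl
  have h2 : ∀ t : ℝ, scaleSnd t (z + (lat k, 0)) = scaleSnd t z + (lat k, 0) := fun t => by simp
  simp only [genFun, primitiveOne, h1, h2, Prod.snd_add, add_zero]

variable [TopologicalSpace M] [ChartedSpace (Euc (2 * n)) M]
  [IsManifold (𝓡 (2 * n)) ∞ M] {σ : SymplecticForm (2 * n) M}
  {P : Type} [NormedAddCommGroup P] [NormedSpace ℝ P] {h : P → Euc n → M}
  {g : P → M → M} {α : Euc n} {Ψ : P → Euc n × Euc n → M} {p : P} [CompleteSpace P] [T2Space M]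

theorem IsInvariantFamily.smoothNear_genForm (H : IsInvariantFamily σ h g α p)
    (hΨ : IsSymplecticTube σ h Ψ p) (x : Euc n) :
    SmoothNear (fun w : P × (Euc n × Euc n) => genForm (g w.1) (Ψ w.1) α w.2) (p, (x, 0)) := by
  have h1 := H.smoothNear_graphMap hΨ x
  have h2 : SmoothNear (fun w : P × (Euc n × Euc n) => (graphMap (g w.1) (Ψ w.1) α w.2).1)
    (p, (x, 0)) := h1.contDiff_comp contDiff_fst
  have h3 : SmoothNear (fun w : P × (Euc n × Euc n) => (graphMap (g w.1) (Ψ w.1) α w.2).2)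
    (p, (x, 0)) := h1.contDiff_comp contDiff_snd
  refine SmoothNear.add (SmoothNear.clm_comp ?_ (smoothNear_const _ _))
    (SmoothNear.clm_comp ?_ (smoothNear_const _ _))
  · exact (smoothNear_const innerL _).clm_apply
      ((smoothNear_of_contDiff (by fun_prop) _).sub h3)
  · exact (smoothNear_const innerL _).clm_apply
      ((smoothNear_of_contDiff (by fun_prop) _).sub h2)

theorem IsInvariantFamily.smoothNear_genFun (H : IsInvariantFamily σ h g α p)
    (hΨ : IsSymplecticTube σ h Ψ p) (x : Euc n) :
    SmoothNear (fun w : P × (Euc n × Euc n) => genFun (g w.1) (Ψ w.1) α w.2) (p, (x, 0)) :=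
  SmoothNear.primitiveOne (lam := fun q => genForm (g q) (Ψ q) α) (H.smoothNear_genForm hΨ x)

theorem IsInvariantFamily.genForm_base (H : IsInvariantFamily σ h g α p)
    (hΨ : IsSymplecticTube σ h Ψ p) (x : Euc n) : genForm (g p) (Ψ p) α (x, 0) = 0 := by
  rw [genForm, H.graphMap_base hΨ]
  simp

/-- Pull the symplectic form back along g Ψ (x, r) = Ψ (x', r'), both sides seen as functions of
(x', r). Since g is symplectic this reads dx ∧ dr = dx' ∧ dr', which is closedness of (r - r') dx' +
(x' - α - x) dr. -/
theorem IsInvariantFamily.genForm_closed (H : IsInvariantFamily σ h g α p)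
    (hg : ∀ᶠ q in 𝓝 p, IsSymplectic σ (g q)) (hΨ : IsSymplecticTube σ h Ψ p) (x : Euc n) :
    ∀ᶠ w in 𝓝 (p, (x, 0)), ∀ u v, fderiv ℝ (genForm (g w.1) (Ψ w.1) α) w.2 u v =
      fderiv ℝ (genForm (g w.1) (Ψ w.1) α) w.2 v u := by
  have hWs := H.smoothNear_graphMap hΨ x
  have hW0 : graphMap (g p) (Ψ p) α (x, 0) = (x - α, 0) := H.graphMap_base hΨ x
  have hA : ContinuousAt (fun w : P × (Euc n × Euc n) =>
      (w.1, ((graphMap (g w.1) (Ψ w.1) α w.2).1, w.2.2))) (p, (x, (0 : Euc n))) := by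
    have := hWs.continuousAt
    fun_prop
  have hB : ContinuousAt (fun w : P × (Euc n × Euc n) =>
      (w.1, (w.2.1, (graphMap (g w.1) (Ψ w.1) α w.2).2))) (p, (x, (0 : Euc n))) := by
    have := hWs.continuousAt
    fun_prop
  rw [ContinuousAt, hW0] at hA hB
  filter_upwards [(H.liftMap_graphMap hΨ x).eventually_nhds, hWs.eventually,
    hA.eventually ((hΨ.smooth (x - α)).eventually.and (hΨ.symplectic (x - α))),
    hB.eventually ((hΨ.smooth x).eventually.and (hΨ.symplectic x)),
    (continuous_fst.tendsto (p, (x, (0 : Euc n)))).eventually (hg.and H.smooth_map)]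
    with ⟨q, z⟩ z1 z2 ⟨z3, z4⟩ ⟨z5, z6⟩ ⟨hgq, hsm⟩ u v
  set W := graphMap (g q) (Ψ q) α with hW
  replace z1 : ∀ᶠ z in 𝓝 z, liftMap (g q) (Ψ q) ((W z).1, z.2) = Ψ q (z.1, (W z).2) :=
    eventually_slice z1
  replace z2 : SmoothNear W z :=
    SmoothNear.snd_of_prod (f := fun q z => graphMap (g q) (Ψ q) α z) z2
  replace z3 := MNear.snd_of_prod (f := Ψ) z3
  replace z5 := MNear.snd_of_prod (f := Ψ) z5
  simp only at z4 z6 ⊢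
  have hgd : ∀ y, MDifferentiableAt (𝓡 (2 * n)) (𝓡 (2 * n)) (g q) y := fun y =>
    ContMDiffAt.mdifferentiableAt (ContMDiffAt.comp (g := fun w : P × M => g w.1 w.2)
      (f := fun y => (q, y)) y (hsm y) (contMDiffAt_const.prodMk contMDiffAt_id)) (by simp)
  have dW := z2.differentiableAt.hasFDerivAt
  have dW1 : HasFDerivAt (fun z => (W z).1) (.fst ℝ _ _ ∘L fderiv ℝ W z) z := dW.fst
  have dW2 : HasFDerivAt (fun z => (W z).2) (.snd ℝ _ _ ∘L fderiv ℝ W z) z := dW.snd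
  have dA : HasFDerivAt (fun z => ((W z).1, z.2)) _ z := dW1.prodMk hasFDerivAt_snd
  have dB : HasFDerivAt (fun z => (z.1, (W z).2)) _ z := hasFDerivAt_fst.prodMk dW2
  have hz3 : MDifferentiableAt 𝓘(ℝ, Euc n × Euc n) (𝓡 (2 * n)) (Ψ q) ((W z).1, z.2) :=
    z3.contMDiffAt.mdifferentiableAt (by simp)
  have hz5 : MDifferentiableAt 𝓘(ℝ, Euc n × Euc n) (𝓡 (2 * n)) (Ψ q) (z.1, (W z).2) :=
    z5.contMDiffAt.mdifferentiableAt (by simp)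
  have hcompA : MDifferentiableAt 𝓘(ℝ, Euc n × Euc n) (𝓡 (2 * n))
      (fun z => Ψ q ((W z).1, z.2)) z :=
    MDifferentiableAt.comp (I' := 𝓘(ℝ, Euc n × Euc n)) z hz3 dA.differentiableAt.mdifferentiableAt
  have k1 := pbForm_congr (σ := σ.form) (z := z)
    (Ψ := fun z => g q (Ψ q ((W z).1, z.2))) (Ψ' := fun z => Ψ q (z.1, (W z).2)) z1
  rw [hgq.pbForm_comp (Ψ := fun z => Ψ q ((W z).1, z.2)) (hgd _) hcompA] at k1
  have k2 := DFunLike.congr_fun (DFunLike.congr_fun k1 u) v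
  have k3 := pbForm_comp (σ := σ.form) (Ψ := Ψ q) (G := fun z => ((W z).1, z.2)) (z := z) hz3
    dA.differentiableAt u v
  have k4 := pbForm_comp (σ := σ.form) (Ψ := Ψ q) (G := fun z => (z.1, (W z).2)) (z := z) hz5
    dB.differentiableAt u v
  rw [z4, dA.fderiv] at k3
  rw [z6, dB.fderiv] at k4
  rw [k3, k4, w0_apply, w0_apply] at k2
  have dl : HasFDerivAt (genForm (g q) (Ψ q) α) _ z :=
    ((innerL.hasFDerivAt.comp z (hasFDerivAt_snd.sub dW2)).clm_comp
      (hasFDerivAt_const (ContinuousLinearMap.fst ℝ (Euc n) (Euc n)) z)).add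
    ((innerL.hasFDerivAt.comp z ((hasFDerivAt_fst.sub_const α).sub dW1)).clm_comp
      (hasFDerivAt_const (ContinuousLinearMap.snd ℝ (Euc n) (Euc n)) z))
  have dl' : ∀ u v, fderiv ℝ (genForm (g q) (Ψ q) α) z u v =
      inner ℝ (u.2 - (fderiv ℝ W z u).2) v.1 + inner ℝ (u.1 - (fderiv ℝ W z u).1) v.2 := by
    intro u v
    rw [dl.fderiv]
    simp [inner_sub_left]
  rw [dl', dl']
  simp only [ContinuousLinearMap.prod_apply, ContinuousLinearMap.comp_apply,
    ContinuousLinearMap.coe_fst', ContinuousLinearMap.coe_snd'] at k2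
  simp only [inner_sub_left]
  have c1 := real_inner_comm u.2 (fderiv ℝ W z v).1
  have c2 := real_inner_comm u.1 (fderiv ℝ W z v).2
  have c3 := real_inner_comm u.2 v.1
  have c4 := real_inner_comm u.1 v.2
  linarith

/-- The relative Poincaré lemma applies because the form is closed and vanishes on r = 0. That
vanishing is needed at every nearby parameter, hence the hypothesis `hb`. -/
theorem IsInvariantFamily.hasFDerivAt_genFun (H : IsInvariantFamily σ h g α p)
    (hg : ∀ᶠ q in 𝓝 p, IsSymplectic σ (g q)) (hΨ : IsSymplecticTube σ h Ψ p)
    (hb : ∀ᶠ q in 𝓝 p, ∀ x, genForm (g q) (Ψ q) α (x, 0) = 0) (x : Euc n) :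
    ∀ᶠ w in 𝓝 (p, (x, 0)), HasFDerivAt (genFun (g w.1) (Ψ w.1) α)
      (genForm (g w.1) (Ψ w.1) α w.2) w.2 := by
  filter_upwards [eventually_forall_scaleSnd (p := fun q z => SmoothNear (fun w : P × (Euc n × Euc n)
      => genForm (g w.1) (Ψ w.1) α w.2) (q, z)) (H.smoothNear_genForm hΨ x).eventually,
    eventually_forall_scaleSnd (p := fun q z => ∀ u v, fderiv ℝ (genForm (g q) (Ψ q) α) z u v =
      fderiv ℝ (genForm (g q) (Ψ q) α) z v u) (H.genForm_closed hg hΨ x),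
    (continuous_fst.tendsto (p, (x, (0 : Euc n)))).eventually hb] with w h1 h2 h3
  exact hasFDerivAt_primitiveOne (fun t ht => SmoothNear.snd_of_prod
    (f := fun q z => genForm (g q) (Ψ q) α z) (h1 t ht)) h2 (h3 _)

theorem IsInvariantFamily.gradFst_genFun (H : IsInvariantFamily σ h g α p)
    (hg : ∀ᶠ q in 𝓝 p, IsSymplectic σ (g q)) (hΨ : IsSymplecticTube σ h Ψ p)
    (hb : ∀ᶠ q in 𝓝 p, ∀ x, genForm (g q) (Ψ q) α (x, 0) = 0) (x : Euc n) :
    ∀ᶠ w in 𝓝 (p, (x, 0)), gradFst (genFun (g w.1) (Ψ w.1) α) w.2 =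
      w.2.2 - (graphMap (g w.1) (Ψ w.1) α w.2).2 := by
  filter_upwards [H.hasFDerivAt_genFun hg hΨ hb x] with w hw
  refine sharp_eq_iff.2 fun v => ?_
  rw [hw.fderiv]
  simp [genForm_apply]

theorem IsInvariantFamily.gradSnd_genFun (H : IsInvariantFamily σ h g α p)
    (hg : ∀ᶠ q in 𝓝 p, IsSymplectic σ (g q)) (hΨ : IsSymplecticTube σ h Ψ p)
    (hb : ∀ᶠ q in 𝓝 p, ∀ x, genForm (g q) (Ψ q) α (x, 0) = 0) (x : Euc n) :
    ∀ᶠ w in 𝓝 (p, (x, 0)), gradSnd (genFun (g w.1) (Ψ w.1) α) w.2 =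
      w.2.1 - α - (graphMap (g w.1) (Ψ w.1) α w.2).1 := by
  filter_upwards [H.hasFDerivAt_genFun hg hΨ hb x] with w hw
  refine sharp_eq_iff.2 fun v => ?_
  rw [hw.fderiv]
  simp [genForm_apply]

end GenFun

/-! ### Smooth homogeneous functions are polynomials. -/

section HomPoly

variable {n : ℕ}

/-- The polynomial representing a smooth function that is homogeneous of degree `m`. -/
def homPoly : ℕ → (Euc n → ℝ) → MvPolynomial (Fin n) ℝ
  | 0, f => MvPolynomial.C (f 0)
  | m + 1, f => MvPolynomial.C ((m + 1 : ℝ)⁻¹) *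
      ∑ i, MvPolynomial.X i * homPoly m fun r => fderiv ℝ f r (EuclideanSpace.single i 1)

theorem totalDegree_homPoly_le (m : ℕ) (f : Euc n → ℝ) : (homPoly m f).totalDegree ≤ m := by
  induction m generalizing f with
  | zero => simp [homPoly]
  | succ m ih =>
    rw [homPoly]
    refine (MvPolynomial.totalDegree_mul _ _).trans ?_
    rw [MvPolynomial.totalDegree_C, zero_add]
    refine MvPolynomial.totalDegree_finsetSum_le fun i _ => ?_
    refine (MvPolynomial.totalDegree_mul _ _).trans ?_
    rw [MvPolynomial.totalDegree_X, add_comm]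
    exact Nat.add_le_add_right (ih _) 1

theorem smoothNear_coeff_homPoly {P : Type} [NormedAddCommGroup P] [NormedSpace ℝ P]
    {f : P → Euc n → ℝ} {p : P} (h : ∀ r, SmoothNear (fun w : P × Euc n => f w.1 w.2) (p, r))
    (m : ℕ) (d : Fin n →₀ ℕ) : SmoothNear (fun q => (homPoly m (f q)).coeff d) p := by
  classical
  induction m generalizing f d with
  | zero =>
    simp only [homPoly, MvPolynomial.coeff_C]
    split_ifs
    · exact SmoothNear.comp (g := fun w : P × Euc n => f w.1 w.2) (f := fun q => (q, 0)) (h 0)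
        (smoothNear_of_contDiff (by fun_prop) _)
    · exact smoothNear_const _ _
  | succ m ih =>
    simp only [homPoly, MvPolynomial.coeff_C_mul, MvPolynomial.coeff_sum]
    refine (smoothNear_const ((m + 1 : ℝ)⁻¹) p).smul ?_
    have h1 : ∀ i : Fin n, SmoothNear (fun q => (MvPolynomial.X i * homPoly m
        fun r => fderiv ℝ (f q) r (EuclideanSpace.single i 1)).coeff d) p := by
      intro i
      simp only [MvPolynomial.coeff_X_mul']
      split_ifs
      · exact ih (f := fun q r => fderiv ℝ (f q) r (EuclideanSpace.single i 1))
          (fun r => (SmoothNear.partial_snd (h r)).clm_apply (smoothNear_const _ _)) _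
      · exact smoothNear_const _ _
    filter_upwards [eventually_all.2 h1] with q hq
    exact ContDiffAt.sum fun i _ => hq i

theorem fderiv_homogeneous {f : Euc n → ℝ} (hf : ContDiff ℝ ∞ f) {m : ℕ}
    (h : ∀ (c : ℝ) r, f (c • r) = c ^ (m + 1) * f r) (v : Euc n) (c : ℝ) (r : Euc n) :
    fderiv ℝ f (c • r) v = c ^ m * fderiv ℝ f r v := by
  have hd : Differentiable ℝ f := hf.differentiable (by simp)
  have key : ∀ c : ℝ, c ≠ 0 → fderiv ℝ f (c • r) v = c ^ m * fderiv ℝ f r v := by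
    intro c hc
    have h1 : HasFDerivAt (fun r => f (c • r))
        (fderiv ℝ f (c • r) ∘L (c • ContinuousLinearMap.id ℝ (Euc n))) r :=
      HasFDerivAt.comp (g := f) r (hd _).hasFDerivAt ((hasFDerivAt_id r).const_smul c)
    have h2 : HasFDerivAt (fun r => c ^ (m + 1) * f r) (c ^ (m + 1) • fderiv ℝ f r) r :=
      (hd r).hasFDerivAt.const_mul _
    have e : (fun r => f (c • r)) = fun r => c ^ (m + 1) * f r := funext fun r => h c r
    rw [e] at h1
    have := DFunLike.congr_fun (h1.unique h2) v
    simp only [ContinuousLinearMap.comp_apply, _root_.smul_apply, ContinuousLinearMap.id_apply,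
      map_smul, smul_eq_mul, pow_succ'] at this
    exact mul_left_cancel₀ hc (by rw [this]; ring)
  have hc1 : Continuous fun c : ℝ => fderiv ℝ f (c • r) v :=
    ((hf.continuous_fderiv (by simp)).comp (by fun_prop)).clm_apply continuous_const
  have hc2 : Continuous fun c : ℝ => c ^ m * fderiv ℝ f r v := by fun_prop
  -- The factor c could be cancelled only for c ≠ 0; the remaining value follows by density.
  have : (fun c : ℝ => fderiv ℝ f (c • r) v) = fun c : ℝ => c ^ m * fderiv ℝ f r v :=
    hc1.ext_on (dense_compl_singleton (0 : ℝ)) hc2 fun c hc => key c hc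
  exact congrFun this c

theorem euler_homogeneous {f : Euc n → ℝ} (hf : ContDiff ℝ ∞ f) {m : ℕ}
    (h : ∀ (c : ℝ) r, f (c • r) = c ^ (m + 1) * f r) (r : Euc n) :
    fderiv ℝ f r r = (m + 1) * f r := by
  have hd : Differentiable ℝ f := hf.differentiable (by simp)
  have h1 : HasDerivAt (fun c : ℝ => f (c • r)) (fderiv ℝ f ((1 : ℝ) • r) ((1 : ℝ) • r)) 1 :=
    (hd _).hasFDerivAt.comp_hasDerivAt (1 : ℝ) ((hasDerivAt_id (1 : ℝ)).smul_const r)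
  have h2 : HasDerivAt (fun c : ℝ => c ^ (m + 1) * f r) ((m + 1 : ℕ) * 1 ^ m * f r) 1 := by
    simpa using (hasDerivAt_pow (m + 1) (1 : ℝ)).mul_const (f r)
  have e : (fun c : ℝ => f (c • r)) = fun c => c ^ (m + 1) * f r := funext fun c => h c r
  rw [e] at h1
  have := h1.unique h2
  simpa using this

/-- Euler's identity recovers f from its partial derivatives, which are smooth and homogeneous of
one degree less. In degree 0, scaling by c = 0 shows that f is constant. -/
theorem polyFun_homPoly {f : Euc n → ℝ} (hf : ContDiff ℝ ∞ f) {m : ℕ}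
    (h : ∀ (c : ℝ) r, f (c • r) = c ^ m * f r) (r : Euc n) : polyFun (homPoly m f) r = f r := by
  induction m generalizing f with
  | zero =>
    have := h 0 r
    rw [zero_smul, pow_zero, one_mul] at this
    simp [polyFun, homPoly, this]
  | succ m ih =>
    have h1 : ∀ i : Fin n, polyFun (homPoly m fun r => fderiv ℝ f r (EuclideanSpace.single i 1)) r =
        fderiv ℝ f r (EuclideanSpace.single i 1) := fun i =>
      ih (f := fun r => fderiv ℝ f r (EuclideanSpace.single i 1))
        ((hf.fderiv_right (m := ∞) (by simp)).clm_apply contDiff_const)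
        fun c r => fderiv_homogeneous hf h _ c r
    simp only [polyFun] at h1
    simp only [polyFun, homPoly, map_mul, map_sum, MvPolynomial.eval_C, MvPolynomial.eval_X, h1]
    have e : ∑ i, r i * fderiv ℝ f r (EuclideanSpace.single i 1) = fderiv ℝ f r r := by
      generalize fderiv ℝ f r = T
      conv_rhs => rw [← (EuclideanSpace.basisFun (Fin n) ℝ).sum_repr r, map_sum]
      simp
    rw [e, euler_homogeneous hf h]
    field_simp

theorem contDiff_polyFun (Q : MvPolynomial (Fin n) ℝ) : ContDiff ℝ ∞ (polyFun Q) := by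
  have e : polyFun Q = fun r : Euc n => ∑ d ∈ Q.support, Q.coeff d * ∏ i, r i ^ d i := by
    funext r
    rw [polyFun, MvPolynomial.eval_eq']
  rw [e]
  fun_prop

/-- The degree bound, uniform in q, confines all monomials to one finite set, so the evaluation is a
fixed finite sum with smooth coefficients. -/
theorem smoothNear_polyFun {P : Type} [NormedAddCommGroup P] [NormedSpace ℝ P]
    {Q : P → MvPolynomial (Fin n) ℝ} {p : P} {N : ℕ} (hN : ∀ q, (Q q).totalDegree ≤ N)
    (h : ∀ d, SmoothNear (fun q => (Q q).coeff d) p) (r : Euc n) :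
    SmoothNear (fun w : P × Euc n => polyFun (Q w.1) w.2) (p, r) := by
  set S : Finset (Fin n →₀ ℕ) := (Finsupp.finite_of_degree_le N).toFinset with hS
  have e : (fun w : P × Euc n => polyFun (Q w.1) w.2) = fun w =>
      ∑ d ∈ S, (Q w.1).coeff d * ∏ i, w.2 i ^ d i := by
    funext w
    rw [polyFun, MvPolynomial.eval_eq']
    refine Finset.sum_subset (fun d hd => ?_) fun d _ hd => ?_
    · rw [hS, Finite.mem_toFinset]
      refine le_trans ?_ (hN w.1)
      exact MvPolynomial.le_totalDegree hd
    · rw [MvPolynomial.notMem_support_iff.1 hd, zero_mul]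
  rw [e]
  have h1 : ∀ᶠ w in 𝓝 (p, r), ∀ d ∈ S, ContDiffAt ℝ ∞ (fun q => (Q q).coeff d) w.1 :=
    (continuous_fst.tendsto (p, r)).eventually
      ((Finset.eventually_all S).2 fun d _ => h d)
  filter_upwards [h1] with w hw
  refine ContDiffAt.sum fun d hd => ?_
  have h2 := (hw d hd).comp w contDiffAt_fst
  exact h2.mul (ContDiff.contDiffAt (by fun_prop))

end HomPoly

/-! ### First-order symplectic changes of coordinates. -/

section Twist

variable {n : ℕ}

/-- The first-order approximation of the symplectic map with generating function `u`. -/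
def twist (u : Euc n × Euc n → ℝ) (z : Euc n × Euc n) : Euc n × Euc n :=
  z + (gradSnd u z, -gradFst u z)

theorem gradFst_add_lat {u : Euc n × Euc n → ℝ} {k : Fin n → ℤ}
    (hu : ∀ z, u (z + (lat k, 0)) = u z) (z : Euc n × Euc n) :
    gradFst u (z + (lat k, 0)) = gradFst u z := by
  rw [gradFst, gradFst, ← fderiv_comp_add_right]
  simp only [hu]

theorem gradSnd_add_lat {u : Euc n × Euc n → ℝ} {k : Fin n → ℤ}
    (hu : ∀ z, u (z + (lat k, 0)) = u z) (z : Euc n × Euc n) :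
    gradSnd u (z + (lat k, 0)) = gradSnd u z := by
  rw [gradSnd, gradSnd, ← fderiv_comp_add_right]
  simp only [hu]

theorem twist_add_lat {u : Euc n × Euc n → ℝ} {k : Fin n → ℤ}
    (hu : ∀ z, u (z + (lat k, 0)) = u z) (z : Euc n × Euc n) :
    twist u (z + (lat k, 0)) = twist u z + (lat k, 0) := by
  rw [twist, twist, gradFst_add_lat hu, gradSnd_add_lat hu]
  abel

/-- Symmetry of the second derivative of u cancels all terms linear in u; what is left is quadratic.
-/
theorem w0_twist {u : Euc n × Euc n → ℝ} {z : Euc n × Euc n} (hu : SmoothNear u z)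
    (v w : Euc n × Euc n) :
    w0 (fderiv ℝ (twist u) z v) (fderiv ℝ (twist u) z w) - w0 v w =
      inner ℝ (fderiv ℝ (gradFst u) z v) (fderiv ℝ (gradSnd u) z w) -
        inner ℝ (fderiv ℝ (gradFst u) z w) (fderiv ℝ (gradSnd u) z v) := by
  have d1 := hu.gradFst'.differentiableAt.hasFDerivAt
  have d2 := hu.gradSnd'.differentiableAt.hasFDerivAt
  have d3 : HasFDerivAt (twist u) _ z := (hasFDerivAt_id z).add (d2.prodMk d1.neg)
  have hsymm : fderiv ℝ (fderiv ℝ u) z v w = fderiv ℝ (fderiv ℝ u) z w v :=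
    (hu.contDiffAt.isSymmSndFDerivAt (by
      simpa using WithTop.coe_le_coe.2 (le_top : (2 : ℕ∞) ≤ ⊤))).eq v w
  have key : ∀ v w, fderiv ℝ (fderiv ℝ u) z v w =
      inner ℝ (fderiv ℝ (gradFst u) z v) w.1 + inner ℝ (fderiv ℝ (gradSnd u) z v) w.2 := by
    intro v w
    have e : (fun z => fderiv ℝ u z w) =
        fun z => inner ℝ (gradFst u z) w.1 + inner ℝ (gradSnd u z) w.2 := by
      funext z
      rw [inner_gradFst, inner_gradSnd, ← map_add]
      simp
    have h1 : HasFDerivAt (fun z => fderiv ℝ u z w) _ z :=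
      hu.fderiv.differentiableAt.hasFDerivAt.clm_apply (hasFDerivAt_const w z)
    have h2 : HasFDerivAt (fun z => inner ℝ (gradFst u z) w.1 + inner ℝ (gradSnd u z) w.2) _ z :=
      (d1.inner ℝ (hasFDerivAt_const w.1 z)).add (d2.inner ℝ (hasFDerivAt_const w.2 z))
    rw [e] at h1
    simpa using DFunLike.congr_fun (h1.unique h2) v
  rw [key, key] at hsymm
  rw [d3.fderiv, w0_apply, w0_apply]
  simp only [_root_.add_apply, ContinuousLinearMap.id_apply, ContinuousLinearMap.prod_apply,
    _root_.neg_apply, Prod.fst_add, Prod.snd_add, inner_add_left, inner_add_right, inner_neg_left,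
    inner_neg_right]
  have c1 := real_inner_comm v.1 (fderiv ℝ (gradFst u) z w)
  have c2 := real_inner_comm v.2 (fderiv ℝ (gradSnd u) z w)
  have c3 := real_inner_comm w.1 (fderiv ℝ (gradFst u) z v)
  have c4 := real_inner_comm w.2 (fderiv ℝ (gradSnd u) z v)
  have c5 := real_inner_comm (fderiv ℝ (gradFst u) z v) (fderiv ℝ (gradSnd u) z w)
  have c6 := real_inner_comm (fderiv ℝ (gradFst u) z w) (fderiv ℝ (gradSnd u) z v)
  linarith

theorem VanishesTo.inner_apply {k l : ℕ} {u v : Euc n × Euc n → Euc n} (hu : VanishesTo k u)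
    (hv : VanishesTo l v) : VanishesTo (k + l) fun z => inner ℝ (u z) (v z) := by
  intro x
  have h1 : (fun z => inner ℝ (u z) (v z)) =O[𝓝 (x, 0)] fun z => ‖u z‖ * ‖v z‖ :=
    IsBigO.of_bound 1 (Eventually.of_forall fun z => by
      rw [one_mul, norm_mul, norm_norm, norm_norm]
      exact norm_inner_le_norm _ _)
  refine h1.trans ?_
  simp only [pow_add]
  exact (hu x).norm_left.mul (hv x).norm_left

theorem twist_base {u : Euc n × Euc n → ℝ} (hu : ∀ x, SmoothNear u (x, 0)) {d : ℕ}
    (h : VanishesTo (d + 2) u) (x : Euc n) : twist u (x, 0) = (x, 0) := by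
  rw [twist, (h.gradSnd hu).eq_zero x, (h.gradFst hu).eq_zero x]
  simp

/-- The derivatives of the two gradients have orders d + 1 and d, so the quadratic defect has order
2 d + 1 ≥ d + 1. The Moser correction then displaces points by O(‖r‖^(d+2)) only. -/
theorem vanishesTo_w0_twist {u : Euc n × Euc n → ℝ} (hu : ∀ x, SmoothNear u (x, 0)) {d : ℕ}
    (h : VanishesTo (d + 2) u) (v w : Euc n × Euc n) :
    VanishesTo (d + 1) fun z =>
      w0 (fderiv ℝ (twist u) z v) (fderiv ℝ (twist u) z w) - w0 v w := by
  have h1 := fun v => (h.gradFst hu).fderiv_apply (fun x => (hu x).gradFst') v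
  have h2 := fun v => (h.gradSnd hu).fderiv_apply (fun x => (hu x).gradSnd') v
  refine ((((h1 v).inner_apply (h2 w)).sub ((h1 w).inner_apply (h2 v))).mono (l := d + 1) (by omega)).congr
    fun x => ?_
  filter_upwards [(hu x).eventually] with z hz
  exact (w0_twist hz v w).symm

theorem VanishesTo.tendsto_of_sub {φ : Euc n × Euc n → Euc n × Euc n} {d : ℕ}
    (hφ : VanishesTo (d + 1) fun z => φ z - z) (x : Euc n) :
    Tendsto φ (𝓝 (x, 0)) (𝓝 (x, 0)) := by
  have h1 : Tendsto (fun z : Euc n × Euc n => ‖z.2‖ ^ (d + 1)) (𝓝 (x, 0)) (𝓝 0) := by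
    have : Continuous fun z : Euc n × Euc n => ‖z.2‖ ^ (d + 1) := by fun_prop
    simpa using this.tendsto (x, 0)
  have h2 := ((hφ x).trans_tendsto h1).add (tendsto_id (x := 𝓝 (x, (0 : Euc n))))
  simpa using h2

theorem VanishesTo.isBigO_snd_of_sub {φ : Euc n × Euc n → Euc n} {d : ℕ}
    (hφ : VanishesTo (d + 1) fun z => φ z - z.2) (x : Euc n) :
    φ =O[𝓝 (x, 0)] fun z => ‖z.2‖ := by
  have h0 : (fun z : Euc n × Euc n => z.2) =O[𝓝 (x, (0 : Euc n))] fun z => ‖z.2‖ :=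
    (isBigO_refl _ _).norm_right
  have h1 := (hφ.mono (l := 1) (by omega)) x
  simp only [pow_one] at h1
  simpa using h1.add h0

theorem vanishesTo_twist_comp_fst {u : Euc n × Euc n → ℝ} (hu : ∀ x, SmoothNear u (x, 0)) {d : ℕ}
    (h : VanishesTo (d + 2) u) {φ : Euc n × Euc n → Euc n × Euc n}
    (hφ : VanishesTo (d + 2) fun z => φ z - z) :
    VanishesTo (d + 2) fun z => (twist u (φ z)).1 - z.1 - gradSnd u z := by
  have h2 : VanishesTo (d + 2) fun z => (φ z).2 - z.2 :=
    hφ.clm_comp (ContinuousLinearMap.snd ℝ (Euc n) (Euc n))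
  have h3 : VanishesTo (d + 2) fun z => (φ z).1 - z.1 :=
    hφ.clm_comp (ContinuousLinearMap.fst ℝ (Euc n) (Euc n))
  intro x
  have h4 : (fun z => gradSnd u (φ z) - gradSnd u (id z)) =O[𝓝 (x, 0)]
      fun z => ‖z.2‖ ^ (d + 2) := by
    refine VanishesTo.sub_comp_isBigO (fun x => (hu x).gradSnd') (h.gradSnd hu)
      (hφ.tendsto_of_sub x) tendsto_id (h2.isBigO_snd_of_sub x) (isBigO_refl _ _).norm_right ?_ ?_
    · simpa using (h3.mono (l := 1) (by omega)) x
    · exact (h2.mono (l := 2) (by omega)) x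
  refine ((h3 x).add h4).congr_left fun z => ?_
  simp only [twist, id, Prod.fst_add]
  abel

theorem vanishesTo_twist_comp_snd {u : Euc n × Euc n → ℝ} (hu : ∀ x, SmoothNear u (x, 0)) {d : ℕ}
    (h : VanishesTo (d + 2) u) {φ : Euc n × Euc n → Euc n × Euc n}
    (hφ : VanishesTo (d + 2) fun z => φ z - z) :
    VanishesTo (d + 2) fun z => (twist u (φ z)).2 - z.2 := by
  have h2 : VanishesTo (d + 2) fun z => (φ z).2 - z.2 :=
    hφ.clm_comp (ContinuousLinearMap.snd ℝ (Euc n) (Euc n))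
  intro x
  have h4 := (h.gradFst hu).comp_isBigO (hφ.tendsto_of_sub x) (h2.isBigO_snd_of_sub x)
  refine ((h2 x).sub h4).congr_left fun z => ?_
  simp only [twist, Prod.snd_add]
  abel

end Twist

/-! ### The corrected twist as a change of symplectic coordinates. -/

section TwistTube

variable {n m : ℕ} {M : Type*} [TopologicalSpace M] [ChartedSpace (Euc m) M]
  [IsManifold (𝓡 m) ∞ M] {σ : SymplecticForm m M}
  {P : Type} [NormedAddCommGroup P] [NormedSpace ℝ P] {h : P → Euc n → M}
  {Ψ : P → Euc n × Euc n → M} {p : P} {u : P → Euc n × Euc n → ℝ}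

/-- A symplectic change of coordinates approximated by `twist u`. -/
def twistFlow (σ : SymplecticForm m M) (Ψ : Euc n × Euc n → M) (u : Euc n × Euc n → ℝ)
    (z : Euc n × Euc n) : Euc n × Euc n :=
  twist u (flowMap (moserField (pbForm σ.form fun z => Ψ (twist u z))) z)

theorem IsSymplecticTube.isTubeFamily_twist (hΨ : IsSymplecticTube σ h Ψ p)
    (hu : ∀ x, SmoothNear (fun w : P × (Euc n × Euc n) => u w.1 w.2) (p, (x, 0)))
    (hper : ∀ q z k, u q (z + (lat k, 0)) = u q z) {d : ℕ} (hd : VanishesTo (d + 2) (u p)) :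
    IsTubeFamily m h (fun q z => Ψ q (twist (u q) z)) p where
  smooth x := by
    refine MNear.comp_of_eq (f := fun w : P × (Euc n × Euc n) => Ψ w.1 w.2)
      (g := fun w : P × (Euc n × Euc n) => (w.1, twist (u w.1) w.2)) (hΨ.smooth x) ?_ ?_
    · exact (smoothNear_of_contDiff contDiff_fst _).prodMk
        ((smoothNear_of_contDiff contDiff_snd _).add
          ((SmoothNear.gradSnd (hu x)).prodMk (SmoothNear.gradFst (hu x)).neg))
    · exact congrArg (Prod.mk p) (twist_base (fun x => SmoothNear.snd_of_prod (hu x)) hd x)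
  base x := by rw [twist_base (fun x => SmoothNear.snd_of_prod (hu x)) hd x, hΨ.base]
  periodic q z k := by rw [twist_add_lat (fun z => hper q z k), hΨ.periodic]

theorem IsSymplecticTube.vanishesTo_pbForm_twist (hΨ : IsSymplecticTube σ h Ψ p)
    (hu : ∀ x, SmoothNear (u p) (x, 0)) {d : ℕ} (hd : VanishesTo (d + 2) (u p)) :
    VanishesTo (d + 1) fun z => pbForm σ.form (fun z => Ψ p (twist (u p) z)) z - w0 := by
  refine VanishesTo.of_apply fun v => VanishesTo.of_apply fun w => ?_
  refine (vanishesTo_w0_twist hu hd v w).congr fun x => ?_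
  have hs : SmoothNear (twist (u p)) (x, 0) := (smoothNear_of_contDiff contDiff_id _).add
    ((hu x).gradSnd'.prodMk (hu x).gradFst'.neg)
  have hc := hs.continuousAt
  rw [ContinuousAt, twist_base hu hd x] at hc
  filter_upwards [hs.eventually, hc.eventually ((hΨ.smooth_right x).eventually.and
    (hΨ.symplectic_right x))] with z h1 ⟨h2, h3⟩
  rw [_root_.sub_apply, _root_.sub_apply, pbForm_comp (σ := σ.form) (Ψ := Ψ p) (G := twist (u p))
    (h2.contMDiffAt.mdifferentiableAt (by simp)) h1.differentiableAt, h3]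

variable [CompleteSpace P]

theorem isMoserForm_twist (hΨ : ∀ᶠ q in 𝓝 p, IsSymplecticTube σ h Ψ q)
    (hu : ∀ᶠ q in 𝓝 p, ∀ x, SmoothNear (fun w : P × (Euc n × Euc n) => u w.1 w.2) (q, (x, 0)))
    (hper : ∀ q z k, u q (z + (lat k, 0)) = u q z) {d : ℕ}
    (hd : ∀ᶠ q in 𝓝 p, VanishesTo (d + 2) (u q)) :
    (∀ᶠ q in 𝓝 p, ∀ x, pbForm σ.form (fun z => Ψ q (twist (u q) z)) (x, 0) = w0) ∧
      IsMoserForm (fun q => pbForm σ.form fun z => Ψ q (twist (u q) z)) p := by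
  have hb : ∀ᶠ q in 𝓝 p, ∀ x, pbForm σ.form (fun z => Ψ q (twist (u q) z)) (x, 0) = w0 := by
    filter_upwards [hΨ, hu, hd] with q h1 h2 h3 x
    exact sub_eq_zero.1 ((h1.vanishesTo_pbForm_twist
      (fun x => SmoothNear.snd_of_prod (f := u) (h2 x)) h3).eq_zero x)
  exact ⟨hb, (hΨ.self_of_nhds.isTubeFamily_twist hu.self_of_nhds hper hd.self_of_nhds).isMoserForm
    (Ψ := fun q z => Ψ q (twist (u q) z)) hb⟩

/-- The change of coordinates approximated by `twist u` preserves symplectic tubes. -/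
theorem isSymplecticTube_comp_twistFlow (hΨ : ∀ᶠ q in 𝓝 p, IsSymplecticTube σ h Ψ q)
    (hu : ∀ᶠ q in 𝓝 p, ∀ x, SmoothNear (fun w : P × (Euc n × Euc n) => u w.1 w.2) (q, (x, 0)))
    (hper : ∀ q z k, u q (z + (lat k, 0)) = u q z) {d : ℕ}
    (hd : ∀ᶠ q in 𝓝 p, VanishesTo (d + 2) (u q)) :
    IsSymplecticTube σ h (fun q z => Ψ q (twistFlow σ (Ψ q) (u q) z)) p ∧
      VanishesTo (d + 2) (fun z => (twistFlow σ (Ψ p) (u p) z).1 - z.1 - gradSnd (u p) z) ∧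
      VanishesTo (d + 2) (fun z => (twistFlow σ (Ψ p) (u p) z).2 - z.2) := by
  obtain ⟨hb, hB⟩ := isMoserForm_twist hΨ hu hper hd
  have hus := fun x => SmoothNear.snd_of_prod (f := u) (hu.self_of_nhds x)
  have h1 := hB.vanishesTo_flowMap_sub (hΨ.self_of_nhds.vanishesTo_pbForm_twist hus hd.self_of_nhds)
  exact ⟨(hΨ.self_of_nhds.isTubeFamily_twist hu.self_of_nhds hper hd.self_of_nhds).moserCorrect
      (Ψ := fun q z => Ψ q (twist (u q) z)) hb,
    vanishesTo_twist_comp_fst hus hd.self_of_nhds h1,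
    vanishesTo_twist_comp_snd hus hd.self_of_nhds h1⟩

end TwistTube

/-! ### Algebra of partial gradients. -/

section GradAlgebra

variable {n : ℕ}

theorem gradFst_sub {u v : Euc n × Euc n → ℝ} {z : Euc n × Euc n} (hu : DifferentiableAt ℝ u z)
    (hv : DifferentiableAt ℝ v z) :
    gradFst (fun z => u z - v z) z = gradFst u z - gradFst v z := by
  refine sharp_eq_iff.2 fun y => ?_
  have d : HasFDerivAt (fun z => u z - v z) _ z := hu.hasFDerivAt.sub hv.hasFDerivAt
  rw [inner_sub_left, inner_gradFst, inner_gradFst, d.fderiv]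
  rfl

theorem gradSnd_sub {u v : Euc n × Euc n → ℝ} {z : Euc n × Euc n} (hu : DifferentiableAt ℝ u z)
    (hv : DifferentiableAt ℝ v z) :
    gradSnd (fun z => u z - v z) z = gradSnd u z - gradSnd v z := by
  refine sharp_eq_iff.2 fun y => ?_
  have d : HasFDerivAt (fun z => u z - v z) _ z := hu.hasFDerivAt.sub hv.hasFDerivAt
  rw [inner_sub_left, inner_gradSnd, inner_gradSnd, d.fderiv]
  rfl

theorem gradFst_snd {f : Euc n → ℝ} (hf : Differentiable ℝ f) (z : Euc n × Euc n) :
    gradFst (fun z => f z.2) z = 0 := by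
  refine sharp_eq_iff.2 fun y => ?_
  have : HasFDerivAt (fun z : Euc n × Euc n => f z.2) (fderiv ℝ f z.2 ∘L .snd ℝ _ _) z :=
    HasFDerivAt.comp (g := f) z (hf z.2).hasFDerivAt hasFDerivAt_snd
  rw [this.fderiv]
  simp

theorem gradSnd_snd {f : Euc n → ℝ} (hf : Differentiable ℝ f) (z : Euc n × Euc n) :
    gradSnd (fun z => f z.2) z = sharp (fderiv ℝ f z.2) := by
  refine sharp_eq_iff.2 fun y => ?_
  have : HasFDerivAt (fun z : Euc n × Euc n => f z.2) (fderiv ℝ f z.2 ∘L .snd ℝ _ _) z :=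
    HasFDerivAt.comp (g := f) z (hf z.2).hasFDerivAt hasFDerivAt_snd
  rw [this.fderiv, inner_sharp]
  simp

theorem gradSnd_sub_left (u : Euc n × Euc n → ℝ) (α : Euc n) (z : Euc n × Euc n) :
    gradSnd (fun z => u (z.1 - α, z.2)) z = gradSnd u (z.1 - α, z.2) := by
  have e : (fun z : Euc n × Euc n => u (z.1 - α, z.2)) = fun z => u (z + (-α, 0)) := by
    funext z
    congr 1
    ext1 <;> simp [sub_eq_add_neg]
  rw [e, gradSnd, fderiv_comp_add_right, gradSnd]
  congr 3
  ext1 <;> simp [sub_eq_add_neg]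

theorem VanishesTo.tendsto_zero {F : Type} [NormedAddCommGroup F] [NormedSpace ℝ F] {k : ℕ}
    {u : Euc n × Euc n → F} (h : VanishesTo (k + 1) u) (x : Euc n) :
    Tendsto u (𝓝 (x, 0)) (𝓝 0) := by
  have h1 : Tendsto (fun z : Euc n × Euc n => ‖z.2‖ ^ (k + 1)) (𝓝 (x, 0)) (𝓝 0) := by
    have : Continuous fun z : Euc n × Euc n => ‖z.2‖ ^ (k + 1) := by fun_prop
    simpa using this.tendsto (x, 0)
  exact (h x).trans_tendsto h1

end GradAlgebra

/-! ### Effect of a change of coordinates on the generating function. -/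

section Conjugation

variable {n : ℕ} {M : Type*} [TopologicalSpace M] [ChartedSpace (Euc (2 * n)) M]
  [IsManifold (𝓡 (2 * n)) ∞ M] {σ : SymplecticForm (2 * n) M}
  {P : Type} [NormedAddCommGroup P] [NormedSpace ℝ P] {h : P → Euc n → M}
  {g : P → M → M} {α : Euc n} {Ψ Ψ' : P → Euc n × Euc n → M} {p : P} [CompleteSpace P] [T2Space M]
  {T : Euc n × Euc n → Euc n × Euc n}

theorem IsInvariantFamily.tendsto_graphMap (H : IsInvariantFamily σ h g α p)
    (hΨ : IsSymplecticTube σ h Ψ p) (x : Euc n) :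
    Tendsto (graphMap (g p) (Ψ p) α) (𝓝 (x, 0)) (𝓝 (x - α, 0)) := by
  have := (SmoothNear.snd_of_prod (f := fun q z => graphMap (g q) (Ψ q) α z)
    (H.smoothNear_graphMap hΨ x)).continuousAt
  rwa [ContinuousAt, H.graphMap_base hΨ x] at this

/-- The behaviour of `graphMap` under a change of coordinates. -/
theorem IsInvariantFamily.graphMap_comp (H : IsInvariantFamily σ h g α p)
    (hΨ : IsSymplecticTube σ h Ψ p) (hΨ' : IsSymplecticTube σ h Ψ' p)
    (hT : ∀ z, Ψ' p z = Ψ p (T z)) (hTc : ∀ x, Tendsto T (𝓝 (x, 0)) (𝓝 (x, 0))) (x : Euc n) :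
    ∀ᶠ z in 𝓝 (x, 0), graphMap (g p) (Ψ p) α
      ((T (z.1, (graphMap (g p) (Ψ' p) α z).2)).1, (T ((graphMap (g p) (Ψ' p) α z).1, z.2)).2) =
      ((T ((graphMap (g p) (Ψ' p) α z).1, z.2)).1, (T (z.1, (graphMap (g p) (Ψ' p) α z).2)).2) := by
  obtain ⟨ε, hε, hU⟩ := H.exists_isGraphUnique hΨ
  set W := graphMap (g p) (Ψ' p) α with hW
  have hWc : Tendsto W (𝓝 (x, 0)) (𝓝 (x - α, 0)) := H.tendsto_graphMap hΨ' x
  have hid : Tendsto (fun z : Euc n × Euc n => z) (𝓝 (x, 0)) (𝓝 (x, 0)) := tendsto_id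
  have hA : Tendsto (fun z => T ((W z).1, z.2)) (𝓝 (x, 0)) (𝓝 (x - α, 0)) :=
    (hTc (x - α)).comp (hWc.fst_nhds.prodMk_nhds hid.snd_nhds)
  have hB : Tendsto (fun z => T (z.1, (W z).2)) (𝓝 (x, 0)) (𝓝 (x, 0)) :=
    (hTc x).comp (hid.fst_nhds.prodMk_nhds hWc.snd_nhds)
  have c1 := (hA.fst_nhds.sub (hB.fst_nhds.sub_const α)).norm
  have hlift : ∀ᶠ z in 𝓝 (x, (0 : Euc n)), liftMap (g p) (Ψ' p) ((W z).1, z.2) =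
      Ψ' p (z.1, (W z).2) :=
    (Continuous.tendsto (f := fun z : Euc n × Euc n => (p, z)) (by fun_prop) (x, 0)).eventually
      (H.liftMap_graphMap hΨ' x)
  filter_upwards [hlift, c1.eventually_lt_const (u := 1 / 2) (by simp),
    hA.snd_nhds.norm.eventually_lt_const (u := ε) (by simpa using hε),
    hB.snd_nhds.norm.eventually_lt_const (u := ε) (by simpa using hε)] with z h1 h2 h3 h4
  refine graphMap_eq hU.self_of_nhds ⟨?_, h2, h3, h4⟩
  rw [liftMap, hT, hT] at h1
  exact h1

theorem eventually_genForm_base (H : ∀ᶠ q in 𝓝 p, IsInvariantFamily σ h g α q)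
    (hΨ : ∀ᶠ q in 𝓝 p, IsSymplecticTube σ h Ψ q) :
    ∀ᶠ q in 𝓝 p, ∀ x, genForm (g q) (Ψ q) α (x, 0) = 0 := by
  filter_upwards [H, hΨ] with q h1 h2 x
  exact h1.genForm_base h2 x

/-- Write S and S' for the old and the new generating function. By `IsInvariantFamily.graphMap_comp`
the r-gradient of S at the mixed point c gives the angle shift seen in the old coordinates.
Subtracting the angle displacements at the two ends gives ∂S'/∂r = ∂S/∂r (c) - ∂u/∂r (x', r') +
∂u/∂r (x, r) + O(‖r‖^(d+2)). Modulo this error the arguments may be replaced by (x', r), (x', r) and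
(x' - α, r), where `heq` removes the angles. Integrating from r = 0 gains the last order. -/
theorem vanishesTo_genFun_comp (Hn : ∀ᶠ q in 𝓝 p, IsInvariantFamily σ h g α q)
    (hg : ∀ᶠ q in 𝓝 p, IsSymplectic σ (g q)) (hΨn : ∀ᶠ q in 𝓝 p, IsSymplecticTube σ h Ψ q)
    (hΨn' : ∀ᶠ q in 𝓝 p, IsSymplecticTube σ h Ψ' q)
    (hT : ∀ z, Ψ' p z = Ψ p (T z)) {d : ℕ} {u v : Euc n × Euc n → ℝ} {κ μ : Euc n → ℝ}
    (hκ : ContDiff ℝ ∞ κ) (hμ : ContDiff ℝ ∞ μ)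
    (hv : ∀ x, SmoothNear v (x, 0)) (hvd : VanishesTo (d + 2) v)
    (hgv : VanishesTo (d + 3) fun z => genFun (g p) (Ψ p) α z - κ z.2 - v z)
    (hu : ContDiff ℝ ∞ u) (hud : VanishesTo (d + 2) u)
    (hT1 : VanishesTo (d + 2) fun z => (T z).1 - z.1 - gradSnd u z)
    (hT2 : VanishesTo (d + 2) fun z => (T z).2 - z.2)
    (heq : ∀ z, u z - u (z.1 - α, z.2) = v z - μ z.2) :
    VanishesTo (d + 3) fun z => genFun (g p) (Ψ' p) α z - (κ z.2 + μ z.2) := by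
  have H := Hn.self_of_nhds
  have hΨ := hΨn.self_of_nhds
  have hΨ' := hΨn'.self_of_nhds
  have hb := eventually_genForm_base Hn hΨn
  have hb' := eventually_genForm_base Hn hΨn'
  have hus : ∀ x, SmoothNear u (x, 0) := fun x => smoothNear_of_contDiff hu _
  have hκs : ∀ z : Euc n × Euc n, SmoothNear (fun z : Euc n × Euc n => κ z.2) z := fun z =>
    smoothNear_of_contDiff (hκ.comp contDiff_snd) _
  have hμs : ∀ z : Euc n × Euc n, SmoothNear (fun z : Euc n × Euc n => μ z.2) z := fun z =>
    smoothNear_of_contDiff (hμ.comp contDiff_snd) _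
  have hκd : Differentiable ℝ κ := hκ.differentiable (by simp)
  have hμd : Differentiable ℝ μ := hμ.differentiable (by simp)
  have hG : ∀ x, SmoothNear (genFun (g p) (Ψ p) α) (x, 0) := fun x =>
    SmoothNear.snd_of_prod (f := fun q z => genFun (g q) (Ψ q) α z) (H.smoothNear_genFun hΨ x)
  have hG' : ∀ x, SmoothNear (genFun (g p) (Ψ' p) α) (x, 0) := fun x =>
    SmoothNear.snd_of_prod (f := fun q z => genFun (g q) (Ψ' q) α z) (H.smoothNear_genFun hΨ' x)
  set s := fun z => genFun (g p) (Ψ p) α z - κ z.2 with hsdef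
  have hs : ∀ x, SmoothNear s (x, 0) := fun x => (hG x).sub (hκs _)
  have hrs : ∀ x, SmoothNear (fun z => s z - v z) (x, 0) := fun x => (hs x).sub (hv x)
  have hsd : VanishesTo (d + 2) s := ((hgv.mono (l := d + 2) (by omega)).add hvd).congr
    fun x => Eventually.of_forall fun z => sub_add_cancel (s z) (v z)
  -- These normalizations at r = 0 allow the estimate of the radial gradient to be integrated.
  have hκ0 : κ 0 = 0 := by
    have := hsd.eq_zero (0 : Euc n)
    rw [hsdef] at this
    simpa [genFun_base] using this
  have hμ0 : μ 0 = 0 := by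
    have := heq (0, 0)
    simpa [hud.eq_zero, hvd.eq_zero] using this
  have ha := hud.gradSnd hus
  have has := fun x => (hus x).gradSnd'
  have hT1' : VanishesTo 1 fun z => (T z).1 - z.1 :=
    ((hT1.mono (l := 1) (by omega)).add (ha.mono (l := 1) (by omega))).congr
      fun x => Eventually.of_forall fun z => sub_add_cancel _ _
  have hTc : ∀ x, Tendsto T (𝓝 (x, 0)) (𝓝 (x, 0)) := fun x => by
    have h1 := (VanishesTo.tendsto_zero (k := 0) hT1' x).add
      (tendsto_id (x := 𝓝 (x, (0 : Euc n)))).fst_nhds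
    have h2 := (VanishesTo.tendsto_zero (k := d + 1) hT2 x).add
      (tendsto_id (x := 𝓝 (x, (0 : Euc n)))).snd_nhds
    simpa using h1.prodMk_nhds h2
  set W := graphMap (g p) (Ψ' p) α with hW
  have hWs : ∀ x, SmoothNear W (x, 0) := fun x =>
    SmoothNear.snd_of_prod (f := fun q z => graphMap (g q) (Ψ' q) α z) (H.smoothNear_graphMap hΨ' x)
  have hW1 : VanishesTo 1 fun z => W z - (z.1 - α, 0) :=
    VanishesTo.fst_of_smoothNear (fun x => (hWs x).sub (smoothNear_of_contDiff (by fun_prop) _))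
      fun x => by rw [hW, H.graphMap_base hΨ' x, sub_self]
  refine VanishesTo.of_gradSnd (fun x => (hG' x).sub ((hκs _).add (hμs _)))
    (fun x => by simp [genFun_base, hκ0, hμ0]) fun x => ?_
  have hWc : Tendsto W (𝓝 (x, 0)) (𝓝 (x - α, 0)) := H.tendsto_graphMap hΨ' x
  have hid : Tendsto (fun z : Euc n × Euc n => z) (𝓝 (x, 0)) (𝓝 (x, 0)) := tendsto_id
  have h0 : (fun z : Euc n × Euc n => z.2) =O[𝓝 (x, (0 : Euc n))] fun z => ‖z.2‖ :=
    (isBigO_refl _ _).norm_right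
  have hpow : ∀ {l : ℕ} {F : Type} [NormedAddCommGroup F] {f : Euc n × Euc n → F}, 1 ≤ l →
      f =O[𝓝 (x, (0 : Euc n))] (fun z => ‖z.2‖ ^ l) →
      f =O[𝓝 (x, (0 : Euc n))] fun z => ‖z.2‖ := fun hl hf => by
    simpa using hf.trans (isBigO_pow_of_le hl x)
  set cA : Euc n × Euc n → Euc n × Euc n := fun z => ((W z).1, z.2) with hcA
  set cB : Euc n × Euc n → Euc n × Euc n := fun z => (z.1, (W z).2) with hcB
  set c : Euc n × Euc n → Euc n × Euc n := fun z => ((T (cB z)).1, (T (cA z)).2) with hc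
  have tA : Tendsto cA (𝓝 (x, 0)) (𝓝 (x - α, 0)) := hWc.fst_nhds.prodMk_nhds hid.snd_nhds
  have tB : Tendsto cB (𝓝 (x, 0)) (𝓝 (x, 0)) := hid.fst_nhds.prodMk_nhds hWc.snd_nhds
  have tc : Tendsto c (𝓝 (x, 0)) (𝓝 (x, 0)) :=
    ((hTc x).comp tB).fst_nhds.prodMk_nhds ((hTc (x - α)).comp tA).snd_nhds
  have bA : (fun z => (cA z).2) =O[𝓝 (x, 0)] fun z => ‖z.2‖ := h0
  have bB : (fun z => (cB z).2) =O[𝓝 (x, 0)] fun z => ‖z.2‖ :=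
    hpow le_rfl ((hW1.clm_comp (ContinuousLinearMap.snd ℝ (Euc n) (Euc n)) x).congr_left
      fun z => by simp [hcB])
  have e1A := hT1.comp_isBigO tA bA
  have e1B := hT1.comp_isBigO tB bB
  have e2A := hT2.comp_isBigO tA bA
  have e2B := hT2.comp_isBigO tB bB
  have bc : (fun z => (c z).2) =O[𝓝 (x, 0)] fun z => ‖z.2‖ :=
    ((hpow (by omega) e2A).add h0).congr_left fun z => sub_add_cancel _ _
  have dc1 : (fun z => (c z).1 - z.1) =O[𝓝 (x, 0)] fun z => ‖z.2‖ :=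
    hpow le_rfl (hT1'.comp_isBigO tB bB)
  have hgc := H.graphMap_comp hΨ hΨ' hT hTc x
  -- The action changes by O(‖r‖^(d+2)) only, because κ does not contribute to the angular gradient
  -- and S - κ has order d + 2.
  have dB2 : (fun z => (cB z).2 - z.2) =O[𝓝 (x, 0)] fun z => ‖z.2‖ ^ (d + 2) := by
    refine ((e2A.sub e2B).sub ((hsd.gradFst hs).comp_isBigO tc bc)).congr' ?_ EventuallyEq.rfl
    filter_upwards [hgc, tc.eventually ((eventually_slice (H.gradFst_genFun hg hΨ hb x)).and (hG x).eventually)]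
      with z k1 ⟨k2, k3⟩
    rw [hsdef, gradFst_sub k3.differentiableAt (hκs _).differentiableAt, gradFst_snd hκd, k2, k1]
    simp only [hcA, hcB, hc]
    abel
  have t1 : (fun z => gradSnd v (c z) - gradSnd v z) =O[𝓝 (x, 0)] fun z => ‖z.2‖ ^ (d + 2) :=
    VanishesTo.sub_comp_isBigO (c' := fun z => z) (fun x => (hv x).gradSnd') (hvd.gradSnd hv) tc hid
      bc h0 dc1 (e2A.trans (isBigO_pow_of_le (by omega) x))
  have t2 : (fun z => gradSnd (fun z => s z - v z) (c z)) =O[𝓝 (x, 0)] fun z => ‖z.2‖ ^ (d + 2) :=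
    (VanishesTo.gradSnd hrs hgv).comp_isBigO tc bc
  have t3 : (fun z => gradSnd (fun z => κ z.2) (c z) - gradSnd (fun z => κ z.2) z) =O[𝓝 (x, 0)]
      fun z => ‖z.2‖ ^ (d + 2) := by
    have hK : ContDiff ℝ ∞ fun r => sharp (fderiv ℝ κ r) :=
      contDiff_const.clm_apply (hκ.fderiv_right (m := ∞) (by simp))
    have := ((hK.contDiffAt (x := 0)).hasStrictFDerivAt (by simp)).isBigO_sub.comp_tendsto
      (tc.snd_nhds.prodMk_nhds hid.snd_nhds)
    refine (this.trans e2A).congr_left fun z => ?_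
    rw [gradSnd_snd hκd (c z), gradSnd_snd hκd z]
    rfl
  have t4 : (fun z => gradSnd u (cB z) - gradSnd u z) =O[𝓝 (x, 0)] fun z => ‖z.2‖ ^ (d + 2) :=
    VanishesTo.sub_comp_isBigO (c' := fun z => z) has ha tB hid bB h0
      (by simpa [hcB] using isBigO_zero _ _) (dB2.trans (isBigO_pow_of_le (by omega) x))
  have t5 : (fun z => gradSnd u (cA z) - gradSnd u (z.1 - α, z.2)) =O[𝓝 (x, 0)]
      fun z => ‖z.2‖ ^ (d + 2) :=
    VanishesTo.sub_comp_isBigO (c' := fun z => (z.1 - α, z.2)) has ha tA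
      ((hid.fst_nhds.sub_const α).prodMk_nhds hid.snd_nhds) bA h0
      (hpow le_rfl ((hW1.clm_comp (ContinuousLinearMap.fst ℝ (Euc n) (Euc n)) x).congr_left
        fun z => by simp [hcA])) (by simpa [hcA] using isBigO_zero _ _)
  -- Replacement of arguments in v, S - κ - v, κ and in u at both ends, together with the errors of
  -- T at both ends.
  refine ((((((t1.add t2).add t3).sub t4).add t5).sub e1B).add e1A).congr' ?_ EventuallyEq.rfl
  filter_upwards [hgc, tc.eventually ((eventually_slice (H.gradSnd_genFun hg hΨ hb x)).and ((hG x).eventually.and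
    (hv x).eventually)), eventually_slice (H.gradSnd_genFun hg hΨ' hb' x), (hG' x).eventually, (hv x).eventually]
    with z k1 ⟨k2, k3, k4⟩ k5 k6 k7
  -- The cohomological equation, differentiated in r.
  have j1 : gradSnd u z - gradSnd u (z.1 - α, z.2) = gradSnd v z - gradSnd (fun z => μ z.2) z := by
    rw [← gradSnd_sub_left, ← gradSnd_sub (hu.differentiable (by simp) _), ← gradSnd_sub
      k7.differentiableAt (hμs z).differentiableAt]
    · simp only [heq]
    · exact (hu.differentiable (by simp) _).comp z (by fun_prop)
  have j2 : gradSnd (fun z => s z - v z) (c z) = (c z).1 - α - (T (cA z)).1 -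
      gradSnd (fun z => κ z.2) (c z) - gradSnd v (c z) := by
    have hsz : SmoothNear s (c z) := k3.sub (hκs _)
    rw [gradSnd_sub hsz.differentiableAt k4.differentiableAt, hsdef,
      gradSnd_sub k3.differentiableAt (hκs _).differentiableAt, k2, k1]
  have j3 : gradSnd (fun z => genFun (g p) (Ψ' p) α z - (κ z.2 + μ z.2)) z =
      z.1 - α - (W z).1 - gradSnd (fun z => κ z.2) z - gradSnd (fun z => μ z.2) z := by
    have e : (fun z => genFun (g p) (Ψ' p) α z - (κ z.2 + μ z.2)) =
        fun z => genFun (g p) (Ψ' p) α z - κ z.2 - μ z.2 := by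
      funext z
      ring
    have hsz : SmoothNear (fun z => genFun (g p) (Ψ' p) α z - κ z.2) z := k6.sub (hκs _)
    rw [e, gradSnd_sub hsz.differentiableAt
      (hμs z).differentiableAt, gradSnd_sub k6.differentiableAt (hκs _).differentiableAt, k5]
  rw [j2, j3]
  rw [sub_eq_iff_eq_add] at j1
  rw [j1]
  simp only [hcA, hcB, hc]
  abel

end Conjugation

/-! ### The cohomological equation with the action as a parameter. -/

section LeadingTerms

variable {n : ℕ}

theorem leadingTerm_add_lat {u : Euc n × Euc n → ℝ} (hu : ∀ z k, u (z + (lat k, 0)) = u z) (m : ℕ)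
    (z : Euc n × Euc n) (k : Fin n → ℤ) : leadingTerm m u (z + (lat k, 0)) = leadingTerm m u z := by
  have key : ∀ t z, scaleQuot u m t (z + (lat k, 0)) = scaleQuot u m t z := by
    induction m with
    | zero =>
      intro t z
      have := hu (z.1, t • z.2) k
      simpa [scaleQuot] using this
    | succ m ih =>
      intro t z
      simp only [scaleQuot, hadamardQuot, ih]
  exact key 0 z

/-- The solution of the cohomological equation on each torus. -/
def cohomSnd (α : Euc n) (N : ℕ) (v : Euc n × Euc n → ℝ) (z : Euc n × Euc n) : ℝ :=
  cohom α N (fun x => v (x, z.2)) z.1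

/-- The average over each torus. -/
def avgSnd (v : Euc n × Euc n → ℝ) (r : Euc n) : ℝ := cubeAvg fun x => v (x, r)

variable {P : Type} [NormedAddCommGroup P] [NormedSpace ℝ P] {v : P → Euc n × Euc n → ℝ} {p : P}

theorem smoothNear_cohomSnd (α : Euc n) (N : ℕ)
    (hv : ∀ z, SmoothNear (fun w : P × (Euc n × Euc n) => v w.1 w.2) (p, z)) (z : Euc n × Euc n) :
    SmoothNear (fun w : P × (Euc n × Euc n) => cohomSnd α N (v w.1) w.2) (p, z) := by
  have h1 := smoothNear_cohom α N (g := fun (w : P × Euc n) x => v w.1 (x, w.2)) (p := (p, z.2))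
    (fun x => SmoothNear.comp (g := fun w : P × (Euc n × Euc n) => v w.1 w.2)
      (f := fun w : (P × Euc n) × Euc n => (w.1.1, (w.2, w.1.2))) (hv (x, z.2))
      (smoothNear_of_contDiff (by fun_prop) _)) z.1
  exact SmoothNear.comp (g := fun w : (P × Euc n) × Euc n =>
      cohom α N ((fun (w : P × Euc n) x => v w.1 (x, w.2)) w.1) w.2)
    (f := fun w : P × (Euc n × Euc n) => ((w.1, w.2.2), w.2.1)) h1
    (smoothNear_of_contDiff (by fun_prop) _)

theorem smoothNear_avgSnd
    (hv : ∀ z, SmoothNear (fun w : P × (Euc n × Euc n) => v w.1 w.2) (p, z)) (r : Euc n) :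
    SmoothNear (fun w : P × Euc n => avgSnd (v w.1) w.2) (p, r) :=
  SmoothNear.cubeAvg (f := fun (w : P × Euc n) x => v w.1 (x, w.2))
    (fun x => SmoothNear.comp (g := fun w : P × (Euc n × Euc n) => v w.1 w.2)
      (f := fun w : (P × Euc n) × Euc n => (w.1.1, (w.2, w.1.2))) (hv (x, r))
      (smoothNear_of_contDiff (by fun_prop) _))

end LeadingTerms

/-! ### The inductive normalization. -/

section Stage

variable {n : ℕ} {M : Type*} [TopologicalSpace M] [ChartedSpace (Euc (2 * n)) M]

/-- The part of the generating function that is not yet in normal form. -/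
def remainder (g : M → M) (α : Euc n) (N : (Euc n × Euc n → M) × MvPolynomial (Fin n) ℝ)
    (z : Euc n × Euc n) : ℝ :=
  genFun g N.1 α z - polyFun N.2 z.2

/-- One step of the normalization, which removes the oscillating part of the terms of degree
`d + 2` of the generating function. -/
def normalStep (σ : SymplecticForm (2 * n) M) (g : M → M) (α : Euc n) (K d : ℕ)
    (N : (Euc n × Euc n → M) × MvPolynomial (Fin n) ℝ) :
    (Euc n × Euc n → M) × MvPolynomial (Fin n) ℝ :=
  (fun z => N.1 (twistFlow σ N.1 (cohomSnd α K (leadingTerm (d + 2) (remainder g α N))) z),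
    N.2 + homPoly (d + 2) (avgSnd (leadingTerm (d + 2) (remainder g α N))))

variable [IsManifold (𝓡 (2 * n)) ∞ M] {σ : SymplecticForm (2 * n) M}
  {P : Type} [NormedAddCommGroup P] [NormedSpace ℝ P] {h : P → Euc n → M}
  {g : P → M → M} {α : Euc n} {N : P → (Euc n × Euc n → M) × MvPolynomial (Fin n) ℝ} {p : P}

/-- Symplectic coordinates in which the generating function is the polynomial `(N q).2` up to terms
of degree `d + 2`. -/
structure IsNormalized (σ : SymplecticForm (2 * n) M) (h : P → Euc n → M) (g : P → M → M)
    (α : Euc n) (d : ℕ) (N : P → (Euc n × Euc n → M) × MvPolynomial (Fin n) ℝ) (p : P) :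
    Prop where
  tube : IsSymplecticTube σ h (fun q => (N q).1) p
  totalDegree_le : ∀ q, (N q).2.totalDegree ≤ d + 1
  smooth_coeff : ∀ e, SmoothNear (fun q => (N q).2.coeff e) p
  flat : VanishesTo (d + 2) (remainder (g p) α (N p))

variable [CompleteSpace P] [T2Space M]

/-- The radial gradient of the generating function is x' - α - x, which vanishes on r = 0. It
therefore has order 1, and the function itself has order 2. -/
theorem isNormalized_zero (Hn : ∀ᶠ q in 𝓝 p, IsInvariantFamily σ h g α q)
    (hg : ∀ᶠ q in 𝓝 p, IsSymplectic σ (g q)) {Ψ : P → Euc n × Euc n → M}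
    (hΨ : ∀ᶠ q in 𝓝 p, IsSymplecticTube σ h Ψ q) :
    IsNormalized σ h g α 0 (fun q => (Ψ q, 0)) p where
  tube := hΨ.self_of_nhds
  totalDegree_le q := by simp
  smooth_coeff e := by simpa using smoothNear_const (0 : ℝ) p
  flat := by
    have e : remainder (g p) α (Ψ p, 0) = genFun (g p) (Ψ p) α := by
      funext z
      simp [remainder, polyFun]
    have hs : ∀ x, SmoothNear (genFun (g p) (Ψ p) α) (x, 0) := fun x =>
      SmoothNear.snd_of_prod (f := fun q z => genFun (g q) (Ψ q) α z)
        (Hn.self_of_nhds.smoothNear_genFun hΨ.self_of_nhds x)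
    rw [e]
    refine VanishesTo.of_gradSnd hs (genFun_base _ _ _)
      (VanishesTo.fst_of_smoothNear (fun x => (hs x).gradSnd') fun x => ?_)
    have hb := eventually_genForm_base Hn hΨ
    rw [(eventually_slice (Hn.self_of_nhds.gradSnd_genFun hg hΨ.self_of_nhds hb x)).self_of_nhds,
      Hn.self_of_nhds.graphMap_base hΨ.self_of_nhds x]
    exact sub_self _

theorem IsNormalized.smoothNear_remainder {d : ℕ} (hN : IsNormalized σ h g α d N p)
    (H : IsInvariantFamily σ h g α p) (x : Euc n) :
    SmoothNear (fun w : P × (Euc n × Euc n) => remainder (g w.1) α (N w.1) w.2) (p, (x, 0)) :=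
  (H.smoothNear_genFun hN.tube x).sub
    (SmoothNear.comp (g := fun w : P × Euc n => polyFun (N w.1).2 w.2)
      (f := fun w : P × (Euc n × Euc n) => (w.1, w.2.2))
      (smoothNear_polyFun hN.totalDegree_le hN.smooth_coeff _)
      (smoothNear_of_contDiff (by fun_prop) _))

/-- The solution of the cohomological equation for the leading part of the remainder. -/
theorem IsNormalized.leadingTerm_remainder {d K : ℕ} (hN : IsNormalized σ h g α d N p)
    (H : IsInvariantFamily σ h g α p) :
    (∀ z, SmoothNear (fun w : P × (Euc n × Euc n) =>
        leadingTerm (d + 2) (remainder (g w.1) α (N w.1)) w.2) (p, z)) ∧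
      (∀ (c : ℝ) x r, leadingTerm (d + 2) (remainder (g p) α (N p)) (x, c • r) =
        c ^ (d + 2) * leadingTerm (d + 2) (remainder (g p) α (N p)) (x, r)) ∧
      (∀ z, SmoothNear (fun w : P × (Euc n × Euc n) =>
        cohomSnd α K (leadingTerm (d + 2) (remainder (g w.1) α (N w.1))) w.2) (p, z)) ∧
      VanishesTo (d + 2) (cohomSnd α K (leadingTerm (d + 2) (remainder (g p) α (N p)))) := by
  have hr := hN.smoothNear_remainder H
  have hr' : ∀ x, SmoothNear (remainder (g p) α (N p)) (x, 0) := fun x =>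
    SmoothNear.snd_of_prod (f := fun q z => remainder (g q) α (N q) z) (hr x)
  set v : P → Euc n × Euc n → ℝ := fun q => leadingTerm (d + 2) (remainder (g q) α (N q)) with hv
  have hvs : ∀ z, SmoothNear (fun w : P × (Euc n × Euc n) => v w.1 w.2) (p, z) := fun z =>
    smoothNear_leadingTerm (u := fun q => remainder (g q) α (N q)) hr (d + 2) z
  have hvp : ∀ z, SmoothNear (v p) z := fun z => SmoothNear.snd_of_prod (f := v) (hvs z)
  have hvc : ContDiff ℝ ∞ (v p) := contDiff_iff_contDiffAt.2 fun z => (hvp z).contDiffAt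
  have hvhom : ∀ (c : ℝ) x r, v p (x, c • r) = c ^ (d + 2) * v p (x, r) := fun c x r =>
    leadingTerm_smul hr' hN.flat c x r
  have hus := smoothNear_cohomSnd (v := v) α K hvs
  have huc : ContDiff ℝ ∞ (cohomSnd α K (v p)) := contDiff_iff_contDiffAt.2 fun z =>
    (SmoothNear.snd_of_prod (f := fun q z => cohomSnd α K (v q) z) (hus z)).contDiffAt
  refine ⟨hvs, hvhom, hus, vanishesTo_of_homogeneous huc.continuous fun c x r => ?_⟩
  -- The cohomological operator is linear and acts in x only, so homogeneity in r passes to the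
  -- solution.
  have e : (fun x => v p (x, c • r)) = fun x => c ^ (d + 2) * v p (x, r) :=
    funext fun x => hvhom c x r
  change cohom α K (fun x => v p (x, c • r)) x = c ^ (d + 2) * cohom α K (fun x => v p (x, r)) x
  rw [e]
  exact cohom_smul α K _ (hvc.comp (by fun_prop)) x

/-- The generator u solves the cohomological equation for the leading term v of the remainder. By
`vanishesTo_genFun_comp` the new generating function is the old polynomial plus the average of v, up
to one order more; the average is smooth and homogeneous, so `homPoly` represents it. -/
theorem IsNormalized.normalStep {d K : ℕ} (hNn : ∀ᶠ q in 𝓝 p, IsNormalized σ h g α d N q)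
    (Hn : ∀ᶠ q in 𝓝 p, IsInvariantFamily σ h g α q) (hg : ∀ᶠ q in 𝓝 p, IsSymplectic σ (g q))
    (hK : Summable fun k => ‖kernelCoeff α K k‖) (hα : ∀ k, k ≠ 0 → 1 - expMode (-k) α ≠ 0) :
    IsNormalized σ h g α (d + 1) (fun q => KAMBirkhoff.normalStep σ (g q) α K d (N q)) p := by
  have hN := hNn.self_of_nhds
  have H := Hn.self_of_nhds
  set v : P → Euc n × Euc n → ℝ := fun q => leadingTerm (d + 2) (remainder (g q) α (N q)) with hv
  have hvn : ∀ᶠ q in 𝓝 p, (∀ z, SmoothNear (fun w : P × (Euc n × Euc n) => v w.1 w.2) (q, z)) ∧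
      (∀ (c : ℝ) x r, v q (x, c • r) = c ^ (d + 2) * v q (x, r)) ∧
      (∀ z, SmoothNear (fun w : P × (Euc n × Euc n) => cohomSnd α K (v w.1) w.2) (q, z)) ∧
      VanishesTo (d + 2) (cohomSnd α K (v q)) := by
    filter_upwards [hNn, Hn] with q h1 h2
    exact h1.leadingTerm_remainder h2
  have hvper : ∀ q z k, v q (z + (lat k, 0)) = v q z := fun q z k =>
    leadingTerm_add_lat (fun z k => by
      rw [remainder, remainder, genFun_add_lat (hN.tube.periodic q)]
      simp) _ z k
  have hvper' : ∀ q r, IsPeriodic fun x => v q (x, r) := fun q r x k => by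
    simpa using hvper q (x, r) k
  have huper : ∀ q z k, cohomSnd α K (v q) (z + (lat k, 0)) = cohomSnd α K (v q) z := by
    intro q z k
    have := isPeriodic_cohom α K (hvper' q z.2) z.1 k
    simpa [cohomSnd] using this
  -- The new tube is needed at all nearby parameters, because closedness and vanishing of the new
  -- `genForm` are used there.
  have htube : ∀ᶠ q in 𝓝 p, IsSymplecticTube σ h
      (fun q z => (N q).1 (twistFlow σ (N q).1 (cohomSnd α K (v q)) z)) q := by
    filter_upwards [hNn.eventually_nhds, hvn.eventually_nhds] with q h1 h2
    exact (isSymplecticTube_comp_twistFlow (Ψ := fun q => (N q).1)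
      (u := fun q => cohomSnd α K (v q)) (h1.mono fun q h => h.tube)
      (h2.mono fun q h x => h.2.2.1 (x, 0)) huper (h2.mono fun q h => h.2.2.2)).1
  obtain ⟨h1, h2, h3⟩ := isSymplecticTube_comp_twistFlow (Ψ := fun q => (N q).1)
    (u := fun q => cohomSnd α K (v q)) (hNn.mono fun q h => h.tube)
    (hvn.mono fun q h x => h.2.2.1 (x, 0)) huper (hvn.mono fun q h => h.2.2.2)
  obtain ⟨hvs, hvhom, hus, hud⟩ := hvn.self_of_nhds
  have hr' : ∀ x, SmoothNear (remainder (g p) α (N p)) (x, 0) := fun x =>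
    SmoothNear.snd_of_prod (f := fun q z => remainder (g q) α (N q) z) (hN.smoothNear_remainder H x)
  have hvp : ∀ z, SmoothNear (v p) z := fun z => SmoothNear.snd_of_prod (f := v) (hvs z)
  have hvc : ContDiff ℝ ∞ (v p) := contDiff_iff_contDiffAt.2 fun z => (hvp z).contDiffAt
  have hvx : ∀ r, ContDiff ℝ ∞ fun x => v p (x, r) := fun r => hvc.comp (by fun_prop)
  have huc : ContDiff ℝ ∞ (cohomSnd α K (v p)) := contDiff_iff_contDiffAt.2 fun z =>
    (SmoothNear.snd_of_prod (f := fun q z => cohomSnd α K (v q) z) (hus z)).contDiffAt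
  have hms := smoothNear_avgSnd (v := v) hvs
  have hmc : ContDiff ℝ ∞ (avgSnd (v p)) := contDiff_iff_contDiffAt.2 fun r =>
    (SmoothNear.snd_of_prod (f := fun q r => avgSnd (v q) r) (hms r)).contDiffAt
  have hmhom : ∀ (c : ℝ) r, avgSnd (v p) (c • r) = c ^ (d + 2) * avgSnd (v p) r := by
    intro c r
    simp only [avgSnd, hvhom]
    exact cubeAvg_smul _ _
  have hstep : (fun q => KAMBirkhoff.normalStep σ (g q) α K d (N q)) = fun q =>
      (fun z => (N q).1 (twistFlow σ (N q).1 (cohomSnd α K (v q)) z),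
        (N q).2 + homPoly (d + 2) (avgSnd (v q))) := rfl
  rw [hstep]
  refine ⟨h1, fun q => ?_, fun e => ?_, ?_⟩
  · dsimp only
    refine (MvPolynomial.totalDegree_add _ _).trans (max_le ((hN.totalDegree_le q).trans ?_) ?_)
    · omega
    · exact (totalDegree_homPoly_le _ _)
  · simp only [MvPolynomial.coeff_add]
    exact (hN.smooth_coeff e).add (smoothNear_coeff_homPoly (f := fun q => avgSnd (v q)) hms _ e)
  · have key := vanishesTo_genFun_comp Hn hg
      (Ψ := fun q => (N q).1) (Ψ' := fun q z => (N q).1 (twistFlow σ (N q).1 (cohomSnd α K (v q)) z))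
      (hNn.mono fun q h => h.tube) htube (T := twistFlow σ (N p).1
      (cohomSnd α K (v p))) (fun z => rfl) (contDiff_polyFun (N p).2) hmc (fun x => hvp _)
      (vanishesTo_of_homogeneous hvc.continuous fun c x r => hvhom c x r)
      (vanishesTo_sub_leadingTerm hr' hN.flat) huc hud h2 h3
      fun z => cohom_sub hK hα (hvx z.2) (hvper' p z.2) z.1
    have e : remainder (g p) α (fun z => (N p).1 (twistFlow σ (N p).1
        (cohomSnd α K (v p)) z), (N p).2 + homPoly (d + 2) (avgSnd (v p))) = fun z =>
        genFun (g p) (fun z => (N p).1 (twistFlow σ (N p).1 (cohomSnd α K (v p)) z)) α z -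
          (polyFun (N p).2 z.2 + avgSnd (v p) z.2) := by
      funext z
      rw [remainder, ← polyFun_homPoly hmc hmhom z.2]
      simp [polyFun]
    rw [e]
    exact key

/-- Coordinates near a torus in which the map is in normal form to order `d`, together with the
normal form. -/
def normalForm (σ : SymplecticForm (2 * n) M) (χ : M → M → ℝ) (l : List M) (h : Euc n → M)
    (g : M → M) (α : Euc n) (K : ℕ) : ℕ → (Euc n × Euc n → M) × MvPolynomial (Fin n) ℝ
  | 0 => (tubeMap σ χ l h, 0)
  | d + 1 => normalStep σ g α K d (normalForm σ χ l h g α K d)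

/-- Each step consumes the previous one on a whole neighbourhood of the parameter, so the induction
carries an `∀ᶠ` conclusion and re-localizes at every nearby q. -/
theorem isNormalized_normalForm (H : ∀ᶠ q in 𝓝 p, IsInvariantFamily σ h g α q)
    (hg : ∀ᶠ q in 𝓝 p, IsSymplectic σ (g q)) {χ : M → M → ℝ} {l : List M} {K : ℕ}
    (hχ : ∀ j, tsupport (χ j) ⊆ (chartAt (Euc (2 * n)) j).source)
    (hχs : ∀ j, ContMDiff (𝓡 (2 * n)) 𝓘(ℝ, ℝ) ∞ (χ j))
    (hl : ∀ y, (l.map fun j => χ j y).sum = 1)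
    (hK : Summable fun k => ‖kernelCoeff α K k‖) (hα : ∀ k, k ≠ 0 → 1 - expMode (-k) α ≠ 0)
    (d : ℕ) : ∀ᶠ q in 𝓝 p,
      IsNormalized σ h g α d (fun q => normalForm σ χ l (h q) (g q) α K d) q := by
  induction d with
  | zero =>
    have ht : ∀ᶠ q in 𝓝 p, IsSymplecticTube σ h (fun q => tubeMap σ χ l (h q)) q := by
      filter_upwards [H.eventually_nhds] with q hq
      exact isSymplecticTube_tubeMap (hq.mono fun q h => h.toIsTorusFamily) hχ hχs hl
    filter_upwards [H.eventually_nhds, hg.eventually_nhds, ht.eventually_nhds] with q h1 h2 h3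
    exact isNormalized_zero h1 h2 h3
  | succ d ih =>
    filter_upwards [H.eventually_nhds, hg.eventually_nhds, ih.eventually_nhds] with q h1 h2 h3
    exact IsNormalized.normalStep (N := fun q => normalForm σ χ l (h q) (g q) α K d) h3 h1 h2 hK hα

end Stage

/-! ### Gradients and derivatives in the form of the final statement. -/

section Gradients

variable {n : ℕ}

theorem gradient_eq_sharp (f : Euc n → ℝ) (x : Euc n) : ∇ f x = sharp (fderiv ℝ f x) := by
  refine (sharp_eq_iff.2 fun v => ?_).symm
  rw [← toDual_gradient, InnerProductSpace.toDual_apply_apply]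

theorem gradient_fst {u : Euc n × Euc n → ℝ} {x r : Euc n} (h : DifferentiableAt ℝ u (x, r)) :
    ∇ (fun x => u (x, r)) x = gradFst u (x, r) := by
  have d : HasFDerivAt (fun x => u (x, r)) (fderiv ℝ u (x, r) ∘L .inl ℝ _ _) x :=
    HasFDerivAt.comp (g := u) (f := fun x => (x, r)) x h.hasFDerivAt (hasFDerivAt_prodMk_left x r)
  rw [gradient_eq_sharp, d.fderiv, gradFst]

theorem gradient_snd {u : Euc n × Euc n → ℝ} {x r : Euc n} (h : DifferentiableAt ℝ u (x, r)) :
    ∇ (fun r => u (x, r)) r = gradSnd u (x, r) := by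
  have d : HasFDerivAt (fun r => u (x, r)) (fderiv ℝ u (x, r) ∘L .inr ℝ _ _) r :=
    HasFDerivAt.comp (g := u) (f := fun r => (x, r)) r h.hasFDerivAt (hasFDerivAt_prodMk_right x r)
  rw [gradient_eq_sharp, d.fderiv, gradSnd]

/-- Each radial derivative lowers the order by one. The target F is quantified inside so that the
induction can pass to the operator-valued derivative. -/
theorem VanishesTo.iteratedFDeriv_eq_zero (x : Euc n) (k : ℕ) :
    ∀ {F : Type} [NormedAddCommGroup F] [NormedSpace ℝ F] [CompleteSpace F]
      {u : Euc n × Euc n → F},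
      (∀ x, SmoothNear u (x, 0)) → VanishesTo (k + 1) u →
        iteratedFDeriv ℝ k (fun r => u (x, r)) 0 = 0 := by
  induction k with
  | zero =>
    intro F _ _ _ u _ hu
    ext m
    simp [hu.eq_zero x]
  | succ k ih =>
    intro F _ _ _ u hs hu
    have h1 : VanishesTo (k + 1) fun z => fderiv ℝ u z ∘L .inr ℝ (Euc n) (Euc n) :=
      VanishesTo.of_apply fun v => hu.fderiv_apply hs (0, v)
    have h2 := ih (fun x => (hs x).fderiv.clm_comp (smoothNear_const _ _)) h1
    have ht : Tendsto (fun r : Euc n => (x, r)) (𝓝 0) (𝓝 (x, 0)) :=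
      (by fun_prop : Continuous fun r : Euc n => (x, r)).tendsto 0
    have h3 : fderiv ℝ (fun r => u (x, r)) =ᶠ[𝓝 0]
        fun r => fderiv ℝ u (x, r) ∘L .inr ℝ (Euc n) (Euc n) := by
      filter_upwards [ht.eventually (hs x).eventually] with r hr
      have d : HasFDerivAt (fun r => u (x, r)) (fderiv ℝ u (x, r) ∘L .inr ℝ _ _) r :=
        HasFDerivAt.comp (g := u) (f := fun r => (x, r)) r hr.differentiableAt.hasFDerivAt
          (hasFDerivAt_prodMk_right x r)
      exact d.fderiv
    rw [← norm_eq_zero, ← norm_iteratedFDeriv_fderiv, (h3.iteratedFDeriv ℝ k).self_of_nhds, h2,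
      norm_zero]

end Gradients

/-! ### Tubes on which the normal form holds. -/

section NormalTube

variable {n : ℕ} {M : Type*} [TopologicalSpace M] [ChartedSpace (Euc (2 * n)) M]

/-- In the tube of radius `ε` the coordinates `N.1` are injective and symplectic, and conjugate `g`
to the map with generating function `N.2` plus the remainder. -/
structure IsNormalTube (σ : SymplecticForm (2 * n) M) (g : M → M) (α : Euc n)
    (N : (Euc n × Euc n → M) × MvPolynomial (Fin n) ℝ) (ε : ℝ) : Prop where
  injective : ∀ x r x' r', ‖r‖ < ε → ‖r'‖ < ε → N.1 (x, r) = N.1 (x', r') →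
    (∃ k, x' = x + lat k) ∧ r' = r
  symplectic : ∀ x r, ‖r‖ < ε → pbForm σ.form N.1 (x, r) = w0
  graph : ∀ x r x' r', ‖r‖ < ε → ‖r'‖ < ε → (g (N.1 (x, r)) = N.1 (x', r') ↔
    (∃ k, x' = x + α + ∇ (polyFun N.2) r + gradSnd (remainder g α N) (x', r) + lat k) ∧
      r' = r - gradFst (remainder g α N) (x', r))

theorem IsNormalTube.mono {σ : SymplecticForm (2 * n) M} {g : M → M} {α : Euc n}
    {N : (Euc n × Euc n → M) × MvPolynomial (Fin n) ℝ} {ε ε' : ℝ} (h : IsNormalTube σ g α N ε)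
    (hε : ε' ≤ ε) : IsNormalTube σ g α N ε' where
  injective x r x' r' hr hr' := h.injective x r x' r' (hr.trans_le hε) (hr'.trans_le hε)
  symplectic x r hr := h.symplectic x r (hr.trans_le hε)
  graph x r x' r' hr hr' := h.graph x r x' r' (hr.trans_le hε) (hr'.trans_le hε)

theorem remainder_add_lat {g : M → M} {α : Euc n}
    {N : (Euc n × Euc n → M) × MvPolynomial (Fin n) ℝ} (hN : ∀ z k, N.1 (z + (lat k, 0)) = N.1 z)
    (z : Euc n × Euc n) (k : Fin n → ℤ) :
    remainder g α N (z + (lat k, 0)) = remainder g α N z := by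
  rw [remainder, remainder, genFun_add_lat hN]
  simp

variable [IsManifold (𝓡 (2 * n)) ∞ M] {σ : SymplecticForm (2 * n) M}
  {P : Type} [NormedAddCommGroup P] [NormedSpace ℝ P] {h : P → Euc n → M}
  {g : P → M → M} {α : Euc n} {N : P → (Euc n × Euc n → M) × MvPolynomial (Fin n) ℝ} {p : P}
  [CompleteSpace P] [T2Space M]

/-- On r = 0 the radial gradient of the generating function is x' - α - x = 0 and that of the
remainder is zero by flatness; their difference is the gradient of the polynomial. -/
theorem IsNormalized.gradient_polyFun {d : ℕ} (hNn : ∀ᶠ q in 𝓝 p, IsNormalized σ h g α d N q)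
    (Hn : ∀ᶠ q in 𝓝 p, IsInvariantFamily σ h g α q) (hg : ∀ᶠ q in 𝓝 p, IsSymplectic σ (g q)) :
    ∇ (polyFun (N p).2) 0 = 0 := by
  have hN := hNn.self_of_nhds
  have H := Hn.self_of_nhds
  have hr : ∀ x, SmoothNear (remainder (g p) α (N p)) (x, 0) := fun x =>
    SmoothNear.snd_of_prod (f := fun q z => remainder (g q) α (N q) z) (hN.smoothNear_remainder H x)
  have hG : SmoothNear (genFun (g p) (N p).1 α) (0, 0) :=
    SmoothNear.snd_of_prod (f := fun q z => genFun (g q) (N q).1 α z)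
      (H.smoothNear_genFun (Ψ := fun q => (N q).1) hN.tube 0)
  have hb := eventually_genForm_base (Ψ := fun q => (N q).1) Hn (hNn.mono fun q h => h.tube)
  have h1 := (H.gradSnd_genFun (Ψ := fun q => (N q).1) hg hN.tube hb 0).self_of_nhds
  have h2 := (hN.flat.gradSnd hr).eq_zero 0
  have hd := (contDiff_polyFun (N p).2).differentiable (by simp)
  have e : remainder (g p) α (N p) = fun z => genFun (g p) (N p).1 α z - polyFun (N p).2 z.2 := rfl
  have hd' : DifferentiableAt ℝ (fun z : Euc n × Euc n => polyFun (N p).2 z.2) (0, 0) :=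
    hd.comp differentiable_snd _
  rw [e, gradSnd_sub hG.differentiableAt hd', gradSnd_snd hd] at h2
  dsimp only at h1
  rw [h1, H.graphMap_base (Ψ := fun q => (N q).1) hN.tube] at h2
  rw [gradient_eq_sharp]
  simpa using h2

/-- Normal tubes have a radius which is locally uniform in the parameter. -/
theorem IsNormalized.exists_normalTube {d : ℕ} (hNn : ∀ᶠ q in 𝓝 p, IsNormalized σ h g α d N q)
    (Hn : ∀ᶠ q in 𝓝 p, IsInvariantFamily σ h g α q) (hg : ∀ᶠ q in 𝓝 p, IsSymplectic σ (g q)) :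
    ∃ ε > 0, ∀ᶠ q in 𝓝 p, IsNormalTube σ (g q) α (N q) ε ∧ ∀ x r, ‖r‖ < ε →
      MNear (2 * n) (fun w : P × (Euc n × Euc n) => (N w.1).1 w.2) (q, (x, r)) ∧
      SmoothNear (fun w : P × (Euc n × Euc n) => remainder (g w.1) α (N w.1) w.2) (q, (x, r)) := by
  have hN := hNn.self_of_nhds
  have H := Hn.self_of_nhds
  have hper := hN.tube.periodic
  have hrper : ∀ q z k, remainder (g q) α (N q) (z + (lat k, 0)) = remainder (g q) α (N q) z :=
    fun q z k => remainder_add_lat (hper q) z k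
  have hGper : ∀ q z k, genFun (g q) (N q).1 α (z + (lat k, 0)) = genFun (g q) (N q).1 α z :=
    fun q z k => by rw [genFun_add_lat (hper q)]
  have hb := eventually_genForm_base (Ψ := fun q => (N q).1) Hn (hNn.mono fun q h => h.tube)
  have hshift : ∀ (x r : Euc n) (k : Fin n → ℤ), (x + lat k, r) = (x, r) + (lat k, (0 : Euc n)) :=
    fun x r k => by simp
  have htr : ∀ (k : Fin n → ℤ) (w : P × (Euc n × Euc n)),
      SmoothNear (fun w : P × (Euc n × Euc n) => (w.1, w.2 + (lat k, (0 : Euc n)))) w :=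
    fun k w => smoothNear_of_contDiff (by fun_prop) _
  -- Each property holds near r = 0 on a tube uniform in the angle and for nearby parameters; the
  -- smallest of the six radii serves for all.
  obtain ⟨ε₁, h1, hinj⟩ := H.exists_injective_tube (Ψ := fun q => (N q).1) hN.tube
  obtain ⟨ε₂, h2, hgraph⟩ := H.exists_graph_tube (Ψ := fun q => (N q).1) hN.tube
  obtain ⟨ε₃, h3, hsymp⟩ := exists_uniform_tube (p := p)
    (G := fun q x r => pbForm σ.form (N q).1 (x, r) = w0) (fun q x r k hG => by
      rw [hshift] at hG
      rwa [pbForm_add_of_periodic (fun z => hper q z k)] at hG) hN.tube.symplectic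
  obtain ⟨ε₄, h4, hsmooth⟩ := exists_uniform_tube (p := p)
    (G := fun q x r => MNear (2 * n) (fun w : P × (Euc n × Euc n) => (N w.1).1 w.2) (q, (x, r)))
    (fun q x r k hG => by
      rw [hshift] at hG
      have := MNear.comp (f := fun w : P × (Euc n × Euc n) => (N w.1).1 w.2)
        (g := fun w : P × (Euc n × Euc n) => (w.1, w.2 + (lat k, (0 : Euc n)))) hG
        (htr k (q, (x, r)))
      simpa only [hper] using this) fun x => (hN.tube.smooth x).eventually
  obtain ⟨ε₅, h5, hrem⟩ := exists_uniform_tube (p := p)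
    (G := fun q x r => SmoothNear
      (fun w : P × (Euc n × Euc n) => remainder (g w.1) α (N w.1) w.2) (q, (x, r)))
    (fun q x r k hG => by
      rw [hshift] at hG
      have := SmoothNear.comp
        (g := fun w : P × (Euc n × Euc n) => remainder (g w.1) α (N w.1) w.2)
        (f := fun w : P × (Euc n × Euc n) => (w.1, w.2 + (lat k, (0 : Euc n)))) hG
        (htr k (q, (x, r)))
      simpa only [hrper] using this) fun x => (hN.smoothNear_remainder H x).eventually
  obtain ⟨ε₆, h6, hgrad⟩ := exists_uniform_tube (p := p)
    (G := fun q x r => gradFst (genFun (g q) (N q).1 α) (x, r) =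
        r - (graphMap (g q) (N q).1 α (x, r)).2 ∧
      gradSnd (genFun (g q) (N q).1 α) (x, r) = x - α - (graphMap (g q) (N q).1 α (x, r)).1)
    (fun q x r k hG => by
      rw [hshift, gradFst_add_lat (fun z => hGper q z k), gradSnd_add_lat (fun z => hGper q z k),
        graphMap_add_lat (hper q)] at hG
      refine ⟨by simpa using hG.1, hG.2.trans ?_⟩
      simp only [Prod.fst_add]
      abel)
    fun x => (H.gradFst_genFun (Ψ := fun q => (N q).1) hg hN.tube hb x).and
      (H.gradSnd_genFun (Ψ := fun q => (N q).1) hg hN.tube hb x)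
  obtain ⟨ε, hε, hle⟩ : ∃ ε > 0, ε ≤ ε₁ ∧ ε ≤ ε₂ ∧ ε ≤ ε₃ ∧ ε ≤ ε₄ ∧ ε ≤ ε₅ ∧ ε ≤ ε₆ := by
    refine ⟨min ε₁ (min ε₂ (min ε₃ (min ε₄ (min ε₅ ε₆)))), by positivity, ?_⟩
    simp only [← le_min_iff, le_refl]
  obtain ⟨l1, l2, l3, l4, l5, l6⟩ := hle
  refine ⟨ε, hε, ?_⟩
  filter_upwards [hinj, hgraph, hsymp, hsmooth, hrem, hgrad] with q a1 a2 a3 a4 a5 a6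
  refine ⟨⟨fun x r x' r' hr hr' => a1 x r x' r' (hr.trans_le l1) (hr'.trans_le l1),
    fun x r hr => a3 x r (hr.trans_le l3), fun x r x' r' hr hr' => ?_⟩,
    fun x r hr => ⟨a4 x r (hr.trans_le l4), a5 x r (hr.trans_le l5)⟩⟩
  obtain ⟨b1, b2⟩ := a6 x' r (hr.trans_le l6)
  have hrd : DifferentiableAt ℝ (remainder (g q) α (N q)) (x', r) := (SmoothNear.snd_of_prod
    (f := fun q z => remainder (g q) α (N q) z) (a5 x' r (hr.trans_le l5))).differentiableAt
  have hd := (contDiff_polyFun (N q).2).differentiable (by simp)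
  have hd' : DifferentiableAt ℝ (fun z : Euc n × Euc n => -polyFun (N q).2 z.2) (x', r) :=
    (hd.comp differentiable_snd _).neg
  have e : genFun (g q) (N q).1 α = fun z => remainder (g q) α (N q) z -
      -polyFun (N q).2 z.2 := by
    funext z
    rw [remainder]
    ring
  have hdn : Differentiable ℝ fun r => -polyFun (N q).2 r := hd.neg
  rw [e, gradFst_sub hrd hd', gradFst_snd hdn, sub_zero] at b1
  rw [e, gradSnd_sub hrd hd', gradSnd_snd hdn] at b2
  dsimp only at b2
  rw [fderiv_fun_neg, map_neg, ← gradient_eq_sharp, sub_neg_eq_add] at b2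
  rw [b1]
  -- The graph description gives x as x' - α minus the radial gradient; solving for x' moves the
  -- same lattice vector to the other side.
  refine (a2 x' r (hr.trans_le l2) x r' (hr'.trans_le l2)).trans (and_congr ?_ ?_)
  · refine exists_congr fun k => ?_
    rw [show (graphMap (g q) (N q).1 α (x', r)).1 = x' - α -
      (gradSnd (remainder (g q) α (N q)) (x', r) + ∇ (polyFun (N q).2) r) by rw [b2]; abel]
    constructor <;> intro hx
    · rw [sub_eq_iff_eq_add, sub_eq_iff_eq_add] at hx
      exact hx.trans (by abel)
    · rw [sub_eq_iff_eq_add, sub_eq_iff_eq_add]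
      exact hx.trans (by abel)
  · rw [sub_sub_cancel]
    exact eq_comm

end NormalTube

/-! ### Symplectic coordinates are open maps. -/

section OpenMap

variable {n : ℕ} {M : Type*} [TopologicalSpace M] [ChartedSpace (Euc (2 * n)) M]
  [IsManifold (𝓡 (2 * n)) ∞ M]

/-- A vector killed by the derivative would be in the kernel of the nondegenerate `w0`. So the
derivative is injective, both dimensions are 2 n, and the inverse function theorem applies. -/
theorem map_nhds_of_pbForm_eq_w0 {σ : SymplecticForm (2 * n) M} {Ψ : Euc n × Euc n → M}
    {z : Euc n × Euc n} (hΨ : MNear (2 * n) Ψ z) (h : pbForm σ.form Ψ z = w0) :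
    map Ψ (𝓝 z) = 𝓝 (Ψ z) := by
  set c := chartAt (Euc (2 * n)) (Ψ z) with hc
  have hcs : Ψ z ∈ c.source := mem_chart_source _ _
  have hs : SmoothNear (fun y => c (Ψ y)) z := hΨ.chart hcs
  have hinj : Function.Injective (fderiv ℝ (fun y => c (Ψ y)) z) := by
    refine (injective_iff_map_eq_zero _).2 fun u hu => ?_
    obtain ⟨e, he⟩ := isInvertible_w0 (n := n)
    have h1 : w0 u = 0 := by
      refine ContinuousLinearMap.ext fun v => ?_
      rw [← h, pbForm_eq_chart (c := Ψ z) (hΨ.contMDiffAt.mdifferentiableAt (by simp)) hcs, hu,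
        map_zero]
      rfl
    rw [← he] at h1
    exact e.map_eq_zero_iff.1 h1
  obtain ⟨e, he⟩ := isInvertible_of_injective hinj (by simp; ring)
  have hst : HasStrictFDerivAt (fun y => c (Ψ y)) (e : Euc n × Euc n →L[ℝ] Euc (2 * n)) z := by
    rw [he]
    exact hs.contDiffAt.hasStrictFDerivAt (by simp)
  have h1 := hst.map_nhds_eq_of_equiv
  have h2 : Ψ =ᶠ[𝓝 z] fun y => c.symm (c (Ψ y)) := by
    filter_upwards [hΨ.eventually_mem_source (c := Ψ z) hcs] with y hy
    exact (c.left_inv hy).symm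
  rw [Filter.map_congr h2, show (fun y => c.symm (c (Ψ y))) = c.symm ∘ fun y => c (Ψ y) from rfl,
    ← Filter.map_map, h1, c.symm_map_nhds_eq hcs]

end OpenMap

/-! ### Iterates of symplectic maps. -/

section Iterates

variable {n p : ℕ} {M : Type*} [TopologicalSpace M] [ChartedSpace (Euc (2 * n)) M]
  {σ : SymplecticForm (2 * n) M} {A : Type*} [TopologicalSpace A] [ChartedSpace (Euc p) A]

theorem IsSymplectic.comp {f g : M → M} (hg : IsSymplectic σ g) (hf : IsSymplectic σ f)
    (hgd : MDifferentiable (𝓡 (2 * n)) (𝓡 (2 * n)) g)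
    (hfd : MDifferentiable (𝓡 (2 * n)) (𝓡 (2 * n)) f) : IsSymplectic σ (g ∘ f) := by
  intro x
  rw [← hf x]
  refine ContinuousAlternatingMap.ext fun v => ?_
  have h1 := mfderiv_comp (I := 𝓡 (2 * n)) (I' := 𝓡 (2 * n)) (I'' := 𝓡 (2 * n)) x (hgd (f x)) (hfd x)
  have h2 := DFunLike.congr_fun (hg (f x)) fun i => mfderiv (𝓡 (2 * n)) (𝓡 (2 * n)) f x (v i)
  refine Eq.trans ?_ h2
  change (σ.form (g (f x))) (fun i => mfderiv (𝓡 (2 * n)) (𝓡 (2 * n)) (g ∘ f) x (v i)) =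
    (σ.form (g (f x))) (fun i => mfderiv (𝓡 (2 * n)) (𝓡 (2 * n)) g (f x)
      (mfderiv (𝓡 (2 * n)) (𝓡 (2 * n)) f x (v i)))
  rw [h1]
  rfl

theorem IsSymplectic.iterate {f : M → M} (hf : IsSymplectic σ f)
    (hfs : ContMDiff (𝓡 (2 * n)) (𝓡 (2 * n)) ∞ f) (k : ℕ) :
    IsSymplectic σ f^[k] ∧ ContMDiff (𝓡 (2 * n)) (𝓡 (2 * n)) ∞ f^[k] := by
  induction k with
  | zero =>
    refine ⟨fun x => ContinuousAlternatingMap.ext fun v => ?_, contMDiff_id⟩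
    change (σ.form x) (fun i => mfderiv (𝓡 (2 * n)) (𝓡 (2 * n)) id x (v i)) = _
    rw [mfderiv_id]
    rfl
  | succ k ih =>
    rw [Function.iterate_succ']
    exact ⟨hf.comp ih.1 (hfs.mdifferentiable (by simp)) (ih.2.mdifferentiable (by simp)),
      hfs.comp ih.2⟩

theorem contMDiff_iterate {f : A → M → M}
    (hf : ContMDiff ((𝓡 p).prod (𝓡 (2 * n))) (𝓡 (2 * n)) ∞ (fun z : A × M => f z.1 z.2)) (k : ℕ) :
    ContMDiff ((𝓡 p).prod (𝓡 (2 * n))) (𝓡 (2 * n)) ∞ (fun z : A × M => (f z.1)^[k] z.2) := by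
  induction k with
  | zero => exact contMDiff_snd
  | succ k ih =>
    simp only [Function.iterate_succ_apply']
    exact ContMDiff.comp (g := fun z : A × M => f z.1 z.2)
      (f := fun z : A × M => (z.1, (f z.1)^[k] z.2)) hf (contMDiff_fst.prodMk ih)

end Iterates

/-! ### From charts of the parameter manifold to the whole of it. -/

section Parameters

variable {n p : ℕ} {M : Type*} [TopologicalSpace M] [ChartedSpace (Euc (2 * n)) M]
  [IsManifold (𝓡 (2 * n)) ∞ M] {σ : SymplecticForm (2 * n) M}
  {A : Type*} [TopologicalSpace A] [ChartedSpace (Euc p) A] [IsManifold (𝓡 p) ∞ A]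

theorem torusProj_add_lat (x : Euc n) (k : Fin n → ℤ) : torusProj (x + lat k) = torusProj x :=
  (torusProj_eq_iff.2 ⟨k, rfl⟩).symm

/-- A family of invariant tori in a chart of the parameter space. -/
theorem isInvariantFamily_chart {f : A → M → M}
    (hf : ContMDiff ((𝓡 p).prod (𝓡 (2 * n))) (𝓡 (2 * n)) ∞ (fun z : A × M => f z.1 z.2))
    {q : ℕ} {α : Euc n} {h : A → Torus n → M}
    (hh : ContMDiff ((𝓡 p).prod (𝓡 n)) (𝓡 (2 * n)) ∞
      (fun z : A × Euc n => h z.1 (torusProj z.2)))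
    (hKAM : ∀ a, IsPeriodicKAMTorus σ (f a) q α (h a)) (a : A) {b : Euc p}
    (hb : b ∈ (chartAt (Euc p) a).target) :
    IsInvariantFamily σ (fun b x => h ((chartAt (Euc p) a).symm b) (torusProj x))
      (fun b => (f ((chartAt (Euc p) a).symm b))^[q]) α b where
  smooth x := by
    have ht : ∀ᶠ w : Euc p × Euc n in 𝓝 (b, x), w.1 ∈ (chartAt (Euc p) a).target :=
      (continuous_fst.tendsto (b, x)).eventually ((chartAt (Euc p) a).open_target.mem_nhds hb)
    filter_upwards [ht] with w hw
    have h1 : ContMDiffAt 𝓘(ℝ, Euc p × Euc n) (𝓡 p) ∞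
        (fun w : Euc p × Euc n => (chartAt (Euc p) a).symm w.1) w :=
      ContMDiffAt.comp w (contMDiffOn_chart_symm.contMDiffAt
        ((chartAt (Euc p) a).open_target.mem_nhds hw)) contDiffAt_fst.contMDiffAt
    exact ContMDiffAt.comp (g := fun z : A × Euc n => h z.1 (torusProj z.2)) w (hh _)
      (h1.prodMk contDiffAt_snd.contMDiffAt)
  periodic q x k := by rw [torusProj_add_lat]
  immersion b x := (hKAM _).immersion x
  lagrangian b x u v := by
    rw [pbForm_apply]
    exact DFunLike.congr_fun ((hKAM ((chartAt (Euc p) a).symm b)).lagrangian x) ![u, v]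
  smooth_map := by
    filter_upwards [(chartAt (Euc p) a).open_target.mem_nhds hb] with b hb y
    have h1 : ContMDiffAt (𝓘(ℝ, Euc p).prod (𝓡 (2 * n))) (𝓡 p) ∞
        (fun w : Euc p × M => (chartAt (Euc p) a).symm w.1) (b, y) :=
      ContMDiffAt.comp (b, y) (contMDiffOn_chart_symm.contMDiffAt
        ((chartAt (Euc p) a).open_target.mem_nhds hb)) contMDiffAt_fst
    exact ContMDiffAt.comp (g := fun z : A × M => (f z.1)^[q] z.2) (b, y)
      (contMDiff_iterate hf q _) (h1.prodMk contMDiffAt_snd)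
  injective b x y hxy := torusProj_eq_iff.1 ((hKAM _).injective hxy)
  conj b x := by rw [(hKAM _).conj, torusProj_add]

/-- The radii of the tubes around the torus with parameter `a` in which the coordinates `(N a).1`
have all the required properties. -/
def goodRadii (p : ℕ) {n : ℕ} {M : Type*} [TopologicalSpace M] [ChartedSpace (Euc (2 * n)) M]
    {A : Type*} [TopologicalSpace A] [ChartedSpace (Euc p) A]
    (σ : SymplecticForm (2 * n) M) (g : A → M → M) (α : Euc n)
    (N : A → (Euc n × Euc n → M) × MvPolynomial (Fin n) ℝ) (a : A) : Set ℝ :=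
  {ε | 0 < ε ∧ IsNormalTube σ (g a) α (N a) ε ∧ ∀ x r, ‖r‖ < ε →
    ContMDiffAt ((𝓡 p).prod 𝓘(ℝ, Euc n × Euc n)) (𝓡 (2 * n)) ∞
      (fun w : A × (Euc n × Euc n) => (N w.1).1 w.2) (a, (x, r)) ∧
    ContMDiffAt ((𝓡 p).prod 𝓘(ℝ, Euc n × Euc n)) 𝓘(ℝ, ℝ) ∞
      (fun w : A × (Euc n × Euc n) => remainder (g w.1) α (N w.1) w.2) (a, (x, r))}

/-- Shrinking a good radius keeps it good, so the good radii form an interval. Convexity is what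
allows local constants to be glued to a continuous function. -/
theorem convex_goodRadii (g : A → M → M) (α : Euc n)
    (N : A → (Euc n × Euc n → M) × MvPolynomial (Fin n) ℝ) (a : A) :
    Convex ℝ (goodRadii p σ g α N a) := by
  refine OrdConnected.convex ⟨fun ε hε ε' hε' δ hδ => ?_⟩
  exact ⟨hε.1.trans_le hδ.1, hε'.2.1.mono hδ.2, fun x r hr => hε'.2.2 x r (hr.trans_le hδ.2)⟩

variable [T2Space M]

/-- The partition of unity and the exponent K are chosen once, so N is one globally defined family.
All its properties are local in the parameter, and in a chart the parameter ranges over a normed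
space, where the normalization theorems apply. -/
theorem exists_normalFamily [CompactSpace M] {f : A → M → M}
    (hf : ContMDiff ((𝓡 p).prod (𝓡 (2 * n))) (𝓡 (2 * n)) ∞ (fun z : A × M => f z.1 z.2))
    (hfσ : ∀ a, IsSymplectic σ (f a)) {q : ℕ} {α : Euc n} (hα : IsDiophantine α)
    {h : A → Torus n → M}
    (hh : ContMDiff ((𝓡 p).prod (𝓡 n)) (𝓡 (2 * n)) ∞
      (fun z : A × Euc n => h z.1 (torusProj z.2)))
    (hKAM : ∀ a, IsPeriodicKAMTorus σ (f a) q α (h a)) (D : ℕ) :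
    ∃ N : A → (Euc n × Euc n → M) × MvPolynomial (Fin n) ℝ,
      (∀ a z k, (N a).1 (z + (lat k, 0)) = (N a).1 z) ∧
      (∀ a x, (N a).1 (x, 0) = h a (torusProj x)) ∧
      (∀ a, (N a).2.totalDegree ≤ D + 1) ∧
      (∀ e, ContMDiff (𝓡 p) 𝓘(ℝ, ℝ) ∞ fun a => (N a).2.coeff e) ∧
      (∀ a, ∇ (polyFun (N a).2) 0 = 0) ∧
      (∀ a x, ∀ k ≤ D + 1,
        iteratedFDeriv ℝ k (fun r => remainder (f a)^[q] α (N a) (x, r)) 0 = 0) ∧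
      ∀ a, ∃ ε, ∀ᶠ b in 𝓝 a, ε ∈ goodRadii p σ (fun a => (f a)^[q]) α N b := by
  obtain ⟨χ, l, hχ, hχs, hl⟩ := exists_finite_partitionOfUnity (2 * n) M
  obtain ⟨K, hK, hne⟩ := hα.exists_summable_kernelCoeff
  set N : A → (Euc n × Euc n → M) × MvPolynomial (Fin n) ℝ := fun a =>
    normalForm σ χ l (fun x => h a (torusProj x)) (f a)^[q] α K D with hN
  have hfa : ∀ a, ContMDiff (𝓡 (2 * n)) (𝓡 (2 * n)) ∞ (f a) := fun a =>
    ContMDiff.comp (g := fun z : A × M => f z.1 z.2) (f := fun y : M => (a, y)) hf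
      (contMDiff_const.prodMk contMDiff_id)
  have hs : ∀ a, IsSymplectic σ (f a)^[q] := fun a => ((hfσ a).iterate (hfa a) q).1
  have H : ∀ a, ∀ᶠ b in 𝓝 (chartAt (Euc p) a a),
      IsInvariantFamily σ (fun b x => h ((chartAt (Euc p) a).symm b) (torusProj x))
        (fun b => (f ((chartAt (Euc p) a).symm b))^[q]) α b := by
    intro a
    filter_upwards [(chartAt (Euc p) a).open_target.mem_nhds (mem_chart_target (Euc p) a)] with b hb
    exact isInvariantFamily_chart hf hh hKAM a hb
  have Hs : ∀ a, ∀ᶠ b in 𝓝 (chartAt (Euc p) a a),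
      IsSymplectic σ (f ((chartAt (Euc p) a).symm b))^[q] := fun a => Eventually.of_forall
    fun b => hs _
  have HN : ∀ a, ∀ᶠ b in 𝓝 (chartAt (Euc p) a a),
      IsNormalized σ (fun b x => h ((chartAt (Euc p) a).symm b) (torusProj x))
        (fun b => (f ((chartAt (Euc p) a).symm b))^[q]) α D
        (fun b => N ((chartAt (Euc p) a).symm b)) b := fun a =>
    isNormalized_normalForm (h := fun b x => h ((chartAt (Euc p) a).symm b) (torusProj x))
      (g := fun b => (f ((chartAt (Euc p) a).symm b))^[q]) (H a) (Hs a) hχ hχs hl hK hne D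
  -- Composing with the chart and its inverse does not change N near a; this transfers the
  -- statements back to the manifold.
  have hinv : ∀ a : A, (chartAt (Euc p) a).symm (chartAt (Euc p) a a) = a := fun a =>
    (chartAt (Euc p) a).left_inv (mem_chart_source _ a)
  have hc : ∀ a : A, ∀ b ∈ (chartAt (Euc p) a).source,
      ContMDiffAt (𝓡 p) (𝓡 p) ∞ (chartAt (Euc p) a) b := fun a b hb =>
    contMDiffOn_chart.contMDiffAt ((chartAt (Euc p) a).open_source.mem_nhds hb)
  have hsrc : ∀ a : A, ∀ b ∈ (chartAt (Euc p) a).source, ∀ᶠ b' in 𝓝 b,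
      (chartAt (Euc p) a).symm (chartAt (Euc p) a b') = b' := fun a b hb => by
    filter_upwards [(chartAt (Euc p) a).open_source.mem_nhds hb] with b' hb'
    exact (chartAt (Euc p) a).left_inv hb'
  refine ⟨N, fun a z k => ?_, fun a x => ?_, fun a => ?_, fun e a => ?_, fun a => ?_,
    fun a x k hk => ?_, fun a => ?_⟩
  · have := (HN a).self_of_nhds.tube.periodic (chartAt (Euc p) a a) z k
    simpa only [hinv] using this
  · have := (HN a).self_of_nhds.tube.base x
    simpa only [hinv] using this
  · have := (HN a).self_of_nhds.totalDegree_le (chartAt (Euc p) a a)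
    simpa only [hinv] using this
  · have h1 := ((HN a).self_of_nhds.smooth_coeff e).contDiffAt.contMDiffAt
    refine (ContMDiffAt.comp a h1 (hc a a (mem_chart_source _ a))).congr_of_eventuallyEq ?_
    filter_upwards [hsrc a a (mem_chart_source _ a)] with b hb
    simp only [Function.comp_apply, hb]
  · have := IsNormalized.gradient_polyFun (N := fun b => N ((chartAt (Euc p) a).symm b))
      (HN a) (H a) (Hs a)
    simpa only [hinv] using this
  · have h1 := (HN a).self_of_nhds.smoothNear_remainder (H a).self_of_nhds
    have h2 := (HN a).self_of_nhds.flat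
    simp only [hinv] at h2
    refine VanishesTo.iteratedFDeriv_eq_zero x k (fun x => ?_) (h2.mono (l := k + 1) (by omega))
    have := SmoothNear.snd_of_prod (f := fun b z => remainder
      (f ((chartAt (Euc p) a).symm b))^[q] α (N ((chartAt (Euc p) a).symm b)) z) (h1 x)
    simpa only [hinv] using this
  · obtain ⟨ε, hε, h1⟩ := IsNormalized.exists_normalTube
      (N := fun b => N ((chartAt (Euc p) a).symm b)) (HN a) (H a) (Hs a)
    refine ⟨ε, ?_⟩
    filter_upwards [((chartAt (Euc p) a).continuousAt (mem_chart_source _ a)).eventually h1,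
      (chartAt (Euc p) a).open_source.mem_nhds (mem_chart_source _ a)] with b ⟨h2, h3⟩ hb
    rw [(chartAt (Euc p) a).left_inv hb] at h2
    refine ⟨hε, h2, fun x r hr => ?_⟩
    obtain ⟨h4, h5⟩ := h3 x r hr
    have h6 : ContMDiffAt ((𝓡 p).prod 𝓘(ℝ, Euc n × Euc n)) 𝓘(ℝ, Euc p × (Euc n × Euc n)) ∞
        (fun w : A × (Euc n × Euc n) => (chartAt (Euc p) a w.1, w.2)) (b, (x, r)) :=
      ContMDiffAt.prodMk_space (ContMDiffAt.comp (b, (x, r)) (hc a b hb) contMDiffAt_fst)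
        contMDiffAt_snd
    have h7 : ∀ᶠ w : A × (Euc n × Euc n) in 𝓝 (b, (x, r)),
        (chartAt (Euc p) a).symm (chartAt (Euc p) a w.1) = w.1 :=
      (continuous_fst.tendsto (b, (x, r))).eventually (hsrc a b hb)
    constructor
    · refine (ContMDiffAt.comp (g := fun w : Euc p × (Euc n × Euc n) =>
        (N ((chartAt (Euc p) a).symm w.1)).1 w.2) (b, (x, r)) h4.contMDiffAt
          h6).congr_of_eventuallyEq (h7.mono fun w hw => ?_)
      simp only [Function.comp_apply, hw]
    · refine (ContMDiffAt.comp (g := fun w : Euc p × (Euc n × Euc n) =>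
        remainder (f ((chartAt (Euc p) a).symm w.1))^[q] α (N ((chartAt (Euc p) a).symm w.1)) w.2)
          (b, (x, r)) h5.contDiffAt.contMDiffAt h6).congr_of_eventuallyEq (h7.mono fun w hw => ?_)
      simp only [Function.comp_apply, hw]

end Parameters

end KAMBirkhoff

/-! ### Continuous radius and descent to the torus. -/

theorem proposition2p6 {n p : ℕ}
    {M : Type*} [TopologicalSpace M] [ChartedSpace (KAMBirkhoff.Euc (2 * n)) M]
    [IsManifold (𝓡 (2 * n)) ∞ M] [T2Space M] [CompactSpace M]
    (σ : KAMBirkhoff.SymplecticForm (2 * n) M)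
    {A : Type*} [TopologicalSpace A] [ChartedSpace (KAMBirkhoff.Euc p) A]
    [IsManifold (𝓡 p) ∞ A] [T2Space A] [SecondCountableTopology A]
    -- a smooth family of symplectomorphisms
    (f : A → Diffeomorph (𝓡 (2 * n)) (𝓡 (2 * n)) M M ∞)
    (hf : ContMDiff ((𝓡 p).prod (𝓡 (2 * n))) (𝓡 (2 * n)) ∞ (fun z : A × M => f z.1 z.2))
    (hfσ : ∀ a, KAMBirkhoff.IsSymplectic σ (f a))
    -- a smooth family of `q`-periodic KAM tori with the same frequency vector
    (q : ℕ) (α : KAMBirkhoff.Euc n) (h : A → KAMBirkhoff.Torus n → M)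
    (hh : ContMDiff ((𝓡 p).prod (𝓡 n)) (𝓡 (2 * n)) ∞
      (fun z : A × KAMBirkhoff.Euc n => h z.1 (KAMBirkhoff.torusProj z.2)))
    (hKAM : ∀ a, KAMBirkhoff.IsPeriodicKAMTorus σ (f a) q α (h a))
    (D : ℕ) :
    ∃ (ρ : A → ℝ) (Ψ : A → KAMBirkhoff.Torus n → KAMBirkhoff.Euc n → M)
      (Q : A → MvPolynomial (Fin n) ℝ)
      (s : A → KAMBirkhoff.Torus n → KAMBirkhoff.Euc n → ℝ),
      KAMBirkhoff.IsSymplecticCoordFamily (p := p) σ (fun a => Set.range (h a)) ρ Ψ ∧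
      -- a smooth family of polynomials of degree at most `D + 1` with `∇ Q_a(0) = 0`
      (∀ a, (Q a).totalDegree ≤ D + 1) ∧
      (∀ m : Fin n →₀ ℕ, ContMDiff (𝓡 p) 𝓘(ℝ, ℝ) ∞ (fun a => (Q a).coeff m)) ∧
      (∀ a, ∇ (KAMBirkhoff.polyFun (Q a)) 0 = 0) ∧
      -- a smooth family of functions, flat to order `D + 1` along `r = 0`
      ContMDiffOn ((𝓡 p).prod 𝓘(ℝ, KAMBirkhoff.Euc n × KAMBirkhoff.Euc n)) 𝓘(ℝ, ℝ) ∞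
        (fun z : A × (KAMBirkhoff.Euc n × KAMBirkhoff.Euc n) =>
          s z.1 (KAMBirkhoff.torusProj z.2.1) z.2.2) {z | ‖z.2.2‖ < ρ z.1} ∧
      (∀ (a : A) (θ : KAMBirkhoff.Torus n), ∀ k ≤ D + 1, iteratedFDeriv ℝ k (s a θ) 0 = 0) ∧
      -- the normal form; `x` and `x'` are lifts of the angles `θ` and `θ'`
      ∀ (a : A) (x r x' r' : KAMBirkhoff.Euc n), ‖r‖ < ρ a → ‖r'‖ < ρ a →
        ((f a)^[q] (Ψ a (KAMBirkhoff.torusProj x) r) = Ψ a (KAMBirkhoff.torusProj x') r' ↔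
          KAMBirkhoff.torusProj x' = KAMBirkhoff.torusProj
            (x + α + ∇ (KAMBirkhoff.polyFun (Q a)) r
              + ∇ (s a (KAMBirkhoff.torusProj x')) r) ∧
          r' = r - ∇ (fun y : KAMBirkhoff.Euc n => s a (KAMBirkhoff.torusProj y) r) x') := by
  have hexc : ∃ N : A → (KAMBirkhoff.Euc n × KAMBirkhoff.Euc n → M) × MvPolynomial (Fin n) ℝ,
      (∀ a z k, (N a).1 (z + (KAMBirkhoff.lat k, 0)) = (N a).1 z) ∧
      (∀ a x, (N a).1 (x, 0) = h a (KAMBirkhoff.torusProj x)) ∧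
      (∀ a, (N a).2.totalDegree ≤ D + 1) ∧
      (∀ e, ContMDiff (𝓡 p) 𝓘(ℝ, ℝ) ∞ fun a => (N a).2.coeff e) ∧
      (∀ a, ∇ (KAMBirkhoff.polyFun (N a).2) 0 = 0) ∧
      (∀ a x, ∀ k ≤ D + 1, iteratedFDeriv ℝ k
        (fun r => KAMBirkhoff.remainder (f a)^[q] α (N a) (x, r)) 0 = 0) ∧
      ∀ a, ∃ ε, ∀ᶠ b in 𝓝 a, ε ∈ KAMBirkhoff.goodRadii p σ (fun a => (f a)^[q]) α N b := by
    -- The Diophantine condition is part of the data at a parameter, so it is available only if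
    -- there is one; otherwise everything is vacuous.
    rcases isEmpty_or_nonempty A with hA | ⟨⟨a⟩⟩
    · exact ⟨fun a => hA.elim a, fun a => hA.elim a, fun a => hA.elim a, fun a => hA.elim a,
        fun e a => hA.elim a, fun a => hA.elim a, fun a => hA.elim a, fun a => hA.elim a⟩
    · exact KAMBirkhoff.exists_normalFamily (f := fun a => f a) hf hfσ (hKAM a).diophantine hh hKAM D
  obtain ⟨N, hper, hbase, hdeg, hcoeff, hgrad, hflat, hgood⟩ := hexc
  -- With the Hausdorff property and second countability this makes the parameter manifold
  -- paracompact, as the gluing of radii requires.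
  have : LocallyCompactSpace A := Manifold.locallyCompact_of_finiteDimensional (𝓡 p)
  obtain ⟨ρ, hρ⟩ := exists_continuous_forall_mem_convex_of_local_const
    (fun a => KAMBirkhoff.convex_goodRadii (fun a => (f a)^[q]) α N a) hgood
  -- A set-theoretic section of the covering. Its discontinuity does no harm, because it is only
  -- composed with lattice-periodic functions.
  set s : KAMBirkhoff.Torus n → KAMBirkhoff.Euc n :=
    Function.surjInv KAMBirkhoff.isOpenQuotientMap_torusProj.surjective with hs
  have hsp : ∀ θ, KAMBirkhoff.torusProj (s θ) = θ := Function.surjInv_eq _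
  have hΨ : ∀ a x r, (N a).1 (s (KAMBirkhoff.torusProj x), r) = (N a).1 (x, r) := fun a x r => by
    obtain ⟨k, hk⟩ := KAMBirkhoff.torusProj_eq_iff.1 (hsp (KAMBirkhoff.torusProj x)).symm
    have := hper a (x, r) k
    rwa [Prod.mk_add_mk, add_zero, ← hk] at this
  have hR : ∀ a x r, KAMBirkhoff.remainder (f a)^[q] α (N a) (s (KAMBirkhoff.torusProj x), r) =
      KAMBirkhoff.remainder (f a)^[q] α (N a) (x, r) := fun a x r => by
    obtain ⟨k, hk⟩ := KAMBirkhoff.torusProj_eq_iff.1 (hsp (KAMBirkhoff.torusProj x)).symm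
    have := KAMBirkhoff.remainder_add_lat (g := (f a)^[q]) (α := α) (hper a) (x, r) k
    rwa [Prod.mk_add_mk, add_zero, ← hk] at this
  have hN1 : ∀ a x r, ‖r‖ < ρ a →
      KAMBirkhoff.MNear (2 * n) (N a).1 (x, r) := fun a x r hr => by
    have hopen : ∀ᶠ z : KAMBirkhoff.Euc n × KAMBirkhoff.Euc n in 𝓝 (x, r), ‖z.2‖ < ρ a :=
      (by fun_prop : Continuous fun z : KAMBirkhoff.Euc n × KAMBirkhoff.Euc n => ‖z.2‖).continuousAt.eventually_lt
        continuousAt_const hr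
    filter_upwards [hopen] with z hz
    exact ContMDiffAt.comp (g := fun w : A × (KAMBirkhoff.Euc n × KAMBirkhoff.Euc n) =>
      (N w.1).1 w.2) (f := fun z => (a, z)) z ((hρ a).2.2 z.1 z.2 hz).1
      (contMDiffAt_const.prodMk contMDiffAt_id)
  have hRd : ∀ a x r, ‖r‖ < ρ a →
      DifferentiableAt ℝ (KAMBirkhoff.remainder (f a)^[q] α (N a)) (x, r) := fun a x r hr => by
    have : ContMDiffAt 𝓘(ℝ, KAMBirkhoff.Euc n × KAMBirkhoff.Euc n) 𝓘(ℝ, ℝ) ∞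
        (KAMBirkhoff.remainder (f a)^[q] α (N a)) (x, r) :=
      ContMDiffAt.comp (g := fun w : A × (KAMBirkhoff.Euc n × KAMBirkhoff.Euc n) =>
        KAMBirkhoff.remainder (f w.1)^[q] α (N w.1) w.2) (f := fun z => (a, z)) (x, r)
        ((hρ a).2.2 x r hr).2 (contMDiffAt_const.prodMk contMDiffAt_id)
    exact this.contDiffAt.differentiableAt (by simp)
  refine ⟨ρ, fun a θ r => (N a).1 (s θ, r), fun a => (N a).2,
    fun a θ r => KAMBirkhoff.remainder (f a)^[q] α (N a) (s θ, r), ?_, hdeg, hcoeff, hgrad, ?_,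
    fun a θ k hk => hflat a (s θ) k hk, ?_⟩
  · refine ⟨ρ.continuous, fun a => (hρ a).1, ?_, ?_, ?_, ?_, ?_⟩
    · simp only [hΨ]
      exact fun z hz => ((hρ z.1).2.2 z.2.1 z.2.2 hz).1.contMDiffWithinAt
    · rintro a ⟨θ, r⟩ hr ⟨θ', r'⟩ hr' e
      obtain ⟨⟨k, hk⟩, hrr⟩ := (hρ a).2.1.injective _ _ _ _ hr hr' e
      refine Prod.ext ?_ hrr.symm
      change θ = θ'
      rw [← hsp θ, ← hsp θ', hk, KAMBirkhoff.torusProj_add_lat]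
    · intro a
      have himg : (fun w : KAMBirkhoff.Torus n × KAMBirkhoff.Euc n => (N a).1 (s w.1, w.2)) ''
          {w | ‖w.2‖ < ρ a} = (N a).1 '' {z | ‖z.2‖ < ρ a} := by
        ext y
        constructor
        · rintro ⟨⟨θ, r⟩, hr, rfl⟩
          exact ⟨(s θ, r), hr, rfl⟩
        · rintro ⟨⟨x, r⟩, hr, rfl⟩
          exact ⟨(KAMBirkhoff.torusProj x, r), hr, hΨ a x r⟩
      rw [himg, isOpen_iff_mem_nhds]
      rintro _ ⟨⟨x, r⟩, hr, rfl⟩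
      -- The coordinates map neighbourhoods onto neighbourhoods at each point of the tube, so its
      -- image is open.
      rw [← KAMBirkhoff.map_nhds_of_pbForm_eq_w0 (hN1 a x r hr) ((hρ a).2.1.symplectic x r hr)]
      refine image_mem_map ((isOpen_lt (by fun_prop) continuous_const).mem_nhds hr)
    · intro a
      ext y
      simp only [mem_range, hbase, hsp]
    · intro a z hz u v
      simp only [hΨ]
      rw [← KAMBirkhoff.pbForm_apply, (hρ a).2.1.symplectic z.1 z.2 hz, KAMBirkhoff.w0_eq_sum]
  · simp only [hR]
    exact fun z hz => ((hρ z.1).2.2 z.2.1 z.2.2 hz).2.contMDiffWithinAt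
  · intro a x r x' r' hr hr'
    simp only [hΨ, hR]
    rw [KAMBirkhoff.gradient_fst (hRd a x' r hr), KAMBirkhoff.gradient_snd (hRd a x' r hr),
      (hρ a).2.1.graph x r x' r' hr hr']
    refine and_congr_left fun _ => ?_
    -- Equality of angles on the torus is equality of lifts modulo the lattice.
    rw [eq_comm, KAMBirkhoff.torusProj_eq_iff]

end
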